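/- **Setting.** Let $M$ be a closed connected orientable smooth $3$-manifold with a Seifert fibration (a partition into circles, each of which is the core of a neighbourhood that is fiber-preservingly diffeomorphic to a standard fibered solid torus), and let $\Sigma\subset M$ be a closed connected smoothly embedded two-sided surface that is horizontal, i.e. transverse to the fibers. Let $G\le\operatorname{Homeo}(\Sigma)$ be the finite group generated by the first return maps of $\Sigma$ along the fibers: it is cyclic, generated by the monodromy $\varphi$, if $\Sigma$ is non-separating, and dihedral, generated by the two involutions $\tau_1,\tau_2$ obtained by following the fibers through the $I$-bundles on the two sides of $\Sigma$, if $\Sigma$ is separating. The base orbifold of $M$ is $\Sigma/G$. **Definitions.** A homeomorphism $\psi$ of a surface is *pseudo-Anosov* if it preserves a pair of transverse singular measured foliations $(\mathcal F^s,\mu^s)$, $(\mathcal F^u,\mu^u)$ and multiplies $\mu^s$ by $\lambda^{-1}$ and $\mu^u$ by $\lambda$ for some $\lambda>1$. The natural coordinates of the foliations are smooth off a finite $\psi$-invariant set which contains the singularities; singularities have at least three prongs, except that at punctures or cone points any number $k\ge1$ of prongs is allowed. The orbifold $\Sigma/G$ is *large* if it admits a pseudo-Anosov self-map, that is, if the surface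 obtained by deleting the cone points does. An embedded closed orientable two-sided incompressible ($\pi_1$-injective) surface $\Sigma\subset M$ is a *pseudo-Anosov surface*, *realized by* the homeomorphism $f$ of $M$, if $f(\Sigma)=\Sigma$ and $f|_\Sigma$ is pseudo-Anosov. A diffeomorphism $\alpha$ of a $3$-manifold $N$ is *partially hyperbolic* if, for some Riemannian metric on $N$, there are an $\alpha$-invariant splitting $TN=E^s\oplus E^c\oplus E^u$ into nonzero sub-bundles and an $n>0$ such that $$\|D\alpha^n v^s\|\le\tfrac12\min\{1,\|D\alpha^n v^c\|\},\qquad \|D\alpha^n v^u\|\ge2\max\{1,\|D\alpha^n v^c\|\}$$ for all unit vectors $v^s\in E^s$, $v^c\in E^c$, $v^u\in E^u$ at a common point. A homeomorphism $f$ of $M$ is *partially pseudo-Anosov* if there is an embedded closed $1$-manifold $C\subset M$ (possibly empty or disconnected) with $f(C)=C$ such that $f$ restricts to a partially hyperbolic diffeomorphism of $M\setminus C$. **Proposition.** If $\Sigma/G$ is large, then $\Sigma$ is a pseudo-Anosov surface in $M$. Moreover, $\Sigma$ is realized by a partially pseudo-Anosov homeomorphism of $M$. -/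

import Mathlib

open Set Filter Topology Manifold
open scoped ContDiff

noncomputable section

namespace PASurface

/-! ## Manifolds -/

section Manifolds

/-- A smooth `n`-manifold is orientable if it has an atlas of charts (compatible with its smooth
structure) all of whose coordinate changes have positive Jacobian determinant. -/
def IsOrientable (n : ℕ) (N : Type*) [TopologicalSpace N]
    [ChartedSpace (EuclideanSpace ℝ (Fin n)) N] : Prop :=
  ∃ A ⊆ IsManifold.maximalAtlas (𝓡 n) ∞ N,
    (∀ x : N, ∃ e ∈ A, x ∈ e.source) ∧
    ∀ e ∈ A, ∀ e' ∈ A, ∀ x ∈ e.source ∩ e'.source,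
      0 < (fderiv ℝ (e' ∘ e.symm) (e x)).det

variable {M : Type*} [TopologicalSpace M] [ChartedSpace (EuclideanSpace ℝ (Fin 3)) M]
variable {S : Type*} [TopologicalSpace S] [ChartedSpace (EuclideanSpace ℝ (Fin 2)) S]

/-- The surface `ι : S → M` is two-sided: it has a product neighbourhood. -/
def IsTwoSided (ι : S → M) : Prop :=
  ∃ b : S × ℝ → M, IsOpenEmbedding b ∧ ∀ x, b (x, 0) = ι x

/-- The surface `ι : S → M` is incompressible, i.e. `π₁`-injective: a loop of `S` that is
null-homotopic in `M` is null-homotopic in `S`. -/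
def IsIncompressible (ι : S → M) : Prop :=
  ∃ hι : Continuous ι, ∀ (x : S) (γ : Path x x),
    (γ.map hι).Homotopic (Path.refl (ι x)) → γ.Homotopic (Path.refl x)

/-- A (possibly empty, not necessarily connected) embedded smooth `1`-manifold, closed as a subset:
near each of its points it is a coordinate line of a smooth chart of `M`. -/
def IsEmbeddedOneManifold (C : Set M) : Prop :=
  IsClosed C ∧ ∀ x ∈ C, ∃ e ∈ IsManifold.maximalAtlas (𝓡 3) ∞ M,
    x ∈ e.source ∧ ∀ y ∈ e.source, y ∈ C ↔ e y 1 = 0 ∧ e y 2 = 0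

end Manifolds

/-! ## Seifert fibrations, horizontal surfaces, first return -/

section Seifert

variable (M : Type*) [TopologicalSpace M] [ChartedSpace (EuclideanSpace ℝ (Fin 3)) M]

/-- A Seifert fibration of a `3`-manifold: a partition into fibers (the classes of `rel`) such that
every fiber has a neighbourhood with a fiber-preserving diffeomorphism from a standard fibered solid
torus that takes the core to the given fiber.  The standard fibered solid torus of type `(p, q)`,
with `p ≥ 1` and `q` coprime, is (open unit disk) × circle, its fibers being the orbits of the
circle action `w • (z, u) = (w ^ q * z, w ^ p * u)`. -/
structure SeifertFibration where
  rel : Setoid M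
  exists_fibered_solid_torus : ∀ x : M, ∃ (p : ℕ) (q : ℤ), 0 < p ∧ IsCoprime (p : ℤ) q ∧
    ∃ Φ : OpenPartialHomeomorph (ℂ × Circle) M,
      Φ.source = Metric.ball (0 : ℂ) 1 ×ˢ univ ∧
      ContMDiffOn (𝓘(ℝ, ℂ).prod (𝓡 1)) (𝓡 3) ∞ Φ Φ.source ∧
      ContMDiffOn (𝓡 3) (𝓘(ℝ, ℂ).prod (𝓡 1)) ∞ Φ.symm Φ.target ∧
      (∃ u : Circle, Φ (0, u) = x) ∧
      ∀ a ∈ Φ.source, ∀ y : M,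
        rel (Φ a) y ↔ ∃ w : Circle, y = Φ (((w ^ q : Circle) : ℂ) * a.1, w ^ p * a.2)

namespace SeifertFibration

variable {M}
variable {S : Type*} [TopologicalSpace S] [ChartedSpace (EuclideanSpace ℝ (Fin 2)) S]
variable (𝓕 : SeifertFibration M)

/-- The fiber through `x`. -/
def fiber (x : M) : Set M := {y | 𝓕.rel x y}

/-- The surface `ι : S → M` is horizontal, i.e. transverse to the fibers: no nonzero tangent vector
of a fiber at a point of the surface is tangent to the surface. -/
def IsHorizontal (ι : S → M) : Prop :=
  ∀ (x : S) (γ : ℝ → M), ContMDiff 𝓘(ℝ, ℝ) (𝓡 3) ∞ γ → γ 0 = ι x →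
    (∀ t, γ t ∈ 𝓕.fiber (ι x)) →
    ∀ v : TangentSpace (𝓡 2) x,
      mfderiv (𝓡 2) (𝓡 3) ι x v = mfderiv 𝓘(ℝ, ℝ) (𝓡 3) γ 0 (1 : ℝ) →
      mfderiv 𝓘(ℝ, ℝ) (𝓡 3) γ 0 (1 : ℝ) = 0

/-- Leaving `x` along the fiber through `x`, in one of its two directions, the first point of the
surface that one meets is `y`. -/
def IsFirstReturn (ι : S → M) (x y : S) : Prop :=
  ∃ γ : Path (ι x) (ι y),
    (∀ t, γ t ∈ 𝓕.fiber (ι x)) ∧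
    InjOn γ (Ioo 0 1) ∧
    ∀ t ∈ Ioo (0 : unitInterval) 1, γ t ∉ range ι

/-- The group `G` of the pair `(M, S)`: the group of self-homeomorphisms of the surface that is
generated by the first return maps along the fibers.  (If the surface is non-separating, these are
`φ` and `φ⁻¹`, where `φ` is the monodromy, and the group is cyclic; if the surface is separating,
these are the two involutions `τ₁`, `τ₂`, one for each side, and the group is dihedral.) -/
def returnGroup (ι : S → M) : Subgroup (S ≃ₜ S) :=
  Subgroup.closure {g | ∀ x, 𝓕.IsFirstReturn ι x (g x)}

end SeifertFibration

end Seifert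

/-! ## Pseudo-Anosov maps -/

section PseudoAnosov

variable {S : Type*} [TopologicalSpace S] [ChartedSpace (EuclideanSpace ℝ (Fin 2)) S]
variable {X : Type*} [TopologicalSpace X]

/-- Near `x`, the function `v` is `± c` times the function `u`, up to an additive constant.  For
local transverse coordinates `u`, `v` of foliations this says that they define the same leaves near
`x`, and that the transverse measures satisfy `|dv| = c |du|`. -/
def ScalesBy (c : ℝ) (u v : X → ℝ) (x : X) : Prop :=
  ∃ a b : ℝ, |a| = c ∧ ∀ᶠ y in 𝓝 x, v y = a * u y + b

/-- A pair of transverse singular measured foliations `(𝓕ˢ, μˢ)`, `(𝓕ᵘ, μᵘ)` on the surface `X`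
with the marked points (punctures, cone points) `P`, given by their natural coordinates.

In each chart `e` the leaves of `𝓕ˢ` are the lines `re e = const`, with `μˢ = |d re e|`, and the
leaves of `𝓕ᵘ` are the lines `im e = const`, with `μᵘ = |d im e|`.

The charts cover the complement of a finite set `sing`.  Near a point of `sing` the natural
coordinates are the branches of `ζ ^ (k / 2)` in a topological coordinate `ζ`, i.e. both foliations
have a `k`-prong there.  One prong is allowed only at marked points.  (A `2`-prong is topologically
a regular point of both foliations; such points may be put into the finite set `sing`, because the
charts are required to be smooth.)

The smooth structure of `X` off the marked points is the one that makes the projection `π : S → X`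
from a smooth surface `S` a local diffeomorphism there.  For a smooth surface itself, `π = id`; for
the quotient of `S` by a finite group of diffeomorphisms, `π` is the quotient map and `P` is the
cone locus. -/
structure TransverseFoliations (π : S → X) (P : Set X) where
  sing : Set X
  finite_sing : sing.Finite
  marked_subset : P ⊆ sing
  charts : Set (OpenPartialHomeomorph X ℂ)
  source_disjoint : ∀ e ∈ charts, Disjoint e.source sing
  exists_chart : ∀ x ∉ sing, ∃ e ∈ charts, x ∈ e.source
  smooth : ∀ e ∈ charts, ∀ s : S, π s ∈ e.source →
    IsLocalDiffeomorphAt (𝓡 2) 𝓘(ℝ, ℂ) ∞ (e ∘ π) s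
  compatible : ∀ e ∈ charts, ∀ e' ∈ charts, ∀ x ∈ e.source ∩ e'.source,
    ScalesBy 1 (fun y => (e y).re) (fun y => (e' y).re) x ∧
    ScalesBy 1 (fun y => (e y).im) (fun y => (e' y).im) x
  prongs : X → ℕ
  one_le_prongs : ∀ p ∈ sing, 1 ≤ prongs p
  two_le_prongs : ∀ p ∈ sing, p ∉ P → 2 ≤ prongs p
  prong_model : ∀ p ∈ sing, ∃ ζ : OpenPartialHomeomorph X ℂ, p ∈ ζ.source ∧ ζ p = 0 ∧
    ∀ e ∈ charts, ∀ x ∈ e.source ∩ ζ.source, ∃ w : X → ℂ,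
      (∀ᶠ y in 𝓝 x, w y ^ 2 = ζ y ^ prongs p) ∧
      ScalesBy 1 (fun y => (e y).re) (fun y => (w y).re) x ∧
      ScalesBy 1 (fun y => (e y).im) (fun y => (w y).im) x

/-- `ψ` is a pseudo-Anosov map of the surface `X` with marked points `P`: it preserves the marked
points and a pair of transverse singular measured foliations, multiplies the transverse measure
`μˢ` by `lam⁻¹` and `μᵘ` by `lam`, for some `lam > 1`. -/
def IsPseudoAnosovRel (π : S → X) (P : Set X) (ψ : X ≃ₜ X) : Prop :=
  ψ '' P = P ∧ ∃ F : TransverseFoliations π P, ψ '' F.sing = F.sing ∧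
    ∃ lam : ℝ, 1 < lam ∧ ∀ e ∈ F.charts, ∀ e' ∈ F.charts, ∀ x ∈ e.source, ψ x ∈ e'.source →
      ScalesBy lam⁻¹ (fun y => (e y).re) (fun y => (e' (ψ y)).re) x ∧
      ScalesBy lam (fun y => (e y).im) (fun y => (e' (ψ y)).im) x

/-- Pseudo-Anosov maps of a closed surface (without marked points). -/
def IsPseudoAnosov (ψ : S ≃ₜ S) : Prop :=
  IsPseudoAnosovRel (id : S → S) ∅ ψ

/-- Two points are equivalent if they are in the same orbit of `G`. -/
def orbitSetoid (G : Subgroup (S ≃ₜ S)) : Setoid S where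
  r x y := ∃ g ∈ G, g x = y
  iseqv :=
    { refl := fun _ => ⟨1, G.one_mem, rfl⟩
      symm := by
        rintro x y ⟨g, hg, rfl⟩
        exact ⟨g⁻¹, G.inv_mem hg, g.symm_apply_apply x⟩
      trans := by
        rintro x y z ⟨g, hg, rfl⟩ ⟨h, hh, rfl⟩
        exact ⟨h * g, G.mul_mem hh hg, rfl⟩ }

/-- The underlying space of the orbifold `S / G`, with the quotient topology. -/
abbrev OrbitSpace (G : Subgroup (S ≃ₜ S)) : Type _ := Quotient (orbitSetoid G)

/-- The orbifold locus of `S / G`: the image of the points with nontrivial stabilizer. -/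
def coneLocus (G : Subgroup (S ≃ₜ S)) : Set (OrbitSpace G) :=
  (Quotient.mk (orbitSetoid G)) '' {x | ∃ g ∈ G, g ≠ 1 ∧ g x = x}

/-- The orbifold `S / G` is large: it admits a pseudo-Anosov self-map.  As usual this is a
pseudo-Anosov map of the surface punctured at the orbifold locus: a homeomorphism of the
underlying surface that preserves the orbifold locus, where one-pronged singularities are
allowed. -/
def IsLargeOrbifold (G : Subgroup (S ≃ₜ S)) : Prop :=
  ∃ ψ : OrbitSpace G ≃ₜ OrbitSpace G,
    IsPseudoAnosovRel (Quotient.mk (orbitSetoid G)) (coneLocus G) ψ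

end PseudoAnosov

/-! ## Partially hyperbolic and partially pseudo-Anosov maps -/

section PartiallyHyperbolic

variable {N : Type*} [TopologicalSpace N] [ChartedSpace (EuclideanSpace ℝ (Fin 3)) N]

/-- A family of subspaces of the tangent spaces is a (continuous) sub-bundle of the tangent bundle:
locally it is spanned by continuous, pointwise linearly independent vector fields. -/
def IsSubbundle [IsManifold (𝓡 3) ∞ N] (E : ∀ x : N, Submodule ℝ (TangentSpace (𝓡 3) x)) : Prop :=
  ∀ x₀ : N, ∃ U ∈ 𝓝 x₀, ∃ (k : ℕ) (s : Fin k → ∀ x : N, TangentSpace (𝓡 3) x),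
    (∀ i, ContinuousOn (fun x => (⟨x, s i x⟩ : TangentBundle (𝓡 3) N)) U) ∧
    ∀ x ∈ U, LinearIndependent ℝ (fun i => s i x) ∧ Submodule.span ℝ (range fun i => s i x) = E x

/-- The diffeomorphism `α` of a `3`-manifold is partially hyperbolic (with respect to some smooth
Riemannian metric `g`): there is an `α`-invariant splitting `TN = Eˢ ⊕ Eᶜ ⊕ Eᵘ` into three nonzero
sub-bundles and some `n > 0` such that, for all unit vectors `vˢ`, `vᶜ`, `vᵘ` of these bundles at a
point, `‖Dαⁿ vˢ‖ ≤ 1/2 min {1, ‖Dαⁿ vᶜ‖}` and `‖Dαⁿ vᵘ‖ ≥ 2 max {1, ‖Dαⁿ vᶜ‖}`. -/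
def IsPartiallyHyperbolic [IsManifold (𝓡 3) ∞ N] (α : Diffeomorph (𝓡 3) (𝓡 3) N N ∞) : Prop :=
  ∃ g : Bundle.ContMDiffRiemannianMetric (𝓡 3) ∞ (EuclideanSpace ℝ (Fin 3))
      (fun x : N => TangentSpace (𝓡 3) x),
  ∃ E : Fin 3 → ∀ x : N, Submodule ℝ (TangentSpace (𝓡 3) x),
    (∀ i, IsSubbundle (E i)) ∧
    (∀ i x, E i x ≠ ⊥) ∧
    (∀ x, DirectSum.IsInternal (fun i => E i x)) ∧
    (∀ i x, (E i x).map (mfderiv (𝓡 3) (𝓡 3) α x).toLinearMap = E i (α x)) ∧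
    ∃ n : ℕ, 0 < n ∧
      let nrm : ∀ x : N, TangentSpace (𝓡 3) x → ℝ := fun x v => √(g.inner x v v)
      let D : ∀ x : N, TangentSpace (𝓡 3) x →L[ℝ] TangentSpace (𝓡 3) (α^[n] x) :=
        fun x => mfderiv (𝓡 3) (𝓡 3) (α^[n]) x
      ∀ x : N, ∀ vs ∈ E 0 x, ∀ vc ∈ E 1 x, ∀ vu ∈ E 2 x,
        nrm x vs = 1 → nrm x vc = 1 → nrm x vu = 1 →
          nrm _ (D x vs) ≤ 1 / 2 * min 1 (nrm _ (D x vc)) ∧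
          2 * max 1 (nrm _ (D x vc)) ≤ nrm _ (D x vu)

/-- The homeomorphism `f` of `N` is partially pseudo-Anosov: there is an invariant embedded
`1`-manifold `C` such that `f` restricts to a partially hyperbolic diffeomorphism of the complement
of `C`. -/
def IsPartiallyPseudoAnosov [IsManifold (𝓡 3) ∞ N] (f : N ≃ₜ N) : Prop :=
  ∃ (C : Set N) (hC : IsEmbeddedOneManifold C), f '' C = C ∧
    let U : TopologicalSpace.Opens N := ⟨Cᶜ, hC.1.isOpen_compl⟩
    ∃ α : Diffeomorph (𝓡 3) (𝓡 3) U U ∞, (∀ x : U, (α x : N) = f x) ∧ IsPartiallyHyperbolic α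

end PartiallyHyperbolic

/-! ## Pseudo-Anosov surfaces -/

section Surfaces

variable {M : Type*} [TopologicalSpace M] [ChartedSpace (EuclideanSpace ℝ (Fin 3)) M]
variable {S : Type*} [TopologicalSpace S] [ChartedSpace (EuclideanSpace ℝ (Fin 2)) S]

/-- The homeomorphism `f` of `M` realizes the surface `ι : S → M`: it preserves the surface and
restricts to a pseudo-Anosov map of it. -/
def Realizes (f : M ≃ₜ M) (ι : S → M) : Prop :=
  ∃ ψ : S ≃ₜ S, IsPseudoAnosov ψ ∧ ∀ x, f (ι x) = ι (ψ x)

/-- The closed surface `ι : S → M` is a pseudo-Anosov surface in `M`: it is embedded, orientable,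
two-sided, incompressible, and realized by some homeomorphism of `M`. -/
def IsPseudoAnosovSurface (ι : S → M) : Prop :=
  CompactSpace S ∧ IsSmoothEmbedding (𝓡 2) (𝓡 3) ∞ ι ∧ IsOrientable 2 S ∧ IsTwoSided ι ∧
    IsIncompressible ι ∧ ∃ f : M ≃ₜ M, Realizes f ι

end Surfaces

end PASurface

end

open Set Filter Topology Manifold
open scoped ContDiff

noncomputable section

set_option linter.unusedSectionVars false

namespace PASurface

/-! ## Local diffeomorphisms -/

section LocalDiffeo

variable {E E' E'' : Type*} [NormedAddCommGroup E] [NormedSpace ℝ E]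
  [NormedAddCommGroup E'] [NormedSpace ℝ E'] [NormedAddCommGroup E''] [NormedSpace ℝ E'']
  {H H' H'' : Type*} [TopologicalSpace H] [TopologicalSpace H'] [TopologicalSpace H'']
  {I : ModelWithCorners ℝ E H} {J : ModelWithCorners ℝ E' H'} {K : ModelWithCorners ℝ E'' H''}
  {N : Type*} [TopologicalSpace N] [ChartedSpace H N]
  {N' : Type*} [TopologicalSpace N'] [ChartedSpace H' N']
  {N'' : Type*} [TopologicalSpace N''] [ChartedSpace H'' N'']

/-! The surface cuts the fibers into arcs, and each arc joins a point of `S` to its first return.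
After a change of time along the fibers, `M` is therefore obtained from `S × (-1, 1)` by gluings
`(x, t) ↦ (g x, ± t + const)`, where `g` lies in the return group `G`. A homeomorphism `Ψ` of `S`
that commutes with `G` extends to `M` by `(x, t) ↦ (Ψ x, t)`. If `Ψ` is pseudo-Anosov for foliations
that `G` preserves together with their measures, then in the coordinates `(re, t, im)` the extension
is diagonal and affine, with factors `± λ⁻¹`, `± 1`, `± λ`. Off the finitely many fibers through the
singular points this is partial hyperbolicity for the flat metric `d re² + dt² + d im²`. It remains
to find the time parameter and the map `Ψ`.

Time parameter. In each fibered solid torus the fibers are orbits of a circle action. On overlaps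
the actions differ by smooth time changes, unique once they are normalized at time zero
(`exists_bridge`). Averaging them with weights that are constant on the fibers gives a time of
constant period, well defined up to direction (`time_bridge`); two-sidedness of `S` fixes the
direction at each starting point (`exists_isFiberClock`). By transversality the resulting map `S × ℝ
→ M` is a local diffeomorphism. It makes `S × S¹` a covering of `M`, so `S` is incompressible
(`isIncompressible`), and it pulls the orientation of `M` back to `S`. The first return time is
smooth (`local_form`), and a symmetric change of time moves every first return to time `± 1`
(`exists_isNormalized`).

The map `Ψ`. Each fiber meets `S` finitely often, and a point off the finite set over the
singularities has trivial stabilizer, so `G` is finite. Let `ψ` be the pseudo-Anosov map of `S / G`.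
Off its singular set `S → S / G` is a covering. Over a finite cover by discs, choose local sections
above each power `ψ ^ n`; their transition functions are locally constant with values in `G` and are
recorded by finitely many values. Two different powers have the same record, so a positive power of
`ψ` lifts to a map commuting with `G` (`exists_lift_pow`), and the lift extends over the finitely
many missing points (`exists_homeomorph_lift_pow`). The foliations lift too. A branch point of order
`m` turns `k` prongs into `m k`; since `m ≥ 2` over cone points, no one-prongs remain
(`exists_branch_chart`, `exists_branched_prong`, `isPseudoAnosov_lift`). -/

/-- The restriction of a partial diffeomorphism to an open set. -/
def restrPartialDiffeomorph (Φ : PartialDiffeomorph I J N N' ∞) (U : Set N) (hU : IsOpen U) :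
    PartialDiffeomorph I J N N' ∞ where
  toPartialEquiv := (Φ.toOpenPartialHomeomorph.restrOpen U hU).toPartialEquiv
  open_source := (Φ.toOpenPartialHomeomorph.restrOpen U hU).open_source
  open_target := (Φ.toOpenPartialHomeomorph.restrOpen U hU).open_target
  contMDiffOn_toFun := Φ.contMDiffOn_toFun.mono fun _ hx => hx.1
  contMDiffOn_invFun := Φ.contMDiffOn_invFun.mono fun _ hx => hx.1

theorem isLocalDiffeomorphAt_congr {f g : N → N'} {x : N}
    (hf : IsLocalDiffeomorphAt I J ∞ f x) (h : g =ᶠ[𝓝 x] f) :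
    IsLocalDiffeomorphAt I J ∞ g x := by
  obtain ⟨Φ, hx, hΦ⟩ := hf
  obtain ⟨U, hU, hUo, hxU⟩ := eventually_nhds_iff.1 h
  refine ⟨restrPartialDiffeomorph Φ U hUo, ⟨hx, hxU⟩, ?_⟩
  intro y hy
  exact (hU y hy.2).trans (hΦ hy.1)

/-- Being a local diffeomorphism is an open condition. -/
theorem IsLocalDiffeomorphAt.eventually {f : N → N'} {x : N}
    (hf : IsLocalDiffeomorphAt I J ∞ f x) : ∀ᶠ y in 𝓝 x, IsLocalDiffeomorphAt I J ∞ f y := by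
  obtain ⟨Φ, hx, hΦ⟩ := hf
  filter_upwards [Φ.open_source.mem_nhds hx] with y hy
  exact ⟨Φ, hy, hΦ⟩

theorem isLocalDiffeomorphAt_comp {g : N' → N''} {f : N → N'} {x : N}
    (hg : IsLocalDiffeomorphAt J K ∞ g (f x)) (hf : IsLocalDiffeomorphAt I J ∞ f x) :
    IsLocalDiffeomorphAt I K ∞ (g ∘ f) x :=
  IsLocalDiffeomorphAt.comp (hf := hf) (hg := hg)

/-- Near `B x` the map `A` is `C` after the local inverse of `B`. No continuity of `A` is assumed,
so this applies to maps that are defined pointwise by choices. -/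
theorem isLocalDiffeomorphAt_of_comp {A : N' → N''} {B : N → N'} {C : N → N''} {x : N}
    (hB : IsLocalDiffeomorphAt I J ∞ B x) (hC : IsLocalDiffeomorphAt I K ∞ C x)
    (h : ∀ᶠ y in 𝓝 x, A (B y) = C y) : IsLocalDiffeomorphAt J K ∞ A (B x) := by
  have h1 : IsLocalDiffeomorphAt J K ∞ (C ∘ hB.localInverse) (B x) := by
    refine isLocalDiffeomorphAt_comp ?_ hB.localInverse_isLocalDiffeomorphAt
    rw [hB.localInverse_left_inv hB.localInverse_mem_target]
    exact hC
  refine isLocalDiffeomorphAt_congr h1 ?_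
  have hx : hB.localInverse (B x) = x := hB.localInverse_left_inv hB.localInverse_mem_target
  have h2 : Tendsto hB.localInverse (𝓝 (B x)) (𝓝 x) := by
    have := hB.localInverse_contMDiffAt.continuousAt.tendsto
    rwa [hx] at this
  filter_upwards [h2.eventually h, hB.localInverse_eventuallyEq_right] with y hy hy'
  have h3 : B (hB.localInverse y) = y := hy'
  rw [h3] at hy
  exact hy

/-- Near `x` the map `B` is the local inverse of `A` after `C`. Continuity of `B` is what keeps its
values in the domain of that inverse. -/
theorem isLocalDiffeomorphAt_of_comp_left {A : N' → N''} {B : N → N'} {C : N → N''} {x : N}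
    (hA : IsLocalDiffeomorphAt J K ∞ A (B x)) (hC : IsLocalDiffeomorphAt I K ∞ C x)
    (hB : ContinuousAt B x)
    (h : ∀ᶠ y in 𝓝 x, A (B y) = C y) : IsLocalDiffeomorphAt I J ∞ B x := by
  have hx : A (B x) = C x := h.self_of_nhds
  have h1 : IsLocalDiffeomorphAt I J ∞ (hA.localInverse ∘ C) x := by
    refine isLocalDiffeomorphAt_comp ?_ hC
    rw [← hx]
    exact hA.localInverse_isLocalDiffeomorphAt
  refine isLocalDiffeomorphAt_congr h1 ?_
  filter_upwards [h, hB.eventually hA.localInverse_eventuallyEq_left] with y hy hy'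
  rw [Function.comp_apply, ← hy]
  exact hy'.symm

theorem IsLocalDiffeomorphAt.map_nhds {f : N → N'} {x : N}
    (hf : IsLocalDiffeomorphAt I J ∞ f x) : map f (𝓝 x) = 𝓝 (f x) := by
  obtain ⟨Φ, hx, hΦ⟩ := hf
  have h1 : f =ᶠ[𝓝 x] Φ.toOpenPartialHomeomorph :=
    eventuallyEq_of_mem (Φ.open_source.mem_nhds hx) hΦ
  rw [map_congr h1, h1.self_of_nhds]
  exact Φ.toOpenPartialHomeomorph.map_nhds_eq hx

theorem IsLocalDiffeomorphAt.exists_injOn {f : N → N'} {x : N}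
    (hf : IsLocalDiffeomorphAt I J ∞ f x) : ∃ U ∈ 𝓝 x, InjOn f U := by
  obtain ⟨Φ, hx, hΦ⟩ := hf
  exact ⟨Φ.source, Φ.open_source.mem_nhds hx, hΦ.symm.injOn_iff.1 Φ.toPartialEquiv.injOn⟩

theorem extChartAt_isLocalDiffeomorphAt [IsManifold I ∞ N] [I.Boundaryless] (x : N) {y : N}
    (hy : y ∈ (extChartAt I x).source) :
    IsLocalDiffeomorphAt I 𝓘(ℝ, E) ∞ (extChartAt I x) y := by
  refine ⟨⟨extChartAt I x, isOpen_extChartAt_source x, isOpen_extChartAt_target x, ?_, ?_⟩, hy,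
    fun _ _ => rfl⟩
  · rw [extChartAt_source]; exact contMDiffOn_extChartAt
  · exact contMDiffOn_extChartAt_symm x

theorem isLocalDiffeomorphAt_of_contDiffOn [CompleteSpace E] {F : E → E'} {O : Set E}
    (hO : IsOpen O) (hF : ContDiffOn ℝ ∞ F O) {x : E} (hx : x ∈ O) (F' : E ≃L[ℝ] E')
    (hF' : HasFDerivAt F (F' : E →L[ℝ] E') x) : IsLocalDiffeomorphAt 𝓘(ℝ, E) 𝓘(ℝ, E') ∞ F x := by
  have hFx : ContDiffAt ℝ ∞ F x := hF.contDiffAt (hO.mem_nhds hx)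
  set e := hFx.toOpenPartialHomeomorph F hF' (by simp) with he
  have hcont : ContinuousOn (fderiv ℝ F) O := hF.continuousOn_fderiv_of_isOpen hO (by simp)
  -- The inverse function theorem gives smoothness of the inverse only at points whose derivative is
  -- invertible. Invertible maps form an open set, so shrinking to `W` gives smoothness on the whole
  -- target.
  have hW : IsOpen (O ∩ fderiv ℝ F ⁻¹' range ((↑) : (E ≃L[ℝ] E') → E →L[ℝ] E')) :=
    hcont.isOpen_inter_preimage hO ContinuousLinearEquiv.isOpen
  set W := O ∩ fderiv ℝ F ⁻¹' range ((↑) : (E ≃L[ℝ] E') → E →L[ℝ] E')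
  have hxW : x ∈ W := ⟨hx, F', by rw [hF'.fderiv]⟩
  set e' := e.restrOpen W hW with he'
  have hes : e'.source = e.source ∩ W := e.restrOpen_source W hW
  refine ⟨⟨e'.toPartialEquiv, e'.open_source, e'.open_target, ?_, ?_⟩, ?_, fun _ _ => rfl⟩
  · refine (contMDiffOn_iff_contDiffOn.2 (hF.mono ?_))
    intro y hy
    have : y ∈ e'.source := hy
    rw [hes] at this
    exact this.2.1
  · refine contMDiffOn_iff_contDiffOn.2 fun y hy => ?_
    have h1 : e'.symm y ∈ e'.source := e'.map_target hy
    rw [hes] at h1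
    obtain ⟨L, hL⟩ := h1.2.2
    have h2 : ContDiffAt ℝ ∞ F (e'.symm y) := hF.contDiffAt (hO.mem_nhds h1.2.1)
    refine (e'.contDiffAt_symm (f₀' := L) hy ?_ h2).contDiffWithinAt
    have h3 := (h2.differentiableAt (by simp)).hasFDerivAt
    rw [← hL] at h3
    exact h3
  · change x ∈ e'.source
    rw [hes]
    exact ⟨hFx.mem_toOpenPartialHomeomorph_source hF' (by simp), hxW⟩

/-- The inverse function theorem for manifolds without boundary. -/
theorem isLocalDiffeomorphAt_of_injective_mfderiv [FiniteDimensional ℝ E] [FiniteDimensional ℝ E']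
    [IsManifold I ∞ N] [IsManifold J ∞ N'] [I.Boundaryless] [J.Boundaryless]
    (hdim : Module.finrank ℝ E = Module.finrank ℝ E') {f : N → N'} {U : Set N} (hU : IsOpen U)
    (hf : ContMDiffOn I J ∞ f U) {x : N} (hx : x ∈ U)
    (hinj : ∀ v : TangentSpace I x, mfderiv I J f x v = 0 → v = 0) :
    IsLocalDiffeomorphAt I J ∞ f x := by
  have : CompleteSpace E := FiniteDimensional.complete ℝ E
  have hfx : ContMDiffAt I J ∞ f x := hf.contMDiffAt (hU.mem_nhds hx)
  set φ := extChartAt I x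
  set ψ := extChartAt J (f x)
  set F : E → E' := ψ ∘ f ∘ φ.symm
  set O : Set E := φ.target ∩ φ.symm ⁻¹' (U ∩ f ⁻¹' ψ.source)
  have hUo : IsOpen (U ∩ f ⁻¹' ψ.source) :=
    hf.continuousOn.isOpen_inter_preimage hU (isOpen_extChartAt_source (I := J) (f x))
  have hO : IsOpen O :=
    (continuousOn_extChartAt_symm (I := I) x).isOpen_inter_preimage
      (isOpen_extChartAt_target (I := I) x) hUo
  have hxO : φ x ∈ O := by
    refine ⟨mem_extChartAt_target (I := I) x, ?_⟩
    change φ.symm (φ x) ∈ U ∩ f ⁻¹' ψ.source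
    rw [extChartAt_to_inv (I := I) x]
    exact ⟨hx, mem_extChartAt_source (I := J) (f x)⟩
  have hF : ContDiffOn ℝ ∞ F O := by
    rw [← contMDiffOn_iff_contDiffOn]
    have h1 : ContMDiffOn 𝓘(ℝ, E) I ∞ φ.symm O := (contMDiffOn_extChartAt_symm x).mono inter_subset_left
    have h2 : ContMDiffOn 𝓘(ℝ, E) J ∞ (f ∘ φ.symm) O := hf.comp h1 fun y hy => hy.2.1
    refine (contMDiffOn_extChartAt (I := J) (x := f x)).comp h2 fun y hy => ?_
    have := hy.2.2
    rw [mem_preimage, extChartAt_source] at this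
    exact this
  have hmd : MDifferentiableAt I J f x := hfx.mdifferentiableAt (by simp)
  have hfd : fderiv ℝ F (φ x) = mfderiv I J f x := by
    have h1 := hmd.mfderiv
    rw [I.range_eq_univ, fderivWithin_univ] at h1
    exact h1.symm
  have hFd : HasFDerivAt F (fderiv ℝ F (φ x)) (φ x) :=
    ((hF.contDiffAt (hO.mem_nhds hxO)).differentiableAt (by simp)).hasFDerivAt
  have hinj' : Function.Injective (fderiv ℝ F (φ x)) := by
    rw [injective_iff_map_eq_zero]
    intro v hv
    rw [hfd] at hv
    exact hinj v hv
  let L : E ≃L[ℝ] E' :=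
    (LinearEquiv.ofInjectiveOfFinrankEq (fderiv ℝ F (φ x)).toLinearMap hinj' hdim).toContinuousLinearEquiv
  have hL : (L : E →L[ℝ] E') = fderiv ℝ F (φ x) := by
    ext v; rfl
  rw [← hL] at hFd
  have h1 := isLocalDiffeomorphAt_of_contDiffOn hO hF hxO L hFd
  have h2 : IsLocalDiffeomorphAt I 𝓘(ℝ, E') ∞ (F ∘ φ) x :=
    isLocalDiffeomorphAt_comp h1
      (extChartAt_isLocalDiffeomorphAt x (mem_extChartAt_source (I := I) x))
  refine isLocalDiffeomorphAt_of_comp_left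
    (extChartAt_isLocalDiffeomorphAt (I := J) (f x) (mem_extChartAt_source (I := J) (f x))) h2
    hfx.continuousAt ?_
  filter_upwards [extChartAt_source_mem_nhds (I := I) x] with y hy
  simp only [F, Function.comp_apply, φ]
  rw [(extChartAt I x).left_inv hy]

/-- In the normal form of an immersion, projection to the first factor gives a smooth left inverse
`r` near `f x`. The chain rule for `r ∘ f = id` then gives injectivity. -/
theorem IsImmersionAt.mfderiv_injective [IsManifold I ∞ N] [IsManifold J ∞ N'] [I.Boundaryless] {f : N → N'}
    {x : N} (hf : IsImmersionAt I J ∞ f x) : Function.Injective (mfderiv I J f x) := by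
  set φ := hf.domChart
  set ψ := hf.codChart
  let r : N' → N := fun y => (φ.extend I).symm ((hf.equiv.symm (ψ.extend J y)).1)
  have hxs : x ∈ φ.source := hf.mem_domChart_source
  have hrf : ∀ᶠ y in 𝓝 x, r (f y) = y := by
    filter_upwards [φ.open_source.mem_nhds hxs] with y hy
    have hy' : y ∈ (φ.extend I).source := by rwa [φ.extend_source]
    have h1 := hf.writtenInCharts ((φ.extend I).map_source hy')
    simp only [Function.comp_apply] at h1
    rw [(φ.extend I).left_inv hy'] at h1
    simp only [r]
    rw [show (ψ.extend J) (f y) = hf.equiv ((φ.extend I) y, 0) from h1]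
    simp only [ContinuousLinearEquiv.symm_apply_apply]
    exact (φ.extend I).left_inv hy'
  have hxφ : x ∈ (φ.extend I).source := by rwa [φ.extend_source]
  have hfx : (hf.equiv.symm (ψ.extend J (f x))).1 = φ.extend I x := by
    have h1 := hf.writtenInCharts ((φ.extend I).map_source hxφ)
    simp only [Function.comp_apply] at h1
    rw [(φ.extend I).left_inv hxφ] at h1
    rw [show (ψ.extend J) (f x) = hf.equiv ((φ.extend I) x, 0) from h1]
    simp
  have hψ : ContMDiffAt J 𝓘(ℝ, E') ∞ (ψ.extend J) (f x) :=
    (OpenPartialHomeomorph.contMDiffOn_extend hf.codChart_mem_maximalAtlas).contMDiffAt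
      (ψ.open_source.mem_nhds hf.mem_codChart_source)
  have h1 : ContMDiffAt J 𝓘(ℝ, E) ∞ (fun y => (hf.equiv.symm (ψ.extend J y)).1) (f x) := by
    have h2 : ContMDiff 𝓘(ℝ, E') 𝓘(ℝ, E) ∞ (fun v => (hf.equiv.symm v).1) := by
      rw [contMDiff_iff_contDiff]
      exact contDiff_fst.comp hf.equiv.symm.contDiff
    exact h2.contMDiffAt.comp (f x) hψ
  have hr : ContMDiffAt J I ∞ r (f x) := by
    have h3 := contMDiffOn_extend_symm (n := ∞) hf.domChart_mem_maximalAtlas (I := I)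
    have hm : φ.extend I x ∈ I '' φ.target := by
      refine ⟨φ x, φ.map_source hxs, rfl⟩
    have h4 : ContMDiffAt 𝓘(ℝ, E) I ∞ (φ.extend I).symm (φ.extend I x) := by
      refine h3.contMDiffAt ?_
      have : IsOpen (I '' φ.target) := by
        rw [show (I : H → E) = I.toHomeomorph from rfl]
        exact I.toHomeomorph.isOpenMap _ φ.open_target
      exact this.mem_nhds hm
    rw [← hfx] at h4
    exact h4.comp (f x) h1
  have hfm : MDifferentiableAt I J f x := hf.contMDiffAt.mdifferentiableAt (by simp)
  have hrm : MDifferentiableAt J I r (f x) := hr.mdifferentiableAt (by simp)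
  have hc : mfderiv I I (r ∘ f) x = mfderiv I I (id : N → N) x := by
    exact Filter.EventuallyEq.mfderiv_eq hrf
  rw [mfderiv_comp x hrm hfm, mfderiv_id] at hc
  intro v w hvw
  have h5 := congrArg (fun L => L v) hc
  have h6 := congrArg (fun L => L w) hc
  simp only [ContinuousLinearMap.comp_apply] at h5 h6
  rw [hvw] at h5
  exact h5.symm.trans h6

end LocalDiffeo

/-! ### Open submanifolds. -/

section Opens

variable {E E' : Type*} [NormedAddCommGroup E] [NormedSpace ℝ E]
  [NormedAddCommGroup E'] [NormedSpace ℝ E']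
  {H H' : Type*} [TopologicalSpace H] [TopologicalSpace H']
  {I : ModelWithCorners ℝ E H} {J : ModelWithCorners ℝ E' H'}
  {N : Type*} [TopologicalSpace N] [ChartedSpace H N]
  {N' : Type*} [TopologicalSpace N'] [ChartedSpace H' N']

theorem subtype_val_isLocalDiffeomorphAt [IsManifold I ∞ N] (U : TopologicalSpace.Opens N) (x : U) :
    IsLocalDiffeomorphAt I I ∞ (Subtype.val : U → N) x := by
  have : Nonempty U := ⟨x⟩
  set e := U.openPartialHomeomorphSubtypeCoe this
  have ht : e.target = U := U.openPartialHomeomorphSubtypeCoe_target this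
  refine ⟨⟨e.toPartialEquiv, e.open_source, e.open_target, contMDiff_subtype_val.contMDiffOn, ?_⟩,
    mem_univ _, fun _ _ => rfl⟩
  intro y hy
  have hy' : y ∈ U := by
    have : y ∈ e.target := hy
    rwa [ht] at this
  have hs : e.symm y = ⟨y, hy'⟩ := Subtype.ext (e.right_inv hy)
  refine ContMDiffAt.contMDiffWithinAt ?_
  have him : IsImmersionAt I I ∞ (Subtype.val : U → N) (e.symm y) := by
    rw [hs]; exact IsImmersionAt.of_opens U hy'
  refine (ContMDiffAt.iff_comp_isImmersionAt him).2 ⟨e.symm.continuousAt hy, ?_⟩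
  refine contMDiffAt_id.congr_of_eventuallyEq ?_
  filter_upwards [e.open_target.mem_nhds hy] with z hz
  exact e.right_inv hz

theorem contMDiffAt_opens_iff [IsManifold J ∞ N'] {U : TopologicalSpace.Opens N'} {f : N → U} {x : N} :
    ContMDiffAt I J ∞ f x ↔ ContMDiffAt I J ∞ (fun y => (f y : N')) x := by
  constructor
  · intro h
    exact contMDiff_subtype_val.contMDiffAt.comp x h
  · intro h
    have him : IsImmersionAt J J ∞ (Subtype.val : U → N') (f x) := IsImmersionAt.of_opens U (f x).2
    refine (ContMDiffAt.iff_comp_isImmersionAt him).2 ⟨?_, h⟩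
    exact IsInducing.subtypeVal.continuousAt_iff.2 h.continuousAt

end Opens

/-! ## Circle-valued functions -/

section CircleLemmas

attribute [local instance] finrank_real_complex_fact'

theorem contMDiff_circle_coe : ContMDiff (𝓡 1) 𝓘(ℝ, ℂ) ∞ (fun w : Circle => (w : ℂ)) :=
  contMDiff_coe_sphere (E := ℂ)

theorem circle_exp_pow (n : ℕ) (s : ℝ) : Circle.exp s ^ n = Circle.exp (n * s) := by simp

theorem circle_exp_zpow (n : ℤ) (s : ℝ) : Circle.exp s ^ n = Circle.exp (n * s) := by simp

theorem circle_exp_eq_one {s : ℝ} (h : Circle.exp s = 1) : ∃ k : ℤ, s = k * (2 * Real.pi) := by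
  rw [← Circle.exp_zero, Circle.exp_eq_exp] at h
  obtain ⟨k, hk⟩ := h
  exact ⟨k, by linarith⟩

/-- A continuous real function is smooth if its image under the exponential covering of the circle
is. -/
theorem contMDiffAt_of_circle_exp {E H N : Type*} [NormedAddCommGroup E] [NormedSpace ℝ E]
    [TopologicalSpace H] {I : ModelWithCorners ℝ E H} [TopologicalSpace N] [ChartedSpace H N]
    {K : N → ℝ} {x : N} (hK : ContinuousAt K x)
    (h : ContMDiffAt I (𝓡 1) ∞ (fun y => Circle.exp (K y)) x) : ContMDiffAt I 𝓘(ℝ, ℝ) ∞ K x := by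
  have h1 : ContMDiffAt I 𝓘(ℝ, ℂ) ∞ (fun y => ((Circle.exp (K y) : Circle) : ℂ)) x :=
    contMDiff_circle_coe.contMDiffAt.comp x h
  -- A branch of the argument centred at `K x`: it recovers `K y` from `Circle.exp (K y)` as long as
  -- `K y` stays within `π` of `K x`.
  have h2 : ContDiffAt ℝ ∞ (fun c : ℂ => K x + (Complex.log (c * (Circle.exp (-K x) : Circle))).im)
      ((Circle.exp (K x) : Circle) : ℂ) := by
    refine contDiffAt_const.add ?_
    have him : ContDiff ℝ ∞ (fun z : ℂ => z.im) := Complex.imCLM.contDiff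
    refine ContDiffAt.comp (g := fun z : ℂ => z.im) _ him.contDiffAt ?_
    have h3 : ((Circle.exp (K x) : Circle) : ℂ) * ((Circle.exp (-K x) : Circle) : ℂ) = 1 := by
      rw [← Circle.coe_mul, ← Circle.exp_add]; simp
    refine ContDiffAt.comp (g := Complex.log)
      (f := fun c : ℂ => c * ((Circle.exp (-K x) : Circle) : ℂ)) _ ?_
      (contDiffAt_id.mul contDiffAt_const)
    rw [h3]
    exact (Complex.contDiffAt_log (by simp)).restrict_scalars ℝ
  have h4 := ContMDiffAt.comp (I' := 𝓘(ℝ, ℂ)) x h2.contMDiffAt h1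
  refine h4.congr_of_eventuallyEq ?_
  have h5 : ∀ᶠ y in 𝓝 x, K y ∈ Metric.ball (K x) Real.pi :=
    hK.eventually (Metric.ball_mem_nhds _ Real.pi_pos)
  filter_upwards [h5] with y hy
  rw [Real.ball_eq_Ioo] at hy
  simp only [Function.comp_apply]
  rw [← Circle.coe_mul, ← Circle.exp_add, Circle.coe_exp, Complex.log_exp]
  · simp
  · simp; linarith [hy.1]
  · simp; linarith [hy.2]

theorem finite_pow_eq {n : ℕ} (hn : 0 < n) (c : ℂ) : {g : ℂ | g ^ n = c}.Finite := by
  refine ((Polynomial.nthRoots n c).toFinset.finite_toSet).subset fun g hg => ?_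
  simpa [Polynomial.mem_nthRoots hn] using hg

/-- A connected set with two points is infinite. This fixes the choice of a root of unity along a
fiber in `exists_bridge`. -/
theorem eq_of_finite_range {f : ℝ → ℂ} (hf : Continuous f) (h : (range f).Finite) (s t : ℝ) :
    f s = f t := by
  by_contra hne
  exact (isPreconnected_range hf).infinite_of_nontrivial ⟨f s, ⟨s, rfl⟩, f t, ⟨t, rfl⟩, hne⟩ h

end CircleLemmas

/-! ## Fibered solid tori -/

section Tori

variable {M : Type*} [TopologicalSpace M] [ChartedSpace (EuclideanSpace ℝ (Fin 3)) M]

/-- An embedded standard fibered solid torus. -/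
structure FiberedTorus (𝓕 : SeifertFibration M) where
  p : ℕ
  q : ℤ
  p_pos : 0 < p
  coprime : IsCoprime (p : ℤ) q
  Φ : OpenPartialHomeomorph (ℂ × Circle) M
  source_eq : Φ.source = Metric.ball (0 : ℂ) 1 ×ˢ univ
  smooth : ContMDiffOn (𝓘(ℝ, ℂ).prod (𝓡 1)) (𝓡 3) ∞ Φ Φ.source
  smooth_symm : ContMDiffOn (𝓡 3) (𝓘(ℝ, ℂ).prod (𝓡 1)) ∞ Φ.symm Φ.target
  rel_iff : ∀ a ∈ Φ.source, ∀ y : M,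
        𝓕.rel (Φ a) y ↔ ∃ w : Circle, y = Φ (((w ^ q : Circle) : ℂ) * a.1, w ^ p * a.2)

theorem SeifertFibration.exists_torus (𝓕 : SeifertFibration M) (x : M) :
    ∃ (A : FiberedTorus 𝓕) (u : Circle), A.Φ (0, u) = x := by
  obtain ⟨p, q, hp, hq, Φ, h1, h2, h3, ⟨u, hu⟩, h4⟩ := 𝓕.exists_fibered_solid_torus x
  exact ⟨⟨p, q, hp, hq, Φ, h1, h2, h3, h4⟩, u, hu⟩

namespace FiberedTorus

variable {𝓕 : SeifertFibration M} (A B D : FiberedTorus 𝓕)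

/-- The flow along the fibers of the standard fibered solid torus. -/
def rot (s : ℝ) (a : ℂ × Circle) : ℂ × Circle :=
  ((Circle.exp (A.q * s) : ℂ) * a.1, Circle.exp (A.p * s) * a.2)

/-- The flow along the fibers of an embedded fibered solid torus. -/
def flow (s : ℝ) (y : M) : M := A.Φ (A.rot s (A.Φ.symm y))

theorem rot_zero (a : ℂ × Circle) : A.rot 0 a = a := by simp [rot]

theorem rot_add (s t : ℝ) (a : ℂ × Circle) : A.rot (s + t) a = A.rot s (A.rot t a) := by
  simp only [rot, mul_add, Circle.exp_add, Circle.coe_mul, mul_assoc]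

theorem rot_mem {a : ℂ × Circle} (ha : a ∈ A.Φ.source) (s : ℝ) : A.rot s a ∈ A.Φ.source := by
  rw [A.source_eq] at ha ⊢
  refine ⟨?_, mem_univ _⟩
  have := ha.1
  simpa [rot] using this

variable {A}

theorem symm_mem {y : M} (hy : y ∈ A.Φ.target) : A.Φ.symm y ∈ A.Φ.source := A.Φ.map_target hy

theorem flow_mem {y : M} (hy : y ∈ A.Φ.target) (s : ℝ) : A.flow s y ∈ A.Φ.target :=
  A.Φ.map_source (A.rot_mem (symm_mem hy) s)

theorem symm_flow {y : M} (hy : y ∈ A.Φ.target) (s : ℝ) :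
    A.Φ.symm (A.flow s y) = A.rot s (A.Φ.symm y) :=
  A.Φ.left_inv (A.rot_mem (symm_mem hy) s)

theorem flow_zero {y : M} (hy : y ∈ A.Φ.target) : A.flow 0 y = y := by
  rw [flow, rot_zero, A.Φ.right_inv hy]

theorem flow_add {y : M} (hy : y ∈ A.Φ.target) (s t : ℝ) :
    A.flow (s + t) y = A.flow s (A.flow t y) := by
  rw [flow, rot_add, flow, symm_flow hy]

theorem flow_two_pi (y : M) (s : ℝ) : A.flow (s + 2 * Real.pi) y = A.flow s y := by
  have h (n : ℤ) : Circle.exp (n * (2 * Real.pi)) = 1 := Circle.exp_int_mul_two_pi n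
  have h' : Circle.exp (A.p * (2 * Real.pi)) = 1 := by simp
  simp [flow, rot, mul_add, Circle.exp_add, h A.q, h']

theorem rel_iff_flow {y : M} (hy : y ∈ A.Φ.target) (y' : M) :
    𝓕.rel y y' ↔ ∃ s, y' = A.flow s y := by
  have h := A.rel_iff _ (symm_mem hy) y'
  rw [A.Φ.right_inv hy] at h
  rw [h]
  constructor
  · rintro ⟨w, hw⟩
    obtain ⟨s, rfl⟩ := Circle.exp_surjective w
    exact ⟨s, by rw [hw, circle_exp_zpow, circle_exp_pow]; rfl⟩
  · rintro ⟨s, hs⟩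
    exact ⟨Circle.exp s, by rw [hs, circle_exp_zpow, circle_exp_pow]; rfl⟩

theorem rel_flow {y : M} (hy : y ∈ A.Φ.target) (s : ℝ) : 𝓕.rel y (A.flow s y) :=
  (rel_iff_flow hy _).2 ⟨s, rfl⟩

theorem mem_of_rel {y y' : M} (hy : y ∈ A.Φ.target) (h : 𝓕.rel y y') : y' ∈ A.Φ.target := by
  obtain ⟨s, rfl⟩ := (rel_iff_flow hy y').1 h
  exact flow_mem hy s

theorem contMDiffOn_flow : ContMDiffOn ((𝓡 3).prod 𝓘(ℝ, ℝ)) (𝓡 3) ∞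
    (fun x : M × ℝ => A.flow x.2 x.1) (A.Φ.target ×ˢ univ) := by
  have h0 : ContMDiffOn ((𝓡 3).prod 𝓘(ℝ, ℝ)) (𝓘(ℝ, ℂ).prod (𝓡 1)) ∞
      (fun x : M × ℝ => A.Φ.symm x.1) (A.Φ.target ×ˢ univ) :=
    A.smooth_symm.comp contMDiff_fst.contMDiffOn fun x hx => hx.1
  have he (c : ℝ) : ContMDiff ((𝓡 3).prod 𝓘(ℝ, ℝ)) (𝓡 1) ∞
      (fun x : M × ℝ => Circle.exp (c * x.2)) := by
    have h1 : ContMDiff ((𝓡 3).prod 𝓘(ℝ, ℝ)) 𝓘(ℝ, ℝ) ∞ (fun x : M × ℝ => c * x.2) :=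
      (contMDiff_iff_contDiff.2 (contDiff_const.mul contDiff_id) :
        ContMDiff 𝓘(ℝ, ℝ) 𝓘(ℝ, ℝ) ∞ (fun t : ℝ => c * t)).comp contMDiff_snd
    exact contMDiff_circleExp.comp h1
  have h2 : ContMDiffOn ((𝓡 3).prod 𝓘(ℝ, ℝ)) (𝓘(ℝ, ℂ).prod (𝓡 1)) ∞
      (fun x : M × ℝ => A.rot x.2 (A.Φ.symm x.1)) (A.Φ.target ×ˢ univ) := by
    refine ContMDiffOn.prodMk ?_ ?_
    · have hm : ContMDiff 𝓘(ℝ, ℂ × ℂ) 𝓘(ℝ, ℂ) ∞ (fun x : ℂ × ℂ => x.1 * x.2) :=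
        contDiff_mul.contMDiff
      exact hm.comp_contMDiffOn ((contMDiff_circle_coe.comp (he A.q)).contMDiffOn.prodMk_space
        (contMDiff_fst.comp_contMDiffOn h0))
    · exact (he A.p).contMDiffOn.mul (contMDiff_snd.comp_contMDiffOn h0)
  exact A.smooth.comp h2 fun x hx => A.rot_mem (symm_mem hx.1) x.2

theorem continuousOn_flow : ContinuousOn (fun x : M × ℝ => A.flow x.2 x.1) (A.Φ.target ×ˢ univ) :=
  contMDiffOn_flow.continuousOn

theorem continuous_flow {y : M} (hy : y ∈ A.Φ.target) : Continuous (fun s => A.flow s y) :=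
  continuousOn_flow.comp_continuous (f := fun s : ℝ => (y, s)) (by fun_prop) fun _ => ⟨hy, mem_univ _⟩

/-- The angular coordinate of the flow at time `s` is `exp (p s)` times a constant, so `p h` and `p
k` lift the same path in the circle. The argument also works on the core, where the minimal period
is smaller than `2π`. -/
theorem flow_unique {y : M} (hy : y ∈ A.Φ.target) {h k : ℝ → ℝ} (hh : Continuous h)
    (hk : Continuous k) {s₀ : ℝ} (h0 : h s₀ = k s₀) (hhk : ∀ s, A.flow (h s) y = A.flow (k s) y) :
    h = k := by
  have h1 : Circle.exp ∘ (fun s => A.p * h s) = Circle.exp ∘ (fun s => A.p * k s) := by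
    funext s
    have := congrArg (fun y => (A.Φ.symm y).2) (hhk s)
    simp only [symm_flow hy, rot] at this
    exact mul_right_cancel this
  have h2 := Circle.isCoveringMap_exp.eq_of_comp_eq (by fun_prop) (by fun_prop) h1 s₀ (by rw [h0])
  funext s
  have h3 := congrFun h2 s
  have : (A.p : ℝ) ≠ 0 := by exact_mod_cast A.p_pos.ne'
  exact mul_left_cancel₀ this h3

/-- Off the core a return forces both `exp (q c) = 1` and `exp (p c) = 1`, and Bézout's identity for
`p`, `q` combines them. On the core only the second condition is available. -/
theorem flow_eq_self {y : M} (hy : y ∈ A.Φ.target) (hz : (A.Φ.symm y).1 ≠ 0) {c : ℝ}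
    (h : A.flow c y = y) : ∃ k : ℤ, c = k * (2 * Real.pi) := by
  have h1 : A.rot c (A.Φ.symm y) = A.Φ.symm y := by rw [← symm_flow hy, h]
  have h2 : Circle.exp (A.q * c) = 1 := by
    have := congrArg Prod.fst h1
    simp only [rot] at this
    exact Circle.ext (by simpa using mul_right_cancel₀ hz (this.trans (one_mul _).symm))
  have h3 : Circle.exp (A.p * c) = 1 := by
    have := congrArg Prod.snd h1
    simpa [rot] using this
  obtain ⟨m, hm⟩ := circle_exp_eq_one h2
  obtain ⟨n, hn⟩ := circle_exp_eq_one h3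
  obtain ⟨a, b, hab⟩ := A.coprime
  refine ⟨a * n + b * m, ?_⟩
  have hab' : (a : ℝ) * A.p + b * A.q = 1 := by exact_mod_cast hab
  push_cast
  calc c = (a * A.p + b * A.q) * c := by rw [hab', one_mul]
    _ = a * (A.p * c) + b * (A.q * c) := by ring
    _ = _ := by rw [hn, hm]; ring

/-! ### Comparison of two flows -/

-- The `B`-angle along an `A`-orbit is lifted to the line and divided by `B.p`. Lifting it as a
-- homotopy that starts at time zero makes the time change jointly continuous in the point and the
-- time.
variable (A) in
theorem exists_bridge : ∃ H : M → ℝ → ℝ,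
    ContinuousOn (fun x : M × ℝ => H x.1 x.2) ((A.Φ.target ∩ B.Φ.target) ×ˢ univ) ∧
    ∀ y ∈ A.Φ.target ∩ B.Φ.target, H y 0 = 0 ∧ ∀ s, B.flow (H y s) y = A.flow s y := by
  classical
  let W := A.Φ.target ∩ B.Φ.target
  have hAB {y : M} (hy : y ∈ W) (s : ℝ) : A.flow s y ∈ B.Φ.target :=
    mem_of_rel hy.2 (rel_flow hy.1 s)
  have hc : Continuous (fun x : unitInterval × (W × ℝ) => A.flow (x.1 * x.2.2) x.2.1) :=
    continuousOn_flow.comp_continuous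
      (f := fun x : unitInterval × (W × ℝ) => ((x.2.1 : M), (x.1 : ℝ) * x.2.2))
      (by fun_prop) fun x => ⟨x.2.1.2.1, mem_univ _⟩
  have hc2 : Continuous (fun x : unitInterval × (W × ℝ) => B.Φ.symm (A.flow (x.1 * x.2.2) x.2.1)) :=
    B.Φ.continuousOn_symm.comp_continuous hc fun x => hAB x.2.1.2 _
  have hc3 : Continuous (fun x : unitInterval × (W × ℝ) => B.Φ.symm (x.2.1 : M)) :=
    B.Φ.continuousOn_symm.comp_continuous (by fun_prop) fun x => x.2.1.2.2
  -- The `B`-angle along the orbit of `A`, relative to its initial value. At homotopy parameter `0`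
  -- it is `1`, so the lift can start at `0`.
  let F : C(unitInterval × (W × ℝ), Circle) :=
    ⟨fun x => (B.Φ.symm (A.flow (x.1 * x.2.2) x.2.1)).2 / (B.Φ.symm (x.2.1 : M)).2, by fun_prop⟩
  have hF0 (a : W × ℝ) : F (0, a) = Circle.exp ((0 : C(W × ℝ, ℝ)) a) := by
    simp [F, flow_zero a.1.2.1]
  let Γ := Circle.isCoveringMap_exp.liftHomotopy F 0 hF0
  have hΓ (x) : Circle.exp (Γ x) = F x :=
    congrFun (Circle.isCoveringMap_exp.liftHomotopy_lifts F 0 hF0) x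
  have hΓ0 (a) : Γ (0, a) = 0 := Circle.isCoveringMap_exp.liftHomotopy_zero F 0 hF0 a
  have hΓ1 (y : W) : Γ (1, (y, 0)) = 0 := by
    have h1 : Circle.exp ∘ (fun τ : unitInterval => Γ (τ, (y, 0))) =
        Circle.exp ∘ (fun _ : unitInterval => (0 : ℝ)) := by
      funext τ
      simp [hΓ, F, flow_zero y.2.1]
    exact congrFun (Circle.isCoveringMap_exp.eq_of_comp_eq (by fun_prop) (by fun_prop) h1 0
      (hΓ0 _)) 1
  have hp : (B.p : ℝ) ≠ 0 := by exact_mod_cast B.p_pos.ne'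
  refine ⟨fun y s => if hy : y ∈ W then Γ (1, (⟨y, hy⟩, s)) / B.p else 0, ?_, ?_⟩
  · rw [continuousOn_iff_continuous_domRestrict]
    have h1 : Continuous (fun x : ((W ×ˢ univ : Set (M × ℝ)) : Type _) =>
        Γ (1, ((⟨x.1.1, x.2.1⟩ : W), x.1.2)) / B.p) := by fun_prop
    convert h1 using 1
    funext x
    simp only [domRestrict_apply]
    rw [dif_pos x.2.1]
  intro y hy
  refine ⟨by simp [hΓ1], ?_⟩
  simp only [dif_pos (show y ∈ W from hy)]
  set h : ℝ → ℝ := fun s => Γ (1, (⟨y, hy⟩, s)) / B.p with hh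
  have hhc : Continuous h := by fun_prop
  have hh0 : h 0 = 0 := by simp [hh, hΓ1]
  set a := B.Φ.symm y with ha
  have hbc : Continuous (fun s => B.Φ.symm (A.flow s y)) :=
    B.Φ.continuousOn_symm.comp_continuous (continuous_flow hy.1) fun s => hAB hy s
  have hu (s : ℝ) : (B.Φ.symm (A.flow s y)).2 = Circle.exp (B.p * h s) * a.2 := by
    have h1 := hΓ (1, (⟨y, hy⟩, s))
    have h2 : (B.p : ℝ) * h s = Γ (1, (⟨y, hy⟩, s)) := by simp only [hh]; field_simp
    rw [h2, h1]
    simp [F, ha]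
  -- The time change is chosen to match the angular coordinates. For the disc coordinate, undo the
  -- rotation it predicts: the `p`-th power of the result is constant, so the result takes finitely
  -- many values and, being continuous, is constant.
  let g : ℝ → ℂ := fun s => (Circle.exp (-(B.q * h s)) : ℂ) * (B.Φ.symm (A.flow s y)).1
  have hgc : Continuous g := by
    have : Continuous (fun s => (Circle.exp (-(B.q * h s)) : ℂ)) := by fun_prop
    exact this.mul (continuous_fst.comp hbc)
  have hgp (s : ℝ) : g s ^ B.p = a.1 ^ B.p := by
    obtain ⟨σ, hσ⟩ := (rel_iff_flow hy.2 _).1 (rel_flow hy.1 s)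
    have h1 : B.Φ.symm (A.flow s y) = B.rot σ a := by rw [hσ, symm_flow hy.2]
    have h2 : Circle.exp (B.p * h s) = Circle.exp (B.p * σ) := by
      have := hu s
      rw [h1] at this
      exact mul_right_cancel this.symm
    have h3 : (Circle.exp (-(B.q * h s)) * Circle.exp (B.q * σ)) ^ B.p = 1 := by
      have h4 : Circle.exp (B.p * (σ - h s)) = 1 := by
        rw [mul_sub, Circle.exp_sub, h2, div_self']
      rw [← Circle.exp_add, circle_exp_pow]
      have : (B.p : ℝ) * (-(B.q * h s) + B.q * σ) = B.q * (B.p * (σ - h s)) := by ring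
      rw [this, ← circle_exp_zpow, h4, one_zpow]
    simp only [g, h1, rot]
    rw [← mul_assoc, ← Circle.coe_mul, mul_pow, ← Circle.coe_pow, h3]
    simp
  have hfin : (range g).Finite := by
    refine (finite_pow_eq B.p_pos (a.1 ^ B.p)).subset ?_
    rintro _ ⟨s, rfl⟩
    exact hgp s
  intro s
  have hg0 : g s = a.1 := by
    rw [eq_of_finite_range hgc hfin s 0]
    simp [g, hh0, flow_zero hy.1, ha]
  have h5 : B.rot (h s) a = B.Φ.symm (A.flow s y) := by
    refine Prod.ext ?_ (hu s).symm
    simp only [rot]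
    rw [← hg0]
    simp only [g]
    rw [← mul_assoc, ← Circle.coe_mul, ← Circle.exp_add]
    simp
  change B.flow (h s) y = A.flow s y
  rw [flow, ← ha, h5, B.Φ.right_inv (hAB hy s)]

end FiberedTorus

end Tori

/-! ### Calculus of the time changes between fibered tori. -/

section Tori

variable {M : Type*} [TopologicalSpace M] [ChartedSpace (EuclideanSpace ℝ (Fin 3)) M]

namespace FiberedTorus

variable {𝓕 : SeifertFibration M} (A B D : FiberedTorus 𝓕)

/-- The time change between the flows of two fibered solid tori. -/
def bridge : M → ℝ → ℝ := (exists_bridge A B).choose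

variable {A B D}

theorem continuousOn_bridge : ContinuousOn (fun x : M × ℝ => bridge A B x.1 x.2)
    ((A.Φ.target ∩ B.Φ.target) ×ˢ univ) := (exists_bridge A B).choose_spec.1

variable {y : M}

theorem bridge_zero (hA : y ∈ A.Φ.target) (hB : y ∈ B.Φ.target) : bridge A B y 0 = 0 :=
  ((exists_bridge A B).choose_spec.2 y ⟨hA, hB⟩).1

theorem flow_bridge (hA : y ∈ A.Φ.target) (hB : y ∈ B.Φ.target) (s : ℝ) :
    B.flow (bridge A B y s) y = A.flow s y :=
  ((exists_bridge A B).choose_spec.2 y ⟨hA, hB⟩).2 s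

theorem continuous_bridge (hA : y ∈ A.Φ.target) (hB : y ∈ B.Φ.target) :
    Continuous (bridge A B y) :=
  continuousOn_bridge.comp_continuous (f := fun s : ℝ => (y, s)) (by fun_prop)
    fun _ => ⟨⟨hA, hB⟩, mem_univ _⟩

theorem isOpen_inter_target : IsOpen ((A.Φ.target ∩ B.Φ.target) ×ˢ (univ : Set ℝ)) :=
  (A.Φ.open_target.inter B.Φ.open_target).prod isOpen_univ

/-- Modulo `2π`, the number `B.p * bridge` is a quotient of smooth angular coordinates; a continuous
lift of a smooth circle-valued function is smooth. -/
theorem contMDiffAt_bridge (hA : y ∈ A.Φ.target) (hB : y ∈ B.Φ.target) (s : ℝ) :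
    ContMDiffAt ((𝓡 3).prod 𝓘(ℝ, ℝ)) 𝓘(ℝ, ℝ) ∞ (fun x : M × ℝ => bridge A B x.1 x.2) (y, s) := by
  have hn : (A.Φ.target ∩ B.Φ.target) ×ˢ (univ : Set ℝ) ∈ 𝓝 (y, s) :=
    isOpen_inter_target.mem_nhds ⟨⟨hA, hB⟩, mem_univ _⟩
  have hc : ContinuousAt (fun x : M × ℝ => bridge A B x.1 x.2) (y, s) :=
    continuousOn_bridge.continuousAt hn
  have hp : (B.p : ℝ) ≠ 0 := by exact_mod_cast B.p_pos.ne'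
  have h1 : ContMDiffAt ((𝓡 3).prod 𝓘(ℝ, ℝ)) 𝓘(ℝ, ℝ) ∞
      (fun x : M × ℝ => B.p * bridge A B x.1 x.2) (y, s) := by
    refine contMDiffAt_of_circle_exp (continuousAt_const.mul hc) ?_
    have h2 : ContMDiffAt ((𝓡 3).prod 𝓘(ℝ, ℝ)) (𝓡 3) ∞ (fun x : M × ℝ => A.flow x.2 x.1) (y, s) :=
      contMDiffOn_flow.contMDiffAt ((A.Φ.open_target.prod isOpen_univ).mem_nhds ⟨hA, mem_univ _⟩)
    have hBf : A.flow s y ∈ B.Φ.target := mem_of_rel hB (rel_flow hA s)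
    have h3 (z : M) (hz : z ∈ B.Φ.target) :
        ContMDiffAt (𝓡 3) (𝓡 1) ∞ (fun z => (B.Φ.symm z).2) z :=
      contMDiff_snd.contMDiffAt.comp z (B.smooth_symm.contMDiffAt (B.Φ.open_target.mem_nhds hz))
    have h4 : ContMDiffAt ((𝓡 3).prod 𝓘(ℝ, ℝ)) (𝓡 1) ∞
        (fun x : M × ℝ => (B.Φ.symm (A.flow x.2 x.1)).2 * ((B.Φ.symm x.1).2)⁻¹) (y, s) :=
      ((h3 _ hBf).comp (y, s) h2).mul ((h3 y hB).comp (y, s) contMDiffAt_fst).inv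
    refine h4.congr_of_eventuallyEq ?_
    filter_upwards [hn] with x hx
    rw [← flow_bridge hx.1.1 hx.1.2, symm_flow hx.1.2]
    simp [rot]
  have h5 : ContMDiff 𝓘(ℝ, ℝ) 𝓘(ℝ, ℝ) ∞ (fun t : ℝ => (B.p : ℝ)⁻¹ * t) :=
    (contDiff_const.mul contDiff_id).contMDiff
  refine (h5.contMDiffAt.comp (y, s) h1).congr_of_eventuallyEq (Eventually.of_forall fun x => ?_)
  simp only [Function.comp_apply]
  field_simp

/-- The composition and shift identities below follow from this uniqueness: both sides are
continuous, vanish at zero and describe the same motion. -/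
theorem bridge_unique (hA : y ∈ A.Φ.target) (hB : y ∈ B.Φ.target) {h : ℝ → ℝ}
    (hc : Continuous h) (h0 : h 0 = 0) (hf : ∀ s, B.flow (h s) y = A.flow s y) :
    h = bridge A B y :=
  flow_unique hB hc (continuous_bridge hA hB) (s₀ := 0) (by rw [h0, bridge_zero hA hB])
    fun s => by rw [hf, flow_bridge hA hB]

theorem bridge_self (hA : y ∈ A.Φ.target) (s : ℝ) : bridge A A y s = s :=
  (congrFun (bridge_unique hA hA continuous_id rfl fun _ => rfl) s).symm

theorem bridge_comp (hA : y ∈ A.Φ.target) (hB : y ∈ B.Φ.target) (hD : y ∈ D.Φ.target) (s : ℝ) :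
    bridge B D y (bridge A B y s) = bridge A D y s := by
  refine congrFun (bridge_unique hA hD (h := fun s => bridge B D y (bridge A B y s))
    ((continuous_bridge hB hD).comp (continuous_bridge hA hB)) ?_ fun s => ?_) s
  · simp only [bridge_zero hA hB, bridge_zero hB hD]
  · rw [flow_bridge hB hD, flow_bridge hA hB]

theorem bridge_flow (hA : y ∈ A.Φ.target) (hB : y ∈ B.Φ.target) (a s : ℝ) :
    bridge A B (A.flow a y) s = bridge A B y (s + a) - bridge A B y a := by
  have hA' := flow_mem hA a
  have hB' : A.flow a y ∈ B.Φ.target := mem_of_rel hB (rel_flow hA a)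
  have hc := continuous_bridge hA hB
  refine (congrFun (bridge_unique hA' hB' (h := fun s => bridge A B y (s + a) - bridge A B y a)
    (by fun_prop) (by simp) fun s => ?_) s).symm
  rw [← flow_bridge hA hB a, ← flow_add hB, sub_add_cancel, flow_bridge hA hB, flow_add hA,
    flow_bridge hA hB]

theorem bridge_add_two_pi (hA : y ∈ A.Φ.target) (hB : y ∈ B.Φ.target) (s : ℝ) :
    bridge A B y (s + 2 * Real.pi) = bridge A B y s + bridge A B y (2 * Real.pi) := by
  have h1 : A.flow (2 * Real.pi) y = y := by
    have := flow_two_pi (A := A) y 0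
    rwa [zero_add, flow_zero hA] at this
  have h := bridge_flow hA hB (2 * Real.pi) s
  rw [h1] at h
  linarith

theorem bridge_add_int_mul (hA : y ∈ A.Φ.target) (hB : y ∈ B.Φ.target) (s : ℝ) (k : ℤ) :
    bridge A B y (s + k * (2 * Real.pi)) = bridge A B y s + k * bridge A B y (2 * Real.pi) := by
  induction k using Int.induction_on with
  | zero => simp
  | succ n ih =>
    have h := bridge_add_two_pi hA hB (s + n * (2 * Real.pi))
    push_cast at ih ⊢
    rw [add_mul, one_mul, ← add_assoc, h, ih]
    ring
  | pred n ih =>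
    have h := bridge_add_two_pi hA hB (s + (-n - 1) * (2 * Real.pi))
    push_cast at ih ⊢
    have h2 : s + (-n - 1) * (2 * Real.pi) + 2 * Real.pi = s + -n * (2 * Real.pi) := by ring
    rw [h2, ih] at h
    linarith

/-- The core is nowhere dense. This allows a statement about periods to be checked on regular fibers
only. -/
theorem exists_regular (hA : y ∈ A.Φ.target) {U : Set M} (hU : U ∈ 𝓝 y) :
    ∃ y' ∈ U, y' ∈ A.Φ.target ∧ (A.Φ.symm y').1 ≠ 0 := by
  by_cases hz : (A.Φ.symm y).1 = 0
  · set a := A.Φ.symm y with ha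
    have ha' : a = (0, a.2) := Prod.ext hz rfl
    have h1 : ContinuousAt (fun z : ℂ => A.Φ (z, a.2)) 0 := by
      refine ContinuousAt.comp (f := fun z : ℂ => (z, a.2)) (g := A.Φ) ?_ (by fun_prop)
      rw [← ha']
      exact A.Φ.continuousAt (symm_mem hA)
    have h2 : A.Φ (0, a.2) = y := by rw [← ha', ha, A.Φ.right_inv hA]
    have h3 : ∀ᶠ z in 𝓝[≠] (0 : ℂ), A.Φ (z, a.2) ∈ U := by
      refine Filter.Eventually.filter_mono nhdsWithin_le_nhds (h1.eventually ?_)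
      change ∀ᶠ y in 𝓝 (A.Φ (0, a.2)), y ∈ U
      rw [h2]
      exact hU
    have h4 : ∀ᶠ z in 𝓝[≠] (0 : ℂ), (z, a.2) ∈ A.Φ.source := by
      refine Filter.Eventually.filter_mono nhdsWithin_le_nhds ?_
      have : ContinuousAt (fun z : ℂ => (z, a.2)) 0 := by fun_prop
      refine this.eventually (A.Φ.open_source.mem_nhds ?_)
      change ((0 : ℂ), a.2) ∈ A.Φ.source
      rw [← ha']
      exact symm_mem hA
    obtain ⟨z, hz1, hz2, hz3⟩ := (h3.and (h4.and self_mem_nhdsWithin)).exists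
    refine ⟨_, hz1, A.Φ.map_source hz2, ?_⟩
    rw [A.Φ.left_inv hz2]
    exact hz3
  · exact ⟨y, mem_of_mem_nhds hU, hA, hz⟩

/-- On a fiber that is regular in both tori, `2π` generates the periods of both flows. Hence the
time change sends `2π` to `k · 2π`, its inverse sends `2π` to `l · 2π`, and `k l = 1`. -/
theorem abs_bridge_of_regular (hA : y ∈ A.Φ.target) (hB : y ∈ B.Φ.target)
    (hzA : (A.Φ.symm y).1 ≠ 0) (hzB : (B.Φ.symm y).1 ≠ 0) :
    |bridge A B y (2 * Real.pi)| = 2 * Real.pi := by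
  have key (A B : FiberedTorus 𝓕) (hA : y ∈ A.Φ.target) (hB : y ∈ B.Φ.target)
      (hzB : (B.Φ.symm y).1 ≠ 0) : ∃ k : ℤ, bridge A B y (2 * Real.pi) = k * (2 * Real.pi) := by
    refine flow_eq_self hB hzB ?_
    rw [flow_bridge hA hB]
    have := flow_two_pi (A := A) y 0
    rwa [zero_add, flow_zero hA] at this
  obtain ⟨k, hk⟩ := key A B hA hB hzB
  obtain ⟨l, hl⟩ := key B A hB hA hzA
  have h1 := bridge_comp hA hB hA (2 * Real.pi)
  rw [bridge_self hA, hk] at h1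
  have h2 := bridge_add_int_mul hB hA 0 k
  rw [zero_add, h1, bridge_zero hB hA, hl] at h2
  have hpi := Real.two_pi_pos
  have h3 : (k * l : ℝ) = 1 := by
    have : (2 * Real.pi) * (k * l) = (2 * Real.pi) * 1 := by linarith
    exact mul_left_cancel₀ hpi.ne' this
  have h4 : k * l = 1 := by exact_mod_cast h3
  rcases Int.eq_one_or_neg_one_of_mul_eq_one h4 with h | h <;>
  · rw [hk, h]
    simp [abs_of_pos Real.pi_pos]

/-- On an exceptional fiber the minimal period may be a proper fraction of `2π`, and the direct
argument fails. Continuity and density of the points that are regular in both tori give the value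
there. -/
theorem abs_bridge_two_pi (hA : y ∈ A.Φ.target) (hB : y ∈ B.Φ.target) :
    |bridge A B y (2 * Real.pi)| = 2 * Real.pi := by
  by_contra hne
  have hc : ContinuousAt (fun z => |bridge A B z (2 * Real.pi)|) y := by
    have h1 : ContinuousAt (fun x : M × ℝ => bridge A B x.1 x.2) (y, 2 * Real.pi) :=
      (contMDiffAt_bridge hA hB _).continuousAt
    have h2 : ContinuousAt (fun z : M => (z, 2 * Real.pi)) y := by fun_prop
    exact (ContinuousAt.comp (f := fun z : M => (z, 2 * Real.pi)) h1 h2).abs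
  have h1 : ∀ᶠ z in 𝓝 y, |bridge A B z (2 * Real.pi)| ≠ 2 * Real.pi := hc.eventually_ne hne
  have h2 : ∀ᶠ z in 𝓝 y, z ∈ B.Φ.target := B.Φ.open_target.mem_nhds hB
  obtain ⟨V, hV, hVo, hyV⟩ := eventually_nhds_iff.1 (h1.and h2)
  obtain ⟨y₁, hy₁V, hy₁A, hz₁⟩ := exists_regular hA (hVo.mem_nhds hyV)
  have h3 : V ∩ (A.Φ.target ∩ {z | (A.Φ.symm z).1 ≠ 0}) ∈ 𝓝 y₁ := by
    refine inter_mem (hVo.mem_nhds hy₁V) (inter_mem (A.Φ.open_target.mem_nhds hy₁A) ?_)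
    exact (continuous_fst.continuousAt.comp (A.Φ.continuousAt_symm hy₁A)).eventually_ne hz₁
  obtain ⟨y₂, hy₂, hy₂B, hz₂⟩ := exists_regular (hV y₁ hy₁V).2 h3
  exact (hV y₂ hy₂.1).1 (abs_bridge_of_regular hy₂.2.1 hy₂B hy₂.2.2 hz₂)

variable (A B) in
/-- Whether the flows of two fibered solid tori have the same direction (`1`) or not (`-1`). -/
def sgn (y : M) : ℝ := bridge A B y (2 * Real.pi) / (2 * Real.pi)

theorem sgn_eq (hA : y ∈ A.Φ.target) (hB : y ∈ B.Φ.target) : sgn A B y = 1 ∨ sgn A B y = -1 := by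
  have hpi := Real.two_pi_pos
  rcases (abs_eq hpi.le).1 (abs_bridge_two_pi hA hB) with h | h
  · left; rw [sgn, h, div_self hpi.ne']
  · right; rw [sgn, h, neg_div, div_self hpi.ne']

theorem sgn_mul_self (hA : y ∈ A.Φ.target) (hB : y ∈ B.Φ.target) : sgn A B y * sgn A B y = 1 := by
  rcases sgn_eq hA hB with h | h <;> simp [h]

theorem bridge_two_pi (y : M) : bridge A B y (2 * Real.pi) = sgn A B y * (2 * Real.pi) := by
  rw [sgn, div_mul_cancel₀ _ Real.two_pi_pos.ne']

theorem sgn_comp (hA : y ∈ A.Φ.target) (hB : y ∈ B.Φ.target) (hD : y ∈ D.Φ.target) :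
    sgn A D y = sgn A B y * sgn B D y := by
  have h := bridge_comp hA hB hD (2 * Real.pi)
  have hpi := Real.two_pi_pos
  rw [bridge_two_pi (A := A) (B := B)] at h
  rw [sgn, ← h]
  rcases sgn_eq hA hB with h1 | h1
  · rw [h1, one_mul, one_mul, sgn]
  · rw [h1]
    have h2 := bridge_add_int_mul hB hD 0 (-1)
    push_cast at h2
    rw [zero_add, bridge_zero hB hD] at h2
    rw [h2, sgn]
    ring

theorem sgn_flow (hA : y ∈ A.Φ.target) (hB : y ∈ B.Φ.target) (a : ℝ) :
    sgn A B (A.flow a y) = sgn A B y := by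
  rw [sgn, sgn, bridge_flow hA hB, add_comm, bridge_add_two_pi hA hB]
  ring

theorem strictMono_sgn_mul_bridge (hA : y ∈ A.Φ.target) (hB : y ∈ B.Φ.target) :
    StrictMono fun s => sgn A B y * bridge A B y s := by
  have hpi := Real.two_pi_pos
  have hne : sgn A B y ≠ 0 := fun h => by simpa [h] using sgn_mul_self hA hB
  have hinj : Function.Injective fun s => sgn A B y * bridge A B y s := by
    intro s t hst
    have h1 := congrArg (bridge B A y) (mul_left_cancel₀ hne hst)
    rwa [bridge_comp hA hB hA, bridge_comp hA hB hA, bridge_self hA, bridge_self hA] at h1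
  have hc : Continuous fun s => sgn A B y * bridge A B y s :=
    continuous_const.mul (continuous_bridge hA hB)
  rcases hc.strictMono_of_inj hinj with h | h
  · exact h
  · have h1 := h hpi
    simp only [bridge_zero hA hB, bridge_two_pi] at h1
    rw [← mul_assoc, sgn_mul_self hA hB] at h1
    linarith

theorem exists_hasDerivAt_bridge (hA : y ∈ A.Φ.target) (hB : y ∈ B.Φ.target) (s : ℝ) :
    ∃ d, HasDerivAt (bridge A B y) d s := by
  have h1 : ContMDiffAt 𝓘(ℝ, ℝ) 𝓘(ℝ, ℝ) ∞ (fun t => bridge A B y t) s := by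
    have h2 : ContMDiffAt 𝓘(ℝ, ℝ) ((𝓡 3).prod 𝓘(ℝ, ℝ)) ∞ (fun t : ℝ => (y, t)) s :=
      contMDiffAt_const.prodMk contMDiffAt_id
    exact ContMDiffAt.comp (f := fun t : ℝ => (y, t)) s (contMDiffAt_bridge hA hB s) h2
  exact ⟨_, (h1.contDiffAt.differentiableAt (by simp)).hasDerivAt⟩

/-- The time changes in the two directions are mutually inverse, so by the chain rule the derivative
is nonzero; monotonicity then makes it positive. -/
theorem exists_hasDerivAt_sgn_mul_bridge (hA : y ∈ A.Φ.target) (hB : y ∈ B.Φ.target) (s : ℝ) :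
    ∃ d, 0 < d ∧ HasDerivAt (fun s => sgn A B y * bridge A B y s) d s := by
  obtain ⟨d, hd⟩ := exists_hasDerivAt_bridge hA hB s
  obtain ⟨d', hd'⟩ := exists_hasDerivAt_bridge hB hA (bridge A B y s)
  have h1 := hd'.comp s hd
  have h2 : (bridge B A y ∘ bridge A B y) = id := by
    funext t
    rw [Function.comp_apply, bridge_comp hA hB hA, bridge_self hA, id]
  rw [h2] at h1
  have h3 : d' * d = 1 := h1.unique (hasDerivAt_id s)
  have h4 := hd.const_mul (sgn A B y)
  have hne : sgn A B y ≠ 0 := fun h => by simpa [h] using sgn_mul_self hA hB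
  have h5 : sgn A B y * d ≠ 0 := mul_ne_zero hne (right_ne_zero_of_mul_eq_one h3)
  have h6 : 0 ≤ sgn A B y * d := by
    rw [← h4.deriv]
    exact (strictMono_sgn_mul_bridge hA hB).monotone.deriv_nonneg
  exact ⟨_, lt_of_le_of_ne h6 h5.symm, h4⟩

/-! ### Weights -/

open Classical in
variable (A) in
/-- A smooth function that is constant on the fibers, with support in the torus. -/
def wt (y : M) : ℝ :=
  if y ∈ A.Φ.target then Real.smoothTransition (2 - 4 * ‖(A.Φ.symm y).1‖ ^ 2) else 0

theorem wt_nonneg (y : M) : 0 ≤ A.wt y := by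
  rw [wt]
  split_ifs
  · exact Real.smoothTransition.nonneg _
  · exact le_rfl

theorem wt_eq_zero (h : y ∉ A.Φ.target) : A.wt y = 0 := by rw [wt, if_neg h]

theorem wt_rel {y' : M} (h : 𝓕.rel y y') : A.wt y' = A.wt y := by
  by_cases hA : y ∈ A.Φ.target
  · obtain ⟨s, rfl⟩ := (rel_iff_flow hA y').1 h
    rw [wt, wt, if_pos hA, if_pos (flow_mem hA s), symm_flow hA]
    simp [rot]
  · rw [wt_eq_zero hA, wt_eq_zero fun h' => hA (mem_of_rel h' (𝓕.rel.symm h))]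

theorem wt_core (u : Circle) : 0 < A.wt (A.Φ (0, u)) := by
  have h : ((0 : ℂ), u) ∈ A.Φ.source := by rw [A.source_eq]; simp
  rw [wt, if_pos (A.Φ.map_source h), A.Φ.left_inv h]
  exact Real.smoothTransition.pos_of_pos (by simp)

theorem wt_eventually_eq_zero [T2Space M] (h : y ∉ A.Φ.target) : ∀ᶠ z in 𝓝 y, A.wt z = 0 := by
  -- The weight vanishes once `‖z‖ ^ 2 ≥ 1 / 2`. Since `(3 / 4) ^ 2 > 1 / 2`, it is zero off this
  -- compact, hence closed, set.
  set K := A.Φ '' (Metric.closedBall (0 : ℂ) (3 / 4) ×ˢ univ) with hK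
  have hsub : Metric.closedBall (0 : ℂ) (3 / 4) ×ˢ (univ : Set Circle) ⊆ A.Φ.source := by
    rw [A.source_eq]
    exact prod_mono (Metric.closedBall_subset_ball (by norm_num)) le_rfl
  have hKc : IsCompact K :=
    ((isCompact_closedBall _ _).prod isCompact_univ).image_of_continuousOn
      (A.Φ.continuousOn.mono hsub)
  have hy : y ∉ K := by
    rintro ⟨a, ha, rfl⟩
    exact h (A.Φ.map_source (hsub ha))
  filter_upwards [hKc.isClosed.isOpen_compl.mem_nhds hy] with z hz
  rw [wt]
  split_ifs with hzA
  · refine Real.smoothTransition.zero_of_nonpos ?_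
    have : 3 / 4 < ‖(A.Φ.symm z).1‖ := by
      by_contra hle
      refine hz ⟨A.Φ.symm z, ⟨?_, mem_univ _⟩, A.Φ.right_inv hzA⟩
      simpa using hle
    nlinarith
  · rfl

theorem contMDiffAt_wt [T2Space M] (y : M) : ContMDiffAt (𝓡 3) 𝓘(ℝ, ℝ) ∞ A.wt y := by
  by_cases hA : y ∈ A.Φ.target
  · have h1 : ContMDiffAt (𝓡 3) 𝓘(ℝ, ℂ) ∞ (fun z => (A.Φ.symm z).1) y :=
      contMDiff_fst.contMDiffAt.comp y (A.smooth_symm.contMDiffAt (A.Φ.open_target.mem_nhds hA))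
    have h2 : ContDiff ℝ ∞ (fun z : ℂ => Real.smoothTransition (2 - 4 * ‖z‖ ^ 2)) :=
      Real.smoothTransition.contDiff.comp
        (contDiff_const.sub (contDiff_const.mul (contDiff_norm_sq ℝ)))
    refine (h2.contMDiff.contMDiffAt.comp y h1).congr_of_eventuallyEq ?_
    filter_upwards [A.Φ.open_target.mem_nhds hA] with z hz
    rw [wt, if_pos hz]
    rfl
  · exact contMDiffAt_const.congr_of_eventuallyEq (wt_eventually_eq_zero hA)

end FiberedTorus

end Tori

/-! ### Averaging the local flows into one time along the fibers. -/

section Clock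

variable {M : Type*} [TopologicalSpace M] [ChartedSpace (EuclideanSpace ℝ (Fin 3)) M]

open FiberedTorus

theorem SeifertFibration.exists_tori [T2Space M] [CompactSpace M] (𝓕 : SeifertFibration M) :
    ∃ (n : ℕ) (Tor : Fin n → FiberedTorus 𝓕), ∀ y, ∃ k, 0 < (Tor k).wt y := by
  choose A u hu using 𝓕.exists_torus
  have h1 (x : M) : {y | 0 < (A x).wt y} ∈ 𝓝 x := by
    refine (contMDiffAt_wt x).continuousAt.eventually (lt_mem_nhds ?_)
    have := wt_core (A := A x) (u x)
    rwa [hu] at this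
  obtain ⟨t, -, ht⟩ := isCompact_univ.elim_nhds_subcover _ fun x _ => h1 x
  refine ⟨t.card, fun i => A (t.equivFin.symm i), fun y => ?_⟩
  obtain ⟨x, hx, hy⟩ := mem_iUnion₂.1 (ht (mem_univ y))
  exact ⟨t.equivFin ⟨x, hx⟩, by simpa using hy⟩

variable {𝓕 : SeifertFibration M} {n : ℕ} (Tor : Fin n → FiberedTorus 𝓕)

/-- The averaged fiber coordinate: a smooth time change of the flow of the torus with index `k`. -/
def time (k : Fin n) (y : M) (s : ℝ) : ℝ :=
  (∑ j, (Tor j).wt y * (sgn (Tor k) (Tor j) y * bridge (Tor k) (Tor j) y s)) / ∑ j, (Tor j).wt y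

variable {Tor} {y : M} {k l : Fin n}

theorem totalWt_pos (hcov : ∀ y, ∃ k, 0 < (Tor k).wt y) (y : M) : 0 < ∑ j, (Tor j).wt y := by
  obtain ⟨k, hk⟩ := hcov y
  exact Finset.sum_pos' (fun j _ => wt_nonneg y) ⟨k, Finset.mem_univ k, hk⟩

theorem mem_target_of_wt_pos {A : FiberedTorus 𝓕} (h : A.wt y ≠ 0) : y ∈ A.Φ.target :=
  not_imp_comm.1 wt_eq_zero h

/-- To compare sums weighted by `wt`, only the tori that contain the point matter. -/
theorem sum_wt_congr {f g : Fin n → ℝ} (h : ∀ j, y ∈ (Tor j).Φ.target → f j = g j) :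
    ∑ j, (Tor j).wt y * f j = ∑ j, (Tor j).wt y * g j := by
  refine Finset.sum_congr rfl fun j _ => ?_
  by_cases hj : y ∈ (Tor j).Φ.target
  · rw [h j hj]
  · rw [wt_eq_zero hj, zero_mul, zero_mul]

theorem time_zero (hk : y ∈ (Tor k).Φ.target) : time Tor k y 0 = 0 := by
  rw [time, sum_wt_congr (g := fun _ => 0)]
  · simp
  · intro j hj
    rw [bridge_zero hk hj, mul_zero]

theorem time_add_two_pi (hcov : ∀ y, ∃ k, 0 < (Tor k).wt y) (hk : y ∈ (Tor k).Φ.target) (s : ℝ) :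
    time Tor k y (s + 2 * Real.pi) = time Tor k y s + 2 * Real.pi := by
  have hp := totalWt_pos hcov y
  rw [time, time, div_add' _ _ _ hp.ne', Finset.mul_sum, sum_wt_congr (g := fun j =>
    sgn (Tor k) (Tor j) y * bridge (Tor k) (Tor j) y s + 2 * Real.pi)]
  · congr 1
    rw [← Finset.sum_add_distrib]
    exact Finset.sum_congr rfl fun j _ => by ring
  · intro j hj
    rw [bridge_add_two_pi hk hj, bridge_two_pi, mul_add, ← mul_assoc, ← mul_assoc,
      sgn_mul_self hk hj, one_mul]

theorem strictMono_time (hcov : ∀ y, ∃ k, 0 < (Tor k).wt y) (hk : y ∈ (Tor k).Φ.target) :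
    StrictMono (time Tor k y) := by
  intro s t hst
  have hp := totalWt_pos hcov y
  refine div_lt_div_of_pos_right ?_ hp
  obtain ⟨l, hl⟩ := hcov y
  refine Finset.sum_lt_sum (fun j _ => ?_) ⟨l, Finset.mem_univ l, ?_⟩
  · by_cases hj : y ∈ (Tor j).Φ.target
    · exact mul_le_mul_of_nonneg_left (strictMono_sgn_mul_bridge hk hj hst).le (wt_nonneg y)
    · rw [wt_eq_zero hj, zero_mul, zero_mul]
  · exact mul_lt_mul_of_pos_left
      (strictMono_sgn_mul_bridge hk (mem_target_of_wt_pos hl.ne') hst) hl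

theorem exists_hasDerivAt_time (hcov : ∀ y, ∃ k, 0 < (Tor k).wt y) (hk : y ∈ (Tor k).Φ.target)
    (s : ℝ) : ∃ d, 0 < d ∧ HasDerivAt (time Tor k y) d s := by
  have hp := totalWt_pos hcov y
  have h1 (j : Fin n) : ∃ d, (0 ≤ d ∧ (0 < (Tor j).wt y → 0 < d)) ∧
      HasDerivAt (fun s => (Tor j).wt y * (sgn (Tor k) (Tor j) y * bridge (Tor k) (Tor j) y s))
        d s := by
    by_cases hj : y ∈ (Tor j).Φ.target
    · obtain ⟨d, hd, hd'⟩ := exists_hasDerivAt_sgn_mul_bridge hk hj s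
      exact ⟨_, ⟨mul_nonneg (wt_nonneg y) hd.le, fun h => mul_pos h hd⟩, hd'.const_mul _⟩
    · refine ⟨0, ⟨le_rfl, fun h => absurd (wt_eq_zero hj) h.ne'⟩, ?_⟩
      simp only [wt_eq_zero hj, zero_mul]
      exact hasDerivAt_const s 0
  choose d hd hd' using h1
  refine ⟨(∑ j, d j) / ∑ j, (Tor j).wt y, div_pos ?_ hp, ?_⟩
  · obtain ⟨l, hl⟩ := hcov y
    exact Finset.sum_pos' (fun j _ => (hd j).1) ⟨l, Finset.mem_univ l, (hd l).2 hl⟩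
  · exact (HasDerivAt.fun_sum fun j _ => hd' j).div_const _

theorem continuous_time (hcov : ∀ y, ∃ k, 0 < (Tor k).wt y) (hk : y ∈ (Tor k).Φ.target) :
    Continuous (time Tor k y) :=
  continuous_iff_continuousAt.2 fun s =>
    (exists_hasDerivAt_time hcov hk s).choose_spec.2.continuousAt

theorem time_add_int_mul (hcov : ∀ y, ∃ k, 0 < (Tor k).wt y) (hk : y ∈ (Tor k).Φ.target) (s : ℝ)
    (m : ℤ) : time Tor k y (s + m * (2 * Real.pi)) = time Tor k y s + m * (2 * Real.pi) := by
  induction m using Int.induction_on with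
  | zero => simp
  | succ m ih =>
    have h := time_add_two_pi hcov hk (s + m * (2 * Real.pi))
    push_cast at ih ⊢
    rw [add_mul, one_mul, ← add_assoc, h, ih]
    ring
  | pred m ih =>
    have h := time_add_two_pi hcov hk (s + (-m - 1) * (2 * Real.pi))
    push_cast at ih ⊢
    have h2 : s + (-m - 1) * (2 * Real.pi) + 2 * Real.pi = s + -m * (2 * Real.pi) := by ring
    rw [h2, ih] at h
    linarith

theorem surjective_time (hcov : ∀ y, ∃ k, 0 < (Tor k).wt y) (hk : y ∈ (Tor k).Φ.target) :
    Function.Surjective (time Tor k y) := by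
  intro t
  obtain ⟨m, hm⟩ := exists_int_gt (t / (2 * Real.pi))
  obtain ⟨l, hl⟩ := exists_int_lt (t / (2 * Real.pi))
  have hpi := Real.two_pi_pos
  rw [lt_div_iff₀ hpi] at hl
  rw [div_lt_iff₀ hpi] at hm
  have h1 := time_add_int_mul hcov hk 0 m
  have h2 := time_add_int_mul hcov hk 0 l
  simp only [time_zero hk, zero_add] at h1 h2
  exact mem_range_of_exists_le_of_exists_ge (continuous_time hcov hk) ⟨_, (h2.trans_lt hl).le⟩
    ⟨_, (hm.trans_eq h1.symm).le⟩

/-- The weights and signs are constant along a fiber, so the shift identity of each `bridge`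
survives averaging. -/
theorem time_flow (hk : y ∈ (Tor k).Φ.target) (a s : ℝ) :
    time Tor k ((Tor k).flow a y) s = time Tor k y (s + a) - time Tor k y a := by
  have hr := rel_flow hk a
  have hw (j) : (Tor j).wt ((Tor k).flow a y) = (Tor j).wt y := wt_rel hr
  simp only [time, hw]
  rw [← sub_div, ← Finset.sum_sub_distrib]
  simp only [← mul_sub]
  congr 1
  refine sum_wt_congr fun j hj => ?_
  rw [sgn_flow hk hj, bridge_flow hk hj]

/-- The averaged time does not depend on the torus in which it is computed, except for the direction
of that torus. This makes it a parameter of the fibers themselves. -/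
theorem time_bridge (hk : y ∈ (Tor k).Φ.target) (hl : y ∈ (Tor l).Φ.target) (s : ℝ) :
    time Tor l y (bridge (Tor k) (Tor l) y s) = sgn (Tor k) (Tor l) y * time Tor k y s := by
  rw [time, time, ← mul_div_assoc, Finset.mul_sum]
  congr 1
  rw [sum_wt_congr (g := fun j => sgn (Tor k) (Tor l) y *
    (sgn (Tor k) (Tor j) y * bridge (Tor k) (Tor j) y s))]
  · exact Finset.sum_congr rfl fun j _ => by ring
  · intro j hj
    rw [bridge_comp hk hl hj, sgn_comp hk hl hj, ← mul_assoc, ← mul_assoc, sgn_mul_self hk hl,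
      one_mul]

theorem contMDiffAt_time [T2Space M] (hcov : ∀ y, ∃ k, 0 < (Tor k).wt y)
    (hk : y ∈ (Tor k).Φ.target) (s : ℝ) :
    ContMDiffAt ((𝓡 3).prod 𝓘(ℝ, ℝ)) 𝓘(ℝ, ℝ) ∞ (fun x : M × ℝ => time Tor k x.1 x.2) (y, s) := by
  have hw (j) : ContMDiffAt ((𝓡 3).prod 𝓘(ℝ, ℝ)) 𝓘(ℝ, ℝ) ∞
      (fun x : M × ℝ => (Tor j).wt x.1) (y, s) := (contMDiffAt_wt y).comp (y, s) contMDiffAt_fst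
  have hsum : ContMDiffAt ((𝓡 3).prod 𝓘(ℝ, ℝ)) 𝓘(ℝ, ℝ) ∞
      (fun x : M × ℝ => (∑ j, (Tor j).wt x.1)⁻¹) (y, s) := by
    have h1 : ContMDiffAt ((𝓡 3).prod 𝓘(ℝ, ℝ)) 𝓘(ℝ, ℝ) ∞
      (fun x : M × ℝ => ∑ j, (Tor j).wt x.1) (y, s) := contMDiffAt_finsetSum fun j _ => hw j
    have h2 : ContDiffAt ℝ ∞ (fun t : ℝ => t⁻¹) (∑ j, (Tor j).wt y) :=
      contDiffAt_inv ℝ (totalWt_pos hcov y).ne'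
    exact h2.contMDiffAt.comp (y, s) h1
  have hb (j) : ContMDiffAt ((𝓡 3).prod 𝓘(ℝ, ℝ)) 𝓘(ℝ, ℝ) ∞ (fun x : M × ℝ => (Tor j).wt x.1 *
      (sgn (Tor k) (Tor j) x.1 * bridge (Tor k) (Tor j) x.1 x.2)) (y, s) := by
    by_cases hj : y ∈ (Tor j).Φ.target
    · refine (hw j).mul (ContMDiffAt.mul ?_ (contMDiffAt_bridge hk hj s))
      have h1 : ContMDiffAt ((𝓡 3).prod 𝓘(ℝ, ℝ)) ((𝓡 3).prod 𝓘(ℝ, ℝ)) ∞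
          (fun x : M × ℝ => (x.1, 2 * Real.pi)) (y, s) := contMDiffAt_fst.prodMk contMDiffAt_const
      have h2 := ContMDiffAt.comp (f := fun x : M × ℝ => (x.1, 2 * Real.pi)) (y, s)
        (contMDiffAt_bridge hk hj (2 * Real.pi)) h1
      have h3 : ContMDiff 𝓘(ℝ, ℝ) 𝓘(ℝ, ℝ) ∞ (fun t : ℝ => t / (2 * Real.pi)) :=
        (contDiff_id.div_const _).contMDiff
      exact h3.contMDiffAt.comp (y, s) h2
    -- Outside the torus `j` the function `bridge` has unspecified values, but the weight vanishes
    -- on a whole neighbourhood.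
    · refine ContMDiffAt.congr_of_eventuallyEq (f := fun _ => (0 : ℝ)) contMDiffAt_const ?_
      filter_upwards [(continuousAt_fst (p := (y, s))).eventually (wt_eventually_eq_zero hj)]
        with x hx
      rw [hx, zero_mul]
  have h := (contMDiffAt_finsetSum (t := Finset.univ) fun j _ => hb j).mul hsum
  exact h.congr_of_eventuallyEq (Eventually.of_forall fun x => div_eq_mul_inv _ _)

end Clock

/-! ## Sheared products -/

section Shear

variable {S : Type*} [TopologicalSpace S] [ChartedSpace (EuclideanSpace ℝ (Fin 2)) S]
  [IsManifold (𝓡 2) ∞ S]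

/-- The differential is block triangular, with the identity of the surface and `∂τ/∂s = d` on the
diagonal. -/
theorem isLocalDiffeomorphAt_shear {τ : S × ℝ → ℝ} {U : Set (S × ℝ)} (hU : IsOpen U)
    (hτ : ContMDiffOn ((𝓡 2).prod 𝓘(ℝ, ℝ)) 𝓘(ℝ, ℝ) ∞ τ U) {x : S} {s : ℝ} (hx : (x, s) ∈ U)
    {d : ℝ} (hd : d ≠ 0) (h : HasDerivAt (fun t => τ (x, t)) d s) :
    IsLocalDiffeomorphAt ((𝓡 2).prod 𝓘(ℝ, ℝ)) ((𝓡 2).prod 𝓘(ℝ, ℝ)) ∞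
      (fun z : S × ℝ => (z.1, τ z)) (x, s) := by
  refine isLocalDiffeomorphAt_of_injective_mfderiv rfl hU
    (contMDiff_fst.contMDiffOn.prodMk hτ) hx ?_
  have hτm : MDifferentiableAt ((𝓡 2).prod 𝓘(ℝ, ℝ)) 𝓘(ℝ, ℝ) τ (x, s) :=
    (hτ.contMDiffAt (hU.mem_nhds hx)).mdifferentiableAt (by simp)
  have hcurve : HasMFDerivAt 𝓘(ℝ, ℝ) ((𝓡 2).prod 𝓘(ℝ, ℝ)) (fun t : ℝ => (x, t)) s
      (ContinuousLinearMap.inr ℝ (TangentSpace (𝓡 2) x) (TangentSpace 𝓘(ℝ, ℝ) s)) := by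
    rw [← mfderiv_prod_right]
    exact (mdifferentiableAt_const.prodMk mdifferentiableAt_id).hasMFDerivAt
  have hcomp := hτm.hasMFDerivAt.comp s hcurve
  have heq := hasMFDerivAt_unique hcomp h.hasFDerivAt.hasMFDerivAt
  intro w hw
  rw [mfderiv_prodMk mdifferentiableAt_fst hτm, mfderiv_fst] at hw
  have h1 : w.1 = 0 := congrArg Prod.fst hw
  have h2 : mfderiv ((𝓡 2).prod 𝓘(ℝ, ℝ)) 𝓘(ℝ, ℝ) τ (x, s) w = 0 := congrArg Prod.snd hw
  have h3 : w = ContinuousLinearMap.inr ℝ (TangentSpace (𝓡 2) x) (TangentSpace 𝓘(ℝ, ℝ) s) w.2 :=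
    Prod.ext h1 rfl
  have h4 : w.2 * d = 0 := by
    have h5 := congrArg (fun L => L w.2) heq
    rw [h3] at h2
    have h6 : (ContinuousLinearMap.toSpanSingleton ℝ d : ℝ →L[ℝ] ℝ) w.2 = 0 := h5.symm.trans h2
    simpa using h6
  have h5 : w.2 = 0 := (mul_eq_zero.1 h4).resolve_right hd
  exact Prod.ext h1 h5

end Shear

open FiberedTorus

/-! ### Transversality: flowing off the surface. -/

section Crossing

variable {M : Type*} [TopologicalSpace M] [ChartedSpace (EuclideanSpace ℝ (Fin 3)) M]
  [IsManifold (𝓡 3) ∞ M] {𝓕 : SeifertFibration M} {A : FiberedTorus 𝓕}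
variable {S : Type*} [TopologicalSpace S] [ChartedSpace (EuclideanSpace ℝ (Fin 2)) S]
  [IsManifold (𝓡 2) ∞ S] {ι : S → M}

theorem FiberedTorus.isLocalDiffeomorphAt_flow {y : M} (hy : y ∈ A.Φ.target) (s : ℝ) :
    IsLocalDiffeomorphAt (𝓡 3) (𝓡 3) ∞ (A.flow s) y := by
  have hs (s : ℝ) : ContMDiffOn (𝓡 3) (𝓡 3) ∞ (A.flow s) A.Φ.target := by
    refine (contMDiffOn_flow (A := A)).comp (f := fun y : M => (y, s))
      (contMDiff_id.prodMk contMDiff_const).contMDiffOn fun y hy => ⟨hy, mem_univ _⟩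
  have hinv (s : ℝ) {y : M} (hy : y ∈ A.Φ.target) : A.flow (-s) (A.flow s y) = y := by
    rw [← flow_add hy, neg_add_cancel, flow_zero hy]
  refine ⟨⟨⟨A.flow s, A.flow (-s), A.Φ.target, A.Φ.target, fun y hy => flow_mem hy s,
    fun y hy => flow_mem hy _, fun y hy => hinv s hy, fun y hy => ?_⟩, A.Φ.open_target,
    A.Φ.open_target, hs s, hs (-s)⟩, hy, fun _ _ => rfl⟩
  have := hinv (-s) hy
  rwa [neg_neg] at this

theorem FiberedTorus.contMDiff_flow_curve {y : M} (hy : y ∈ A.Φ.target) :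
    ContMDiff 𝓘(ℝ, ℝ) (𝓡 3) ∞ (fun s => A.flow s y) := by
  have := (contMDiffOn_flow (A := A)).comp_contMDiff (f := fun s : ℝ => (y, s))
    (contMDiff_const.prodMk contMDiff_id) fun s => ⟨hy, mem_univ _⟩
  exact this

/-- The angular coordinate moves with speed `p > 0`. Horizontality says nothing about a fiber curve
with zero velocity, so this is needed to use it. -/
theorem FiberedTorus.mfderiv_flow_ne_zero {y : M} (hy : y ∈ A.Φ.target) :
    mfderiv 𝓘(ℝ, ℝ) (𝓡 3) (fun s => A.flow s y) 0 (1 : ℝ) ≠ 0 := by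
  intro h0
  set u := (A.Φ.symm y).2
  have h1 : ContMDiffAt (𝓡 3) 𝓘(ℝ, ℂ) ∞ (fun z => ((A.Φ.symm z).2 : ℂ)) (A.flow 0 y) :=
    contMDiff_circle_coe.contMDiffAt.comp _ (contMDiff_snd.contMDiffAt.comp _
      (A.smooth_symm.contMDiffAt (A.Φ.open_target.mem_nhds (flow_mem hy 0))))
  have h2 := (h1.mdifferentiableAt (by simp)).hasMFDerivAt.comp (0 : ℝ)
    ((contMDiff_flow_curve hy).mdifferentiableAt (by simp)).hasMFDerivAt
  have h3 : HasDerivAt (fun s : ℝ => Complex.exp ((A.p * s : ℝ) * Complex.I) * (u : ℂ))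
      (A.p * Complex.I * u) 0 := by
    have h4 : HasDerivAt (fun s : ℝ => ((A.p * s : ℝ) : ℂ) * Complex.I) (A.p * Complex.I) 0 := by
      have h5 : HasDerivAt (fun s : ℝ => A.p * s) (A.p : ℝ) 0 := by
        simpa using (hasDerivAt_id (0 : ℝ)).const_mul (A.p : ℝ)
      simpa using h5.ofReal_comp.mul_const Complex.I
    simpa using h4.cexp.mul_const (u : ℂ)
  have h4 : ((fun z => ((A.Φ.symm z).2 : ℂ)) ∘ fun s => A.flow s y) =
      (fun s : ℝ => Complex.exp ((A.p * s : ℝ) * Complex.I) * (u : ℂ)) := by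
    funext s
    simp only [Function.comp_apply]
    rw [symm_flow hy]
    simp only [rot, Circle.coe_mul, Circle.coe_exp]
    rfl
  rw [h4] at h2
  have h5 := congrArg (fun L => L (1 : ℝ)) (hasMFDerivAt_unique h2 h3.hasFDerivAt.hasMFDerivAt)
  have h6 : (ContinuousLinearMap.toSpanSingleton ℝ (A.p * Complex.I * u : ℂ) : ℝ →L[ℝ] ℂ) 1 = 0 := by
    refine h5.symm.trans ?_
    have h7 := congrArg (mfderiv (𝓡 3) 𝓘(ℝ, ℂ) (fun z => ((A.Φ.symm z).2 : ℂ)) (A.flow 0 y)) h0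
    exact h7.trans (map_zero _)
  have hp : (A.p : ℂ) ≠ 0 := by exact_mod_cast A.p_pos.ne'
  simp [hp] at h6

/-- A line that is not contained in the image of a plane, together with that injectively mapped
plane, spans. The hypothesis `h1` has the form in which `IsHorizontal` supplies it. -/
theorem eq_zero_of_transverse
    (L : EuclideanSpace ℝ (Fin 2) × ℝ →L[ℝ] EuclideanSpace ℝ (Fin 3)) (h0 : L (0, 1) ≠ 0)
    (h1 : ∀ v, L (v, 0) = L (0, 1) → L (0, 1) = 0) (h2 : ∀ v, L (v, 0) = 0 → v = 0)
    (w : EuclideanSpace ℝ (Fin 2) × ℝ) (hw : L w = 0) : w = 0 := by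
  have hs : w = (w.1, 0) + w.2 • ((0 : EuclideanSpace ℝ (Fin 2)), (1 : ℝ)) := by
    ext <;> simp
  rw [hs, map_add, map_smul] at hw
  by_cases hr : w.2 = 0
  · rw [hr, zero_smul, add_zero] at hw
    exact Prod.ext (h2 _ hw) hr
  · refine absurd (h1 (-(w.2⁻¹ • w.1)) ?_) h0
    have h3 : L (w.1, 0) = -(w.2 • L (0, 1)) := eq_neg_of_add_eq_zero_left hw
    have h4 : ((-(w.2⁻¹ • w.1), (0 : ℝ)) : EuclideanSpace ℝ (Fin 2) × ℝ) = -(w.2⁻¹ • (w.1, 0)) := by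
      ext <;> simp
    rw [h4, map_neg, map_smul, h3, smul_neg, neg_neg, smul_smul, inv_mul_cancel₀ hr, one_smul]

/-- At time zero this is transversality together with the inverse function theorem. For a general
`s`, shift the time by `-s`, cross near time zero, and apply the local diffeomorphism `A.flow s`. -/
theorem isLocalDiffeomorphAt_crossing (hι : IsSmoothEmbedding (𝓡 2) (𝓡 3) ∞ ι)
    (horizontal : 𝓕.IsHorizontal ι) {x : S} (hx : ι x ∈ A.Φ.target) (s : ℝ) :
    IsLocalDiffeomorphAt ((𝓡 2).prod 𝓘(ℝ, ℝ)) (𝓡 3) ∞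
      (fun z : S × ℝ => A.flow z.2 (ι z.1)) (x, s) := by
  set c : S × ℝ → M := fun z => A.flow z.2 (ι z.1) with hc
  set U : Set (S × ℝ) := (ι ⁻¹' A.Φ.target) ×ˢ univ
  have hU : IsOpen U := (A.Φ.open_target.preimage hι.isEmbedding.continuous).prod isOpen_univ
  have hcs : ContMDiffOn ((𝓡 2).prod 𝓘(ℝ, ℝ)) (𝓡 3) ∞ c U := by
    refine (contMDiffOn_flow (A := A)).comp (f := fun z : S × ℝ => (ι z.1, z.2))
      ((hι.contMDiff.comp contMDiff_fst).prodMk contMDiff_snd).contMDiffOn fun z hz => ⟨hz.1, mem_univ _⟩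
  have h0 : IsLocalDiffeomorphAt ((𝓡 2).prod 𝓘(ℝ, ℝ)) (𝓡 3) ∞ c (x, 0) := by
    have hx0 : (x, (0 : ℝ)) ∈ U := ⟨hx, mem_univ _⟩
    have hcm : MDifferentiableAt ((𝓡 2).prod 𝓘(ℝ, ℝ)) (𝓡 3) c (x, 0) :=
      (hcs.contMDiffAt (hU.mem_nhds hx0)).mdifferentiableAt (by simp)
    refine isLocalDiffeomorphAt_of_injective_mfderiv (by simp) hU hcs hx0 ?_
    have hcurve : HasMFDerivAt 𝓘(ℝ, ℝ) ((𝓡 2).prod 𝓘(ℝ, ℝ)) (fun t : ℝ => (x, t)) 0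
        (ContinuousLinearMap.inr ℝ (TangentSpace (𝓡 2) x) (TangentSpace 𝓘(ℝ, ℝ) (0 : ℝ))) := by
      rw [← mfderiv_prod_right]
      exact (mdifferentiableAt_const.prodMk mdifferentiableAt_id).hasMFDerivAt
    have hslice : HasMFDerivAt (𝓡 2) ((𝓡 2).prod 𝓘(ℝ, ℝ)) (fun x' : S => (x', (0 : ℝ))) x
        (ContinuousLinearMap.inl ℝ (TangentSpace (𝓡 2) x) (TangentSpace 𝓘(ℝ, ℝ) (0 : ℝ))) := by
      rw [← mfderiv_prod_left]
      exact (mdifferentiableAt_id.prodMk mdifferentiableAt_const).hasMFDerivAt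
    set γ : ℝ → M := fun t => A.flow t (ι x) with hγ
    have hγs : ContMDiff 𝓘(ℝ, ℝ) (𝓡 3) ∞ γ := contMDiff_flow_curve hx
    have hd1 : mfderiv 𝓘(ℝ, ℝ) (𝓡 3) γ 0 = (mfderiv ((𝓡 2).prod 𝓘(ℝ, ℝ)) (𝓡 3) c (x, 0)).comp
        (ContinuousLinearMap.inr ℝ (TangentSpace (𝓡 2) x) (TangentSpace 𝓘(ℝ, ℝ) (0 : ℝ))) :=
      (hcm.hasMFDerivAt.comp (0 : ℝ) hcurve).mfderiv
    have hd2 : mfderiv (𝓡 2) (𝓡 3) ι x = (mfderiv ((𝓡 2).prod 𝓘(ℝ, ℝ)) (𝓡 3) c (x, 0)).comp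
        (ContinuousLinearMap.inl ℝ (TangentSpace (𝓡 2) x) (TangentSpace 𝓘(ℝ, ℝ) (0 : ℝ))) := by
      have h1 := (hcm.hasMFDerivAt.comp x hslice)
      have h2 : ι =ᶠ[𝓝 x] (c ∘ fun x' : S => (x', (0 : ℝ))) := by
        filter_upwards [(A.Φ.open_target.preimage hι.isEmbedding.continuous).mem_nhds hx] with x' hx'
        exact (flow_zero hx').symm
      have h3 := h1.congr_of_eventuallyEq h2
      exact hasMFDerivAt_unique
        ((hι.contMDiff.mdifferentiableAt (by simp)).hasMFDerivAt) (h1.congr_of_eventuallyEq h2)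
    have hhor (v : TangentSpace (𝓡 2) x) (hv : mfderiv (𝓡 2) (𝓡 3) ι x v =
        mfderiv 𝓘(ℝ, ℝ) (𝓡 3) γ 0 (1 : ℝ)) : mfderiv 𝓘(ℝ, ℝ) (𝓡 3) γ 0 (1 : ℝ) = 0 :=
      horizontal x γ hγs (flow_zero hx) (fun t => rel_flow hx t) v hv
    have hinj := IsImmersionAt.mfderiv_injective (hι.isImmersion.isImmersionAt x)
    refine eq_zero_of_transverse (mfderiv ((𝓡 2).prod 𝓘(ℝ, ℝ)) (𝓡 3) c (x, 0)) ?_ ?_ ?_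
    · have h1 := mfderiv_flow_ne_zero hx
      intro h
      refine h1 ?_
      change mfderiv 𝓘(ℝ, ℝ) (𝓡 3) γ 0 (1 : ℝ) = 0
      rw [hd1]
      exact h
    · intro v hv
      have h1 := hhor v
      rw [hd1, hd2] at h1
      exact h1 hv
    · intro v hv
      refine hinj ?_
      rw [hd2]
      exact hv.trans (map_zero _).symm
  have hshift : IsLocalDiffeomorphAt ((𝓡 2).prod 𝓘(ℝ, ℝ)) ((𝓡 2).prod 𝓘(ℝ, ℝ)) ∞
      (fun z : S × ℝ => (z.1, z.2 - s)) (x, s) := by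
    have h1 : ContMDiff ((𝓡 2).prod 𝓘(ℝ, ℝ)) 𝓘(ℝ, ℝ) ∞ (fun z : S × ℝ => z.2 - s) :=
      ((contDiff_id.sub contDiff_const).contMDiff :
        ContMDiff 𝓘(ℝ, ℝ) 𝓘(ℝ, ℝ) ∞ (fun t : ℝ => t - s)).comp contMDiff_snd
    exact isLocalDiffeomorphAt_shear isOpen_univ h1.contMDiffOn (mem_univ _) one_ne_zero
      ((hasDerivAt_id s).sub_const s)
  have h1 : IsLocalDiffeomorphAt ((𝓡 2).prod 𝓘(ℝ, ℝ)) (𝓡 3) ∞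
      (c ∘ fun z : S × ℝ => (z.1, z.2 - s)) (x, s) := by
    refine isLocalDiffeomorphAt_comp ?_ hshift
    simpa using h0
  have h2 : IsLocalDiffeomorphAt ((𝓡 2).prod 𝓘(ℝ, ℝ)) (𝓡 3) ∞
      (A.flow s ∘ (c ∘ fun z : S × ℝ => (z.1, z.2 - s))) (x, s) := by
    refine isLocalDiffeomorphAt_comp (isLocalDiffeomorphAt_flow ?_ s) h1
    exact flow_mem hx _
  refine isLocalDiffeomorphAt_congr h2 ?_
  filter_upwards [hU.mem_nhds (⟨hx, mem_univ _⟩ : (x, s) ∈ U)] with z hz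
  simp only [Function.comp_apply, hc]
  rw [← flow_add hz.1, add_sub_cancel]

end Crossing

open FiberedTorus

/-! ### The two sides of the surface. -/

theorem pos_or_neg_of_isPreconnected {X : Type*} [TopologicalSpace X] {s : Set X}
    (hs : IsPreconnected s) {g : X → ℝ} (hg : ContinuousOn g s) (h : ∀ x ∈ s, g x ≠ 0) :
    (∀ x ∈ s, 0 < g x) ∨ ∀ x ∈ s, g x < 0 := by
  by_contra! hcon
  obtain ⟨⟨x, hx, hx'⟩, y, hy, hy'⟩ := hcon
  obtain ⟨z, hz, hz'⟩ := hs.intermediate_value hx hy hg ⟨hx', hy'⟩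
  exact h z hz hz'

section Sides

variable {M : Type*} [TopologicalSpace M] {S : Type*} [TopologicalSpace S] {ι : S → M}

/-- The side coordinate of a two-sided surface. -/
def side (b : S × ℝ → M) (y : M) : ℝ :=
  open Classical in if h : ∃ z, b z = y then h.choose.2 else 0

theorem side_apply {b : S × ℝ → M} (hb : IsOpenEmbedding b) (z : S × ℝ) : side b (b z) = z.2 := by
  have h : ∃ z', b z' = b z := ⟨z, rfl⟩
  rw [side, dif_pos h]
  exact congrArg Prod.snd (hb.injective h.choose_spec)

theorem continuousOn_side {b : S × ℝ → M} (hb : IsOpenEmbedding b) :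
    ContinuousOn (side b) (range b) := by
  rintro _ ⟨z, rfl⟩
  refine ContinuousAt.continuousWithinAt ?_
  rw [hb.continuousAt_iff.symm]
  have : side b ∘ b = Prod.snd := by
    funext z
    exact side_apply hb z
  rw [this]
  exact continuousAt_snd

/-- A local flow box across a two-sided surface goes from one side to the other. -/
theorem exists_crossing_sign [LocallyConnectedSpace S] {b : S × ℝ → M} (hb : IsOpenEmbedding b)
    (hbι : ∀ x, b (x, 0) = ι x) {c : S × ℝ → M} (hcι : ∀ x, c (x, 0) = ι x) {x₀ : S}
    (hc : ∀ᶠ z in 𝓝 (x₀, (0 : ℝ)), ContinuousAt c z)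
    (hmap : map c (𝓝 (x₀, 0)) = 𝓝 (ι x₀)) (hinj : ∃ U ∈ 𝓝 (x₀, (0 : ℝ)), InjOn c U) :
    ∃ ε : ℝ, (ε = 1 ∨ ε = -1) ∧ ∀ᶠ x in 𝓝 x₀, ∀ᶠ s in 𝓝[>] (0 : ℝ),
      0 < ε * side b (c (x, s)) ∧ ε * side b (c (x, -s)) < 0 := by
  obtain ⟨V, hV, hVinj⟩ := hinj
  have hc0 : ContinuousAt c (x₀, 0) := hc.self_of_nhds
  have hr : ∀ᶠ z in 𝓝 (x₀, (0 : ℝ)), c z ∈ range b := by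
    refine hc0.eventually (hb.isOpen_range.mem_nhds ?_)
    rw [hcι, ← hbι]
    exact ⟨_, rfl⟩
  let e : M → S := fun y => open Classical in if h : ∃ z, b z = y then h.choose.1 else x₀
  have he (z : S × ℝ) : e (b z) = z.1 := by
    have h : ∃ z', b z' = b z := ⟨z, rfl⟩
    simp only [e]
    rw [dif_pos h]
    exact congrArg Prod.fst (hb.injective h.choose_spec)
  have hec : ContinuousAt e (ι x₀) := by
    rw [← hbι, hb.continuousAt_iff.symm]
    have : e ∘ b = Prod.fst := by
      funext z
      exact he z
    rw [this]
    exact continuousAt_fst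
  -- If `c z` lies on the surface, it equals `c (w, 0)` for a point `w` near `x₀`; injectivity of
  -- `c` near `(x₀, 0)` then forces the time of `z` to be zero.
  have hs : ∀ᶠ z in 𝓝 (x₀, (0 : ℝ)), side b (c z) = 0 → z.2 = 0 := by
    have h1 : ∀ᶠ z in 𝓝 (x₀, (0 : ℝ)), (e (c z), (0 : ℝ)) ∈ V := by
      have h2 : ContinuousAt (fun z => (e (c z), (0 : ℝ))) (x₀, (0 : ℝ)) := by
        refine ContinuousAt.prodMk ?_ continuousAt_const
        refine ContinuousAt.comp (g := e) ?_ hc0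
        rw [hcι]
        exact hec
      refine h2.eventually ?_
      have h3 : e (c (x₀, 0)) = x₀ := by rw [hcι, ← hbι, he]
      beta_reduce
      rw [h3]
      exact hV
    filter_upwards [h1, hV, hr] with z hz1 hz2 hz3 hz4
    obtain ⟨w, hw⟩ := hz3
    rw [← hw, side_apply hb] at hz4
    rw [← hw, he] at hz1
    have h5 : c (w.1, 0) = c z := by
      rw [hcι, ← hbι, ← hw]
      congr 1
      exact Prod.ext rfl hz4.symm
    have := hVinj hz1 hz2 h5
    rw [← this]
  have hall := hc.and (hr.and hs)
  rw [nhds_prod_eq, eventually_prod_iff] at hall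
  obtain ⟨P, hP, R, hR, hPR⟩ := hall
  obtain ⟨δ, hδ, hRδ⟩ := Metric.eventually_nhds_iff.1 hR
  obtain ⟨U, hUP, hUo, hxU, hUc⟩ := locallyConnectedSpace_iff_subsets_isOpen_isConnected.1
    ‹_› x₀ {x | P x} hP
  have hbox {x : S} (hx : x ∈ U) {s : ℝ} (hs : |s| < δ) := hPR (hUP hx) (hRδ (y := s) (by simpa using hs))
  have hgc {T : Set (S × ℝ)} (hT : ∀ z ∈ T, z.1 ∈ U ∧ |z.2| < δ) :
      ContinuousOn (fun z => side b (c z)) T := by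
    intro z hz
    have h1 := hbox (hT z hz).1 (hT z hz).2
    refine ContinuousAt.continuousWithinAt ?_
    refine ContinuousAt.comp (g := side b) ?_ h1.1
    exact (continuousOn_side hb).continuousAt (hb.isOpen_range.mem_nhds h1.2.1)
  have hpos := pos_or_neg_of_isPreconnected (s := U ×ˢ Ioo 0 δ) (hUc.isPreconnected.prod isPreconnected_Ioo)
    (hgc fun z hz => ⟨hz.1, by rw [abs_of_pos hz.2.1]; exact hz.2.2⟩) (fun z hz h0 =>
      hz.2.1.ne' ((hbox hz.1 (by rw [abs_of_pos hz.2.1]; exact hz.2.2)).2.2 h0))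
  have hneg := pos_or_neg_of_isPreconnected (s := U ×ˢ Ioo (-δ) 0) (hUc.isPreconnected.prod isPreconnected_Ioo)
    (hgc fun z hz => ⟨hz.1, by rw [abs_of_neg hz.2.2]; linarith [hz.2.1]⟩) (fun z hz h0 =>
      hz.2.2.ne ((hbox hz.1 (by rw [abs_of_neg hz.2.2]; linarith [hz.2.1])).2.2 h0))
  have hN : c '' (U ×ˢ Ioo (-δ) δ) ∈ 𝓝 (ι x₀) := by
    rw [← hmap]
    exact image_mem_map (prod_mem_nhds (hUo.mem_nhds hxU) (Ioo_mem_nhds (by linarith) hδ))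
  have hside0 (x : S) : side b (c (x, 0)) = 0 := by rw [hcι, ← hbι, side_apply hb]
  have hbc : ContinuousAt (fun r : ℝ => b (x₀, r)) 0 :=
    (hb.continuous.comp (by fun_prop : Continuous fun r : ℝ => (x₀, r))).continuousAt
  have hNb : ∀ᶠ r in 𝓝 (0 : ℝ), b (x₀, r) ∈ c '' (U ×ˢ Ioo (-δ) δ) := by
    refine hbc.eventually ?_
    beta_reduce
    rw [hbι]
    exact hN
  obtain ⟨η, hη, hηN⟩ := Metric.eventually_nhds_iff.1 hNb
  have hex (r : ℝ) (hr : |r| < η) : ∃ x ∈ U, ∃ s ∈ Ioo (-δ) δ, side b (c (x, s)) = r := by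
    obtain ⟨z, hz, hz'⟩ := hηN (y := r) (by simpa using hr)
    exact ⟨z.1, hz.1, z.2, hz.2, by rw [hz', side_apply hb]⟩
  have key {ε : ℝ} (hp : ∀ z ∈ U ×ˢ Ioo 0 δ, 0 < ε * side b (c z))
      (hn : ∀ z ∈ U ×ˢ Ioo (-δ) 0, ε * side b (c z) < 0) :
      ∀ᶠ x in 𝓝 x₀, ∀ᶠ s in 𝓝[>] (0 : ℝ),
        0 < ε * side b (c (x, s)) ∧ ε * side b (c (x, -s)) < 0 := by
    filter_upwards [hUo.mem_nhds hxU] with x hx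
    filter_upwards [Ioo_mem_nhdsGT hδ] with s hs
    exact ⟨hp (x, s) ⟨hx, hs⟩, hn (x, -s) ⟨hx, by linarith [hs.2], by linarith [hs.1]⟩⟩
  -- On each half of the box the side coordinate has constant sign. Equal signs are impossible: `c`
  -- is open at `(x₀, 0)`, so its image contains points `b (x₀, r)` with `r` of either sign.
  rcases hpos with hpos | hpos <;> rcases hneg with hneg | hneg
  · exfalso
    obtain ⟨x, hx, s, hs, hxs⟩ := hex (-(η / 2)) (by rw [abs_neg, abs_of_pos] <;> linarith)
    rcases lt_trichotomy s 0 with h | h | h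
    · linarith [hneg (x, s) ⟨hx, hs.1, h⟩]
    · rw [h, hside0] at hxs; linarith
    · linarith [hpos (x, s) ⟨hx, h, hs.2⟩]
  · exact ⟨1, Or.inl rfl, key (by simpa using hpos) (by simpa using hneg)⟩
  · exact ⟨-1, Or.inr rfl, key (by simpa using hpos) (by simpa using hneg)⟩
  · exfalso
    obtain ⟨x, hx, s, hs, hxs⟩ := hex (η / 2) (by rw [abs_of_pos] <;> linarith)
    rcases lt_trichotomy s 0 with h | h | h
    · linarith [hneg (x, s) ⟨hx, hs.1, h⟩]
    · rw [h, hside0] at hxs; linarith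
    · linarith [hpos (x, s) ⟨hx, h, hs.2⟩]

end Sides

/-! ### The direction of a flow relative to the two sides. -/

section Orient

variable {M : Type*} [TopologicalSpace M] [ChartedSpace (EuclideanSpace ℝ (Fin 3)) M]
  {𝓕 : SeifertFibration M} {A B : FiberedTorus 𝓕}
variable {S : Type*} {ι : S → M}

open Classical in
variable (A ι) in
/-- Whether the flow of the torus `A` leaves the surface on the positive side (`1`) or not (`-1`). -/
def orient (b : S × ℝ → M) (x : S) : ℝ :=
  if ∀ᶠ s in 𝓝[>] (0 : ℝ), 0 < side b (A.flow s (ι x)) then 1 else -1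

theorem orient_eq (b : S × ℝ → M) (x : S) : orient A ι b x = 1 ∨ orient A ι b x = -1 := by
  rw [orient]
  split_ifs <;> simp

theorem orient_mul_self (b : S × ℝ → M) (x : S) : orient A ι b x * orient A ι b x = 1 := by
  rcases orient_eq (A := A) (ι := ι) b x with h | h <;> simp [h]

theorem orient_eq_of_crossing {b : S × ℝ → M} {x : S} {ε : ℝ} (hε : ε = 1 ∨ ε = -1)
    (h : ∀ᶠ s in 𝓝[>] (0 : ℝ), 0 < ε * side b (A.flow s (ι x)) ∧
      ε * side b (A.flow (-s) (ι x)) < 0) : orient A ι b x = ε := by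
  rw [orient]
  rcases hε with rfl | rfl
  · rw [if_pos]
    filter_upwards [h] with s hs
    linarith [hs.1]
  · rw [if_neg]
    intro h'
    obtain ⟨s, hs, hs'⟩ := (h.and h').exists
    linarith [hs.1]

/-- The flow of `A` crosses the surface at `x` from one side to the other. -/
def Crosses (A : FiberedTorus 𝓕) (ι : S → M) (b : S × ℝ → M) (x : S) : Prop :=
  ∀ᶠ s in 𝓝[>] (0 : ℝ), 0 < orient A ι b x * side b (A.flow s (ι x)) ∧
    orient A ι b x * side b (A.flow (-s) (ι x)) < 0

/-- The time change from `A` to `B` passes through zero increasingly or decreasingly according to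
`sgn`. So the flow of `B` leaves the surface on the same side as that of `A`, or on the other one.
-/
theorem orient_change {b : S × ℝ → M} {x : S} (hA : ι x ∈ A.Φ.target) (hB : ι x ∈ B.Φ.target)
    (hcA : Crosses A ι b x) (hcB : Crosses B ι b x) :
    orient B ι b x = sgn A B (ι x) * orient A ι b x := by
  set H := bridge A B (ι x)
  have hH0 : H 0 = 0 := bridge_zero hA hB
  have hHc : Tendsto H (𝓝[>] 0) (𝓝 0) := by
    have := (continuous_bridge hA hB).tendsto 0
    rw [bridge_zero hA hB] at this
    exact this.mono_left nhdsWithin_le_nhds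
  have hmono := strictMono_sgn_mul_bridge hA hB
  set oA := orient A ι b x
  set oB := orient B ι b x
  have hoA : oA = 1 ∨ oA = -1 := orient_eq b x
  have hoB : oB = 1 ∨ oB = -1 := orient_eq b x
  have hfl (s : ℝ) : B.flow (H s) (ι x) = A.flow s (ι x) := flow_bridge hA hB s
  rcases sgn_eq hA hB with h1 | h1
  · have h2 : Tendsto H (𝓝[>] 0) (𝓝[>] 0) := by
      refine tendsto_nhdsWithin_iff.2 ⟨hHc, ?_⟩
      filter_upwards [self_mem_nhdsWithin] with s hs
      have := hmono hs
      simp only [h1, one_mul] at this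
      exact hH0.symm.trans_lt this
    obtain ⟨s, hs, hs'⟩ := ((Filter.Eventually.and hcA (h2.eventually hcB))).exists
    rw [hfl] at hs'
    rw [h1, one_mul]
    rcases hoA with h | h <;> rcases hoB with h' | h' <;> rw [h, h'] <;>
      (simp only [oA] at h; simp only [oB] at h'; rw [h] at hs; rw [h'] at hs'; linarith [hs.1, hs'.1])
  · have h2 : Tendsto (fun s => -H s) (𝓝[>] 0) (𝓝[>] 0) := by
      refine tendsto_nhdsWithin_iff.2 ⟨by simpa using hHc.neg, ?_⟩
      filter_upwards [self_mem_nhdsWithin] with s hs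
      have h3 := hmono hs
      simp only [h1] at h3
      have h4 : -1 * bridge A B (ι x) 0 = 0 := by rw [bridge_zero hA hB]; simp
      rw [h4] at h3
      change 0 < -H s
      linarith
    obtain ⟨s, hs, hs'⟩ := ((Filter.Eventually.and hcA (h2.eventually hcB))).exists
    rw [neg_neg, hfl] at hs'
    rw [h1]
    rcases hoA with h | h <;> rcases hoB with h' | h' <;> rw [h, h'] <;>
      (simp only [oA] at h; simp only [oB] at h'; rw [h] at hs; rw [h'] at hs'; linarith [hs.1, hs'.2])

end Orient

open FiberedTorus

/-! ### The global clock on the fibers. -/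

section FiberClock

variable {M : Type*} [TopologicalSpace M] [ChartedSpace (EuclideanSpace ℝ (Fin 3)) M]
variable {S : Type*} [TopologicalSpace S] [ChartedSpace (EuclideanSpace ℝ (Fin 2)) S]

/-- A parametrization of the fibers by the line, starting at the points of a horizontal surface,
whose time changes are trivial, and such that all fibers have period `1 / 2`. -/
structure IsFiberClock (𝓕 : SeifertFibration M) (ι : S → M) (p : S × ℝ → M) : Prop where
  localDiffeo : ∀ z, IsLocalDiffeomorphAt ((𝓡 2).prod 𝓘(ℝ, ℝ)) (𝓡 3) ∞ p z
  zero : ∀ x, p (x, 0) = ι x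
  rel_iff : ∀ x y, 𝓕.rel (ι x) y ↔ ∃ t, y = p (x, t)
  periodic : ∀ x t, p (x, t + 1 / 2) = p (x, t)
  flow : ∀ x t x' t', p (x, t) = p (x', t') →
    ∃ ε : ℝ, (ε = 1 ∨ ε = -1) ∧ ∀ r, p (x', t' + r) = p (x, t + ε * r)

/-- Local constancy of `orient` is what makes the sign in the definition of the clock smooth. -/
theorem crosses_of_mem [IsManifold (𝓡 3) ∞ M] [IsManifold (𝓡 2) ∞ S] {𝓕 : SeifertFibration M}
    {ι : S → M} (hι : IsSmoothEmbedding (𝓡 2) (𝓡 3) ∞ ι) (horizontal : 𝓕.IsHorizontal ι)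
    {b : S × ℝ → M} (hb : IsOpenEmbedding b) (hbι : ∀ x, b (x, 0) = ι x) {A : FiberedTorus 𝓕}
    {x : S} (hx : ι x ∈ A.Φ.target) :
    (∀ᶠ x' in 𝓝 x, orient A ι b x' = orient A ι b x) ∧ Crosses A ι b x := by
  classical
  have : LocallyConnectedSpace S := ChartedSpace.locallyConnectedSpace (EuclideanSpace ℝ (Fin 2)) S
  -- The flow is meaningful only inside the torus. The other value is chosen so that `c (x, 0) = ι
  -- x` holds for every `x`, as `exists_crossing_sign` requires.
  let c : S × ℝ → M := fun z => if ι z.1 ∈ A.Φ.target then A.flow z.2 (ι z.1) else ι z.1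
  have hUo : IsOpen (ι ⁻¹' A.Φ.target) := A.Φ.open_target.preimage hι.isEmbedding.continuous
  have hceq {x : S} (hx : ι x ∈ A.Φ.target) (s : ℝ) :
      c =ᶠ[𝓝 (x, s)] fun z => A.flow z.2 (ι z.1) := by
    filter_upwards [(hUo.prod isOpen_univ).mem_nhds
      (⟨hx, mem_univ _⟩ : (x, s) ∈ (ι ⁻¹' A.Φ.target) ×ˢ univ)] with z hz
    exact if_pos hz.1
  have hcd {x : S} (hx : ι x ∈ A.Φ.target) (s : ℝ) :
      IsLocalDiffeomorphAt ((𝓡 2).prod 𝓘(ℝ, ℝ)) (𝓡 3) ∞ c (x, s) :=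
    isLocalDiffeomorphAt_congr (isLocalDiffeomorphAt_crossing hι horizontal hx s) (hceq hx s)
  have hc0 (x : S) : c (x, 0) = ι x := by
    simp only [c]
    split_ifs with h
    · exact flow_zero h
    · rfl
  obtain ⟨ε, hε, h⟩ := exists_crossing_sign hb hbι hc0 (x₀ := x)
    ((IsLocalDiffeomorphAt.eventually (hcd hx 0)).mono fun z hz => hz.contMDiffAt.continuousAt)
    (by rw [IsLocalDiffeomorphAt.map_nhds (hcd hx 0), hc0])
    (IsLocalDiffeomorphAt.exists_injOn (hcd hx 0))
  have h2 : ∀ᶠ x' in 𝓝 x, orient A ι b x' = ε ∧ Crosses A ι b x' := by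
    filter_upwards [h, hUo.mem_nhds hx] with x' hx' hm
    have h3 : ∀ᶠ s in 𝓝[>] (0 : ℝ), 0 < ε * side b (A.flow s (ι x')) ∧
        ε * side b (A.flow (-s) (ι x')) < 0 := by
      filter_upwards [hx'] with s hs
      simpa [c, if_pos (show ι x' ∈ A.Φ.target from hm)] using hs
    have h4 := orient_eq_of_crossing hε h3
    refine ⟨h4, ?_⟩
    rw [Crosses, h4]
    exact h3
  have h3 := h2.self_of_nhds
  refine ⟨?_, h3.2⟩
  filter_upwards [h2] with x' hx'
  rw [hx'.1, h3.1]

/-- Changing the torus multiplies both the averaged time (`time_bridge`) and the crossing direction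
(`orient_change`) by the same sign. Their product `τ` therefore has a torus-independent meaning, and
the clock is the flow reparametrized by `τ`. -/
theorem exists_isFiberClock [T2Space M] [CompactSpace M] [IsManifold (𝓡 3) ∞ M]
    [IsManifold (𝓡 2) ∞ S] (𝓕 : SeifertFibration M)
    {ι : S → M} (hι : IsSmoothEmbedding (𝓡 2) (𝓡 3) ∞ ι) (two_sided : IsTwoSided ι)
    (horizontal : 𝓕.IsHorizontal ι) : ∃ p : S × ℝ → M, IsFiberClock 𝓕 ι p := by
  obtain ⟨n, Tor, hcov⟩ := 𝓕.exists_tori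
  obtain ⟨b, hb, hbι⟩ := two_sided
  have hcr (k : Fin n) {x : S} (hx : ι x ∈ (Tor k).Φ.target) :=
    crosses_of_mem hι horizontal hb hbι hx
  choose kk hkk using fun x : S => hcov (ι x)
  have hk (x : S) : ι x ∈ (Tor (kk x)).Φ.target := mem_target_of_wt_pos (hkk x).ne'
  have hpi := Real.pi_pos
  -- This turns the period `2π` into `1 / 2`. All first return times are then below `1`, which makes
  -- `normalTime` increasing.
  set c₀ : ℝ := (4 * Real.pi)⁻¹ with hc₀
  have hc₀pos : 0 < c₀ := by positivity
  let o (k : Fin n) (x : S) : ℝ := orient (Tor k) ι b x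
  have ho (k x) : o k x * o k x = 1 := orient_mul_self b x
  let τ (k : Fin n) (x : S) (s : ℝ) : ℝ := c₀ * (o k x * time Tor k (ι x) s)
  have hτsurj (k : Fin n) {x : S} (hx : ι x ∈ (Tor k).Φ.target) (t : ℝ) : ∃ s, τ k x s = t := by
    obtain ⟨s, hs⟩ := surjective_time hcov hx (o k x * (t / c₀))
    refine ⟨s, ?_⟩
    simp only [τ]
    rw [hs, ← mul_assoc (o k x), ho, one_mul, mul_div_cancel₀ _ hc₀pos.ne']
  choose σ hσ using fun z : S × ℝ => hτsurj (kk z.1) (hk z.1) z.2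
  let p : S × ℝ → M := fun z => (Tor (kk z.1)).flow (σ z) (ι z.1)
  have hp (k : Fin n) {x : S} (hx : ι x ∈ (Tor k).Φ.target) (s : ℝ) :
      p (x, τ k x s) = (Tor k).flow s (ι x) := by
    have h1 : σ (x, τ k x s) = bridge (Tor k) (Tor (kk x)) (ι x) s := by
      refine (strictMono_time hcov (hk x)).injective ?_
      rw [time_bridge hx (hk x)]
      have h2 := hσ (x, τ k x s)
      simp only [τ] at h2
      have h3 := mul_left_cancel₀ hc₀pos.ne' h2
      have h4 : o (kk x) x = sgn (Tor k) (Tor (kk x)) (ι x) * o k x :=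
        orient_change hx (hk x) (hcr k hx).2 (hcr _ (hk x)).2
      calc time Tor (kk x) (ι x) (σ (x, τ k x s))
          = o (kk x) x * (o (kk x) x * time Tor (kk x) (ι x) (σ (x, τ k x s))) := by
            rw [← mul_assoc, ho, one_mul]
        _ = (o (kk x) x * o k x) * time Tor k (ι x) s := by rw [h3, mul_assoc]
        _ = _ := by 
            rw [h4]
            linear_combination (sgn (Tor k) (Tor (kk x)) (ι x) * time Tor k (ι x) s) * ho k x
    simp only [p]
    rw [h1, flow_bridge hx (hk x)]
  refine ⟨p, ?_, ?_, ?_, ?_, ?_⟩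
  · rintro ⟨x, t⟩
    set k := kk x
    obtain ⟨s, hs⟩ := hτsurj k (hk x) t
    have hUo : IsOpen (ι ⁻¹' (Tor k).Φ.target) :=
      (Tor k).Φ.open_target.preimage hι.isEmbedding.continuous
    have hUo' : IsOpen ((ι ⁻¹' (Tor k).Φ.target) ×ˢ (univ : Set ℝ)) := hUo.prod isOpen_univ
    have hτs : ContMDiffOn ((𝓡 2).prod 𝓘(ℝ, ℝ)) 𝓘(ℝ, ℝ) ∞ (fun z : S × ℝ => τ k z.1 z.2)
        ((ι ⁻¹' (Tor k).Φ.target) ×ˢ univ) := by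
      rintro ⟨x', s'⟩ ⟨hx', -⟩
      refine ContMDiffAt.contMDiffWithinAt ?_
      have h1 : ContMDiffAt ((𝓡 2).prod 𝓘(ℝ, ℝ)) 𝓘(ℝ, ℝ) ∞
          (fun z : S × ℝ => time Tor k (ι z.1) z.2) (x', s') := by
        have h2 : ContMDiffAt ((𝓡 2).prod 𝓘(ℝ, ℝ)) ((𝓡 3).prod 𝓘(ℝ, ℝ)) ∞
            (fun z : S × ℝ => (ι z.1, z.2)) (x', s') :=
          ((hι.contMDiff.comp contMDiff_fst).prodMk contMDiff_snd).contMDiffAt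
        exact ContMDiffAt.comp (f := fun z : S × ℝ => (ι z.1, z.2)) (x', s')
          (contMDiffAt_time hcov hx' s') h2
      have h3 : ContMDiff 𝓘(ℝ, ℝ) 𝓘(ℝ, ℝ) ∞ (fun r : ℝ => c₀ * (o k x' * r)) :=
        (contDiff_const.mul (contDiff_const.mul contDiff_id)).contMDiff
      refine (h3.contMDiffAt.comp (x', s') h1).congr_of_eventuallyEq ?_
      filter_upwards [(continuousAt_fst (p := (x', s'))).eventually (hcr k hx').1] with z hz
      simp only [τ, o, Function.comp_apply]
      rw [hz]
    obtain ⟨d, hd, hd'⟩ := exists_hasDerivAt_time hcov (hk x) s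
    have hone : o k x ≠ 0 := fun h => by simpa [h] using ho k x
    have hB := isLocalDiffeomorphAt_shear hUo' hτs (x := x) (s := s) ⟨hk x, mem_univ _⟩
      (d := c₀ * (o k x * d)) (mul_ne_zero hc₀pos.ne' (mul_ne_zero hone hd.ne'))
      (show HasDerivAt (fun t => τ k x t) _ s from (hd'.const_mul (o k x)).const_mul c₀)
    -- The map `p` after the shear `(x, s) ↦ (x, τ x s)` is the crossing map of the torus, and both
    -- of these are local diffeomorphisms.
    have := isLocalDiffeomorphAt_of_comp (A := p) hB
      (isLocalDiffeomorphAt_crossing hι horizontal (hk x) s) (by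
        filter_upwards [hUo'.mem_nhds
          (⟨hk x, mem_univ _⟩ : (x, s) ∈ (ι ⁻¹' (Tor k).Φ.target) ×ˢ univ)] with z hz
        exact hp k hz.1 z.2)
    simpa [hs] using this
  · intro x
    have h1 := hp (kk x) (hk x) 0
    have h2 : τ (kk x) x 0 = 0 := by simp [τ, time_zero (hk x)]
    rwa [h2, flow_zero (hk x)] at h1
  · intro x y
    rw [rel_iff_flow (hk x)]
    constructor
    · rintro ⟨s, rfl⟩
      exact ⟨_, (hp (kk x) (hk x) s).symm⟩
    · rintro ⟨t, rfl⟩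
      exact ⟨_, rfl⟩
  · intro x t
    obtain ⟨s, hs⟩ := hτsurj (kk x) (hk x) t
    have h1 (s : ℝ) : p (x, τ (kk x) x (s + 2 * Real.pi)) = p (x, τ (kk x) x s) := by
      rw [hp _ (hk x), hp _ (hk x), flow_two_pi]
    have h2 (s : ℝ) : τ (kk x) x (s + 2 * Real.pi) = τ (kk x) x s + o (kk x) x * (1 / 2) := by
      simp only [τ]
      rw [time_add_two_pi hcov (hk x), mul_add, mul_add, hc₀]
      congr 1
      field_simp
      ring
    rcases orient_eq (A := Tor (kk x)) (ι := ι) b x with h | h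
    · have h3 := h1 s
      rw [h2, hs] at h3
      simpa [o, h] using h3
    · obtain ⟨s', hs'⟩ := hτsurj (kk x) (hk x) (t + 1 / 2)
      have h3 := h1 s'
      rw [h2, hs'] at h3
      have h4 : t + 1 / 2 + o (kk x) x * (1 / 2) = t := by simp [o, h]
      rw [h4] at h3
      exact h3.symm
  · intro x t x' t' hxt
    set k := kk x
    obtain ⟨s, hs⟩ := hτsurj k (hk x) t
    have hx' : ι x' ∈ (Tor k).Φ.target := by
      have h1 : p (x, t) ∈ (Tor k).Φ.target := flow_mem (hk x) _
      rw [hxt] at h1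
      refine mem_of_rel h1 (𝓕.rel.symm ?_)
      exact rel_flow (hk x') _
    obtain ⟨s', hs'⟩ := hτsurj k hx' t'
    rw [← hs, ← hs', hp k (hk x), hp k hx'] at hxt
    set y := ι x with hy
    set a := s - s' with ha
    have hy' : ι x' = (Tor k).flow a y := by
      have h1 : (Tor k).flow (-s') ((Tor k).flow s' (ι x')) = ι x' := by
        rw [← flow_add hx', neg_add_cancel, flow_zero hx']
      rw [← h1, ← hxt, ← flow_add (hk x)]
      congr 1
      ring
    -- Both starting points lie on one fiber, hence in the same torus `k`. Its flow may leave the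
    -- surface on different sides at the two points, and the relative sign records this.
    refine ⟨o k x * o k x', ?_, fun r => ?_⟩
    · rcases orient_eq (A := Tor k) (ι := ι) b x with h | h <;>
      rcases orient_eq (A := Tor k) (ι := ι) b x' with h' | h' <;> simp [o, h, h']
    obtain ⟨v, hv⟩ := hτsurj k hx' (t' + r)
    have h1 : t + o k x * o k x' * r = τ k x (v + a) := by
      have e1 : time Tor k (ι x') v = time Tor k y (v + a) - time Tor k y a := by
        rw [hy']; exact time_flow (hk x) a v
      have e2 : time Tor k (ι x') s' = time Tor k y s - time Tor k y a := by
        rw [hy', time_flow (hk x) a s', ha]; congr 2; ring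
      have e3 : r = τ k x' v - τ k x' s' := by rw [hv, hs']; ring
      rw [e3, ← hs]
      simp only [τ]
      rw [e1, e2]
      have := ho k x'
      linear_combination (c₀ * o k x * (time Tor k y (v + a) - time Tor k y s)) * this
    rw [h1, ← hv, hp k hx', hp k (hk x), hy', ← flow_add (hk x)]

end FiberClock

theorem IsLocalDiffeomorphAt.exists_openPartialHomeomorph {𝕜 : Type*} [NontriviallyNormedField 𝕜]
    {E₁ E₂ H₁ H₂ N₁ N₂ : Type*} [NormedAddCommGroup E₁] [NormedSpace 𝕜 E₁]
    [NormedAddCommGroup E₂] [NormedSpace 𝕜 E₂] [TopologicalSpace H₁] [TopologicalSpace H₂]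
    {I₁ : ModelWithCorners 𝕜 E₁ H₁} {I₂ : ModelWithCorners 𝕜 E₂ H₂}
    [TopologicalSpace N₁] [ChartedSpace H₁ N₁] [TopologicalSpace N₂] [ChartedSpace H₂ N₂]
    {n : ℕ∞ω} {f : N₁ → N₂} {x : N₁} (h : IsLocalDiffeomorphAt I₁ I₂ n f x) :
    ∃ e : OpenPartialHomeomorph N₁ N₂, x ∈ e.source ∧ EqOn f e e.source := by
  obtain ⟨Φ, hx, he⟩ := h
  exact ⟨Φ.toOpenPartialHomeomorph, hx, he⟩

/-! ### The covering of `M` by the surface times a circle; incompressibility. -/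

section Clock

variable {M : Type*} [TopologicalSpace M] [ChartedSpace (EuclideanSpace ℝ (Fin 3)) M]
variable {S : Type*} [TopologicalSpace S] [ChartedSpace (EuclideanSpace ℝ (Fin 2)) S]
variable {𝓕 : SeifertFibration M} {ι : S → M} {p : S × ℝ → M}

namespace IsFiberClock

theorem isLocalHomeomorph (hp : IsFiberClock 𝓕 ι p) : IsLocalHomeomorph p :=
  IsLocalHomeomorph.mk p fun z =>
    IsLocalDiffeomorphAt.exists_openPartialHomeomorph (hp.localDiffeo z)

theorem periodic_natMul (hp : IsFiberClock 𝓕 ι p) (x : S) (t : ℝ) (n : ℤ) :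
    p (x, t + n * (1 / 2)) = p (x, t) :=
  (show Function.Periodic (fun t => p (x, t)) (1 / 2) from hp.periodic x).int_mul n t

theorem range_eq_image (hp : IsFiberClock 𝓕 ι p) : range p = p '' (univ ×ˢ Icc 0 (1 / 2)) := by
  refine subset_antisymm ?_ (image_subset_range _ _)
  rintro _ ⟨⟨x, t⟩, rfl⟩
  refine ⟨(x, t + (-⌊2 * t⌋ : ℤ) * (1 / 2)), ⟨mem_univ _, ?_⟩, hp.periodic_natMul ..⟩
  have := Int.floor_le (2 * t)
  have := Int.lt_floor_add_one (2 * t)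
  push_cast
  constructor <;> linarith

/-- By periodicity the image is the image of a compact set, hence closed; it is also open, and `M`
is connected. -/
theorem surjective (hp : IsFiberClock 𝓕 ι p) [T2Space M] [ConnectedSpace M] [CompactSpace S]
    [Nonempty S] : Function.Surjective p := by
  rw [← range_eq_univ]
  refine IsClopen.eq_univ ⟨?_, hp.isLocalHomeomorph.isOpenMap.isOpen_range⟩ (range_nonempty p)
  rw [hp.range_eq_image]
  exact ((isCompact_univ.prod isCompact_Icc).image hp.isLocalHomeomorph.continuous).isClosed

/-- A clock makes the product of the surface with a circle a covering of the `3`-manifold. -/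
theorem exists_isCoveringMap (hp : IsFiberClock 𝓕 ι p) [T2Space M] [CompactSpace S] [T2Space S] :
    ∃ q : S × AddCircle (1 / 2 : ℝ) → M, IsCoveringMap q ∧ ∀ x (t : ℝ), q (x, t) = p (x, t) := by
  have : Fact (0 < (1 / 2 : ℝ)) := ⟨by norm_num⟩
  let q : S × AddCircle (1 / 2 : ℝ) → M := fun z =>
    (show Function.Periodic (fun t => p (z.1, t)) (1 / 2) from hp.periodic z.1).lift z.2
  have hq (x : S) (t : ℝ) : q (x, t) = p (x, t) := rfl
  let r : S × ℝ → S × AddCircle (1 / 2 : ℝ) := Prod.map id (fun t => (t : AddCircle (1 / 2 : ℝ)))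
  have hr : IsLocalHomeomorph r := by
    have h1 := AddCircle.isLocalHomeomorph_coe (1 / 2 : ℝ)
    refine IsLocalHomeomorph.mk r fun z => ?_
    obtain ⟨e, he, he'⟩ := h1 z.2
    refine ⟨(OpenPartialHomeomorph.refl S).prod e, ⟨mem_univ _, he⟩, fun z hz => ?_⟩
    simp [r, Prod.map, he']
  have hrs : Function.Surjective r := by
    rintro ⟨x, t⟩
    induction t using QuotientAddGroup.induction_on with
    | H t => exact ⟨(x, t), rfl⟩
  have hqr : q ∘ r = p := by
    ext ⟨x, t⟩
    exact hq x t
  have hql : IsLocalHomeomorph q := by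
    rw [isLocalHomeomorph_iff_isLocalHomeomorphOn_univ, ← hrs.range_eq, ← image_univ]
    refine IsLocalHomeomorphOn.of_comp_right ?_ hr.isLocalHomeomorphOn
    rw [hqr]
    exact hp.isLocalHomeomorph.isLocalHomeomorphOn
  -- A local homeomorphism from a compact space between Hausdorff spaces is a covering.
  exact ⟨q, isLocalHomeomorph_iff_isCoveringMap.mp hql, hq⟩

/-- A null-homotopy in `M` of a loop of the surface lifts to the covering `S × S¹`, where the loop
sits in the slice at time zero. Projecting the lifted homotopy to `S` contracts the loop there. -/
theorem isIncompressible (hp : IsFiberClock 𝓕 ι p) [T2Space M] [CompactSpace S] [T2Space S]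
    (hι : Continuous ι) : IsIncompressible ι := by
  refine ⟨hι, fun x γ hγ => ?_⟩
  obtain ⟨q, hq, hqp⟩ := hp.exists_isCoveringMap
  let j : C(S, S × AddCircle (1 / 2 : ℝ)) := ⟨fun x => (x, (0 : ℝ)), by fun_prop⟩
  have h1 : (j.comp γ.toContinuousMap).HomotopicRel (j.comp (Path.refl x).toContinuousMap)
      {0, 1} := by
    rw [hq.homotopicRel_iff_comp ⟨0, .inl rfl, by simp⟩]
    have e1 : (ContinuousMap.comp ⟨q, hq.continuous⟩ (j.comp γ.toContinuousMap)) =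
        (γ.map hι).toContinuousMap := by
      ext t
      exact (hqp _ 0).trans (hp.zero _)
    have e2 : (ContinuousMap.comp ⟨q, hq.continuous⟩ (j.comp (Path.refl x).toContinuousMap)) =
        (Path.refl (ι x)).toContinuousMap := by
      ext t
      exact (hqp _ 0).trans (hp.zero _)
    rw [e1, e2]
    exact hγ
  have h2 := h1.map fun H => H.compContinuousMap
    (⟨Prod.fst, continuous_fst⟩ : C(S × AddCircle (1 / 2 : ℝ), S))
  exact h2

end IsFiberClock

end Clock

/-! ### Products of local diffeomorphisms. -/

section ProdMap

variable {E₁ E₂ E₃ E₄ H₁ H₂ H₃ H₄ N₁ N₂ N₃ N₄ : Type*}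
  [NormedAddCommGroup E₁] [NormedSpace ℝ E₁] [NormedAddCommGroup E₂] [NormedSpace ℝ E₂]
  [NormedAddCommGroup E₃] [NormedSpace ℝ E₃] [NormedAddCommGroup E₄] [NormedSpace ℝ E₄]
  [TopologicalSpace H₁] [TopologicalSpace H₂] [TopologicalSpace H₃] [TopologicalSpace H₄]
  {I₁ : ModelWithCorners ℝ E₁ H₁} {I₂ : ModelWithCorners ℝ E₂ H₂}
  {I₃ : ModelWithCorners ℝ E₃ H₃} {I₄ : ModelWithCorners ℝ E₄ H₄}
  [TopologicalSpace N₁] [ChartedSpace H₁ N₁] [TopologicalSpace N₂] [ChartedSpace H₂ N₂]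
  [TopologicalSpace N₃] [ChartedSpace H₃ N₃] [TopologicalSpace N₄] [ChartedSpace H₄ N₄]

theorem isLocalDiffeomorphAt_prodMap {f : N₁ → N₂} {g : N₃ → N₄} {x : N₁} {y : N₃}
    (hf : IsLocalDiffeomorphAt I₁ I₂ ∞ f x) (hg : IsLocalDiffeomorphAt I₃ I₄ ∞ g y) :
    IsLocalDiffeomorphAt (I₁.prod I₃) (I₂.prod I₄) ∞ (Prod.map f g) (x, y) := by
  obtain ⟨Φ, hx, hΦ⟩ := hf
  obtain ⟨Ψ, hy, hΨ⟩ := hg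
  let P := Φ.toOpenPartialHomeomorph.prod Ψ.toOpenPartialHomeomorph
  refine ⟨⟨P.toPartialEquiv, P.open_source, P.open_target, ?_, ?_⟩, ⟨hx, hy⟩, ?_⟩
  · exact Φ.contMDiffOn_toFun.prodMap Ψ.contMDiffOn_toFun
  · exact Φ.contMDiffOn_invFun.prodMap Ψ.contMDiffOn_invFun
  · rintro ⟨a, b⟩ ⟨ha, hb⟩
    exact Prod.ext (hΦ ha) (hΨ hb)

theorem isLocalDiffeomorphAt_id (x : N₁) : IsLocalDiffeomorphAt I₁ I₁ ∞ (id : N₁ → N₁) x :=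
  (Diffeomorph.refl I₁ N₁ ∞).isLocalDiffeomorph x

theorem isLocalDiffeomorphAt_continuousLinearEquiv (L : E₁ ≃L[ℝ] E₂) (x : E₁) :
    IsLocalDiffeomorphAt 𝓘(ℝ, E₁) 𝓘(ℝ, E₂) ∞ L x :=
  L.toDiffeomorph.isLocalDiffeomorph x

end ProdMap

/-! ### Charts of the maximal atlas as local diffeomorphisms. -/

section MaximalAtlas

variable {n : ℕ} {N : Type*} [TopologicalSpace N] [ChartedSpace (EuclideanSpace ℝ (Fin n)) N]
  {e : OpenPartialHomeomorph N (EuclideanSpace ℝ (Fin n))}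

/-- A chart of the maximal atlas, as a partial diffeomorphism. -/
def chartPartialDiffeomorph (he : e ∈ IsManifold.maximalAtlas (𝓡 n) ∞ N) :
    PartialDiffeomorph (𝓡 n) (𝓡 n) N (EuclideanSpace ℝ (Fin n)) ∞ where
  toPartialEquiv := e.toPartialEquiv
  open_source := e.open_source
  open_target := e.open_target
  contMDiffOn_toFun := contMDiffOn_of_mem_maximalAtlas he
  contMDiffOn_invFun := contMDiffOn_symm_of_mem_maximalAtlas he

theorem isLocalDiffeomorphAt_of_mem_maximalAtlas
    (he : e ∈ IsManifold.maximalAtlas (𝓡 n) ∞ N) {x : N} (hx : x ∈ e.source) :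
    IsLocalDiffeomorphAt (𝓡 n) (𝓡 n) ∞ e x :=
  ⟨chartPartialDiffeomorph he, hx, fun _ _ => rfl⟩

theorem isLocalDiffeomorphAt_symm_of_mem_maximalAtlas
    (he : e ∈ IsManifold.maximalAtlas (𝓡 n) ∞ N) {x : EuclideanSpace ℝ (Fin n)}
    (hx : x ∈ e.target) :
    IsLocalDiffeomorphAt (𝓡 n) (𝓡 n) ∞ e.symm x :=
  ⟨(chartPartialDiffeomorph he).symm, hx, fun _ _ => rfl⟩

end MaximalAtlas

/-! ### Orientability of the surface. -/

section Orientation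

local notation "𝔼" n => EuclideanSpace ℝ (Fin n)

/-- An identification of the plane times the line with space. -/
def splitSpace : ((𝔼 2) × ℝ) ≃L[ℝ] 𝔼 3 :=
  ContinuousLinearEquiv.ofFinrankEq (by simp)

theorem fderiv_det_ne_zero {V : Type*} [NormedAddCommGroup V] [NormedSpace ℝ V] {f : V → V} {x : V}
    (hf : IsLocalDiffeomorphAt 𝓘(ℝ, V) 𝓘(ℝ, V) ∞ f x) : (fderiv ℝ f x).det ≠ 0 := by
  have h1 := hf.mfderivToContinuousLinearEquiv_coe (by simp)
  rw [mfderiv_eq_fderiv] at h1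
  rw [← h1]
  exact (LinearEquiv.isUnit_det' (hf.mfderivToContinuousLinearEquiv (by simp)).toLinearEquiv).ne_zero

variable {M : Type*} [TopologicalSpace M] [ChartedSpace (𝔼 3) M]
variable {S : Type*} [TopologicalSpace S] [ChartedSpace (𝔼 2) S]

/-- The coordinate expression of a map from a surface times a line to a `3`-manifold. -/
def prodCoord (p : S × ℝ → M) (c : OpenPartialHomeomorph S (𝔼 2))
    (e : OpenPartialHomeomorph M (𝔼 3)) (w : (𝔼 2) × ℝ) : (𝔼 2) × ℝ :=
  splitSpace.symm (e (p (c.symm w.1, w.2)))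

variable {p : S × ℝ → M} {c c' : OpenPartialHomeomorph S (𝔼 2)}
  {e e' : OpenPartialHomeomorph M (𝔼 3)} {x : S}

theorem isLocalDiffeomorphAt_prodCoord
    (hp : IsLocalDiffeomorphAt ((𝓡 2).prod 𝓘(ℝ, ℝ)) (𝓡 3) ∞ p (x, 0))
    (hc : c ∈ IsManifold.maximalAtlas (𝓡 2) ∞ S) (hx : x ∈ c.source)
    (he : e ∈ IsManifold.maximalAtlas (𝓡 3) ∞ M) (hpx : p (x, 0) ∈ e.source) :
    IsLocalDiffeomorphAt 𝓘(ℝ, (𝔼 2) × ℝ) 𝓘(ℝ, (𝔼 2) × ℝ) ∞ (prodCoord p c e) (c x, 0) := by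
  have h1 := isLocalDiffeomorphAt_prodMap (x := c x) (y := (0 : ℝ))
    (isLocalDiffeomorphAt_symm_of_mem_maximalAtlas hc (c.map_source hx))
    (isLocalDiffeomorphAt_id (I₁ := 𝓘(ℝ, ℝ)) (0 : ℝ))
  have h0 : Prod.map c.symm (id : ℝ → ℝ) (c x, 0) = (x, 0) := by simp [c.left_inv hx]
  have h2 := isLocalDiffeomorphAt_comp (g := p) (h0 ▸ hp) h1
  have h3 := isLocalDiffeomorphAt_comp (g := e) (f := p ∘ Prod.map c.symm (id : ℝ → ℝ))
    (x := (c x, 0)) (by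
      rw [Function.comp_apply, h0]
      exact isLocalDiffeomorphAt_of_mem_maximalAtlas he hpx) h2
  have h4 := isLocalDiffeomorphAt_comp (isLocalDiffeomorphAt_continuousLinearEquiv splitSpace.symm _) h3
  rw [← modelWithCornersSelf_prod, chartedSpaceSelf_prod] at h4
  exact h4

/-- The chain rule, with the change of surface chart acting as a block with the identity in the time
direction. For oriented charts of `M` the sign of the surface Jacobian is thus the quotient of the
signs of the two product Jacobians. -/
theorem prodCoord_change
    (hp : ∀ x, IsLocalDiffeomorphAt ((𝓡 2).prod 𝓘(ℝ, ℝ)) (𝓡 3) ∞ p (x, 0))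
    (hc : c ∈ IsManifold.maximalAtlas (𝓡 2) ∞ S) (hx : x ∈ c.source)
    (hc' : c' ∈ IsManifold.maximalAtlas (𝓡 2) ∞ S) (hx' : x ∈ c'.source)
    (he : e ∈ IsManifold.maximalAtlas (𝓡 3) ∞ M) (hpx : p (x, 0) ∈ e.source)
    (he' : e' ∈ IsManifold.maximalAtlas (𝓡 3) ∞ M) (hpx' : p (x, 0) ∈ e'.source) :
    (fderiv ℝ (prodCoord p c e) (c x, 0)).det =
      (fderiv ℝ (e ∘ e'.symm) (e' (p (x, 0)))).det *
        (fderiv ℝ (prodCoord p c' e') (c' x, 0)).det * (fderiv ℝ (c' ∘ c.symm) (c x)).det := by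
  have hdiff {V W : Type _} [NormedAddCommGroup V] [NormedSpace ℝ V] [NormedAddCommGroup W]
      [NormedSpace ℝ W] {f : V → W} {v : V}
      (h : IsLocalDiffeomorphAt 𝓘(ℝ, V) 𝓘(ℝ, W) ∞ f v) : HasFDerivAt f (fderiv ℝ f v) v :=
    (h.contMDiffAt.contDiffAt.differentiableAt (by simp)).hasFDerivAt
  have h1 : HasFDerivAt (e ∘ e'.symm) (fderiv ℝ (e ∘ e'.symm) (e' (p (x, 0)))) (e' (p (x, 0))) := by
    refine hdiff (isLocalDiffeomorphAt_comp ?_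
      (isLocalDiffeomorphAt_symm_of_mem_maximalAtlas he' (e'.map_source hpx')))
    rw [e'.left_inv hpx']
    exact isLocalDiffeomorphAt_of_mem_maximalAtlas he hpx
  have h2 : HasFDerivAt (c' ∘ c.symm) (fderiv ℝ (c' ∘ c.symm) (c x)) (c x) := by
    refine hdiff (isLocalDiffeomorphAt_comp ?_
      (isLocalDiffeomorphAt_symm_of_mem_maximalAtlas hc (c.map_source hx)))
    rw [c.left_inv hx]
    exact isLocalDiffeomorphAt_of_mem_maximalAtlas hc' hx'
  have h3 := hdiff (isLocalDiffeomorphAt_prodCoord (hp x) hc' hx' he' hpx')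
  set A := fderiv ℝ (e ∘ e'.symm) (e' (p (x, 0)))
  set B := fderiv ℝ (c' ∘ c.symm) (c x)
  set D := fderiv ℝ (prodCoord p c' e') (c' x, 0)
  have h4 : HasFDerivAt (Prod.map (c' ∘ c.symm) (id : ℝ → ℝ))
      (B.prodMap (ContinuousLinearMap.id ℝ ℝ)) (c x, 0) :=
    HasFDerivAt.prodMap (c x, 0) h2 (hasFDerivAt_id _)
  have e0 : Prod.map (c' ∘ c.symm) (id : ℝ → ℝ) (c x, 0) = (c' x, 0) := by
    simp [c.left_inv hx]
  have e1 : splitSpace (prodCoord p c' e' (c' x, 0)) = e' (p (x, 0)) := by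
    simp [prodCoord, c'.left_inv hx']
  have h6 : HasFDerivAt (splitSpace ∘ prodCoord p c' e')
      ((splitSpace : (𝔼 2) × ℝ →L[ℝ] (𝔼 3)).comp D) (c' x, 0) :=
    splitSpace.hasFDerivAt.comp (c' x, (0 : ℝ)) h3
  have h7 : HasFDerivAt ((e ∘ e'.symm) ∘ (splitSpace ∘ prodCoord p c' e'))
      (A.comp ((splitSpace : (𝔼 2) × ℝ →L[ℝ] (𝔼 3)).comp D)) (c' x, 0) :=
    HasFDerivAt.comp (c' x, (0 : ℝ)) (by rw [Function.comp_apply, e1]; exact h1) h6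
  have h8 : HasFDerivAt (splitSpace.symm ∘ ((e ∘ e'.symm) ∘ (splitSpace ∘ prodCoord p c' e')))
      ((splitSpace.symm : (𝔼 3) →L[ℝ] (𝔼 2) × ℝ).comp
        (A.comp ((splitSpace : (𝔼 2) × ℝ →L[ℝ] (𝔼 3)).comp D))) (c' x, 0) :=
    splitSpace.symm.hasFDerivAt.comp (c' x, (0 : ℝ)) h7
  have h5 := HasFDerivAt.comp (c x, (0 : ℝ)) (e0 ▸ h8) h4
  have hev : prodCoord p c e =ᶠ[𝓝 (c x, 0)] (splitSpace.symm ∘ ((e ∘ e'.symm) ∘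
      (splitSpace ∘ prodCoord p c' e'))) ∘ Prod.map (c' ∘ c.symm) (id : ℝ → ℝ) := by
    have hcont : ContinuousAt (fun w : (𝔼 2) × ℝ => p (c.symm w.1, w.2)) (c x, 0) := by
      refine ContinuousAt.comp (g := p) ?_ ?_
      · simp only [c.left_inv hx]
        exact (hp x).contMDiffAt.continuousAt
      · refine ContinuousAt.prodMk ?_ continuousAt_snd
        exact (c.continuousAt_symm (c.map_source hx)).comp (f := Prod.fst) continuousAt_fst
    have hcont' : ContinuousAt (fun w : (𝔼 2) × ℝ => c.symm w.1) (c x, 0) :=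
      (c.continuousAt_symm (c.map_source hx)).comp (f := Prod.fst) continuousAt_fst
    filter_upwards [hcont.eventually_mem (e'.open_source.mem_nhds (by simpa [c.left_inv hx])),
      hcont'.eventually_mem (c'.open_source.mem_nhds (by simpa [c.left_inv hx]))] with w hw hw'
    simp [prodCoord, e'.left_inv hw, c'.left_inv hw']
  rw [(h5.congr_of_eventuallyEq hev).fderiv]
  have e2 : (splitSpace.symm : (𝔼 3) →L[ℝ] (𝔼 2) × ℝ).comp (A.comp
      ((splitSpace : (𝔼 2) × ℝ →L[ℝ] (𝔼 3)).comp D)) =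
      ((splitSpace.symm : (𝔼 3) →L[ℝ] (𝔼 2) × ℝ).comp (A.comp
      (splitSpace : (𝔼 2) × ℝ →L[ℝ] (𝔼 3)))).comp D := rfl
  rw [e2]
  have e3 := LinearMap.det_conj (A : (𝔼 3) →ₗ[ℝ] (𝔼 3)) splitSpace.symm.toLinearEquiv
  simp only [ContinuousLinearMap.det]
  change LinearMap.det (((splitSpace.symm.toLinearEquiv : (𝔼 3) →ₗ[ℝ] (𝔼 2) × ℝ) ∘ₗ
    A.toLinearMap ∘ₗ (splitSpace.symm.toLinearEquiv.symm : (𝔼 2) × ℝ →ₗ[ℝ] (𝔼 3))) ∘ₗ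
    D.toLinearMap ∘ₗ LinearMap.prodMap B.toLinearMap LinearMap.id) = _
  rw [LinearMap.det_comp, LinearMap.det_comp, e3, LinearMap.det_prodMap, LinearMap.det_id]
  ring

theorem exists_reflection : ∃ R : (𝔼 2) ≃L[ℝ] 𝔼 2, (R.symm : (𝔼 2) →L[ℝ] 𝔼 2).det = -1 := by
  let v : 𝔼 2 := EuclideanSpace.single 0 1
  have hv : v ≠ 0 := by simp [v]
  refine ⟨((ℝ ∙ v)ᗮ.reflection).toContinuousLinearEquiv, ?_⟩
  have h := (ℝ ∙ v)ᗮ.det_reflection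
  rw [Submodule.orthogonal_orthogonal, finrank_span_singleton hv, pow_one] at h
  have h2 : (((ℝ ∙ v)ᗮ.reflection).toContinuousLinearEquiv.symm) =
    ((ℝ ∙ v)ᗮ.reflection).toContinuousLinearEquiv := by
    ext1
    rfl
  rw [h2]
  exact h

/-- A surface is orientable if its product with an interval is. -/
theorem isOrientable_of_isLocalDiffeomorphAt [IsManifold (𝓡 2) ∞ S] (hM : IsOrientable 3 M)
    (hp : ∀ x, IsLocalDiffeomorphAt ((𝓡 2).prod 𝓘(ℝ, ℝ)) (𝓡 3) ∞ p (x, 0)) :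
    IsOrientable 2 S := by
  obtain ⟨A, hA, hcov, hpos⟩ := hM
  refine ⟨{c | c ∈ IsManifold.maximalAtlas (𝓡 2) ∞ S ∧ ∀ x ∈ c.source, ∃ e ∈ A,
    p (x, 0) ∈ e.source ∧ 0 < (fderiv ℝ (prodCoord p c e) (c x, 0)).det}, fun c h => h.1, ?_, ?_⟩
  · intro x
    obtain ⟨e, heA, hxe⟩ := hcov (p (x, 0))
    obtain ⟨c, hc, hxc, hJ⟩ : ∃ c ∈ IsManifold.maximalAtlas (𝓡 2) ∞ S, x ∈ c.source ∧
        0 < (fderiv ℝ (prodCoord p c e) (c x, 0)).det := by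
      set c₀ := chartAt (𝔼 2) x
      have hc₀ : c₀ ∈ IsManifold.maximalAtlas (𝓡 2) ∞ S := IsManifold.chart_mem_maximalAtlas x
      have hx₀ : x ∈ c₀.source := mem_chart_source _ x
      rcases (fderiv_det_ne_zero
        (isLocalDiffeomorphAt_prodCoord (hp x) hc₀ hx₀ (hA heA) hxe)).lt_or_gt with h | h
      swap
      · exact ⟨c₀, hc₀, hx₀, h⟩
      -- A chart with the wrong sign is corrected by a reflection of the plane.
      obtain ⟨R, hR⟩ := exists_reflection
      have hc₁ : c₀.transHomeomorph R.toHomeomorph ∈ IsManifold.maximalAtlas (𝓡 2) ∞ S := by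
        refine OpenPartialHomeomorph.mem_maximalAtlas_of_contMDiffOn _ ?_ ?_
        · exact R.contDiff.contMDiff.comp_contMDiffOn (contMDiffOn_of_mem_maximalAtlas hc₀)
        · exact (contMDiffOn_symm_of_mem_maximalAtlas hc₀).comp
            R.symm.contDiff.contMDiff.contMDiffOn fun _ h => h
      refine ⟨_, hc₁, hx₀, ?_⟩
      rw [prodCoord_change hp hc₁ hx₀ hc₀ hx₀ (hA heA) hxe (hA heA) hxe]
      have h1 := hpos e heA e heA _ ⟨hxe, hxe⟩
      have h2 : (fderiv ℝ (c₀ ∘ (c₀.transHomeomorph R.toHomeomorph).symm)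
          (c₀.transHomeomorph R.toHomeomorph x)) = R.symm := by
        have h3 : c₀ ∘ (c₀.transHomeomorph R.toHomeomorph).symm =ᶠ[𝓝 (R (c₀ x))] R.symm := by
          filter_upwards [R.symm.continuous.continuousAt.eventually_mem
            (c₀.open_target.mem_nhds (by simpa using c₀.map_source hx₀))] with y hy
          exact c₀.right_inv hy
        exact h3.fderiv_eq.trans R.symm.fderiv
      rw [h2, hR]
      nlinarith
    have hcontJ : ContinuousAt (fun y => (fderiv ℝ (prodCoord p c e) (c y, 0)).det) x := by
      have h1 := (isLocalDiffeomorphAt_prodCoord (hp x) hc hxc (hA heA) hxe).contMDiffAt.contDiffAt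
      have h2 := (h1.fderiv_right (m := 0) (by simp)).continuousAt
      refine ContinuousLinearMap.continuous_det.continuousAt.comp ?_
      exact ContinuousAt.comp (g := fderiv ℝ (prodCoord p c e)) (f := fun y => (c y, (0 : ℝ))) h2
        ((c.continuousAt hxc).prodMk continuousAt_const)
    have hcontp : ContinuousAt (fun y => p (y, 0)) x :=
      (hp x).contMDiffAt.continuousAt.comp (f := fun y => (y, (0 : ℝ))) (by fun_prop)
    -- The Jacobian varies continuously, so its sign persists nearby. The chart is restricted to
    -- where it does, and where one chart `e` still covers the surface.
    have hW := (hcontp.eventually_mem (e.open_source.mem_nhds hxe)).and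
      (hcontJ.eventually_mem (isOpen_Ioi.mem_nhds hJ))
    obtain ⟨W, hW, hWo, hxW⟩ := eventually_nhds_iff.1 hW
    refine ⟨c.restr W, ⟨restr_mem_maximalAtlas (contDiffGroupoid ∞ (𝓡 2)) hc hWo, ?_⟩, ?_⟩
    · intro y hy
      rw [c.restr_source' W hWo] at hy
      exact ⟨e, heA, hW y hy.2⟩
    · rw [c.restr_source' W hWo]
      exact ⟨hxc, hxW⟩
  · rintro c ⟨hc, hc'⟩ d ⟨hd, hd'⟩ x ⟨hxc, hxd⟩
    obtain ⟨e, he, hxe, h1⟩ := hc' x hxc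
    obtain ⟨e', he', hxe', h2⟩ := hd' x hxd
    rw [prodCoord_change hp hc hxc hd hxd (hA he) hxe (hA he') hxe'] at h1
    exact pos_of_mul_pos_right h1 (mul_pos (hpos e' he' e he _ ⟨hxe', hxe⟩) h2).le

end Orientation

/-! ### Returns to the surface along the clock. -/

section Returns

variable {M : Type*} [TopologicalSpace M] [ChartedSpace (EuclideanSpace ℝ (Fin 3)) M]
variable {S : Type*} [TopologicalSpace S] [ChartedSpace (EuclideanSpace ℝ (Fin 2)) S]
variable {𝓕 : SeifertFibration M} {ι : S → M} {p : S × ℝ → M}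

/-- After time `s` the fiber through `x` meets the surface in `x'`, where the clock of `x'` runs
with the speed `ε = ± 1`. -/
structure IsReturn (p : S × ℝ → M) (x : S) (s : ℝ) (x' : S) (ε : ℝ) : Prop where
  sign : ε = 1 ∨ ε = -1
  eq : ∀ r, p (x', r) = p (x, s + ε * r)

/-- The first return along the fibers, in the positive direction of the clock. -/
structure IsFirstReturnData (ι : S → M) (p : S × ℝ → M) (L : S → ℝ) (φ : S → S) (ε : S → ℝ) :
    Prop where
  pos : ∀ x, 0 < L x
  le_half : ∀ x, L x ≤ 1 / 2
  isReturn : ∀ x, IsReturn p x (L x) (φ x) (ε x)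
  notMem : ∀ x, ∀ t ∈ Ioo 0 (L x), p (x, t) ∉ range ι

namespace IsReturn

variable {x x' x'' : S} {s s' ε ε' : ℝ}

theorem mul_self (h : IsReturn p x s x' ε) : ε * ε = 1 := by
  rcases h.sign with h | h <;> simp [h]

theorem symm (h : IsReturn p x s x' ε) : IsReturn p x' (-(ε * s)) x ε where
  sign := h.sign
  eq r := by
    rw [h.eq]
    congr 2
    linear_combination (s - r) * h.mul_self

theorem apply_eq (h : IsReturn p x s x' ε) (t : ℝ) : p (x, t) = p (x', ε * (t - s)) := by
  rw [h.eq]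
  congr 2
  linear_combination (s - t) * h.mul_self

theorem refl (x : S) : IsReturn p x 0 x 1 := ⟨.inl rfl, fun r => by simp⟩

end IsReturn

namespace IsFiberClock

/-- With this, every fact about returns in the positive direction also applies to the other side of
the surface. -/
theorem reverse (hp : IsFiberClock 𝓕 ι p) : IsFiberClock 𝓕 ι fun z => p (z.1, -z.2) where
  localDiffeo := by
    rintro ⟨x, t⟩
    have h1 := isLocalDiffeomorphAt_prodMap (isLocalDiffeomorphAt_id (I₁ := 𝓡 2) x)
      (isLocalDiffeomorphAt_continuousLinearEquiv (ContinuousLinearEquiv.neg ℝ : ℝ ≃L[ℝ] ℝ) t)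
    exact isLocalDiffeomorphAt_comp (g := p) (hp.localDiffeo (x, -t)) h1
  zero x := by simp [hp.zero]
  rel_iff x y := by
    rw [hp.rel_iff]
    exact ⟨fun ⟨t, ht⟩ => ⟨-t, by simpa using ht⟩, fun ⟨t, ht⟩ => ⟨-t, ht⟩⟩
  periodic x t := by
    have := hp.periodic x (-(t + 1 / 2))
    simp only [neg_add_rev] at this ⊢
    rw [← this]
    congr 2
    ring
  flow x t x' t' h := by
    obtain ⟨ε, hε, h'⟩ := hp.flow x (-t) x' (-t') h
    refine ⟨ε, hε, fun r => ?_⟩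
    have := h' (-r)
    simp only
    rw [neg_add, this]
    congr 2
    ring

theorem continuous (hp : IsFiberClock 𝓕 ι p) : Continuous p := hp.isLocalHomeomorph.continuous

theorem exists_injOn (hp : IsFiberClock 𝓕 ι p) (z : S × ℝ) : ∃ U ∈ 𝓝 z, InjOn p U :=
  IsLocalDiffeomorphAt.exists_injOn (hp.localDiffeo z)

/-- A fiber cannot fold back on itself at a point, because `p` is locally injective. -/
theorem not_symmetric (hp : IsFiberClock 𝓕 ι p) (x : S) (s : ℝ) :
    ¬ ∀ r, p (x, s + r) = p (x, s - r) := by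
  intro h
  obtain ⟨U, hU, hinj⟩ := hp.exists_injOn (x, s)
  have h1 : ∀ᶠ r in 𝓝 (0 : ℝ), (x, s + r) ∈ U := by
    have : ContinuousAt (fun r : ℝ => (x, s + r)) 0 := by fun_prop
    exact this (by simpa using hU)
  have h2 : ∀ᶠ r in 𝓝 (0 : ℝ), (x, s - r) ∈ U := by
    have : ContinuousAt (fun r : ℝ => (x, s - r)) 0 := by fun_prop
    exact this (by simpa using hU)
  have h3 := (h1.and h2).filter_mono (nhdsWithin_le_nhds (s := Ioi 0))
  obtain ⟨r, ⟨hr1, hr2⟩, hr0⟩ := (h3.and self_mem_nhdsWithin).exists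
  have := congrArg Prod.snd (hinj hr1 hr2 (h r))
  have hr0' : 0 < r := hr0
  simp only at this
  linarith

/-- Two different signs at one return time would make the clock symmetric about that time. -/
theorem isReturn_unique (hp : IsFiberClock 𝓕 ι p) (hι : Function.Injective ι) {x x' x'' : S}
    {s ε ε' : ℝ} (h : IsReturn p x s x' ε) (h' : IsReturn p x s x'' ε') : x' = x'' ∧ ε = ε' := by
  constructor
  · apply hι
    rw [← hp.zero, ← hp.zero, h.eq, h'.eq]
    simp
  · by_contra hne
    have hs : ε = -ε' := by
      rcases h.sign with h | h <;> rcases h'.sign with h' | h' <;> simp_all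
    have hx : x' = x'' := by
      apply hι
      rw [← hp.zero, ← hp.zero, h.eq, h'.eq]
      simp
    subst hx
    refine hp.not_symmetric x s fun r => ?_
    have h1 := h.eq (ε * r)
    have h2 := h'.eq (ε * r)
    rw [h1, ← mul_assoc, h.mul_self] at h2
    rw [one_mul] at h2
    rw [h2, hs]
    congr 2
    linear_combination (-r) * h'.mul_self

theorem exists_isReturn (hp : IsFiberClock 𝓕 ι p) {x : S} {s : ℝ} (h : p (x, s) ∈ range ι) :
    ∃ x' ε, IsReturn p x s x' ε := by
  obtain ⟨x', hx'⟩ := h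
  obtain ⟨ε, hε, h'⟩ := hp.flow x s x' 0 (by rw [← hx', hp.zero])
  exact ⟨x', ε, hε, fun r => by rw [← h', zero_add]⟩

theorem mem_range (hp : IsFiberClock 𝓕 ι p) {x x' : S} {s ε : ℝ} (h : IsReturn p x s x' ε) :
    p (x, s) ∈ range ι := ⟨x', by rw [← hp.zero, h.eq]; simp⟩

variable [CompactSpace S] [T2Space M]

/-- If `p (x, t)` is a surface point and `t` is small, it equals `p (x', 0)` for a nearby `x'`,
because `ι` is an embedding; local injectivity of `p` gives `t = 0`. Compactness of `S` makes `δ`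
uniform. -/
theorem exists_separation (hp : IsFiberClock 𝓕 ι p) (hι : IsEmbedding ι) :
    ∃ δ > 0, ∀ x t, |t| < δ → p (x, t) ∈ range ι → t = 0 := by
  have h : ∀ x ∈ (univ : Set S), ∀ᶠ z : ℝ × S in 𝓝 (0, x), p (z.2, z.1) ∈ range ι → z.1 = 0 := by
    intro x₀ _
    obtain ⟨U, hU, hinj⟩ := hp.exists_injOn (x₀, 0)
    have h1 : ∀ᶠ x in 𝓝 x₀, (x, (0 : ℝ)) ∈ U := by
      have : ContinuousAt (fun x : S => (x, (0 : ℝ))) x₀ := by fun_prop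
      exact this hU
    rw [hι.isInducing.nhds_eq_comap, eventually_comap] at h1
    have h2 : ContinuousAt (fun z : ℝ × S => p (z.2, z.1)) (0, x₀) :=
      (hp.continuous.comp continuous_swap).continuousAt
    have h3 : Tendsto (fun z : ℝ × S => p (z.2, z.1)) (𝓝 (0, x₀)) (𝓝 (ι x₀)) := by
      simpa [ContinuousAt, hp.zero] using h2
    have h4 : Tendsto (fun z : ℝ × S => (z.2, z.1)) (𝓝 (0, x₀)) (𝓝 (x₀, 0)) :=
      continuous_swap.continuousAt
    filter_upwards [h3.eventually h1, h4.eventually_mem hU] with z hz hzU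
    rintro ⟨x', hx'⟩
    have := hinj hzU (hz x' hx') (by rw [hp.zero, hx'])
    exact congrArg Prod.snd this
  obtain ⟨δ, hδ, h'⟩ := Metric.eventually_nhds_iff.1
    (isCompact_univ.eventually_forall_of_forall_eventually
      (P := fun t x => p (x, t) ∈ range ι → t = 0) h)
  exact ⟨δ, hδ, fun x t ht => h' (by simpa using ht) x (mem_univ x)⟩

theorem isClosed_returnTimes (hp : IsFiberClock 𝓕 ι p) (hι : IsEmbedding ι) (x : S) :
    IsClosed {t | p (x, t) ∈ range ι} :=
  (isCompact_range hι.continuous).isClosed.preimage (hp.continuous.comp (by fun_prop))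

/-- The return times are closed and stay away from zero, and the full period `1 / 2` is one of them,
so there is a least positive one. -/
theorem exists_isFirstReturnData (hp : IsFiberClock 𝓕 ι p) (hι : IsEmbedding ι) :
    ∃ L φ ε, IsFirstReturnData ι p L φ ε := by
  obtain ⟨δ, hδ, hsep⟩ := hp.exists_separation hι
  have h (x : S) : ∃ (L : ℝ) (x' : S) (ε : ℝ), 0 < L ∧ L ≤ 1 / 2 ∧ IsReturn p x L x' ε ∧
      ∀ t ∈ Ioo 0 L, p (x, t) ∉ range ι := by
    have hhalf : p (x, 1 / 2) ∈ range ι := ⟨x, by rw [← hp.zero, ← hp.periodic, zero_add]⟩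
    have hδ2 : δ ≤ 1 / 2 := by
      by_contra! hlt
      have := hsep x (1 / 2) (by rwa [abs_of_pos (by norm_num)]) hhalf
      norm_num at this
    obtain ⟨L, ⟨⟨hL1, hL2⟩, hL3⟩, hL4⟩ := (isCompact_Icc.inter_right
      (hp.isClosed_returnTimes hι x) (s := Icc δ (1 / 2))).exists_isLeast ⟨1 / 2, ⟨hδ2, le_rfl⟩, hhalf⟩
    obtain ⟨x', ε, hr⟩ := hp.exists_isReturn hL3
    refine ⟨L, x', ε, hδ.trans_le hL1, hL2, hr, fun t ht hmem => ?_⟩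
    rcases lt_or_ge t δ with h | h
    · exact ht.1.ne' (hsep x t (by rwa [abs_of_pos ht.1]) hmem)
    · exact absurd (hL4 ⟨⟨h, ht.2.le.trans hL2⟩, hmem⟩) (not_le.2 ht.2)
  choose L φ ε h1 h2 h3 h4 using h
  exact ⟨L, φ, ε, h1, h2, h3, h4⟩

end IsFiberClock

namespace IsFirstReturnData

variable {L L' : S → ℝ} {φ φ' : S → S} {ε ε' : S → ℝ}

theorem eq_of_isReturn (h : IsFirstReturnData ι p L φ ε) (hp : IsFiberClock 𝓕 ι p)
    (hι : Function.Injective ι) {x x' : S} {s e : ℝ} (hs : 0 < s) (hr : IsReturn p x s x' e)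
    (hn : ∀ t ∈ Ioo 0 s, p (x, t) ∉ range ι) : L x = s ∧ φ x = x' ∧ ε x = e := by
  have h1 : L x = s := by
    refine le_antisymm ?_ ?_
    · by_contra! hlt
      exact h.notMem x s ⟨hs, hlt⟩ (hp.mem_range hr)
    · by_contra! hlt
      exact hn _ ⟨h.pos x, hlt⟩ (hp.mem_range (h.isReturn x))
  exact ⟨h1, hp.isReturn_unique hι (h.isReturn x) (h1 ▸ hr)⟩

/-- If the first return reverses the clock, then it is an involution. -/
theorem involutive (h : IsFirstReturnData ι p L φ ε) (hp : IsFiberClock 𝓕 ι p)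
    (hι : Function.Injective ι) {x : S} (hx : ε x = -1) :
    L (φ x) = L x ∧ φ (φ x) = x ∧ ε (φ x) = -1 := by
  have hr := (h.isReturn x).symm
  rw [hx, neg_one_mul, neg_neg] at hr
  refine h.eq_of_isReturn hp hι (h.pos x) hr fun t ht => ?_
  rw [(h.isReturn x).eq, hx]
  exact h.notMem x _ ⟨by linarith [ht.2], by linarith [ht.1]⟩

/-- If the first return preserves the clock, then its inverse is the first return in the opposite
direction. -/
theorem inverse (h : IsFirstReturnData ι p L φ ε) (hp : IsFiberClock 𝓕 ι p)
    (h' : IsFirstReturnData ι (fun z => p (z.1, -z.2)) L' φ' ε')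
    (hι : Function.Injective ι) {x : S} (hx : ε x = 1) :
    L' (φ x) = L x ∧ φ' (φ x) = x ∧ ε' (φ x) = 1 := by
  have hr := (h.isReturn x).symm
  rw [hx, one_mul] at hr
  refine h'.eq_of_isReturn hp.reverse hι (h.pos x) ⟨.inl rfl, fun r => ?_⟩ fun t ht => ?_
  · simp only [hr.eq]
    congr 2
    ring
  · simp only [(h.isReturn x).eq, hx]
    exact h.notMem x _ ⟨by linarith [ht.2], by linarith [ht.1]⟩

theorem reverse_reverse (h : IsFirstReturnData ι p L φ ε) :
    IsFirstReturnData ι (fun z => (fun z : S × ℝ => p (z.1, -z.2)) (z.1, -z.2)) L φ ε := by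
  simpa using h

/-- The clock of `x` meets `x'` at the time `a - e a'`, and there is no return strictly between that
time and `a`. As `a` lies between the consecutive returns `0` and `L x`, this time must be one of
the two. -/
theorem exchange_of_pos (h : IsFirstReturnData ι p L φ ε) (hp : IsFiberClock 𝓕 ι p)
    (h' : IsFirstReturnData ι (fun z => p (z.1, -z.2)) L' φ' ε')
    (hι : Function.Injective ι) {x x' : S} {a a' : ℝ} (ha : a ∈ Ioo 0 (L x))
    (ha' : a' ∈ Ioo (-L' x') (L x')) (heq : p (x, a) = p (x', a')) :
    (x' = x ∧ a' = a) ∨ (x' = φ x ∧ a' = ε x * (a - L x)) := by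
  obtain ⟨e, he, hfl⟩ := hp.flow x a x' a' heq
  have hee : e * e = 1 := by rcases he with h | h <;> simp [h]
  have hr : IsReturn p x (a - e * a') x' e := ⟨he, fun r => by
    have := hfl (r - a')
    rw [add_sub_cancel] at this
    rw [this]
    congr 2
    ring⟩
  have hmem := hp.mem_range hr
  -- The inequality says that `t` is strictly between `a - e a'` and `a`. On the clock of `x'` this
  -- means strictly between `0` and `a'`, where no return occurs.
  have hno (t : ℝ) (ht : 0 < (t - (a - e * a')) * (a - t)) : p (x, t) ∉ range ι := by
    rw [hr.apply_eq]
    set r := e * (t - (a - e * a')) with hr'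
    have h1 : 0 < r * (a' - r) := by
      have : r * (a' - r) = (t - (a - e * a')) * (a - t) := by
        rw [hr']
        linear_combination (-(t - a + e * a') ^ 2) * hee
      rwa [this]
    rcases lt_trichotomy r 0 with h0 | h0 | h0
    · have h2 : a' < r := by
        by_contra! hge
        nlinarith
      have := h'.notMem x' (-r) ⟨by linarith, by linarith [ha'.1]⟩
      simpa using this
    · simp [h0] at h1
    · have h2 : r < a' := by
        by_contra! hge
        nlinarith
      exact h.notMem x' r ⟨h0, by linarith [ha'.2]⟩
  have h0 : p (x, 0) ∈ range ι := ⟨x, (hp.zero x).symm⟩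
  have hL := hp.mem_range (h.isReturn x)
  rcases lt_trichotomy (a - e * a') 0 with hs | hs | hs
  · refine absurd h0 (hno 0 ?_)
    have := ha.1
    nlinarith
  · left
    rw [hs] at hr
    obtain ⟨h1, h2⟩ := hp.isReturn_unique hι hr (IsReturn.refl x)
    refine ⟨h1, ?_⟩
    rw [h2] at hs
    linarith
  · rcases lt_trichotomy (a - e * a') (L x) with hs' | hs' | hs'
    · exact absurd hmem (h.notMem x _ ⟨hs, hs'⟩)
    · right
      rw [hs'] at hr
      obtain ⟨h1, h2⟩ := hp.isReturn_unique hι hr (h.isReturn x)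
      refine ⟨h1, ?_⟩
      rw [← h2, ← hs']
      linear_combination (-a') * hee
    · refine absurd hL (hno (L x) ?_)
      have := ha.2
      nlinarith

theorem exchange (h : IsFirstReturnData ι p L φ ε) (hp : IsFiberClock 𝓕 ι p)
    (h' : IsFirstReturnData ι (fun z => p (z.1, -z.2)) L' φ' ε')
    (hι : Function.Injective ι) {x x' : S} {a a' : ℝ} (ha : a ∈ Ioo (-L' x) (L x))
    (ha' : a' ∈ Ioo (-L' x') (L x')) (heq : p (x, a) = p (x', a')) :
    (x' = x ∧ a' = a) ∨ (0 < a ∧ x' = φ x ∧ a' = ε x * (a - L x)) ∨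
      (a < 0 ∧ x' = φ' x ∧ a' = ε' x * (a + L' x)) := by
  rcases lt_trichotomy a 0 with h0 | h0 | h0
  · have := h'.exchange_of_pos hp.reverse h.reverse_reverse hι (x := x) (x' := x') (a := -a)
      (a' := -a') ⟨by linarith, by linarith [ha.1]⟩ ⟨by linarith [ha'.2], by linarith [ha'.1]⟩
      (by simpa using heq)
    rcases this with ⟨h1, h2⟩ | ⟨h1, h2⟩
    · exact .inl ⟨h1, by linarith⟩
    · exact .inr (.inr ⟨h0, h1, by linear_combination -h2⟩)
  · left
    subst h0
    rw [hp.zero] at heq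
    have h1 : a' = 0 := by
      rcases lt_trichotomy a' 0 with h0 | h0 | h0
      · refine absurd ⟨x, ?_⟩ (h'.notMem x' (-a') ⟨by linarith, by linarith [ha'.1]⟩)
        simpa using heq
      · exact h0
      · exact absurd ⟨x, heq⟩ (h.notMem x' a' ⟨h0, ha'.2⟩)
    refine ⟨hι ?_, h1⟩
    rw [heq, h1, hp.zero]
  · rcases h.exchange_of_pos hp h' hι ⟨h0, ha.2⟩ ha' heq with h1 | h1
    · exact .inl h1
    · exact .inr (.inl ⟨h0, h1⟩)

variable [CompactSpace S] [T2Space M]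

/-- Start from any parameter `(x, t)` with `t ≥ 0` and move to the last return at or before `t`.
From there the point is reached before the next return, on the side given by the sign of that
return. -/
theorem exists_eq [ConnectedSpace M] [Nonempty S] (h : IsFirstReturnData ι p L φ ε)
    (hp : IsFiberClock 𝓕 ι p) (h' : IsFirstReturnData ι (fun z => p (z.1, -z.2)) L' φ' ε')
    (hι : IsEmbedding ι) (y : M) : ∃ x, ∃ a ∈ Ioo (-L' x) (L x), p (x, a) = y := by
  have hy : y ∈ p '' (univ ×ˢ Icc 0 (1 / 2)) := by
    rw [← hp.range_eq_image]
    exact hp.surjective y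
  obtain ⟨⟨x, t⟩, ⟨-, ht⟩, rfl⟩ := hy
  have ht0 : 0 ≤ t := ht.1
  obtain ⟨s, ⟨⟨hs0, hst⟩, hs⟩, hmax⟩ := (isCompact_Icc.inter_right
    (hp.isClosed_returnTimes hι x) (s := Icc 0 t)).exists_isGreatest
      ⟨0, ⟨le_rfl, ht0⟩, x, (hp.zero x).symm⟩
  obtain ⟨x', e, hr⟩ := hp.exists_isReturn hs
  have hno (u : ℝ) (hu : u ∈ Ioc s t) : p (x, u) ∉ range ι := fun hmem =>
    absurd (hmax ⟨⟨hs0.trans hu.1.le, hu.2⟩, hmem⟩) (not_le.2 hu.1)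
  refine ⟨x', e * (t - s), ?_, (hr.apply_eq t).symm⟩
  rcases hr.sign with he | he
  · refine ⟨by rw [he]; linarith [h'.pos x'], ?_⟩
    by_contra! hge
    rw [he, one_mul] at hge
    refine hno (s + L x') ⟨by linarith [h.pos x'], by linarith⟩ ?_
    have h1 := hr.eq (L x')
    rw [he, one_mul] at h1
    rw [← h1]
    exact hp.mem_range (h.isReturn x')
  · refine ⟨?_, by rw [he]; linarith [h.pos x']⟩
    by_contra! hge
    rw [he] at hge
    refine hno (s + L' x') ⟨by linarith [h'.pos x'], by linarith⟩ ?_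
    have h1 := hr.eq (-L' x')
    rw [he, neg_one_mul, neg_neg] at h1
    rw [← h1]
    exact hp.reverse.mem_range (h'.isReturn x')

end IsFirstReturnData

end Returns

/-! ### Smoothness of the first return. -/

section ReturnSmooth

variable {M : Type*} [TopologicalSpace M] [ChartedSpace (EuclideanSpace ℝ (Fin 3)) M]
variable {S : Type*} [TopologicalSpace S] [ChartedSpace (EuclideanSpace ℝ (Fin 2)) S]
variable {𝓕 : SeifertFibration M} {ι : S → M} {p : S × ℝ → M}

namespace IsFirstReturnData

variable {L L' : S → ℝ} {φ φ' : S → S} {ε ε' : S → ℝ} [CompactSpace S] [T2Space M]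

/-- The implicit function theorem, applied through the local inverse of `p` at the return point: the
nearby fibers reach the surface at a smooth time close to `L x₀`, with the same sign. Compactness
and separation show that this nearby return is still the first one. -/
theorem local_form (h : IsFirstReturnData ι p L φ ε) (hp : IsFiberClock 𝓕 ι p)
    (hι : IsEmbedding ι) (x₀ : S) :
    (∀ᶠ x in 𝓝 x₀, ε x = ε x₀) ∧ ContMDiffAt (𝓡 2) 𝓘(ℝ, ℝ) ∞ L x₀ ∧ ContinuousAt φ x₀ := by
  set L₀ := L x₀ with hL₀
  set y₀ := φ x₀ with hy₀
  set e₀ := ε x₀ with he₀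
  have hr₀ : IsReturn p x₀ L₀ y₀ e₀ := h.isReturn x₀
  have hloc := hp.localDiffeo (y₀, 0)
  set Θ := hloc.localInverse with hΘ
  have hpy : p (x₀, L₀) = p (y₀, 0) := by rw [hr₀.eq]; simp
  have hΘ0 : Θ (p (x₀, L₀)) = (y₀, 0) := by
    rw [hpy]
    exact hloc.localInverse_left_inv hloc.localInverse_mem_target
  have hΘs : ContMDiffAt (𝓡 3) ((𝓡 2).prod 𝓘(ℝ, ℝ)) ∞ Θ (p (x₀, L₀)) := by
    rw [hpy]
    exact hloc.localInverse_contMDiffAt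
  -- a neighbourhood on which the local inverse is a left inverse
  obtain ⟨U, hU, u, hu, hUu⟩ : ∃ U ∈ 𝓝 y₀, ∃ u > 0, ∀ y ∈ U, ∀ t, |t| < 2 * u →
      (y, t) ∈ hloc.localInverse.target := by
    have h1 : hloc.localInverse.target ∈ 𝓝 (y₀, (0 : ℝ)) :=
      hloc.localInverse.open_target.mem_nhds hloc.localInverse_mem_target
    rw [mem_nhds_prod_iff] at h1
    obtain ⟨U, hU, V, hV, hUV⟩ := h1
    obtain ⟨r, hr, hrV⟩ := Metric.mem_nhds_iff.1 hV
    refine ⟨U, hU, r / 2, by positivity, fun y hy t ht => hUV ⟨hy, hrV ?_⟩⟩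
    simpa [abs_lt] using (by simpa [abs_lt, mul_div_cancel₀] using ht : -r < t ∧ t < r)
  have hleft {y : S} {t : ℝ} (hy : y ∈ U) (ht : |t| < 2 * u) : Θ (p (y, t)) = (y, t) :=
    hloc.localInverse_left_inv (hUu y hy t ht)
  have hcΘ {t : ℝ} (ht : |t| < 2 * u) : ContinuousAt Θ (p (y₀, t)) := by
    have h1 : p (y₀, t) ∈ hloc.localInverse.source := by
      have h2 := hUu y₀ (mem_of_mem_nhds hU) t ht
      have h3 := hloc.localInverse.map_target h2
      have h4 : hloc.localInverse.symm (y₀, t) = p (y₀, t) := by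
        have h5 := hloc.localInverse_right_inv h3
        have h6 : Θ (hloc.localInverse.symm (y₀, t)) = (y₀, t) :=
          hloc.localInverse.right_inv h2
        change p (Θ _) = _ at h5
        exact h5.symm.trans (congrArg p h6)
      rwa [← h4]
    exact (hloc.localInverse_contMDiffOn.contMDiffAt
      (hloc.localInverse.open_source.mem_nhds h1)).continuousAt
  let a (x : S) : S := (Θ (p (x, L₀))).1
  let b (x : S) : ℝ := (Θ (p (x, L₀))).2
  have hline (s : ℝ) : ContMDiff (𝓡 2) ((𝓡 2).prod 𝓘(ℝ, ℝ)) ∞ fun x : S => (x, s) :=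
    contMDiff_id.prodMk contMDiff_const
  have hΘp : ContMDiffAt (𝓡 2) ((𝓡 2).prod 𝓘(ℝ, ℝ)) ∞ (fun x => Θ (p (x, L₀))) x₀ := by
    have h1 : ContMDiffAt (𝓡 2) (𝓡 3) ∞ (fun x => p (x, L₀)) x₀ :=
      ContMDiffAt.comp (g := p) x₀ (hp.localDiffeo _).contMDiffAt (hline L₀).contMDiffAt
    exact ContMDiffAt.comp (g := Θ) x₀ hΘs h1
  have hbs : ContMDiffAt (𝓡 2) 𝓘(ℝ, ℝ) ∞ b x₀ := contMDiffAt_snd.comp x₀ hΘp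
  have hac : ContinuousAt a x₀ := continuousAt_fst.comp hΘp.continuousAt
  have ha0 : a x₀ = y₀ := by simp [a, hΘ0]
  have hb0 : b x₀ = 0 := by simp [b, hΘ0]
  have hpΘ : ∀ᶠ x in 𝓝 x₀, p (Θ (p (x, L₀))) = p (x, L₀) := by
    have h1 : ∀ᶠ y in 𝓝 (p (x₀, L₀)), p (Θ y) = y := by
      rw [hpy]
      exact hloc.localInverse_eventuallyEq_right
    exact ((hp.continuous.comp (hline L₀).continuous).tendsto x₀).eventually h1
  -- A second observation on the fiber, at distance `u` from the return. In the coordinates at `y₀`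
  -- its time is close to `u`; a return with the opposite sign would put it close to `-u`.
  have hplus : ContinuousAt (fun x => (Θ (p (x, L₀ + e₀ * u))).2) x₀ := by
    have h1 : p (x₀, L₀ + e₀ * u) = p (y₀, u) := (hr₀.eq u).symm
    refine continuousAt_snd.comp (ContinuousAt.comp (g := Θ) ?_
      (hp.continuous.comp (hline (L₀ + e₀ * u)).continuous).continuousAt)
    simp only [h1]
    exact hcΘ (by rw [abs_of_pos hu]; linarith)
  have hplus0 : (Θ (p (x₀, L₀ + e₀ * u))).2 = u := by
    rw [← hr₀.eq u, hleft (mem_of_mem_nhds hU) (by rw [abs_of_pos hu]; linarith)]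
  have hret : ∀ᶠ x in 𝓝 x₀, IsReturn p x (L₀ - e₀ * b x) (a x) e₀ := by
    have hU' : U ∈ 𝓝 (a x₀) := by rwa [ha0]
    filter_upwards [hpΘ, hac.eventually_mem hU',
      hbs.continuousAt.eventually_mem (Metric.ball_mem_nhds (b x₀) (half_pos hu)),
      hplus.eventually_mem (Metric.ball_mem_nhds _ (half_pos hu))] with x h1 h2 h3 h4
    rw [hb0, Real.ball_eq_Ioo] at h3
    rw [hplus0, Real.ball_eq_Ioo] at h4
    obtain ⟨e, he, hfl⟩ := hp.flow x L₀ (a x) (b x) h1.symm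
    have hee : e * e = 1 := by rcases he with h | h <;> simp [h]
    have hr : IsReturn p x (L₀ - e * b x) (a x) e := ⟨he, fun r => by
      have := hfl (r - b x)
      rw [add_sub_cancel] at this
      rw [this]
      congr 2
      ring⟩
    have he' : e = e₀ := by
      by_contra hne
      have hs : e * e₀ = -1 := by
        rcases he with h | h <;> rcases hr₀.sign with h' | h' <;> simp_all
      have h5 := hfl (e * e₀ * u)
      have h6 : L₀ + e * (e * e₀ * u) = L₀ + e₀ * u := by linear_combination e₀ * u * hee
      rw [h6, hs] at h5
      have h7 : |b x + -1 * u| < 2 * u := by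
        rw [abs_lt]
        constructor <;> linarith [h3.1, h3.2]
      rw [← h5, hleft h2 h7] at h4
      have h8 := h4.1
      have h9 := h3.2
      simp only at h8
      linarith
    rw [← he']
    exact hr
  have hℓs : ContMDiffAt (𝓡 2) 𝓘(ℝ, ℝ) ∞ (fun x => L₀ - e₀ * b x) x₀ := by
    have h1 : ContMDiff 𝓘(ℝ, ℝ) 𝓘(ℝ, ℝ) ∞ fun r : ℝ => L₀ - e₀ * r :=
      (contDiff_const.sub (contDiff_const.mul contDiff_id)).contMDiff
    exact h1.contMDiffAt.comp x₀ hbs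
  have hℓ0 : L₀ - e₀ * b x₀ = L₀ := by simp [hb0]
  obtain ⟨δ, hδ, hsep⟩ := hp.exists_separation hι
  -- Earlier returns are excluded in three ranges: before `δ` by separation from time zero, in this
  -- compact middle range by continuity, and near the end by separation from the return already
  -- found.
  have hmid : ∀ᶠ x in 𝓝 x₀, ∀ t ∈ Icc (δ / 2) (L₀ - δ / 2), p (x, t) ∉ range ι := by
    refine isCompact_Icc.eventually_forall_of_forall_eventually
      (P := fun x t => p (x, t) ∉ range ι) fun t ht => ?_
    refine hp.continuous.continuousAt.eventually_mem
      ((isCompact_range hι.continuous).isClosed.isOpen_compl.mem_nhds ?_)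
    exact h.notMem x₀ t ⟨by linarith [ht.1], by linarith [ht.2]⟩
  have hpos : 0 < L₀ := h.pos x₀
  have hfinal : ∀ᶠ x in 𝓝 x₀, L x = L₀ - e₀ * b x ∧ φ x = a x ∧ ε x = e₀ := by
    filter_upwards [hret, hmid,
      hℓs.continuousAt.eventually_mem (Metric.ball_mem_nhds _ (half_pos hδ)),
      hℓs.continuousAt.eventually_mem (Metric.ball_mem_nhds _ hpos)] with x h1 h2 h3 h4
    rw [hℓ0, Real.ball_eq_Ioo] at h3 h4
    refine h.eq_of_isReturn hp hι.injective (by linarith [h4.1]) h1 fun t ht hmem => ?_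
    rcases lt_or_ge t δ with h5 | h5
    · exact ht.1.ne' (hsep x t (by rwa [abs_of_pos ht.1]) hmem)
    rcases le_or_gt t (L₀ - δ / 2) with h6 | h6
    · exact h2 t ⟨by linarith, h6⟩ hmem
    rw [h1.apply_eq] at hmem
    have h7 : |e₀ * (t - (L₀ - e₀ * b x))| < δ := by
      have h8 : |e₀| = 1 := by rcases hr₀.sign with h | h <;> simp [h]
      rw [abs_mul, h8, one_mul, abs_lt]
      constructor <;> linarith [ht.2, h3.2]
    have h9 := hsep _ _ h7 hmem
    rcases mul_eq_zero.1 h9 with h0 | h0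
    · rcases hr₀.sign with h | h <;> norm_num [h] at h0
    · linarith [ht.2]
  refine ⟨hfinal.mono fun x hx => hx.2.2, hℓs.congr_of_eventuallyEq (hfinal.mono fun x hx => hx.1),
    hac.congr (hfinal.mono fun x hx => hx.2.1.symm)⟩

theorem contMDiff (h : IsFirstReturnData ι p L φ ε) (hp : IsFiberClock 𝓕 ι p)
    (hι : IsEmbedding ι) : ContMDiff (𝓡 2) 𝓘(ℝ, ℝ) ∞ L :=
  fun x => (h.local_form hp hι x).2.1

theorem continuous (h : IsFirstReturnData ι p L φ ε) (hp : IsFiberClock 𝓕 ι p)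
    (hι : IsEmbedding ι) : Continuous φ :=
  continuous_iff_continuousAt.2 fun x => (h.local_form hp hι x).2.2

theorem sign_const [PreconnectedSpace S] (h : IsFirstReturnData ι p L φ ε)
    (hp : IsFiberClock 𝓕 ι p) (hι : IsEmbedding ι) (x y : S) : ε x = ε y :=
  ((IsLocallyConstant.iff_eventually_eq ε).2 fun x => (h.local_form hp hι x).1).apply_eq_of_preconnectedSpace x y

/-- The first return in the positive direction is a generator of the return group. -/
theorem exists_mem_returnGroup [PreconnectedSpace S] (h : IsFirstReturnData ι p L φ ε)
    (hp : IsFiberClock 𝓕 ι p) (h' : IsFirstReturnData ι (fun z => p (z.1, -z.2)) L' φ' ε')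
    (hι : IsEmbedding ι) : ∃ g ∈ 𝓕.returnGroup ι, ∀ x, g x = φ x := by
  -- If the clock is preserved, the inverse of `φ` is the first return in the opposite direction; if
  -- it is reversed, `φ` is its own inverse.
  obtain ⟨g, hg⟩ : ∃ g : S ≃ₜ S, ∀ x, g x = φ x := by
    by_cases hne : ∃ x, ε x = 1
    · obtain ⟨x₁, hx₁⟩ := hne
      have h1 (x : S) : ε x = 1 := (h.sign_const hp hι x x₁).trans hx₁
      have h2 (x : S) : ε' x = 1 := by
        rw [h'.sign_const hp.reverse hι x (φ x₁)]
        exact (h.inverse hp h' hι.injective hx₁).2.2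
      exact ⟨⟨⟨φ, φ', fun x => (h.inverse hp h' hι.injective (h1 x)).2.1,
        fun x => (h'.inverse hp.reverse h.reverse_reverse hι.injective (h2 x)).2.1⟩,
        h.continuous hp hι, h'.continuous hp.reverse hι⟩, fun _ => rfl⟩
    · have h1 (x : S) : ε x = -1 :=
        (h.isReturn x).sign.resolve_left fun hx => hne ⟨x, hx⟩
      have h2 (x : S) := (h.involutive hp hι.injective (h1 x)).2.1
      exact ⟨⟨⟨φ, φ, h2, h2⟩, h.continuous hp hι, h.continuous hp hι⟩, fun _ => rfl⟩
  refine ⟨g, Subgroup.subset_closure fun x => ?_, hg⟩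
  rw [hg]
  let γ : Path (ι x) (ι (φ x)) :=
    { toFun := fun t => p (x, t * L x)
      continuous_toFun := hp.continuous.comp (by fun_prop)
      source' := by simp [hp.zero]
      target' := by
        rw [← hp.zero (φ x), (h.isReturn x).eq]
        simp }
  have hIoo {t : unitInterval} (ht : t ∈ Ioo (0 : unitInterval) 1) :
      (t : ℝ) * L x ∈ Ioo 0 (L x) := by
    have h0 : (0 : ℝ) < t := ht.1
    have h1 : (t : ℝ) < 1 := ht.2
    have := h.pos x
    exact ⟨by positivity, by nlinarith⟩
  refine ⟨γ, fun t => (hp.rel_iff x _).2 ⟨_, rfl⟩, fun t ht t' ht' heq => ?_,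
    fun t ht => h.notMem x _ (hIoo ht)⟩
  have hpos := h.pos x
  have hpos' := h'.pos x
  have h1 := hIoo ht
  have h2 := hIoo ht'
  rcases h.exchange_of_pos hp h' hι.injective h1 ⟨by linarith [h2.1], h2.2⟩ heq with h3 | h3
  · exact Subtype.ext (mul_right_cancel₀ hpos.ne' h3.2).symm
  -- Suppose two interior points of the arc coincide. If the sign is `1`, one of the times would be
  -- negative. If it is `-1`, then `φ x = x` and the fiber would be symmetric about the time `L x /
  -- 2`.
  · exfalso
    rcases (h.isReturn x).sign with h4 | h4
    · have := h3.2
      rw [h4] at this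
      linarith [h1.2, h2.1]
    · have h5 := (h.isReturn x).eq
      rw [h4, ← h3.1] at h5
      refine hp.not_symmetric x (L x / 2) fun r => ?_
      rw [h5]
      congr 2
      ring

end IsFirstReturnData

end ReturnSmooth

/-! ### Finiteness of the orbits of the return group. -/

section Orbits

variable {M : Type*} [TopologicalSpace M] [ChartedSpace (EuclideanSpace ℝ (Fin 3)) M]
variable {S : Type*} [TopologicalSpace S] [ChartedSpace (EuclideanSpace ℝ (Fin 2)) S]
variable {𝓕 : SeifertFibration M} {ι : S → M} {p : S × ℝ → M}

theorem rel_of_mem_returnGroup {g : S ≃ₜ S} (hg : g ∈ 𝓕.returnGroup ι) :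
    ∀ x, 𝓕.rel (ι x) (ι (g x)) := by
  induction hg using Subgroup.closure_induction with
  | mem g hg =>
    intro x
    obtain ⟨γ, hγ, -⟩ := hg x
    simpa [SeifertFibration.fiber] using hγ 1
  | one => exact fun x => 𝓕.rel.refl _
  | mul g h _ _ hg hh => exact fun x => 𝓕.rel.trans (hh x) (hg (h x))
  | inv g _ hg =>
    intro x
    have := hg (g⁻¹ x)
    rw [show g (g⁻¹ x) = x from g.apply_symm_apply x] at this
    exact 𝓕.rel.symm this

/-- The return times in one period form a compact set which is discrete by separation, and every
surface point on the fiber occurs at one of them. -/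
theorem IsFiberClock.finite_orbit [CompactSpace S] [T2Space M] (hp : IsFiberClock 𝓕 ι p)
    (hι : IsEmbedding ι) (x : S) : {y | 𝓕.rel (ι x) (ι y)}.Finite := by
  obtain ⟨δ, hδ, hsep⟩ := hp.exists_separation hι
  have hK : IsCompact (Icc 0 (1 / 2) ∩ {t | p (x, t) ∈ range ι}) :=
    isCompact_Icc.inter_right (hp.isClosed_returnTimes hι x)
  have hfin : (Icc 0 (1 / 2) ∩ {t | p (x, t) ∈ range ι}).Finite := by
    refine hK.finite ?_
    rw [isDiscrete_iff_forall_mem_exists_isOpen]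
    rintro s ⟨hs, hs'⟩
    refine ⟨Metric.ball s δ, Metric.isOpen_ball, ?_⟩
    refine subset_antisymm ?_ (by simpa using ⟨hδ, ⟨hs.1, by simpa using hs.2⟩, hs'⟩)
    rintro t ⟨ht, -, ht'⟩
    obtain ⟨x', e, hr⟩ := hp.exists_isReturn hs'
    rw [mem_ofPred_eq, hr.apply_eq] at ht'
    have h1 : |e * (t - s)| < δ := by
      have h8 : |e| = 1 := by rcases hr.sign with h | h <;> simp [h]
      rw [abs_mul, h8, one_mul]
      simpa [Real.dist_eq] using ht
    have h9 := hsep _ _ h1 ht'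
    rcases mul_eq_zero.1 h9 with h0 | h0
    · rcases hr.sign with h | h <;> norm_num [h] at h0
    · simpa using sub_eq_zero.1 h0
  refine Finite.of_finite_image (f := ι) ((hfin.image fun t => p (x, t)).subset ?_) hι.injective.injOn
  rintro _ ⟨y, hy, rfl⟩
  obtain ⟨t, ht⟩ := (hp.rel_iff x _).1 hy
  have h1 : p (x, t + (-⌊2 * t⌋ : ℤ) * (1 / 2)) = ι y := by rw [hp.periodic_natMul, ht]
  refine ⟨_, ⟨?_, ⟨y, h1.symm⟩⟩, h1⟩
  have := Int.floor_le (2 * t)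
  have := Int.lt_floor_add_one (2 * t)
  push_cast
  constructor <;> linarith

end Orbits

/-! ### A symmetric change of time. -/

section NormalTime

/-- The time change that moves the first returns at the times `a` and `-b` to the times `1` and
`-1`. -/
def normalTime (a b t : ℝ) : ℝ :=
  t + (1 - a) * Real.smoothTransition (t / a) - (1 - b) * Real.smoothTransition (-t / b)

/-- This symmetry makes the normalized times seen from the two ends of an arc fit together, as used
in `normalTime_return`. -/
theorem smoothTransition_one_sub (x : ℝ) :
    Real.smoothTransition (1 - x) = 1 - Real.smoothTransition x := by
  have h := (Real.smoothTransition.pos_denom x).ne'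
  rw [Real.smoothTransition, Real.smoothTransition, sub_sub_cancel,
    add_comm (expNegInvGlue (1 - x)), eq_sub_iff_add_eq, ← add_div, add_comm, div_self h]

variable {a b t : ℝ}

theorem normalTime_zero : normalTime a b 0 = 0 := by simp [normalTime]

theorem normalTime_neg : normalTime b a (-t) = -normalTime a b t := by
  simp only [normalTime, neg_neg]
  ring

theorem normalTime_of_nonneg (hb : 0 < b) (ht : 0 ≤ t) :
    normalTime a b t = t + (1 - a) * Real.smoothTransition (t / a) := by
  rw [normalTime, Real.smoothTransition.zero_of_nonpos (x := -t / b)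
    (div_nonpos_of_nonpos_of_nonneg (by linarith) hb.le)]
  ring

theorem normalTime_left (ha : 0 < a) (hb : 0 < b) : normalTime a b a = 1 := by
  rw [normalTime_of_nonneg hb ha.le, div_self ha.ne', Real.smoothTransition.one]
  ring

theorem normalTime_right (ha : 0 < a) (hb : 0 < b) : normalTime a b (-b) = -1 := by
  rw [normalTime_neg, normalTime_left hb ha]

/-- For `a, b ≤ 1` both correction terms are nondecreasing, so the derivative is at least `1`. -/
theorem exists_hasDerivAt_normalTime (ha : 0 < a) (ha' : a ≤ 1) (hb : 0 < b) (hb' : b ≤ 1) (t : ℝ) :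
    ∃ d > 0, HasDerivAt (normalTime a b) d t := by
  have hB (s : ℝ) : HasDerivAt Real.smoothTransition (deriv Real.smoothTransition s) s :=
    ((Real.smoothTransition.contDiff (n := 1)).differentiable (by simp) s).hasDerivAt
  have hB0 (s : ℝ) : 0 ≤ deriv Real.smoothTransition s := Real.smoothTransition.monotone.deriv_nonneg
  have h1 := (hB (t / a)).comp t ((hasDerivAt_id t).div_const a)
  have h2 := (hB (-t / b)).comp t ((hasDerivAt_id t).neg.div_const b)
  refine ⟨_, ?_, ((hasDerivAt_id t).add (h1.const_mul (1 - a))).sub (h2.const_mul (1 - b))⟩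
  have e1 : 0 ≤ (1 - a) * (deriv Real.smoothTransition (t / a) * (1 / a)) :=
    mul_nonneg (by linarith) (mul_nonneg (hB0 _) (by positivity))
  have e2 : 0 ≤ (1 - b) * (deriv Real.smoothTransition (-t / b) * (1 / b)) :=
    mul_nonneg (by linarith) (mul_nonneg (hB0 _) (by positivity))
  rw [neg_div b 1, mul_neg, mul_neg, sub_neg_eq_add]
  linarith

theorem strictMono_normalTime (ha : 0 < a) (ha' : a ≤ 1) (hb : 0 < b) (hb' : b ≤ 1) :
    StrictMono (normalTime a b) :=
  strictMono_of_deriv_pos fun t => by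
    obtain ⟨d, hd, h⟩ := exists_hasDerivAt_normalTime ha ha' hb hb' t
    rwa [h.deriv]

theorem surjective_normalTime (ha : 0 < a) (ha' : a ≤ 1) (hb : 0 < b) (hb' : b ≤ 1) :
    Function.Surjective (normalTime a b) := by
  have hc : Continuous (normalTime a b) := continuous_iff_continuousAt.2 fun t => by
    obtain ⟨d, hd, h⟩ := exists_hasDerivAt_normalTime ha ha' hb hb' t
    exact h.continuousAt
  have h1 (t : ℝ) : |normalTime a b t - t| ≤ 1 := by
    have e1 := mul_nonneg (sub_nonneg.2 ha') (Real.smoothTransition.nonneg (t / a))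
    have e2 := mul_nonneg (sub_nonneg.2 hb') (Real.smoothTransition.nonneg (-t / b))
    have e3 := mul_le_of_le_one_right (sub_nonneg.2 ha') (Real.smoothTransition.le_one (t / a))
    have e4 := mul_le_of_le_one_right (sub_nonneg.2 hb') (Real.smoothTransition.le_one (-t / b))
    rw [abs_le, normalTime]
    constructor <;> linarith
  refine hc.surjective ?_ ?_
  · refine tendsto_atTop_mono (f := fun t : ℝ => t + -1) (fun t => ?_)
      (tendsto_atTop_add_const_right _ _ tendsto_id)
    linarith [(abs_le.1 (h1 t)).1]
  · refine tendsto_atBot_mono (g := normalTime a b) (f := fun t : ℝ => t + 1) (fun t => ?_)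
      (tendsto_atBot_add_const_right _ _ tendsto_id)
    linarith [(abs_le.1 (h1 t)).2]

theorem contDiffAt_normalTime (ha : 0 < a) (hb : 0 < b) (t : ℝ) :
    ContDiffAt ℝ ∞ (fun w : ℝ × ℝ × ℝ => normalTime w.1 w.2.1 w.2.2) (a, b, t) := by
  have hB (s : ℝ) : ContDiffAt ℝ ∞ Real.smoothTransition s := Real.smoothTransition.contDiffAt
  have h1 : ContDiffAt ℝ ∞ (fun w : ℝ × ℝ × ℝ => w.1) (a, b, t) := contDiffAt_fst
  have h2 : ContDiffAt ℝ ∞ (fun w : ℝ × ℝ × ℝ => w.2.1) (a, b, t) :=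
    contDiff_fst.contDiffAt.comp _ contDiffAt_snd
  have h3 : ContDiffAt ℝ ∞ (fun w : ℝ × ℝ × ℝ => w.2.2) (a, b, t) :=
    contDiff_snd.contDiffAt.comp _ contDiffAt_snd
  have h4 := (hB _).comp (a, b, t) (h3.div h1 ha.ne')
  have h5 := (hB _).comp (a, b, t) (h3.neg.div h2 hb.ne')
  exact (h3.add ((contDiffAt_const.sub h1).mul h4)).sub ((contDiffAt_const.sub h2).mul h5)

end NormalTime

/-! ### The parametrization with first returns at times `± 1`. -/

section Normalized

variable {M : Type*} [TopologicalSpace M] [ChartedSpace (EuclideanSpace ℝ (Fin 3)) M]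
variable {S : Type*} [TopologicalSpace S] [ChartedSpace (EuclideanSpace ℝ (Fin 2)) S]

/-- A parametrization of the fibers, starting at the points of a horizontal surface, for which the
first returns are at the times `± 1`: on one side of the surface the first return map is `φ`, on
the other side it is `φ'`, and `e = ± 1` tells whether the two sides are in the same component of
the complement. -/
structure IsNormalized (𝓕 : SeifertFibration M) (ι : S → M) (q : S × ℝ → M) (φ φ' : S ≃ₜ S)
    (e : ℝ) : Prop where
  localDiffeo : ∀ z, IsLocalDiffeomorphAt ((𝓡 2).prod 𝓘(ℝ, ℝ)) (𝓡 3) ∞ q z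
  zero : ∀ x, q (x, 0) = ι x
  sign : e = 1 ∨ e = -1
  mem : φ ∈ 𝓕.returnGroup ι
  mem' : φ' ∈ 𝓕.returnGroup ι
  exists_eq : ∀ y, ∃ x, ∃ t ∈ Ioo (-1 : ℝ) 1, q (x, t) = y
  eq_of_pos : ∀ x, ∀ t ∈ Ioo (0 : ℝ) 1, q (φ x, e * (t - 1)) = q (x, t)
  eq_of_neg : ∀ x, ∀ t ∈ Ioo (-1 : ℝ) 0, q (φ' x, e * (t + 1)) = q (x, t)
  exchange : ∀ x x', ∀ t ∈ Ioo (-1 : ℝ) 1, ∀ t' ∈ Ioo (-1 : ℝ) 1, q (x, t) = q (x', t') →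
    (x' = x ∧ t' = t) ∨ (0 < t ∧ x' = φ x ∧ t' = e * (t - 1)) ∨
      (t < 0 ∧ x' = φ' x ∧ t' = e * (t + 1))

namespace IsFirstReturnData

variable {𝓕 : SeifertFibration M} {ι : S → M} {p : S × ℝ → M}
variable {L L' : S → ℝ} {φ φ' : S → S} {ε ε' : S → ℝ}

/-- The arc from `x` to `φ x` has the same length seen from either end. Replacing `t` by `L x - t`
replaces the transition function by one minus itself, so the normalized time becomes `1` minus
itself. -/
theorem normalTime_return (h : IsFirstReturnData ι p L φ ε) (hp : IsFiberClock 𝓕 ι p)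
    (h' : IsFirstReturnData ι (fun z => p (z.1, -z.2)) L' φ' ε')
    (hι : Function.Injective ι) {x : S} {t : ℝ} (ht : t ∈ Ioo 0 (L x)) :
    normalTime (L (φ x)) (L' (φ x)) (ε x * (t - L x)) =
      ε x * (normalTime (L x) (L' x) t - 1) := by
  have hL := h.pos x
  have key : Real.smoothTransition ((L x - t) / L x) = 1 - Real.smoothTransition (t / L x) := by
    rw [← smoothTransition_one_sub, sub_div, div_self hL.ne']
  rw [normalTime_of_nonneg (h'.pos x) ht.1.le]
  rcases (h.isReturn x).sign with he | he
  · obtain ⟨h1, -⟩ := h.inverse hp h' hι he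
    rw [he, one_mul, one_mul, ← neg_sub (L x) t, normalTime_neg,
      normalTime_of_nonneg (h.pos _) (by linarith [ht.2]), h1, key]
    ring
  · obtain ⟨h1, -⟩ := h.involutive hp hι he
    rw [he, neg_one_mul, neg_one_mul, neg_sub,
      normalTime_of_nonneg (h'.pos _) (by linarith [ht.2]), h1, key]
    ring

end IsFirstReturnData

/-- After this change of time the gluings act on the time by isometries, and all points have the
common time window `(-1, 1)`. This later makes the fiber direction neutral. -/
theorem exists_isNormalized [CompactSpace S] [T2Space M] [ConnectedSpace M] [ConnectedSpace S]
    [IsManifold (𝓡 2) ∞ S]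
    {𝓕 : SeifertFibration M} {ι : S → M} {p : S × ℝ → M} (hp : IsFiberClock 𝓕 ι p)
    (hι : IsEmbedding ι) : ∃ q φ φ' e, IsNormalized 𝓕 ι q φ φ' e := by
  obtain ⟨L, φ, ε, h⟩ := hp.exists_isFirstReturnData hι
  obtain ⟨L', φ', ε', h'⟩ := hp.reverse.exists_isFirstReturnData hι
  have hrev := h.reverse_reverse
  obtain ⟨g, hgG, hg⟩ := h.exists_mem_returnGroup hp h' hι
  obtain ⟨g', hgG', hg'⟩ := h'.exists_mem_returnGroup hp.reverse hrev hι
  obtain ⟨x₀⟩ := (inferInstance : Nonempty S)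
  set e := ε x₀ with he
  have hε (x : S) : ε x = e := h.sign_const hp hι x x₀
  have hes : e = 1 ∨ e = -1 := (h.isReturn x₀).sign
  -- Both sides have the same sign: a return on one side that preserves the clock is inverse to one
  -- on the other side that also preserves it.
  have hε' (x : S) : ε' x = e := by
    rcases hes with h1 | h1
    · rw [h'.sign_const hp.reverse hι x (φ x₀), h1]
      exact (h.inverse hp h' hι.injective h1).2.2
    · rw [h1]
      refine (h'.isReturn x).sign.resolve_left fun h2 => ?_
      have := (h'.inverse hp.reverse hrev hι.injective h2).2.2
      rw [hε, h1] at this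
      norm_num at this
  have hL1 (x : S) : L x ≤ 1 := (h.le_half x).trans (by norm_num)
  have hL1' (x : S) : L' x ≤ 1 := (h'.le_half x).trans (by norm_num)
  let N (x : S) : ℝ → ℝ := normalTime (L x) (L' x)
  have hmono (x : S) : StrictMono (N x) := strictMono_normalTime (h.pos x) (hL1 x) (h'.pos x) (hL1' x)
  have hsurj (x : S) : Function.Surjective (N x) :=
    surjective_normalTime (h.pos x) (hL1 x) (h'.pos x) (hL1' x)
  have hN0 (x : S) : N x 0 = 0 := normalTime_zero
  have hN1 (x : S) : N x (L x) = 1 := normalTime_left (h.pos x) (h'.pos x)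
  have hN1' (x : S) : N x (-L' x) = -1 := normalTime_right (h.pos x) (h'.pos x)
  choose σ hσ using hsurj
  let q : S × ℝ → M := fun z => p (z.1, σ z.1 z.2)
  have hq (x : S) (t : ℝ) : q (x, N x t) = p (x, t) := by
    simp only [q]
    rw [(hmono x).injective (hσ x (N x t))]
  have hmem (x : S) (t : ℝ) : N x t ∈ Ioo (-1 : ℝ) 1 ↔ t ∈ Ioo (-L' x) (L x) := by
    rw [mem_Ioo, mem_Ioo, ← hN1' x, ← hN1 x, (hmono x).lt_iff_lt, (hmono x).lt_iff_lt]
  have hpos (x : S) (t : ℝ) : 0 < N x t ↔ 0 < t := by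
    have := (hmono x).lt_iff_lt (a := 0) (b := t)
    rwa [hN0] at this
  have hneg (x : S) (t : ℝ) : N x t < 0 ↔ t < 0 := by
    have := (hmono x).lt_iff_lt (a := t) (b := 0)
    rwa [hN0] at this
  have hret {x : S} {t : ℝ} (ht : t ∈ Ioo 0 (L x)) : N (φ x) (e * (t - L x)) = e * (N x t - 1) := by
    have := h.normalTime_return hp h' hι.injective ht
    rwa [hε] at this
  have hret' {x : S} {t : ℝ} (ht : t ∈ Ioo (-L' x) 0) :
      N (φ' x) (e * (t + L' x)) = e * (N x t + 1) := by
    have := h'.normalTime_return hp.reverse hrev hι.injective (x := x) (t := -t)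
      ⟨by linarith [ht.2], by linarith [ht.1]⟩
    rw [hε', normalTime_neg, show e * (-t - L' x) = -(e * (t + L' x)) by ring, normalTime_neg] at this
    simp only [N]
    linarith
  refine ⟨q, g, g', e, ?_, ?_, hes, hgG, hgG', ?_, ?_, ?_, ?_⟩
  · rintro ⟨x, s⟩
    obtain ⟨t, rfl⟩ : ∃ t, N x t = s := ⟨_, hσ x s⟩
    obtain ⟨d, hd, hd'⟩ := exists_hasDerivAt_normalTime (h.pos x) (hL1 x) (h'.pos x) (hL1' x) t
    have hsm : ContMDiff ((𝓡 2).prod 𝓘(ℝ, ℝ)) 𝓘(ℝ, ℝ) ∞ fun z : S × ℝ => N z.1 z.2 := by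
      rintro ⟨x, t⟩
      have h1 := (contDiffAt_normalTime (h.pos x) (h'.pos x) t).contMDiffAt
      have h2 : ContMDiff ((𝓡 2).prod 𝓘(ℝ, ℝ)) 𝓘(ℝ, ℝ × ℝ × ℝ) ∞
          fun z : S × ℝ => (L z.1, L' z.1, z.2) :=
        ((h.contMDiff hp hι).comp contMDiff_fst).prodMk_space
          (((h'.contMDiff hp.reverse hι).comp contMDiff_fst).prodMk_space contMDiff_snd)
      exact ContMDiffAt.comp (f := fun z : S × ℝ => (L z.1, L' z.1, z.2)) (x, t) h1 h2.contMDiffAt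
    have hB := isLocalDiffeomorphAt_shear isOpen_univ hsm.contMDiffOn (mem_univ (x, t)) hd.ne' hd'
    exact isLocalDiffeomorphAt_of_comp (A := q) (B := fun z : S × ℝ => (z.1, N z.1 z.2)) (x := (x, t))
      hB (hp.localDiffeo (x, t)) (Eventually.of_forall fun z => hq z.1 z.2)
  · intro x
    have := hq x 0
    rwa [hN0, hp.zero] at this
  · intro y
    obtain ⟨x, a, ha, rfl⟩ := h.exists_eq hp h' hι y
    exact ⟨x, N x a, (hmem x a).2 ha, hq x a⟩
  · intro x s hs
    obtain ⟨t, rfl⟩ : ∃ t, N x t = s := ⟨_, hσ x s⟩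
    have ht : t ∈ Ioo 0 (L x) :=
      ⟨(hpos x t).1 hs.1, ((hmem x t).1 ⟨by linarith [hs.1], hs.2⟩).2⟩
    rw [← hret ht, hg, hq, hq, ← hε x, ← (h.isReturn x).apply_eq]
  · intro x s hs
    obtain ⟨t, rfl⟩ : ∃ t, N x t = s := ⟨_, hσ x s⟩
    have ht : t ∈ Ioo (-L' x) 0 :=
      ⟨((hmem x t).1 ⟨hs.1, by linarith [hs.2]⟩).1, (hneg x t).1 hs.2⟩
    rw [← hret' ht, hg', hq, hq]
    have := (h'.isReturn x).apply_eq (-t)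
    simp only [neg_neg] at this
    rw [this, hε']
    congr 2
    ring
  · intro x x' s hs s' hs' heq
    obtain ⟨t, rfl⟩ : ∃ t, N x t = s := ⟨_, hσ x s⟩
    obtain ⟨t', rfl⟩ : ∃ t', N x' t' = s' := ⟨_, hσ x' s'⟩
    rw [hq, hq] at heq
    have ht := (hmem x t).1 hs
    rcases h.exchange hp h' hι.injective ht ((hmem x' t').1 hs') heq with
      ⟨rfl, rfl⟩ | ⟨h0, rfl, rfl⟩ | ⟨h0, rfl, rfl⟩
    · exact .inl ⟨rfl, rfl⟩
    · refine .inr (.inl ⟨(hpos x t).2 h0, (hg x).symm, ?_⟩)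
      rw [hε, hret ⟨h0, ht.2⟩]
    · refine .inr (.inr ⟨(hneg x t).2 h0, (hg' x).symm, ?_⟩)
      rw [hε', hret' ⟨ht.1, h0⟩]

end Normalized

/-! ### Finite covers of a punctured surface by discs. -/

section Cover

universe u

variable {X : Type u} [TopologicalSpace X]

/-- A coordinate disc: an open set that is star-shaped in a chart. -/
def IsDisc (V : Set X) : Prop :=
  ∃ (c : OpenPartialHomeomorph X ℂ) (A : Set ℂ) (a : ℂ), IsOpen A ∧ a ∈ A ∧ StarConvex ℝ a A ∧
    A ⊆ c.target ∧ V = c.symm '' A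

/-- There is a finite subset of `W` such that a clopen subset of `W` that contains it contains
`O`. -/
def HasTest (W O : Set X) : Prop :=
  ∃ T : Set X, T.Finite ∧ T ⊆ W ∧ ∀ A, IsOpen A → IsOpen (W \ A) → T ⊆ A → O ⊆ A

theorem IsDisc.isOpen {V : Set X} (h : IsDisc V) : IsOpen V := by
  obtain ⟨c, A, a, hA, -, -, hAc, rfl⟩ := h
  exact c.isOpen_image_symm_of_subset_target hA hAc

/-- Maps from a disc lift to coverings. -/
theorem IsDisc.exists_lift {V : Set X} (h : IsDisc V) {Y Z : Type*} [TopologicalSpace Y]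
    [TopologicalSpace Z] {π : Z → Y} (hπ : Function.Surjective π) {s : Set Y}
    (cov : IsCoveringMapOn π s) {f : X → Y} (hf : ContinuousOn f V) (hfs : MapsTo f V s) :
    ∃ g : X → Z, ContinuousOn g V ∧ ∀ v ∈ V, π (g v) = f v := by
  obtain ⟨c, A, a, hA, ha, hstar, hAc, rfl⟩ := h
  -- A star-shaped open set is contractible and locally path connected, so the lifting criterion for
  -- coverings applies.
  have := hstar.contractibleSpace ⟨a, ha⟩
  have := hA.locallyPathConnectedSpace
  have hmem (w : A) : c.symm w ∈ c.symm '' A := mem_image_of_mem _ w.2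
  let f' : C(A, Y) := ⟨fun w => f (c.symm w),
    hf.comp_continuous (continuousOn_iff_continuous_domRestrict.1 (c.continuousOn_symm.mono hAc)) hmem⟩
  obtain ⟨z₀, hz₀⟩ := hπ (f' ⟨a, ha⟩)
  obtain ⟨F, ⟨-, hF⟩, -⟩ := cov.existsUnique_continuousMap_lifts f' hz₀ fun w => hfs (hmem w)
  classical
  refine ⟨fun v => if hv : c v ∈ A then F ⟨c v, hv⟩ else z₀, ?_, ?_⟩
  · have hmaps : ∀ v ∈ c.symm '' A, c v ∈ A := by
      rintro _ ⟨w, hw, rfl⟩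
      rwa [c.right_inv (hAc hw)]
    rw [continuousOn_iff_continuous_domRestrict]
    have h1 : Continuous fun v : c.symm '' A => F ⟨c v, hmaps v v.2⟩ := by
      refine F.continuous.comp (Continuous.subtype_mk ?_ _)
      refine continuousOn_iff_continuous_domRestrict.1 (c.continuousOn.mono ?_)
      rintro _ ⟨w, hw, rfl⟩
      exact c.map_target (hAc hw)
    refine h1.congr fun v => ?_
    simp [hmaps v v.2]
  · rintro _ ⟨w, hw, rfl⟩
    have h1 : c (c.symm w) = w := c.right_inv (hAc hw)
    have h2 := congrFun hF ⟨w, hw⟩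
    simp only [h1, hw, dif_pos]
    exact h2

theorem HasTest.mono {W O O' : Set X} (h : HasTest W O) (hO : O' ⊆ O) : HasTest W O' := by
  obtain ⟨T, hT, hTW, h'⟩ := h
  exact ⟨T, hT, hTW, fun A h1 h2 h3 => hO.trans (h' A h1 h2 h3)⟩

theorem hasTest_of_isPreconnected {W : Set X} (hW : IsPreconnected W) : HasTest W W := by
  rcases W.eq_empty_or_nonempty with rfl | ⟨x, hx⟩
  · exact ⟨∅, finite_empty, subset_rfl, fun _ _ _ _ => empty_subset _⟩
  · refine ⟨{x}, finite_singleton x, singleton_subset_iff.2 hx, fun A h1 h2 h3 => ?_⟩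
    refine hW.subset_left_of_subset_union h1 h2 disjoint_sdiff_right (fun y hy => ?_)
      ⟨x, hx, h3 rfl⟩
    by_cases h : y ∈ A
    · exact .inl h
    · exact .inr ⟨hy, h⟩

theorem HasTest.union {W W' O O' : Set X} (hW : IsOpen W) (hW' : IsOpen W') (h : HasTest W O)
    (h' : HasTest W' O') : HasTest (W ∪ W') (O ∪ O') := by
  obtain ⟨T, hT, hTW, h⟩ := h
  obtain ⟨T', hT', hTW', h'⟩ := h'
  refine ⟨T ∪ T', hT.union hT', union_subset_union hTW hTW', fun A h1 h2 h3 => union_subset ?_ ?_⟩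
  · refine h A h1 ?_ (subset_union_left.trans h3)
    rw [show W \ A = W ∩ ((W ∪ W') \ A) by ext; simp; tauto]
    exact hW.inter h2
  · refine h' A h1 ?_ (subset_union_right.trans h3)
    rw [show W' \ A = W' ∩ ((W ∪ W') \ A) by ext; simp; tauto]
    exact hW'.inter h2

/-- Components of an open subset of a locally connected space are open, so finitely many components
of `W` cover `K`. One test point in each of them suffices. -/
theorem hasTest_of_isCompact [LocallyConnectedSpace X] {W K : Set X} (hK : IsCompact K)
    (hW : IsOpen W) (hKW : K ⊆ W) : HasTest W K := by
  have h (x : X) (hx : x ∈ K) : ∃ C, IsOpen C ∧ x ∈ C ∧ IsPreconnected C ∧ C ⊆ W := by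
    refine ⟨connectedComponentIn W x, hW.connectedComponentIn, mem_connectedComponentIn (hKW hx),
      isPreconnected_connectedComponentIn, connectedComponentIn_subset W x⟩
  choose! C hCo hC hCp hCW using h
  obtain ⟨t, htK, ht⟩ := hK.elim_nhds_subcover C fun x hx => (hCo x hx).mem_nhds (hC x hx)
  refine ⟨t, t.finite_toSet, fun x hx => hKW (htK x hx), fun A h1 h2 h3 x hx => ?_⟩
  obtain ⟨y, hy, hxy⟩ := mem_iUnion₂.1 (ht hx)
  refine (hCp y (htK y hy)).subset_left_of_subset_union h1 h2 disjoint_sdiff_right (fun z hz => ?_)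
    ⟨y, hC y (htK y hy), h3 hy⟩ hxy
  by_cases h : z ∈ A
  · exact .inl h
  · exact .inr ⟨hCW y (htK y hy) hz, h⟩

theorem starConvex_ball_inter_slitPlane {r : ℝ} (hr : 0 < r) :
    StarConvex ℝ ((r / 2 : ℝ) : ℂ) (Metric.ball 0 r ∩ Complex.slitPlane) := by
  refine StarConvex.inter ?_ (Complex.starConvex_ofReal_slitPlane (by positivity))
  refine (convex_ball (0 : ℂ) r).starConvex ?_
  simp [abs_of_pos hr, hr]

theorem exists_centered_chart {sing : Set X} [T1Space X] (hs : sing.Finite) {x : X}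
    (hch : ∃ c : OpenPartialHomeomorph X ℂ, x ∈ c.source) :
    ∃ (c : OpenPartialHomeomorph X ℂ) (r : ℝ), 0 < r ∧ x ∈ c.source ∧ c x = 0 ∧
      Metric.ball 0 r ⊆ c.target ∧ ∀ z ∈ Metric.ball 0 r, c.symm z ∈ sing → z = 0 := by
  obtain ⟨c₀, hx⟩ := hch
  let c := c₀.transHomeomorph (Homeomorph.addRight (-c₀ x))
  have hx' : x ∈ c.source := hx
  have hc0 : c x = 0 := by simp [c]
  have h0 : (0 : ℂ) ∈ c.target := hc0 ▸ c.map_source hx'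
  have hsymm0 : c.symm 0 = x := by rw [← hc0, c.left_inv hx']
  have h1 : c.symm ⁻¹' (sing \ {x})ᶜ ∈ 𝓝 (0 : ℂ) := by
    refine (c.continuousAt_symm h0).preimage_mem_nhds ?_
    refine (hs.subset sdiff_subset).isClosed.isOpen_compl.mem_nhds ?_
    rw [hsymm0]
    simp
  obtain ⟨r, hr, hrs⟩ := Metric.mem_nhds_iff.1 (inter_mem (c.open_target.mem_nhds h0) h1)
  refine ⟨c, r, hr, hx', hc0, fun z hz => (hrs hz).1, fun z hz hzs => ?_⟩
  have h2 := (hrs hz).2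
  have h3 : c.symm z = x := by
    by_contra hne
    exact h2 ⟨hzs, hne⟩
  rw [← c.right_inv (hrs hz).1, h3, hc0]

/-- A punctured disc is not simply connected, so at a puncture two oppositely slit discs are used.
Their intersection has two components, hence is still tested by two points. The sets `K` keep the
smaller sets `O` under control, touching the complement of `V` at most at the puncture. -/
theorem exists_local_cover [LocallyConnectedSpace X] [T1Space X] {sing : Set X} (hs : sing.Finite)
    {x : X} (hch : ∃ c : OpenPartialHomeomorph X ℂ, x ∈ c.source) :
    ∃ N ∈ 𝓝 x, ∃ V O K : Bool → Set X, (∀ b, IsDisc (V b)) ∧ (∀ b, Disjoint (V b) sing) ∧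
      (∀ b, IsOpen (O b)) ∧ (∀ b, O b ⊆ V b) ∧ (∀ b, O b ⊆ K b) ∧ (∀ b, IsCompact (K b)) ∧
      (∀ b, K b ⊆ V b ∪ ({x} ∩ sing)) ∧ N \ sing ⊆ ⋃ b, O b ∧
      ∀ b b', HasTest (V b ∩ V b') (O b ∩ O b') := by
  obtain ⟨c, r, hr, hx, hc0, hball, hsing⟩ := exists_centered_chart hs hch
  have h0 : (0 : ℂ) ∈ c.target := hc0 ▸ c.map_source hx
  have hsymm0 : c.symm 0 = x := by rw [← hc0, c.left_inv hx]
  have hcb : Metric.closedBall (0 : ℂ) (r / 2) ⊆ Metric.ball 0 r :=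
    Metric.closedBall_subset_ball (by linarith)
  have hb2 : Metric.ball (0 : ℂ) (r / 2) ⊆ Metric.ball 0 r := Metric.ball_subset_ball (by linarith)
  have hN : c.symm '' Metric.ball 0 (r / 2) ∈ 𝓝 x := by
    refine (c.isOpen_image_symm_of_subset_target Metric.isOpen_ball (hb2.trans hball)).mem_nhds ?_
    exact ⟨0, by simpa using hr, hsymm0⟩
  have hcomp {K : Set ℂ} (hK : IsClosed K) (hK' : K ⊆ Metric.closedBall 0 (r / 2)) :
      IsCompact (c.symm '' K) :=
    ((isCompact_closedBall _ _).of_isClosed_subset hK hK').image_of_continuousOn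
      (c.continuousOn_symm.mono (hK'.trans (hcb.trans hball)))
  by_cases hxs : x ∈ sing
  · let Sl : Bool → Set ℂ := fun b => cond b Complex.slitPlane (Neg.neg ⁻¹' Complex.slitPlane)
    let A : Bool → Set ℂ := fun b => Metric.ball 0 r ∩ Sl b
    -- The condition `f b z > 0` cuts out an open sector of angle `3π / 2` around one real
    -- half-axis. The two sectors cover the punctured disc, and the closed sectors minus the origin
    -- stay inside the slit planes.
    let f : Bool → ℂ → ℝ := fun b z => |z.im| + cond b z.re (-z.re)
    have hfc (b : Bool) : Continuous (f b) := by
      cases b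
      · exact (continuous_abs.comp Complex.continuous_im).add Complex.continuous_re.neg
      · exact (continuous_abs.comp Complex.continuous_im).add Complex.continuous_re
    have hSlo (b : Bool) : IsOpen (Sl b) := by
      cases b
      · exact Complex.isOpen_slitPlane.preimage continuous_neg
      · exact Complex.isOpen_slitPlane
    have hAo (b : Bool) : IsOpen (A b) := Metric.isOpen_ball.inter (hSlo b)
    have hAc (b : Bool) : A b ⊆ c.target := inter_subset_left.trans hball
    have hSl0 {b : Bool} {z : ℂ} (hz : z ∈ Sl b) : z ≠ 0 := by
      rintro rfl
      cases b <;> simp [Sl, Complex.mem_slitPlane_iff] at hz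
    have hfSl {b : Bool} {z : ℂ} (hz : 0 ≤ f b z) (hz0 : z ≠ 0) : z ∈ Sl b := by
      have h1 : z.re ≠ 0 ∨ z.im ≠ 0 := by
        by_contra! h
        exact hz0 (Complex.ext h.1 h.2)
      by_cases him : z.im = 0
      · have hre : z.re ≠ 0 := h1.resolve_right (by simpa using him)
        cases b
        · simp only [f, him, abs_zero, zero_add, cond_false] at hz
          have : 0 < -z.re := lt_of_le_of_ne hz (by simpa [eq_comm] using hre)
          exact .inl (by simpa using this)
        · simp only [f, him, abs_zero, zero_add, cond_true] at hz
          simp [Sl, Complex.mem_slitPlane_iff, lt_of_le_of_ne hz hre.symm]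
      · cases b <;> simp [Sl, Complex.mem_slitPlane_iff, him]
    have hf0 {b : Bool} {z : ℂ} (hz : 0 < f b z) : z ≠ 0 := by
      rintro rfl
      cases b <;> simp [f] at hz
    have hdisc (b : Bool) : ∃ a ∈ A b, StarConvex ℝ a (A b) := by
      have h1 := starConvex_ball_inter_slitPlane hr
      have h2 : ((r / 2 : ℝ) : ℂ) ∈ Metric.ball 0 r ∩ Complex.slitPlane := by
        refine ⟨by simp [abs_of_pos hr, hr], ?_⟩
        simp [Complex.mem_slitPlane_iff, hr]
      cases b
      · have h3 : A false = -(Metric.ball 0 r ∩ Complex.slitPlane) := by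
          ext z
          simp [A, Sl]
        rw [h3]
        exact ⟨_, by simpa using h2, h1.neg⟩
      · exact ⟨_, h2, h1⟩
    refine ⟨_, hN, fun b => c.symm '' A b,
      fun b => c.symm '' (Metric.ball 0 (r / 2) ∩ {z | 0 < f b z}),
      fun b => c.symm '' (Metric.closedBall 0 (r / 2) ∩ {z | 0 ≤ f b z}), fun b => ?_, fun b => ?_,
      fun b => ?_, fun b => ?_, fun b => ?_, fun b => ?_, fun b => ?_, ?_, fun b b' => ?_⟩
    · obtain ⟨a, ha, hst⟩ := hdisc b
      exact ⟨c, A b, a, hAo b, ha, hst, hAc b, rfl⟩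
    · rw [Set.disjoint_left]
      rintro _ ⟨z, hz, rfl⟩ hmem
      exact hSl0 hz.2 (hsing z hz.1 hmem)
    · exact c.isOpen_image_symm_of_subset_target
        (Metric.isOpen_ball.inter (isOpen_lt continuous_const (hfc b)))
        (inter_subset_left.trans (hb2.trans hball))
    · exact image_mono fun z hz => ⟨hb2 hz.1, hfSl (le_of_lt hz.2) (hf0 hz.2)⟩
    · exact image_mono fun z hz => ⟨Metric.ball_subset_closedBall hz.1, (show 0 < f b z from hz.2).le⟩
    · exact hcomp (Metric.isClosed_closedBall.inter (isClosed_le continuous_const (hfc b)))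
        inter_subset_left
    · rintro _ ⟨z, hz, rfl⟩
      by_cases hz0 : z = 0
      · right
        rw [hz0, hsymm0]
        exact ⟨rfl, hxs⟩
      · exact .inl ⟨z, ⟨hcb hz.1, hfSl hz.2 hz0⟩, rfl⟩
    · rintro _ ⟨⟨z, hz, rfl⟩, hzs⟩
      have hz0 : z ≠ 0 := by
        rintro rfl
        rw [hsymm0] at hzs
        exact hzs hxs
      have h1 : 0 < f true z ∨ 0 < f false z := by
        by_contra! h
        simp only [f, cond_true, cond_false] at h
        have := abs_nonneg z.im
        have hre : z.re = 0 := by linarith [h.1, h.2]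
        have him : |z.im| = 0 := by linarith [h.1, h.2]
        exact hz0 (Complex.ext hre (abs_eq_zero.1 him))
      rw [mem_iUnion]
      rcases h1 with h1 | h1
      · exact ⟨true, z, ⟨hz, h1⟩, rfl⟩
      · exact ⟨false, z, ⟨hz, h1⟩, rfl⟩
    · refine HasTest.mono (O := c.symm '' A b ∩ c.symm '' A b') ?_ (inter_subset_inter
        (image_mono fun z hz => ⟨hb2 hz.1, hfSl (le_of_lt hz.2) (hf0 hz.2)⟩)
        (image_mono fun z hz => ⟨hb2 hz.1, hfSl (le_of_lt hz.2) (hf0 hz.2)⟩))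
      have hpre {B : Set ℂ} (hB : IsPreconnected B) (hB' : B ⊆ c.target) :
          HasTest (c.symm '' B) (c.symm '' B) :=
        hasTest_of_isPreconnected (hB.image _ (c.continuousOn_symm.mono hB'))
      have hsame (b : Bool) : HasTest (c.symm '' A b) (c.symm '' A b) := by
        obtain ⟨a, ha, hst⟩ := hdisc b
        exact hpre (hst.isPathConnected ha).isConnected.isPreconnected (hAc b)
      have hdiff : HasTest (c.symm '' (A true ∩ A false)) (c.symm '' (A true ∩ A false)) := by
        have h1 : A true ∩ A false = (Metric.ball 0 r ∩ {z | 0 < z.im}) ∪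
            (Metric.ball 0 r ∩ {z | z.im < 0}) := by
          ext z
          simp only [A, Sl, mem_inter_iff, mem_union, mem_preimage, Complex.mem_slitPlane_iff,
            cond_true, cond_false, Complex.neg_re, Complex.neg_im, mem_ofPred_eq]
          constructor
          · rintro ⟨⟨h1, h2⟩, -, h3⟩
            rcases lt_trichotomy z.im 0 with h | h | h
            · exact .inr ⟨h1, h⟩
            · simp only [h, neg_zero, ne_eq, not_true_eq_false, or_false] at h2 h3
              linarith
            · exact .inl ⟨h1, h⟩
          · rintro (⟨h1, h2⟩ | ⟨h1, h2⟩)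
            · exact ⟨⟨h1, .inr h2.ne'⟩, h1, .inr (by linarith : -z.im < 0).ne⟩
            · exact ⟨⟨h1, .inr h2.ne⟩, h1, .inr (by linarith : 0 < -z.im).ne'⟩
        have hup : IsOpen (Metric.ball (0 : ℂ) r ∩ {z | 0 < z.im}) :=
          Metric.isOpen_ball.inter (isOpen_lt continuous_const Complex.continuous_im)
        have hlo : IsOpen (Metric.ball (0 : ℂ) r ∩ {z | z.im < 0}) :=
          Metric.isOpen_ball.inter (isOpen_lt Complex.continuous_im continuous_const)
        rw [h1, image_union]
        refine HasTest.union
          (c.isOpen_image_symm_of_subset_target hup (inter_subset_left.trans hball))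
          (c.isOpen_image_symm_of_subset_target hlo (inter_subset_left.trans hball))
          (hpre ?_ (inter_subset_left.trans hball)) (hpre ?_ (inter_subset_left.trans hball))
        · exact ((convex_ball 0 r).inter (convex_halfSpace_im_gt 0)).isPreconnected
        · exact ((convex_ball 0 r).inter (convex_halfSpace_im_lt 0)).isPreconnected
      have hinj : InjOn c.symm (A true ∪ A false) :=
        c.symm.injOn.mono (union_subset (hAc true) (hAc false))
      have hint : c.symm '' A true ∩ c.symm '' A false = c.symm '' (A true ∩ A false) :=
        (hinj.image_inter subset_union_left subset_union_right).symm
      rcases b with _ | _ <;> rcases b' with _ | _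
      · rw [inter_self]; exact hsame _
      · rw [inter_comm, hint]; exact hdiff
      · rw [hint]; exact hdiff
      · rw [inter_self]; exact hsame _
  · have hVo : IsOpen (c.symm '' Metric.ball 0 r) :=
      c.isOpen_image_symm_of_subset_target Metric.isOpen_ball hball
    have hns {z : ℂ} (hz : z ∈ Metric.ball 0 r) : c.symm z ∉ sing := fun h => by
      have h1 := hsing z hz h
      rw [h1, hsymm0] at h
      exact hxs h
    refine ⟨_, hN, fun _ => c.symm '' Metric.ball 0 r, fun _ => c.symm '' Metric.ball 0 (r / 2),
      fun _ => c.symm '' Metric.closedBall 0 (r / 2), fun _ => ?_, fun _ => ?_, fun _ => ?_,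
      fun _ => image_mono hb2, fun _ => image_mono Metric.ball_subset_closedBall,
      fun _ => hcomp Metric.isClosed_closedBall subset_rfl,
      fun _ => subset_union_of_subset_left (image_mono hcb) _, ?_, fun _ _ => ?_⟩
    · exact ⟨c, _, 0, Metric.isOpen_ball, by simpa using hr,
        (convex_ball (0 : ℂ) r).starConvex (by simpa using hr), hball, rfl⟩
    · rw [Set.disjoint_left]
      rintro _ ⟨z, hz, rfl⟩
      exact hns hz
    · exact c.isOpen_image_symm_of_subset_target Metric.isOpen_ball (hb2.trans hball)
    · exact fun y hy => mem_iUnion.2 ⟨true, hy.1⟩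
    · simp only [inter_self]
      exact (hasTest_of_isCompact (hcomp Metric.isClosed_closedBall subset_rfl) hVo
        (image_mono hcb)).mono (image_mono Metric.ball_subset_closedBall)

/-- A punctured closed surface has a finite cover by discs such that locally constant functions on
their intersections are determined by finitely many values. -/
theorem exists_finite_cover [CompactSpace X] [T2Space X] [LocallyConnectedSpace X] {sing : Set X}
    (hs : sing.Finite) (hch : ∀ x, ∃ c : OpenPartialHomeomorph X ℂ, x ∈ c.source) :
    ∃ (I : Type u) (_ : Finite I) (V O : I → Set X), (∀ i, IsDisc (V i)) ∧
      (∀ i, Disjoint (V i) sing) ∧ (∀ i, IsOpen (O i)) ∧ (∀ i, O i ⊆ V i) ∧ singᶜ ⊆ ⋃ i, O i ∧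
      ∀ i j, HasTest (V i ∩ V j) (O i ∩ O j) := by
  choose N hN V O K h1 h2 h3 h4 h5 h6 h7 h8 h9 using fun x => exists_local_cover hs (hch x)
  obtain ⟨t, ht⟩ := CompactSpace.elim_nhds_subcover N hN
  refine ⟨t × Bool, inferInstance, fun i => V i.1 i.2, fun i => O i.1 i.2, fun i => h1 _ _,
    fun i => h2 _ _, fun i => h3 _ _, fun i => h4 _ _, fun y hy => ?_, ?_⟩
  · have h10 : y ∈ ⋃ x ∈ t, N x := by rw [ht]; trivial
    obtain ⟨x, hx, hxy⟩ := mem_iUnion₂.1 h10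
    obtain ⟨b, hb⟩ := mem_iUnion.1 (h8 x ⟨hxy, hy⟩)
    exact mem_iUnion.2 ⟨(⟨x, hx⟩, b), hb⟩
  · rintro ⟨⟨x, hx⟩, b⟩ ⟨⟨x', hx'⟩, b'⟩
    by_cases hxx : x = x'
    · subst hxx
      exact h9 x b b'
    -- For different centres, `K ∩ K'` lies in `V ∩ V'`: the only point of `K` that can fail to be
    -- in `V` is the puncture `x`, which is neither in `V'` nor equal to `x'`.
    · refine (hasTest_of_isCompact ((h6 x b).inter (h6 x' b'))
        ((h1 x b).isOpen.inter (h1 x' b').isOpen) ?_).mono (inter_subset_inter (h5 x b) (h5 x' b'))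
      rintro y ⟨hy, hy'⟩
      rcases h7 x b hy with h | ⟨rfl, hs⟩
      · refine ⟨h, (h7 x' b' hy').resolve_right ?_⟩
        rintro ⟨-, hs'⟩
        exact Set.disjoint_left.1 (h2 x b) h hs'
      · rcases h7 x' b' hy' with h | ⟨rfl, -⟩
        · exact absurd hs (Set.disjoint_left.1 (h2 x' b') h)
        · exact absurd rfl hxx

end Cover

/-! ### Lifting a power of a map to the punctured cover. -/

section Lift

universe u v

variable {S : Type v} [TopologicalSpace S] {X : Type u} [TopologicalSpace X]

/-- `π : S → X` is the quotient by the group `G`, which acts freely off the preimage of `sing`. -/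
structure IsBranchedQuotient (π : S → X) (G : Subgroup (S ≃ₜ S)) (sing : Set X) : Prop where
  continuous : Continuous π
  surjective : Function.Surjective π
  rel_iff : ∀ x y, π x = π y ↔ ∃ g ∈ G, g x = y
  covering : IsCoveringMapOn π singᶜ
  free : ∀ g ∈ G, ∀ x, π x ∉ sing → g x = x → g = 1

namespace IsBranchedQuotient

variable {π : S → X} {G : Subgroup (S ≃ₜ S)} {sing : Set X}

theorem map_eq (hπ : IsBranchedQuotient π G sing) {g : S ≃ₜ S} (hg : g ∈ G) (x : S) :
    π (g x) = π x := ((hπ.rel_iff _ _).2 ⟨g, hg, rfl⟩).symm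

theorem eq_of_apply_eq (hπ : IsBranchedQuotient π G sing) {g g' : S ≃ₜ S} (hg : g ∈ G)
    (hg' : g' ∈ G) {x : S} (hx : π x ∉ sing) (h : g x = g' x) : g = g' := by
  have h1 := hπ.free (g'⁻¹ * g) (G.mul_mem (G.inv_mem hg') hg) x hx (by
    change g'.symm (g x) = x
    rw [h, g'.symm_apply_apply])
  exact (inv_mul_eq_one.1 h1).symm

theorem exists_injOn (hπ : IsBranchedQuotient π G sing) {x : S} (hx : π x ∉ sing) :
    ∃ U ∈ 𝓝 x, InjOn π U := by
  obtain ⟨e, he, hπe⟩ := hπ.covering.isLocalHomeomorphOn x hx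
  refine ⟨e.source, e.open_source.mem_nhds he, ?_⟩
  rw [hπe]
  exact e.injOn

theorem eventuallyEq (hπ : IsBranchedQuotient π G sing) {Y : Type*} {l : Filter Y} {f g : Y → S}
    {x : S} (hx : π x ∉ sing) (hf : Tendsto f l (𝓝 x)) (hg : Tendsto g l (𝓝 x))
    (h : ∀ᶠ y in l, π (f y) = π (g y)) : f =ᶠ[l] g := by
  obtain ⟨U, hU, hinj⟩ := hπ.exists_injOn hx
  filter_upwards [hf hU, hg hU, h] with y h1 h2 h3
  exact hinj h1 h2 h3

/-- Off the branch set `π` is locally injective, so an equality `s' = g ∘ s` at one point spreads to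
a neighbourhood. Transition elements are thus locally constant. -/
theorem isOpen_transition (hπ : IsBranchedQuotient π G sing) {Y : Type*} [TopologicalSpace Y]
    {W : Set Y} (hW : IsOpen W) {f : Y → X} (hf : ∀ v ∈ W, f v ∉ sing) {s s' : Y → S}
    (hs : ContinuousOn s W)
    (hs' : ContinuousOn s' W) (hsf : ∀ v ∈ W, π (s v) = f v) (hsf' : ∀ v ∈ W, π (s' v) = f v)
    {g : S ≃ₜ S} (hg : g ∈ G) : IsOpen {v | v ∈ W ∧ s' v = g (s v)} := by
  rw [isOpen_iff_mem_nhds]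
  rintro v ⟨hv, hvg⟩
  have hWv := hW.mem_nhds hv
  have h1 : s' =ᶠ[𝓝 v] fun w => g (s w) := by
    refine hπ.eventuallyEq (x := s' v) (by rw [hsf' v hv]; exact hf v hv)
      (hs'.continuousAt hWv) ?_ ?_
    · rw [hvg]
      exact g.continuous.continuousAt.comp (hs.continuousAt hWv)
    · filter_upwards [hWv] with w hw
      rw [hπ.map_eq hg, hsf w hw, hsf' w hw]
  filter_upwards [hWv, h1] with w hw h2
  exact ⟨hw, h2⟩

/-- Two families of local sections with the same transition functions define a map of the covering
surface. -/
theorem exists_transfer (hπ : IsBranchedQuotient π G sing) {I : Type*} {O : I → Set X}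
    (hOo : ∀ i, IsOpen (O i)) (hcov : singᶜ ⊆ ⋃ i, O i) {Ψ : X ≃ₜ X}
    (hΨ : ∀ x, Ψ x ∈ sing ↔ x ∈ sing)
    {s s' : I → X → S} (hs : ∀ i, ContinuousOn (s i) (O i)) (hs' : ∀ i, ContinuousOn (s' i) (O i))
    (hsΨ : ∀ i, ∀ v ∈ O i, π (s i v) = Ψ v)
    (hO : ∀ i, Disjoint (O i) sing)
    (hmatch : ∀ i j, ∀ v ∈ O i ∩ O j, ∃ g ∈ G, s j v = g (s i v) ∧ s' j v = g (s' i v)) :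
    ∃ h : S → S, ContinuousOn h (π ⁻¹' singᶜ) ∧
      ∀ i, ∀ v ∈ O i, ∀ g ∈ G, h (g (s i v)) = g (s' i v) := by
  classical
  rcases isEmpty_or_nonempty I with hI | hI
  · exact ⟨id, continuousOn_id, fun i => isEmptyElim i⟩
  have hrep (y : S) (hy : π y ∉ sing) : ∃ i, Ψ.symm (π y) ∈ O i ∧ ∃ g ∈ G,
      g (s i (Ψ.symm (π y))) = y := by
    have h1 : Ψ.symm (π y) ∈ singᶜ := by
      rw [mem_compl_iff, ← hΨ, Ψ.apply_symm_apply]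
      exact hy
    obtain ⟨i, hi⟩ := mem_iUnion.1 (hcov h1)
    refine ⟨i, hi, (hπ.rel_iff _ _).1 ?_⟩
    rw [hsΨ i _ hi, Ψ.apply_symm_apply]
  choose! i hi g hg hgy using hrep
  -- Write `y` as `g (s i v)` and send it to `g (s' i v)`. Freeness of `G` makes the transition
  -- elements unique, and since those of `s` and `s'` agree, the choice of `i` does not matter.
  let h : S → S := fun y => g y (s' (i y) (Ψ.symm (π y)))
  have hval : ∀ j, ∀ v ∈ O j, ∀ k ∈ G, h (k (s j v)) = k (s' j v) := by
    intro j v hv k hk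
    have hvs : v ∉ sing := Set.disjoint_left.1 (hO j) hv
    have hπk : π (k (s j v)) = Ψ v := by rw [hπ.map_eq hk, hsΨ j v hv]
    have hy : π (k (s j v)) ∉ sing := by rwa [hπk, hΨ]
    have hsy : Ψ.symm (π (k (s j v))) = v := by rw [hπk, Ψ.symm_apply_apply]
    set y := k (s j v) with hydef
    have h1 := hi y hy
    have h2 := hgy y hy
    rw [hsy] at h1 h2
    obtain ⟨m, hm, hm1, hm2⟩ := hmatch (i y) j v ⟨h1, hv⟩
    have h3 : g y = k * m := by
      refine hπ.eq_of_apply_eq (hg y hy) (G.mul_mem hk hm) (x := s (i y) v) ?_ ?_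
      · rwa [hsΨ _ v h1, hΨ]
      · exact h2.trans (hydef.trans (congrArg k hm1))
    simp only [h]
    rw [hsy, h3, hm2]
    rfl
  refine ⟨h, ?_, hval⟩
  refine continuousOn_of_forall_continuousAt fun y hy => ?_
  have h1 := hi y hy
  have hOy := (hOo (i y)).mem_nhds h1
  have hcv : ContinuousAt (fun z => Ψ.symm (π z)) y :=
    (Ψ.symm.continuous.comp hπ.continuous).continuousAt
  have hev := hcv.eventually_mem hOy
  have hsc : ContinuousAt (fun z => g y (s (i y) (Ψ.symm (π z)))) y :=
    (g y).continuous.continuousAt.comp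
      (((hs (i y)).continuousAt hOy).comp (f := fun z => Ψ.symm (π z)) hcv)
  have hsc' : ContinuousAt (fun z => g y (s' (i y) (Ψ.symm (π z)))) y :=
    (g y).continuous.continuousAt.comp
      (((hs' (i y)).continuousAt hOy).comp (f := fun z => Ψ.symm (π z)) hcv)
  have h2 : (fun z => g y (s (i y) (Ψ.symm (π z)))) =ᶠ[𝓝 y] id := by
    refine hπ.eventuallyEq hy ?_ tendsto_id ?_
    · have := hsc.tendsto
      simp only [hgy y hy] at this
      exact this
    · filter_upwards [hev] with z hz
      rw [hπ.map_eq (hg y hy), hsΨ _ _ hz, Ψ.apply_symm_apply]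
      rfl
  refine hsc'.congr ?_
  filter_upwards [h2, hev] with z hz hz'
  have := hval (i y) _ hz' (g y) (hg y hy)
  rw [hz] at this
  exact this.symm

/-- Some power of a homeomorphism of the quotient lifts to the punctured covering surface. -/
theorem exists_lift_pow [CompactSpace X] [T2Space X] [LocallyConnectedSpace X] [Finite G]
    (hπ : IsBranchedQuotient π G sing) (hsing : sing.Finite)
    (hch : ∀ x : X, ∃ c : OpenPartialHomeomorph X ℂ, x ∈ c.source) {ψ : X ≃ₜ X}
    (hψ : ∀ x, ψ x ∈ sing ↔ x ∈ sing) :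
    ∃ n : ℕ, 0 < n ∧ ∃ h h' : S → S, ContinuousOn h (π ⁻¹' singᶜ) ∧ ContinuousOn h' (π ⁻¹' singᶜ) ∧
      (∀ y, π y ∉ sing → π (h y) = (ψ ^ n) (π y)) ∧
      (∀ y, π y ∉ sing → π (h' y) = (ψ ^ n).symm (π y)) ∧
      (∀ y, π y ∉ sing → h' (h y) = y) ∧ (∀ y, π y ∉ sing → h (h' y) = y) ∧
      ∀ g ∈ G, ∀ y, π y ∉ sing → h (g y) = g (h y) := by
  obtain ⟨I, _, V, O, hVd, hVs, hOo, hOV, hcov, htest⟩ := exists_finite_cover hsing hch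
  have hψn (n : ℕ) : ∀ x, (ψ ^ n) x ∈ sing ↔ x ∈ sing := by
    induction n with
    | zero => exact fun x => Iff.rfl
    | succ n ih =>
      intro x
      rw [pow_succ]
      exact (ih (ψ x)).trans (hψ x)
  have hVs' {i : I} {v : X} (hv : v ∈ V i) : v ∉ sing := Set.disjoint_left.1 (hVs i) hv
  have hsec (n : ℕ) (i : I) : ∃ s : X → S, ContinuousOn s (V i) ∧ ∀ v ∈ V i, π (s v) = (ψ ^ n) v :=
    (hVd i).exists_lift hπ.surjective hπ.covering (ψ ^ n).continuous.continuousOn fun v hv => by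
      rw [mem_compl_iff, hψn]
      exact hVs' hv
  choose s hsc hsπ using hsec
  choose T hTf hTW hT using htest
  have htr (n : ℕ) (i j : I) (v : X) (hv : v ∈ V i ∩ V j) : ∃ g ∈ G, s n j v = g (s n i v) := by
    obtain ⟨g, hg, hgv⟩ := (hπ.rel_iff (s n i v) (s n j v)).1 (by
      rw [hsπ n i v hv.1, hsπ n j v hv.2])
    exact ⟨g, hg, hgv.symm⟩
  choose! γ hγG hγ using htr
  -- The record of the `n`-th power: the transition elements at the test points. It ranges over a
  -- finite set, so two exponents have the same record.
  let P (n : ℕ) : (i j : I) → T i j → G := fun i j t =>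
    ⟨γ n i j t, hγG n i j t (hTW i j t.2)⟩
  have (i j : I) : Finite (T i j) := hTf i j
  obtain ⟨n, m, hne, hP⟩ := Finite.exists_ne_map_eq_of_infinite P
  have key (n m : ℕ) (hP : P n = P m) (i j : I) (v : X) (hv : v ∈ O i ∩ O j) :
      ∃ g ∈ G, s n j v = g (s n i v) ∧ s m j v = g (s m i v) := by
    have hWo : IsOpen (V i ∩ V j) := (hVd i).isOpen.inter (hVd j).isOpen
    have hD (n : ℕ) {g : S ≃ₜ S} (hg : g ∈ G) :
        IsOpen {v | v ∈ V i ∩ V j ∧ s n j v = g (s n i v)} :=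
      hπ.isOpen_transition hWo (f := ⇑(ψ ^ n)) (fun v hv => by rw [hψn]; exact hVs' hv.1)
        ((hsc n i).mono inter_subset_left) ((hsc n j).mono inter_subset_right)
        (fun v hv => hsπ n i v hv.1) (fun v hv => hsπ n j v hv.2) hg
    -- The set where the transition elements of the two powers agree. It is open, and so is its
    -- complement in `V i ∩ V j`; as it contains the test points, it contains `O i ∩ O j`.
    let A : Set X := ⋃ g ∈ G, {v | v ∈ V i ∩ V j ∧ s n j v = g (s n i v)} ∩
      {v | v ∈ V i ∩ V j ∧ s m j v = g (s m i v)}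
    have hA : IsOpen A := isOpen_biUnion fun g hg => (hD n hg).inter (hD m hg)
    have hA' : (V i ∩ V j) \ A = ⋃ g ∈ G, ⋃ g' ∈ {g' | g' ∈ G ∧ g ≠ g'},
        {v | v ∈ V i ∩ V j ∧ s n j v = g (s n i v)} ∩
        {v | v ∈ V i ∩ V j ∧ s m j v = g' (s m i v)} := by
      ext v
      simp only [A, Set.mem_sdiff, mem_iUnion, exists_prop, mem_inter_iff, mem_ofPred_eq, not_exists,
        not_and]
      constructor
      · rintro ⟨hv, hno⟩
        refine ⟨γ n i j v, hγG n i j v hv, γ m i j v, ⟨hγG m i j v hv, fun heq => ?_⟩,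
          ⟨hv, hγ n i j v hv⟩, hv, hγ m i j v hv⟩
        refine hno _ (hγG n i j v hv) ⟨hv, hγ n i j v hv⟩ hv ?_
        rw [heq]
        exact hγ m i j v hv
      · rintro ⟨g, hg, g', ⟨hg', hgg'⟩, ⟨hv, h1⟩, -, h2⟩
        refine ⟨hv, fun k hk h3 _ h4 => hgg' ?_⟩
        have e1 : g = k := hπ.eq_of_apply_eq hg hk (x := s n i v)
          (by rw [hsπ n i v hv.1, hψn]; exact hVs' hv.1) (h1.symm.trans h3.2)
        have e2 : g' = k := hπ.eq_of_apply_eq hg' hk (x := s m i v)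
          (by rw [hsπ m i v hv.1, hψn]; exact hVs' hv.1) (h2.symm.trans h4)
        rw [e1, e2]
    have hA'' : IsOpen ((V i ∩ V j) \ A) := by
      rw [hA']
      exact isOpen_biUnion fun g hg => isOpen_biUnion fun g' hg' => (hD n hg).inter (hD m hg'.1)
    have hTA : T i j ⊆ A := by
      intro t ht
      have htW := hTW i j ht
      have h1 : γ n i j t = γ m i j t := congrArg Subtype.val (congrFun (congrFun (congrFun hP i) j) ⟨t, ht⟩)
      refine mem_iUnion₂.2 ⟨γ n i j t, hγG n i j t htW, ⟨htW, hγ n i j t htW⟩, htW, ?_⟩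
      rw [h1]
      exact hγ m i j t htW
    obtain ⟨g, hg, h1, h2⟩ := mem_iUnion₂.1 (hT i j A hA hA'' hTA hv)
    exact ⟨g, hg, h1.2, h2.2⟩
  obtain ⟨n, m, hlt, hP⟩ : ∃ n m, n < m ∧ P n = P m := by
    rcases lt_or_gt_of_ne hne with h | h
    · exact ⟨n, m, h, hP⟩
    · exact ⟨m, n, h, hP.symm⟩
  have hOs (i : I) : Disjoint (O i) sing := (hVs i).mono_left (hOV i)
  -- The transfer takes sections above `ψ ^ n` to sections above `ψ ^ m`, so it covers `ψ ^ (m -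
  -- n)`. Exchanging `n` and `m` gives the inverse.
  obtain ⟨h, hhc, hh⟩ := hπ.exists_transfer hOo hcov (hψn n) (fun i => (hsc n i).mono (hOV i))
    (fun i => (hsc m i).mono (hOV i)) (fun i v hv => hsπ n i v (hOV i hv)) hOs (key n m hP)
  obtain ⟨h', hhc', hh'⟩ := hπ.exists_transfer hOo hcov (hψn m) (fun i => (hsc m i).mono (hOV i))
    (fun i => (hsc n i).mono (hOV i)) (fun i v hv => hsπ m i v (hOV i hv)) hOs (key m n hP.symm)
  have hrep (n : ℕ) (y : S) (hy : π y ∉ sing) : ∃ i, ∃ v ∈ O i, ∃ g ∈ G, g (s n i v) = y ∧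
      (ψ ^ n) v = π y := by
    have h1 : (ψ ^ n).symm (π y) ∈ singᶜ := by
      rw [mem_compl_iff, ← hψn n, (ψ ^ n).apply_symm_apply]
      exact hy
    obtain ⟨i, hi⟩ := mem_iUnion.1 (hcov h1)
    obtain ⟨g, hg, hgy⟩ := (hπ.rel_iff (s n i ((ψ ^ n).symm (π y))) y).1 (by
      rw [hsπ n i _ (hOV i hi), (ψ ^ n).apply_symm_apply])
    exact ⟨i, _, hi, g, hg, hgy, (ψ ^ n).apply_symm_apply _⟩
  have hpow (x : X) : (ψ ^ m) x = (ψ ^ (m - n)) ((ψ ^ n) x) := by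
    have : ψ ^ m = ψ ^ (m - n) * ψ ^ n := by rw [← pow_add, Nat.sub_add_cancel hlt.le]
    rw [this]
    rfl
  refine ⟨m - n, Nat.sub_pos_of_lt hlt, h, h', hhc, hhc', fun y hy => ?_, fun y hy => ?_,
    fun y hy => ?_, fun y hy => ?_, fun g hg y hy => ?_⟩
  · obtain ⟨i, v, hv, g, hg, rfl, hvy⟩ := hrep n y hy
    rw [hh i v hv g hg, ← hvy, hπ.map_eq hg, hsπ m i v (hOV i hv), hpow]
  · obtain ⟨i, v, hv, g, hg, rfl, hvy⟩ := hrep m y hy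
    rw [hh' i v hv g hg, ← hvy, hπ.map_eq hg, hsπ n i v (hOV i hv), hpow,
      Homeomorph.symm_apply_apply]
  · obtain ⟨i, v, hv, g, hg, rfl, hvy⟩ := hrep n y hy
    rw [hh i v hv g hg, hh' i v hv g hg]
  · obtain ⟨i, v, hv, g, hg, rfl, hvy⟩ := hrep m y hy
    rw [hh' i v hv g hg, hh i v hv g hg]
  · obtain ⟨i, v, hv, k, hk, rfl, hvy⟩ := hrep n y hy
    rw [hh i v hv k hk]
    exact hh i v hv (g * k) (G.mul_mem hg hk)

end IsBranchedQuotient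

end Lift

/-! ### Extending the lift over the branch points. -/

section Extend

universe u v

variable {S : Type v} [TopologicalSpace S] {X : Type u} [TopologicalSpace X]

/-- Points of a manifold of dimension at least two have arbitrarily small connected punctured
neighbourhoods. -/
theorem exists_isConnected_punctured_nhds {E : Type*} [NormedAddCommGroup E] [NormedSpace ℝ E]
    (hE : 1 < Module.rank ℝ E) (c : OpenPartialHomeomorph S E) {q : S} (hq : q ∈ c.source)
    {U : Set S} (hU : U ∈ 𝓝[≠] q) : ∃ D ∈ 𝓝[≠] q, IsConnected D ∧ D ⊆ U := by
  obtain ⟨W, hW, hWU⟩ := mem_nhdsWithin_iff_exists_mem_nhds_inter.1 hU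
  have h1 : c.symm ⁻¹' W ∈ 𝓝 (c q) := by
    refine (c.continuousAt_symm (c.map_source hq)).preimage_mem_nhds ?_
    rwa [c.left_inv hq]
  obtain ⟨r, hr, hrs⟩ := Metric.mem_nhds_iff.1
    (inter_mem (c.open_target.mem_nhds (c.map_source hq)) h1)
  let b : OpenPartialHomeomorph E E := OpenPartialHomeomorph.univBall (c q) r
  have hbs : b.source = univ := OpenPartialHomeomorph.univBall_source _ _
  have hbt : b.target = Metric.ball (c q) r := OpenPartialHomeomorph.univBall_target _ hr
  have hb0 : b 0 = c q := OpenPartialHomeomorph.univBall_apply_zero _ _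
  have hbm (v : E) : b v ∈ Metric.ball (c q) r := hbt ▸ b.map_source (hbs ▸ mem_univ v)
  have hbc : Continuous b := OpenPartialHomeomorph.continuous_univBall _ _
  have hcont : Continuous fun v => c.symm (b v) :=
    continuous_iff_continuousAt.2 fun v =>
      (c.continuousAt_symm (hrs (hbm v)).1).comp (f := b) hbc.continuousAt
  refine ⟨(fun v => c.symm (b v)) '' {0}ᶜ, ?_,
    (isConnected_compl_singleton_of_one_lt_rank hE 0).image _ hcont.continuousOn, ?_⟩
  · refine mem_nhdsWithin_iff_exists_mem_nhds_inter.2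
      ⟨c.symm '' Metric.ball (c q) r, ?_, ?_⟩
    · refine (c.isOpen_image_symm_of_subset_target Metric.isOpen_ball fun z hz => (hrs hz).1).mem_nhds
        ⟨c q, Metric.mem_ball_self hr, c.left_inv hq⟩
    · rintro _ ⟨⟨z, hz, rfl⟩, hne⟩
      rw [← hbt] at hz
      refine ⟨b.symm z, fun h0 => hne ?_, by simp only [b.right_inv hz]⟩
      have : b.symm z = 0 := h0
      change c.symm z = q
      rw [← b.right_inv hz, this, hb0, c.left_inv hq]
  · rintro _ ⟨v, hv, rfl⟩
    refine hWU ⟨(hrs (hbm v)).2, fun heq => hv ?_⟩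
    have h2 : c.symm (b v) = q := heq
    have h3 : b v = b 0 := by rw [hb0, ← h2, c.right_inv (hrs (hbm v)).1]
    exact b.injOn (hbs ▸ mem_univ v) (hbs ▸ mem_univ 0) h3

/-- A lift through a finite-to-one map extends over isolated points. -/
theorem exists_tendsto_of_lift [CompactSpace S] [T2Space S] [T2Space X] {π : S → X}
    (hπ : Continuous π) (hfib : ∀ x, (π ⁻¹' {x}).Finite) {Q : Set S} (hQ : Q.Finite) {h : S → S}
    (hh : ContinuousOn h Qᶜ) {Ψ : X → X} (hΨ : Continuous Ψ) (hhΨ : ∀ y ∉ Q, π (h y) = Ψ (π y))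
    {q : S} (hq : ∀ U ∈ 𝓝[≠] q, ∃ D ∈ 𝓝[≠] q, IsConnected D ∧ D ⊆ U) :
    ∃ z, Tendsto h (𝓝[≠] q) (𝓝 z) := by
  have hne : (𝓝[≠] q).NeBot := forall_mem_nonempty_iff_neBot.1 fun U hU => by
    obtain ⟨D, -, hD, hDU⟩ := hq U hU
    exact hD.nonempty.mono hDU
  have hoff : ∀ᶠ y in 𝓝[≠] q, y ∉ Q := by
    have h1 : (Q \ {q})ᶜ ∈ 𝓝 q :=
      (hQ.subset sdiff_subset).isClosed.isOpen_compl.mem_nhds (by simp)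
    filter_upwards [mem_nhdsWithin_of_mem_nhds h1, self_mem_nhdsWithin] with y h2 h3 h4
    exact h2 ⟨h4, h3⟩
  obtain ⟨z, hz⟩ := exists_clusterPt_of_compactSpace (map h (𝓝[≠] q))
  have hlim : Tendsto (π ∘ h) (𝓝[≠] q) (𝓝 (Ψ (π q))) := by
    refine Tendsto.congr' (f₁ := Ψ ∘ π) ?_
      ((hΨ.comp hπ).continuousAt.tendsto.mono_left nhdsWithin_le_nhds)
    filter_upwards [hoff] with y hy
    exact (hhΨ y hy).symm
  have hπz : π z = Ψ (π q) := by
    have h1 : ClusterPt (π z) (map π (map h (𝓝[≠] q))) := hz.map hπ.continuousAt tendsto_map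
    have h2 : ClusterPt (π z) (𝓝 (Ψ (π q))) := h1.mono hlim
    exact eq_of_nhds_neBot h2
  refine ⟨z, fun U hU => ?_⟩
  -- Separate the cluster point `z` from the other points of its finite fiber.
  obtain ⟨O, O', hO, hO', hzO, hZO', hdisj⟩ := SeparatedNhds.of_isCompact_isCompact
    (isCompact_singleton (x := z)) ((hfib (Ψ (π q))).subset (sdiff_subset (t := {z}))).isCompact
    disjoint_sdiff_right
  let O₁ := O ∩ interior U
  have hO₁ : IsOpen O₁ := hO.inter isOpen_interior
  have hzO₁ : z ∈ O₁ := ⟨hzO rfl, mem_interior_iff_mem_nhds.2 hU⟩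
  -- Since `π` is a closed map, points whose projection is near `Ψ (π q)` lie near the fiber. A
  -- connected punctured neighbourhood of `q` that meets the part near `z` is therefore mapped
  -- entirely into it.
  have hev : ∀ᶠ y in 𝓝[≠] q, h y ∈ O₁ ∪ O' := by
    have h1 : (π '' (O₁ ∪ O')ᶜ)ᶜ ∈ 𝓝 (Ψ (π q)) := by
      refine (hπ.isClosedMap _ (hO₁.union hO').isClosed_compl).isOpen_compl.mem_nhds ?_
      rintro ⟨y, hy, hyz⟩
      refine hy ?_
      by_cases hyz' : y = z
      · exact .inl (hyz' ▸ hzO₁)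
      · exact .inr (hZO' ⟨hyz, hyz'⟩)
    filter_upwards [hlim h1] with y hy
    by_contra hno
    exact hy ⟨h y, hno, rfl⟩
  obtain ⟨D, hD, hDc, hDU⟩ := hq _ (hev.and hoff)
  have himg : IsPreconnected (h '' D) :=
    hDc.isPreconnected.image h (hh.mono fun y hy => (hDU hy).2)
  have hmeet : (h '' D ∩ O₁).Nonempty := by
    rw [inter_comm]
    exact clusterPt_iff_nonempty.1 hz (hO₁.mem_nhds hzO₁) (image_mem_map hD)
  have hsub := himg.subset_left_of_subset_union hO₁ hO' (hdisj.mono_left inter_subset_left)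
    (by rintro _ ⟨y, hy, rfl⟩; exact (hDU hy).1) hmeet
  change h ⁻¹' U ∈ 𝓝[≠] q
  filter_upwards [hD] with y hy
  have h2 := (hsub (mem_image_of_mem h hy)).2
  exact interior_subset (s := U) h2

theorem exists_continuous_extension [CompactSpace S] [T2Space S] [T2Space X] {π : S → X}
    (hπ : Continuous π) (hfib : ∀ x, (π ⁻¹' {x}).Finite) {Q : Set S} (hQ : Q.Finite) {h : S → S}
    (hh : ContinuousOn h Qᶜ) {Ψ : X → X} (hΨ : Continuous Ψ) (hhΨ : ∀ y ∉ Q, π (h y) = Ψ (π y))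
    (hS : ∀ q : S, ∀ U ∈ 𝓝[≠] q, ∃ D ∈ 𝓝[≠] q, IsConnected D ∧ D ⊆ U) :
    ∃ k : S → S, Continuous k ∧ ∀ y ∉ Q, k y = h y := by
  classical
  choose z hz using fun q => exists_tendsto_of_lift hπ hfib hQ hh hΨ hhΨ (hS q)
  refine ⟨fun y => if y ∈ Q then z y else h y, continuous_iff_continuousAt.2 fun y => ?_,
    fun y hy => if_neg hy⟩
  have hQo : IsOpen Qᶜ := hQ.isClosed.isOpen_compl
  by_cases hy : y ∈ Q
  · rw [continuousAt_iff_punctured_nhds]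
    rw [if_pos hy]
    refine (hz y).congr' ?_
    have h1 : (Q \ {y})ᶜ ∈ 𝓝 y :=
      (hQ.subset sdiff_subset).isClosed.isOpen_compl.mem_nhds (by simp)
    filter_upwards [mem_nhdsWithin_of_mem_nhds h1, self_mem_nhdsWithin] with w h2 h3
    exact (if_neg fun h4 => h2 ⟨h4, h3⟩).symm
  · refine (hh.continuousAt (hQo.mem_nhds hy)).congr ?_
    filter_upwards [hQo.mem_nhds hy] with w hw
    exact (if_neg hw).symm

namespace IsBranchedQuotient

variable {π : S → X} {G : Subgroup (S ≃ₜ S)} {sing : Set X}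

theorem finite_fiber [Finite G] (hπ : IsBranchedQuotient π G sing) (x : X) : (π ⁻¹' {x}).Finite := by
  obtain ⟨y, rfl⟩ := hπ.surjective x
  refine (finite_range fun g : G => (g : S ≃ₜ S) y).subset fun w hw => ?_
  obtain ⟨g, hg, hgw⟩ := (hπ.rel_iff y w).1 (Eq.symm hw)
  exact ⟨⟨g, hg⟩, hgw⟩

theorem finite_preimage [Finite G] (hπ : IsBranchedQuotient π G sing) (hs : sing.Finite) :
    (π ⁻¹' sing).Finite :=
  hs.preimage' fun x _ => hπ.finite_fiber x

theorem _root_.PASurface.dense_compl_of_finite [T1Space S]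
    (hS : ∀ q : S, ∀ U ∈ 𝓝[≠] q, ∃ D ∈ 𝓝[≠] q, IsConnected D ∧ D ⊆ U) {Q : Set S}
    (hQ : Q.Finite) : Dense Qᶜ := by
  have hne (q : S) : (𝓝[≠] q).NeBot := forall_mem_nonempty_iff_neBot.1 fun U hU => by
    obtain ⟨D, -, hD, hDU⟩ := hS q U hU
    exact hD.nonempty.mono hDU
  rw [compl_eq_univ_sdiff]
  exact dense_univ.sdiff_finite hQ

/-- Some power of a homeomorphism of the quotient lifts to a homeomorphism of the branched cover
that commutes with the deck group. -/
theorem exists_homeomorph_lift_pow [CompactSpace S] [T2Space S] [CompactSpace X] [T2Space X]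
    [LocallyConnectedSpace X] [Finite G]
    (hπ : IsBranchedQuotient π G sing) (hsing : sing.Finite)
    (hch : ∀ x : X, ∃ c : OpenPartialHomeomorph X ℂ, x ∈ c.source)
    (hS : ∀ q : S, ∀ U ∈ 𝓝[≠] q, ∃ D ∈ 𝓝[≠] q, IsConnected D ∧ D ⊆ U) {ψ : X ≃ₜ X}
    (hψ : ∀ x, ψ x ∈ sing ↔ x ∈ sing) :
    ∃ n : ℕ, 0 < n ∧ ∃ Ψ : S ≃ₜ S, (∀ y, π (Ψ y) = (ψ ^ n) (π y)) ∧
      ∀ g ∈ G, ∀ y, Ψ (g y) = g (Ψ y) := by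
  obtain ⟨n, hn, h, h', hc, hc', hh, hh', hinv, hinv', hG⟩ := hπ.exists_lift_pow hsing hch hψ
  have hψn (n : ℕ) : ∀ x, (ψ ^ n) x ∈ sing ↔ x ∈ sing := by
    induction n with
    | zero => exact fun x => Iff.rfl
    | succ n ih =>
      intro x
      rw [pow_succ]
      exact (ih (ψ x)).trans (hψ x)
  have hQ := hπ.finite_preimage hsing
  have hdense := dense_compl_of_finite hS hQ
  obtain ⟨k, hk, hkh⟩ := exists_continuous_extension hπ.continuous hπ.finite_fiber hQ hc
    (ψ ^ n).continuous hh hS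
  obtain ⟨k', hk', hkh'⟩ := exists_continuous_extension hπ.continuous hπ.finite_fiber hQ hc'
    (ψ ^ n).symm.continuous hh' hS
  have hm (y : S) (hy : π y ∉ sing) : π (h y) ∉ sing := by rwa [hh y hy, hψn]
  have hm' (y : S) (hy : π y ∉ sing) : π (h' y) ∉ sing := by
    rwa [hh' y hy, ← hψn n, Homeomorph.apply_symm_apply]
  have e1 : k' ∘ k = id := (hk'.comp hk).ext_on hdense continuous_id fun y hy => by
    change k' (k y) = y
    rw [hkh y hy, hkh' _ (hm y hy), hinv y hy]
  have e2 : k ∘ k' = id := (hk.comp hk').ext_on hdense continuous_id fun y hy => by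
    change k (k' y) = y
    rw [hkh' y hy, hkh _ (hm' y hy), hinv' y hy]
  refine ⟨n, hn, ⟨⟨k, k', congrFun e1, congrFun e2⟩, hk, hk'⟩, fun y => ?_, fun g hg y => ?_⟩
  · refine congrFun ((hπ.continuous.comp hk).ext_on hdense ((ψ ^ n).continuous.comp hπ.continuous)
      fun y hy => ?_) y
    change π (k y) = _
    rw [hkh y hy, hh y hy]
    rfl
  · refine congrFun ((hk.comp g.continuous).ext_on hdense (g.continuous.comp hk) fun y hy => ?_) y
    change k (g y) = g (k y)
    rw [hkh y hy, hkh (g y) (by change π (g y) ∉ sing; rwa [hπ.map_eq hg]), hG g hg y hy]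

end IsBranchedQuotient

end Extend

/-! ### The orbit space as a branched quotient. -/

section Quotient

variable {S : Type*} [TopologicalSpace S] {G : Subgroup (S ≃ₜ S)}

theorem isOpenQuotientMap_orbit (G : Subgroup (S ≃ₜ S)) :
    IsOpenQuotientMap (Quotient.mk (orbitSetoid G)) where
  surjective := Quotient.mk_surjective
  continuous := continuous_quotient_mk'
  isOpenMap := by
    intro U hU
    rw [← isQuotientMap_quotient_mk'.isOpen_preimage]
    have h1 : Quotient.mk (orbitSetoid G) ⁻¹' (Quotient.mk (orbitSetoid G) '' U) =
        ⋃ g ∈ G, (g : S ≃ₜ S) ⁻¹' U := by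
      ext x
      simp only [mem_preimage, mem_image, mem_iUnion, exists_prop]
      constructor
      · rintro ⟨y, hy, hyx⟩
        obtain ⟨g, hg, hgx⟩ := Quotient.exact hyx.symm
        exact ⟨g, hg, hgx ▸ hy⟩
      · rintro ⟨g, hg, hgx⟩
        exact ⟨g x, hgx, (Quotient.sound ⟨g, hg, rfl⟩ : Quotient.mk (orbitSetoid G) x = _).symm⟩
    change IsOpen (Quotient.mk (orbitSetoid G) ⁻¹' (Quotient.mk (orbitSetoid G) '' U))
    rw [h1]
    exact isOpen_biUnion fun g _ => hU.preimage g.continuous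

theorem orbit_eq_iff {x y : S} :
    Quotient.mk (orbitSetoid G) x = Quotient.mk (orbitSetoid G) y ↔ ∃ g ∈ G, g x = y :=
  Quotient.eq

theorem t2Space_orbitSpace [T2Space S] [Finite G] : T2Space (OrbitSpace G) := by
  rw [t2Space_iff_of_isOpenQuotientMap (isOpenQuotientMap_orbit G)]
  have h1 : {q : S × S | Quotient.mk (orbitSetoid G) q.1 = Quotient.mk (orbitSetoid G) q.2} =
      ⋃ g : G, {q | (g : S ≃ₜ S) q.1 = q.2} := by
    ext q
    simp [orbit_eq_iff]
  rw [h1]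
  exact isClosed_iUnion_of_finite fun g =>
    isClosed_eq ((g : S ≃ₜ S).continuous.comp continuous_fst) continuous_snd

variable [ChartedSpace (EuclideanSpace ℝ (Fin 2)) S]

theorem locallyConnectedSpace_orbitSpace (G : Subgroup (S ≃ₜ S)) :
    LocallyConnectedSpace (OrbitSpace G) := by
  have := ChartedSpace.locallyPathConnectedSpace (EuclideanSpace ℝ (Fin 2)) S
  have := (isOpenQuotientMap_orbit G).isQuotientMap.locallyPathConnectedSpace
  infer_instance

theorem exists_isConnected_punctured_nhds_surface (q : S) (U : Set S) (hU : U ∈ 𝓝[≠] q) :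
    ∃ D ∈ 𝓝[≠] q, IsConnected D ∧ D ⊆ U :=
  exists_isConnected_punctured_nhds (by simp [rank_eq_card_basis (EuclideanSpace.basisFun (Fin 2) ℝ).toBasis])
    (chartAt (EuclideanSpace ℝ (Fin 2)) q) (mem_chart_source _ q) hU

variable {X : Type*} [TopologicalSpace X] {π : S → X} {P : Set X}

/-- For a chart `e` of the foliations, `e ∘ π` is a local diffeomorphism by `smooth`, and `π` is
locally `e.symm` after it. -/
theorem TransverseFoliations.isLocalHomeomorphOn (hπ : Continuous π)
    (F : TransverseFoliations π P) : IsLocalHomeomorphOn π (π ⁻¹' F.singᶜ) := by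
  refine IsLocalHomeomorphOn.mk _ _ fun x hx => ?_
  obtain ⟨e, he, hxe⟩ := F.exists_chart (π x) hx
  obtain ⟨d, hxd, hd⟩ := IsLocalDiffeomorphAt.exists_openPartialHomeomorph (F.smooth e he x hxe)
  let d' := d.restrOpen (π ⁻¹' e.source) (e.open_source.preimage hπ)
  have hd' {y : S} (hy : y ∈ d'.source) : y ∈ d.source ∧ π y ∈ e.source := by
    rwa [OpenPartialHomeomorph.restrOpen_source] at hy
  have key {y : S} (hy : y ∈ d'.source) : d' y = e (π y) := (hd (hd' hy).1).symm
  refine ⟨d'.trans e.symm, ?_, fun y hy => ?_⟩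
  · rw [OpenPartialHomeomorph.trans_source]
    have hx' : x ∈ d'.source := by
      rw [OpenPartialHomeomorph.restrOpen_source]
      exact ⟨hxd, hxe⟩
    refine ⟨hx', ?_⟩
    change d' x ∈ e.target
    rw [key hx']
    exact e.map_source hxe
  · rw [OpenPartialHomeomorph.trans_source] at hy
    change π y = e.symm (d' y)
    rw [key hy.1, e.left_inv (hd' hy.1).2]

theorem TransverseFoliations.exists_chart_source (F : TransverseFoliations π P) (x : X) :
    ∃ c : OpenPartialHomeomorph X ℂ, x ∈ c.source := by
  by_cases hx : x ∈ F.sing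
  · obtain ⟨ζ, h, -⟩ := F.prong_model x hx
    exact ⟨ζ, h⟩
  · obtain ⟨e, -, h⟩ := F.exists_chart x hx
    exact ⟨e, h⟩

/-- A group with finite orbits whose orbit space carries a pair of transverse foliations is
finite. -/
theorem finite_of_finite_orbits [T2Space S] [Nonempty S]
    (horb : ∀ x, {y | ∃ g ∈ G, g x = y}.Finite)
    (F : TransverseFoliations (Quotient.mk (orbitSetoid G)) (coneLocus G)) : Finite G := by
  have hQ : (Quotient.mk (orbitSetoid G) ⁻¹' F.sing).Finite := by
    refine F.finite_sing.preimage' fun b _ => ?_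
    obtain ⟨x, rfl⟩ := Quotient.mk_surjective b
    exact (horb x).subset fun y hy => orbit_eq_iff.1 (Eq.symm hy)
  -- A point off the preimage of `sing` has trivial stabilizer, because `sing` contains the cone
  -- locus. So `G` injects into the finite orbit of this point.
  obtain ⟨x, hx⟩ := (dense_compl_of_finite exists_isConnected_punctured_nhds_surface hQ).nonempty
  have := (horb x).to_subtype
  refine Finite.of_injective (fun g : G => (⟨(g : S ≃ₜ S) x, g, g.2, rfl⟩ :
    {y | ∃ g ∈ G, g x = y})) fun g g' h => ?_
  have h1 : (g : S ≃ₜ S) x = (g' : S ≃ₜ S) x := congrArg Subtype.val h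
  have h2 : (g'⁻¹ * g : G) = 1 := by
    by_contra hne
    refine hx (F.marked_subset ⟨x, ⟨(g'⁻¹ * g : G), (g'⁻¹ * g : G).2, fun h => hne (Subtype.ext h), ?_⟩, rfl⟩)
    change (g' : S ≃ₜ S).symm ((g : S ≃ₜ S) x) = x
    rw [h1, Homeomorph.symm_apply_apply]
  exact (inv_mul_eq_one.1 h2).symm

theorem isBranchedQuotient_orbit [T2Space S] [CompactSpace S] [Finite G]
    (F : TransverseFoliations (Quotient.mk (orbitSetoid G)) (coneLocus G)) :
    IsBranchedQuotient (Quotient.mk (orbitSetoid G)) G F.sing where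
  continuous := (isOpenQuotientMap_orbit G).continuous
  surjective := Quotient.mk_surjective
  rel_iff _ _ := orbit_eq_iff
  covering := by
    have := t2Space_orbitSpace (G := G)
    exact .of_isLocalHomeomorphOn (isOpenQuotientMap_orbit G).continuous
      (F.isLocalHomeomorphOn (isOpenQuotientMap_orbit G).continuous)
  free g hg x hx hgx := by
    by_contra hne
    exact hx (F.marked_subset ⟨x, ⟨g, hg, hne, hgx⟩, rfl⟩)

end Quotient

/-! ### The local form of the quotient map at a branch point. -/

section Branch

universe u v

variable {S : Type v} [TopologicalSpace S] {X : Type u} [TopologicalSpace X]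

/-- A continuous injection between surfaces that is open off a point is open at this point. -/
theorem isOpen_image_of_punctured [T2Space S] [LocallyCompactSpace S] {Y : Type*}
    [TopologicalSpace Y] [T2Space Y] {f : S → Y} {N : Set S} (hf : ContinuousOn f N)
    (hinj : InjOn f N) {q : S} [(𝓝[≠] q).NeBot]
    (hY : ∀ U ∈ 𝓝[≠] (f q), ∃ D ∈ 𝓝[≠] (f q), IsConnected D ∧ D ⊆ U)
    (hop : ∀ U ⊆ N \ {q}, IsOpen U → IsOpen (f '' U)) {U : Set S} (hUN : U ⊆ N) (hU : IsOpen U) :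
    IsOpen (f '' U) := by
  have h1 : IsOpen (f '' (U \ {q})) :=
    hop _ (fun y hy => ⟨hUN hy.1, hy.2⟩) (hU.sdiff isClosed_singleton)
  by_cases hq : q ∈ U
  swap
  · rwa [sdiff_singleton_eq_self hq] at h1
  suffices h2 : f '' U ∈ 𝓝 (f q) by
    rw [isOpen_iff_mem_nhds]
    rintro _ ⟨y, hy, rfl⟩
    by_cases hyq : y = q
    · rwa [hyq]
    · exact mem_of_superset (h1.mem_nhds ⟨y, ⟨hy, hyq⟩, rfl⟩) (image_mono sdiff_subset)
  obtain ⟨K, hKn, hKU, hK⟩ := local_compact_nhds (hU.mem_nhds hq)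
  have hqK : q ∈ interior K := mem_interior_iff_mem_nhds.2 hKn
  have hfr : IsClosed (f '' (K \ interior K)) :=
    ((hK.diff isOpen_interior).image_of_continuousOn
      (hf.mono (sdiff_subset.trans (hKU.trans hUN)))).isClosed
  have hV : (f '' (K \ interior K))ᶜ ∈ 𝓝 (f q) := by
    refine hfr.isOpen_compl.mem_nhds ?_
    rintro ⟨y, hy, hyq⟩
    have : y = q := hinj (hUN (hKU hy.1)) (hUN hq) hyq
    exact hy.2 (this ▸ hqK)
  -- `D` avoids `f q` and the image of the frontier, so it is covered by the disjoint open sets `f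
  -- '' (interior K \ {q})` and `(f '' K)ᶜ`. It meets the first by continuity at `q`, hence lies in
  -- it.
  obtain ⟨D, hD, hDc, hDV⟩ := hY _ (inter_mem (mem_nhdsWithin_of_mem_nhds hV) self_mem_nhdsWithin)
  have hA : IsOpen (f '' (interior K \ {q})) :=
    hop _ (fun y hy => ⟨hUN (hKU (interior_subset hy.1)), hy.2⟩)
      (isOpen_interior.sdiff isClosed_singleton)
  have hB : IsOpen (f '' K)ᶜ :=
    (hK.image_of_continuousOn (hf.mono (hKU.trans hUN))).isClosed.isOpen_compl
  have hsub : D ⊆ f '' (interior K \ {q}) := by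
    refine hDc.isPreconnected.subset_left_of_subset_union hA hB ?_ ?_ ?_
    · refine disjoint_compl_right.mono_left (image_mono (sdiff_subset.trans interior_subset))
    · intro d hd
      by_cases h3 : d ∈ f '' K
      · obtain ⟨k, hk, rfl⟩ := h3
        refine .inl ⟨k, ⟨?_, ?_⟩, rfl⟩
        · by_contra hki
          exact (hDV hd).1 ⟨k, ⟨hk, hki⟩, rfl⟩
        · rintro rfl
          exact (hDV hd).2 rfl
      · exact .inr h3
    · have h3 : insert (f q) D ∈ 𝓝 (f q) := insert_mem_nhds_iff.2 hD
      have h4 : ∀ᶠ y in 𝓝[≠] q, f y ∈ insert (f q) D :=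
        ((hf.continuousAt (hU.mem_nhds hq |> mem_of_superset <| hUN)).eventually_mem
          h3).filter_mono nhdsWithin_le_nhds
      have h5 : ∀ᶠ y in 𝓝[≠] q, y ∈ interior K :=
        mem_nhdsWithin_of_mem_nhds (isOpen_interior.mem_nhds hqK)
      have h6 : ∀ᶠ y in 𝓝[≠] q, y ∈ ({q}ᶜ : Set S) := self_mem_nhdsWithin
      obtain ⟨y, hy1, hy2, hy3⟩ := (h4.and (h5.and h6)).exists
      refine ⟨f y, hy1.resolve_left fun heq => hy3 ?_, y, ⟨hy2, hy3⟩, rfl⟩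
      exact hinj (hUN (hKU (interior_subset hy2))) (hUN hq) heq
  have h5 := insert_mem_nhds_iff.2 (mem_of_superset hD hsub)
  refine mem_of_superset h5 (insert_subset ⟨q, hq, rfl⟩ (image_mono ?_))
  exact sdiff_subset.trans (interior_subset.trans hKU)

namespace IsBranchedQuotient

variable {π : S → X} {G : Subgroup (S ≃ₜ S)} {sing : Set X}

/-- Two lifts of a map on a connected set differ by an element of the deck group. -/
theorem eqOn_of_lifts (hπ : IsBranchedQuotient π G sing) {Y : Type*} [TopologicalSpace Y]
    {W : Set Y} (hW : IsOpen W) (hWc : IsPreconnected W) {f : Y → X} (hf : ∀ v ∈ W, f v ∉ sing)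
    {s s' : Y → S} (hs : ContinuousOn s W)
    (hs' : ContinuousOn s' W) (hsf : ∀ v ∈ W, π (s v) = f v) (hsf' : ∀ v ∈ W, π (s' v) = f v)
    {g : S ≃ₜ S} (hg : g ∈ G) {v₀ : Y} (hv₀ : v₀ ∈ W) (h₀ : s' v₀ = g (s v₀)) :
    ∀ v ∈ W, s' v = g (s v) := by
  have h1 := hπ.isOpen_transition hW hf hs hs' hsf hsf' hg
  have h2 : IsOpen (⋃ g' ∈ {g' | g' ∈ G ∧ g' ≠ g}, {v | v ∈ W ∧ s' v = g' (s v)}) :=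
    isOpen_biUnion fun g' hg' => hπ.isOpen_transition hW hf hs hs' hsf hsf' hg'.1
  have h3 := hWc.subset_left_of_subset_union h1 h2 ?_ ?_ ⟨v₀, hv₀, hv₀, h₀⟩
  · exact fun v hv => (h3 hv).2
  · rw [Set.disjoint_left]
    rintro v ⟨hv, hv1⟩ hv2
    obtain ⟨g', ⟨hg', hne⟩, -, hv3⟩ := mem_iUnion₂.1 hv2
    exact hne (hπ.eq_of_apply_eq hg' hg (by rw [hsf v hv]; exact hf v hv) (hv3.symm.trans hv1))
  · intro v hv
    obtain ⟨g', hg', hv1⟩ := (hπ.rel_iff (s v) (s' v)).1 (by rw [hsf v hv, hsf' v hv])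
    by_cases h : g' = g
    · exact .inl ⟨hv, by rw [← h, hv1]⟩
    · exact .inr (mem_iUnion₂.2 ⟨g', ⟨hg', h⟩, hv, hv1.symm⟩)

/-- In suitable coordinates a branched covering is locally a power map. -/
theorem exists_branch_chart [T2Space S] [LocallyCompactSpace S] [Finite G]
    (hπ : IsBranchedQuotient π G sing) (hsing : sing.Finite)
    (hS : ∀ q : S, ∀ U ∈ 𝓝[≠] q, ∃ D ∈ 𝓝[≠] q, IsConnected D ∧ D ⊆ U) [T1Space X]
    (ζ : OpenPartialHomeomorph X ℂ) {q : S} (hq : π q ∈ ζ.source) (hζ : ζ (π q) = 0)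
    (hqs : π q ∈ sing) :
    ∃ m : ℕ, 0 < m ∧ ∃ ξ : OpenPartialHomeomorph S ℂ, q ∈ ξ.source ∧ ξ q = 0 ∧
      ∀ y ∈ ξ.source, π y ∈ ζ.source ∧ ξ y ^ m = ζ (π y) := by
  classical
  have h0 : (0 : ℂ) ∈ ζ.target := hζ ▸ ζ.map_source hq
  have hsymm0 : ζ.symm 0 = π q := by rw [← hζ, ζ.left_inv hq]
  have h1 : ζ.symm ⁻¹' (sing \ {π q})ᶜ ∈ 𝓝 (0 : ℂ) := by
    refine (ζ.continuousAt_symm h0).preimage_mem_nhds ?_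
    refine (hsing.subset sdiff_subset).isClosed.isOpen_compl.mem_nhds ?_
    rw [hsymm0]
    simp
  obtain ⟨r, hr, hrs⟩ := Metric.mem_nhds_iff.1 (inter_mem (ζ.open_target.mem_nhds h0) h1)
  have hns (w : ℂ) (hw : w ∈ Metric.ball (0 : ℂ) r) (hw0 : w ≠ 0) : ζ.symm w ∉ sing := by
    intro hws
    have h3 : ζ.symm w = π q := by
      by_contra hne
      exact (hrs hw).2 ⟨hws, hne⟩
    exact hw0 (by rw [← ζ.right_inv (hrs hw).1, h3, hζ])
  -- The exponential makes this half-plane the universal cover of the punctured disc of radius `r`.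
  -- The map from it to `X` lifts to a map `E` into `S`, chosen to pass through `y₀`.
  let H : Set ℂ := {z | z.re < Real.log r}
  have hH : IsOpen H := isOpen_lt Complex.continuous_re continuous_const
  have hHc : Convex ℝ H := convex_halfSpace_re_lt _
  have hexp (z : ℂ) (hz : z ∈ H) : Complex.exp z ∈ Metric.ball (0 : ℂ) r := by
    rw [mem_ball_zero_iff, Complex.norm_exp]
    exact (Real.lt_log_iff_exp_lt hr).1 hz
  let f : ℂ → X := fun z => ζ.symm (Complex.exp z)
  have hfs : ∀ z ∈ H, f z ∉ sing := fun z hz => hns _ (hexp z hz) (Complex.exp_ne_zero z)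
  have hfc : ContinuousOn f H := ζ.continuousOn_symm.comp Complex.continuous_exp.continuousOn
    fun z hz => (hrs (hexp z hz)).1
  have hfζ (z : ℂ) (hz : z ∈ H) : ζ (f z) = Complex.exp z := ζ.right_inv (hrs (hexp z hz)).1
  let U : Set S := {y | π y ∈ ζ.source ∧ ζ (π y) ∈ Metric.ball (0 : ℂ) r ∧ π y ∉ sing}
  have hoff : ∀ᶠ y in 𝓝[≠] q, π y ∉ sing := by
    have h1 : (π ⁻¹' sing \ {q})ᶜ ∈ 𝓝 q :=
      ((hπ.finite_preimage hsing).subset sdiff_subset).isClosed.isOpen_compl.mem_nhds (by simp)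
    filter_upwards [mem_nhdsWithin_of_mem_nhds h1, self_mem_nhdsWithin] with y h2 h3 h4
    exact h2 ⟨h4, h3⟩
  have hU : U ∈ 𝓝[≠] q := by
    have e1 := hπ.continuous.continuousAt.eventually_mem (ζ.open_source.mem_nhds hq)
    have e2 : ∀ᶠ y in 𝓝 q, ζ (π y) ∈ Metric.ball (0 : ℂ) r := by
      refine ((ζ.continuousAt hq).comp hπ.continuous.continuousAt).eventually_mem ?_
      rw [Function.comp_apply, hζ]
      exact Metric.ball_mem_nhds _ hr
    filter_upwards [mem_nhdsWithin_of_mem_nhds e1, mem_nhdsWithin_of_mem_nhds e2, hoff] with y a b c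
    exact ⟨a, b, c⟩
  have hlog (y : S) (hy : y ∈ U) : ∃ z ∈ H, f z = π y := by
    have hne : ζ (π y) ≠ 0 := by
      intro h
      refine hy.2.2 ?_
      rwa [← ζ.left_inv hy.1, h, hsymm0]
    refine ⟨Complex.log (ζ (π y)), ?_, ?_⟩
    · change (Complex.log (ζ (π y))).re < Real.log r
      rw [Complex.log_re]
      exact Real.log_lt_log (norm_pos_iff.2 hne) (mem_ball_zero_iff.1 hy.2.1)
    · simp only [f]
      rw [Complex.exp_log hne, ζ.left_inv hy.1]
  obtain ⟨D, hD, hDc, hDU⟩ := hS q U hU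
  obtain ⟨y₀, hy₀⟩ := hDc.nonempty
  obtain ⟨z₀, hz₀, hfz₀⟩ := hlog y₀ (hDU hy₀)
  have hdisc : IsDisc H := ⟨OpenPartialHomeomorph.refl ℂ, H, z₀, hH, hz₀,
    hHc.starConvex hz₀, subset_univ _, by simp⟩
  obtain ⟨E₀, hE₀c, hE₀⟩ := hdisc.exists_lift hπ.surjective hπ.covering hfc hfs
  obtain ⟨k, hk, hky⟩ := (hπ.rel_iff (E₀ z₀) y₀).1 (by rw [hE₀ z₀ hz₀, hfz₀])
  let E : ℂ → S := fun z => k (E₀ z)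
  have hEc : ContinuousOn E H := k.continuous.comp_continuousOn hE₀c
  have hEf : ∀ z ∈ H, π (E z) = f z := fun z hz => by simp only [E]; rw [hπ.map_eq hk, hE₀ z hz]
  have hEs : ∀ z ∈ H, π (E z) ∉ sing := fun z hz => by rw [hEf z hz]; exact hfs z hz
  let T : ℂ := 2 * Real.pi * Complex.I
  have hT (z : ℂ) (n : ℤ) : z + n * T ∈ H ↔ z ∈ H := by
    simp [H, T]
  have hT1 (z : ℂ) : z + T ∈ H ↔ z ∈ H := by simpa using hT z 1
  have hfT (z : ℂ) : f (z + T) = f z := by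
    simp only [f, T]
    rw [Complex.exp_periodic z]
  -- The monodromy: going once around the puncture multiplies the lift by the deck transformation
  -- `g`. Its order is the branching index `m`.
  obtain ⟨g, hg, hgz⟩ := (hπ.rel_iff (E z₀) (E (z₀ + T))).1 (by
    rw [hEf _ hz₀, hEf _ ((hT1 z₀).2 hz₀), hfT])
  have hmon : ∀ z ∈ H, E (z + T) = g (E z) :=
    hπ.eqOn_of_lifts hH hHc.isPreconnected hfs hEc
      (hEc.comp (by fun_prop) fun z hz => (hT1 z).2 hz) hEf
      (fun z hz => (hEf _ ((hT1 z).2 hz)).trans (hfT z)) hg hz₀ hgz.symm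
  have hmon' (n : ℤ) : ∀ z ∈ H, E (z + n * T) = (g ^ n) (E z) := by
    induction n with
    | zero => intro z _; simp
    | succ n ih =>
      intro z hz
      have h2 := ih (z + T) ((hT1 z).2 hz)
      rw [hmon z hz] at h2
      rw [zpow_add_one]
      refine Eq.trans (congrArg E ?_) h2
      push_cast
      ring
    | pred n ih =>
      intro z hz
      have hz' : z - T ∈ H := (hT1 _).1 (by rwa [sub_add_cancel])
      have h2 := ih (z - T) hz'
      have h3 := hmon (z - T) hz'
      rw [sub_add_cancel] at h3
      have h4 : E (z - T) = g⁻¹ (E z) := by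
        rw [h3]
        exact (g.symm_apply_apply _).symm
      rw [h4] at h2
      rw [zpow_sub_one]
      refine Eq.trans (congrArg E ?_) h2
      push_cast
      ring
  let γ : G := ⟨g, hg⟩
  let m := orderOf γ
  have hm : 0 < m := orderOf_pos γ
  have hmC : (m : ℂ) ≠ 0 := Nat.cast_ne_zero.2 hm.ne'
  have hγ (n : ℤ) : g ^ n = 1 ↔ (m : ℤ) ∣ n := by
    rw [orderOf_dvd_iff_zpow_eq_one, Subtype.ext_iff]
    simp [γ]
  -- `E` identifies exactly the points that differ by multiples of `2πi m`, so `exp (z / m)`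
  -- descends to an injective coordinate on its image.
  have hE {z z' : ℂ} (hz : z ∈ H) (hz' : z' ∈ H) :
      E z = E z' ↔ Complex.exp (z / m) = Complex.exp (z' / m) := by
    constructor
    · intro h
      have h2 : Complex.exp z = Complex.exp z' := by
        rw [← hfζ z hz, ← hfζ z' hz', ← hEf z hz, ← hEf z' hz', h]
      obtain ⟨n, hn⟩ := Complex.exp_eq_exp_iff_exists_int.1 h2
      have h3 := hmon' n z' hz'
      rw [← hn, h] at h3
      have h4 : g ^ n = 1 := hπ.free _ (G.zpow_mem hg n) _ (hEs z' hz') h3.symm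
      obtain ⟨j, rfl⟩ := (hγ n).1 h4
      refine Complex.exp_eq_exp_iff_exists_int.2 ⟨j, ?_⟩
      rw [hn]
      field_simp
      push_cast
      ring
    · intro h
      obtain ⟨j, hj⟩ := Complex.exp_eq_exp_iff_exists_int.1 h
      have h3 := hmon' (m * j) z' hz'
      rw [(hγ _).2 (dvd_mul_right _ _)] at h3
      refine Eq.trans (congrArg E ?_) h3
      field_simp at hj
      rw [hj]
      simp only [T]
      push_cast
      ring
  have hEo (W : Set ℂ) (hW : IsOpen W) (hWH : W ⊆ H) : IsOpen (E '' W) := by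
    rw [isOpen_iff_mem_nhds]
    rintro _ ⟨z, hz, rfl⟩
    obtain ⟨V, hV, hVinj⟩ := hπ.exists_injOn (hEs z (hWH hz))
    have h2 : W ∩ E ⁻¹' V ∈ 𝓝 z :=
      inter_mem (hW.mem_nhds hz) ((hEc.continuousAt (hH.mem_nhds (hWH hz))).preimage_mem_nhds hV)
    obtain ⟨W', hW'W, hW', hzW'⟩ := mem_nhds_iff.1 h2
    have h3 : IsOpen (f '' W') := by
      have : f '' W' = ζ.symm '' (Complex.exp '' W') := by rw [image_image]
      rw [this]
      refine ζ.isOpen_image_symm_of_subset_target (Complex.isOpenMap_exp W' hW') ?_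
      rintro _ ⟨w, hw, rfl⟩
      exact (hrs (hexp w (hWH (hW'W hw).1))).1
    have h4 : π ⁻¹' (f '' W') ∈ 𝓝 (E z) :=
      (h3.preimage hπ.continuous).mem_nhds ⟨z, hzW', (hEf z (hWH hz)).symm⟩
    filter_upwards [hV, h4] with y hyV ⟨w, hw, hwy⟩
    refine ⟨w, (hW'W hw).1, hVinj (hW'W hw).2 hyV ?_⟩
    rw [hEf w (hWH (hW'W hw).1), hwy]
  -- Every point of `D` lies in a translate `g' '' (E '' H)`. A translate that meets `E '' H` comes
  -- from a power of the monodromy and equals it; the others form a disjoint open set, and `D` is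
  -- connected.
  have hDE : D ⊆ E '' H := by
    have h2 : IsOpen (⋃ g' ∈ {g' | g' ∈ G ∧ Disjoint (g' '' (E '' H)) (E '' H)},
        (g' : S ≃ₜ S) '' (E '' H)) :=
      isOpen_biUnion fun g' _ => g'.isOpenMap _ (hEo H hH subset_rfl)
    refine hDc.isPreconnected.subset_left_of_subset_union (hEo H hH subset_rfl) h2 ?_ ?_
      ⟨y₀, hy₀, z₀, hz₀, hky⟩
    · rw [Set.disjoint_left]
      rintro y hy hy'
      obtain ⟨g', ⟨-, hg'⟩, hyg⟩ := mem_iUnion₂.1 hy'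
      exact Set.disjoint_left.1 hg' hyg hy
    · intro y hy
      obtain ⟨z, hz, hzy⟩ := hlog y (hDU hy)
      obtain ⟨g', hg', hgy⟩ := (hπ.rel_iff (E z) y).1 (by rw [hEf z hz, hzy])
      by_cases hdis : Disjoint (g' '' (E '' H)) (E '' H)
      · exact .inr (mem_iUnion₂.2 ⟨g', ⟨hg', hdis⟩, E z, ⟨z, hz, rfl⟩, hgy⟩)
      · refine .inl ?_
        obtain ⟨_, ⟨_, ⟨z₁, hz₁, rfl⟩, rfl⟩, z₂, hz₂, h12⟩ := Set.not_disjoint_iff.1 hdis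
        have h3 : Complex.exp z₂ = Complex.exp z₁ := by
          rw [← hfζ z₁ hz₁, ← hfζ z₂ hz₂, ← hEf z₁ hz₁, ← hEf z₂ hz₂, h12, hπ.map_eq hg']
        obtain ⟨n, hn⟩ := Complex.exp_eq_exp_iff_exists_int.1 h3
        have h4 := hmon' n z₁ hz₁
        rw [← hn, h12] at h4
        have h5 := hπ.eq_of_apply_eq hg' (G.zpow_mem hg n) (hEs z₁ hz₁) h4
        refine ⟨z + n * T, (hT z n).2 hz, ?_⟩
        rw [hmon' n z hz, ← h5, hgy]
  let ξ : S → ℂ := fun y => if h : ∃ z ∈ H, E z = y then Complex.exp (h.choose / m) else 0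
  have hξE (z : ℂ) (hz : z ∈ H) : ξ (E z) = Complex.exp (z / m) := by
    have h : ∃ z' ∈ H, E z' = E z := ⟨z, hz, rfl⟩
    simp only [ξ]
    rw [dif_pos h]
    exact (hE h.choose_spec.1 hz).1 h.choose_spec.2
  have hqE : q ∉ E '' H := by
    rintro ⟨z, hz, hzq⟩
    exact hEs z hz (by rwa [hzq])
  have hξq : ξ q = 0 := dif_neg fun ⟨z, hz, h⟩ => hqE ⟨z, hz, h⟩
  let N : Set S := insert q (E '' H)
  have hNpow : ∀ y ∈ N, π y ∈ ζ.source ∧ ξ y ^ m = ζ (π y) := by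
    rintro y (rfl | ⟨z, hz, rfl⟩)
    · exact ⟨hq, by rw [hξq, hζ, zero_pow hm.ne']⟩
    · rw [hEf z hz, hξE z hz, hfζ z hz, ← Complex.exp_nat_mul, mul_div_cancel₀ _ hmC]
      exact ⟨ζ.map_target (hrs (hexp z hz)).1, rfl⟩
  have hNo : IsOpen N := by
    rw [isOpen_iff_mem_nhds]
    rintro y (rfl | hy)
    · exact insert_mem_nhds_iff.2 (mem_of_superset hD hDE)
    · exact mem_of_superset ((hEo H hH subset_rfl).mem_nhds hy) (subset_insert _ _)
  have hinj : InjOn ξ N := by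
    rintro y (rfl | ⟨z, hz, rfl⟩) y' (rfl | ⟨z', hz', rfl⟩) h
    · rfl
    · rw [hξq, hξE z' hz'] at h
      exact absurd h.symm (Complex.exp_ne_zero _)
    · rw [hξq, hξE z hz] at h
      exact absurd h (Complex.exp_ne_zero _)
    · rw [hξE z hz, hξE z' hz'] at h
      exact (hE hz hz').2 h
  have hcont : ContinuousOn ξ N := by
    refine continuousOn_of_forall_continuousAt ?_
    rintro y (rfl | ⟨z, hz, rfl⟩)
    · rw [ContinuousAt, hξq, tendsto_zero_iff_norm_tendsto_zero]
      have h2 : Tendsto (fun y => ‖ζ (π y)‖) (𝓝 y) (𝓝 0) := by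
        have := ((ζ.continuousAt hq).comp hπ.continuous.continuousAt).norm.tendsto
        simpa only [Function.comp_apply, hζ, norm_zero] using this
      rw [Metric.tendsto_nhds] at h2 ⊢
      intro ε hε
      filter_upwards [h2 (ε ^ m) (pow_pos hε m), hNo.mem_nhds (mem_insert y _)] with w hw hwN
      rw [Real.dist_eq, sub_zero, abs_norm] at hw ⊢
      rw [← (hNpow w hwN).2, norm_pow] at hw
      exact lt_of_pow_lt_pow_left₀ m hε.le hw
    · intro O hO
      rw [hξE z hz] at hO
      have h2 : Continuous fun z : ℂ => Complex.exp (z / m) := by fun_prop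
      obtain ⟨W, hWO, hW, hzW⟩ := mem_nhds_iff.1 (inter_mem (hH.mem_nhds hz)
        (h2.continuousAt.preimage_mem_nhds hO))
      change ξ ⁻¹' O ∈ 𝓝 (E z)
      refine mem_of_superset ((hEo W hW fun w hw => (hWO hw).1).mem_nhds ⟨z, hzW, rfl⟩) ?_
      rintro _ ⟨w, hw, rfl⟩
      rw [mem_preimage, hξE w (hWO hw).1]
      exact (hWO hw).2
  have hop : ∀ U ⊆ N \ {q}, IsOpen U → IsOpen (ξ '' U) := by
    intro U hUN hUo
    have h2 : ξ '' U = (fun z : ℂ => Complex.exp (z / m)) '' (H ∩ E ⁻¹' U) := by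
      ext w
      constructor
      · rintro ⟨y, hy, rfl⟩
        obtain ⟨z, hz, rfl⟩ := (hUN hy).1.resolve_left (hUN hy).2
        exact ⟨z, ⟨hz, hy⟩, (hξE z hz).symm⟩
      · rintro ⟨z, ⟨hz, hzU⟩, rfl⟩
        exact ⟨E z, hzU, hξE z hz⟩
    rw [h2]
    have h3 : IsOpenMap fun z : ℂ => Complex.exp (z / m) :=
      Complex.isOpenMap_exp.comp (by
        simp only [div_eq_mul_inv]
        exact (Homeomorph.mulRight₀ _ (inv_ne_zero hmC)).isOpenMap)
    exact h3 _ (hEc.isOpen_inter_preimage hH hUo)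
  have hne : (𝓝[≠] q).NeBot := forall_mem_nonempty_iff_neBot.1 fun U hU => by
    obtain ⟨D, -, hD, hDU⟩ := hS q U hU
    exact hD.nonempty.mono hDU
  -- Openness at `q` itself follows from openness on the punctured neighbourhood.
  have hop' {U : Set S} (hUN : U ⊆ N) (hU : IsOpen U) : IsOpen (ξ '' U) :=
    isOpen_image_of_punctured hcont hinj (fun U hU => exists_isConnected_punctured_nhds
      (by rw [Complex.rank_real_complex]; norm_num) (OpenPartialHomeomorph.refl ℂ) (mem_univ _) hU)
      hop hUN hU
  have : Nonempty S := ⟨q⟩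
  refine ⟨m, hm, OpenPartialHomeomorph.ofContinuousOpenRestrict (hinj.toPartialEquiv ξ N) hcont ?_
    hNo, mem_insert q _, hξq, hNpow⟩
  intro U hU
  obtain ⟨V, hV, rfl⟩ := isOpen_induced_iff.1 hU
  have h2 : N.domRestrict ξ '' (Subtype.val ⁻¹' V) = ξ '' (N ∩ V) := by
    ext w
    constructor
    · rintro ⟨y, hy, rfl⟩
      exact ⟨y, ⟨y.2, hy⟩, rfl⟩
    · rintro ⟨y, ⟨hy, hyV⟩, rfl⟩
      exact ⟨⟨y, hy⟩, hyV, rfl⟩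
  exact h2 ▸ hop' inter_subset_left (hNo.inter hV)

end IsBranchedQuotient

end Branch

/-! ### Lifting the foliations and the pseudo-Anosov property. -/

section Lifted

variable {X Y : Type*} [TopologicalSpace X] [TopologicalSpace Y]

theorem ScalesBy.comp {c : ℝ} {u v : X → ℝ} {p : Y → X} {y : Y} (h : ScalesBy c u v (p y))
    (hp : ContinuousAt p y) : ScalesBy c (fun z => u (p z)) (fun z => v (p z)) y := by
  obtain ⟨a, b, hab, h⟩ := h
  exact ⟨a, b, hab, hp.eventually h⟩

theorem ScalesBy.congr {c : ℝ} {u v u' v' : X → ℝ} {x : X} (h : ScalesBy c u v x)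
    (hu : u =ᶠ[𝓝 x] u') (hv : v =ᶠ[𝓝 x] v') : ScalesBy c u' v' x := by
  obtain ⟨a, b, hab, h⟩ := h
  refine ⟨a, b, hab, ?_⟩
  filter_upwards [h, hu, hv] with y h1 h2 h3
  rw [← h2, ← h3, h1]

theorem ScalesBy.trans {c d : ℝ} {u v w : X → ℝ} {x : X} (h : ScalesBy c u v x)
    (h' : ScalesBy d v w x) : ScalesBy (c * d) u w x := by
  obtain ⟨a, b, rfl, h⟩ := h
  obtain ⟨a', b', rfl, h'⟩ := h'
  refine ⟨a' * a, a' * b + b', by rw [abs_mul, mul_comm], ?_⟩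
  filter_upwards [h, h'] with y h1 h2
  rw [h2, h1]
  ring

variable {S : Type*} [TopologicalSpace S] [ChartedSpace (EuclideanSpace ℝ (Fin 2)) S]
  {π : S → X} {P : Set X} {G : Subgroup (S ≃ₜ S)}

/-- The charts of a branched cover that are lifted from the quotient. -/
def TransverseFoliations.liftCharts (F : TransverseFoliations π P) :
    Set (OpenPartialHomeomorph S ℂ) :=
  {d | ∃ e ∈ F.charts, ∀ y ∈ d.source, π y ∈ e.source ∧ d y = e (π y)}

theorem TransverseFoliations.exists_liftChart (hπ : Continuous π) (F : TransverseFoliations π P)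
    {x : S} (hx : π x ∉ F.sing) : ∃ d ∈ F.liftCharts, x ∈ d.source := by
  obtain ⟨e, he, hxe⟩ := F.exists_chart (π x) hx
  obtain ⟨d, hxd, hd⟩ := IsLocalDiffeomorphAt.exists_openPartialHomeomorph (F.smooth e he x hxe)
  refine ⟨d.restrOpen (π ⁻¹' e.source) (e.open_source.preimage hπ), ⟨e, he, fun y hy => ?_⟩, ?_⟩
  · rw [OpenPartialHomeomorph.restrOpen_source] at hy
    exact ⟨hy.2, (hd hy.1).symm⟩
  · rw [OpenPartialHomeomorph.restrOpen_source]
    exact ⟨hxd, hxe⟩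

theorem eventuallyEq_of_lift
    {d : OpenPartialHomeomorph S ℂ} {e : OpenPartialHomeomorph X ℂ}
    (h : ∀ y ∈ d.source, π y ∈ e.source ∧ d y = e (π y)) {x : S} (hx : x ∈ d.source) :
    (fun y => e (π y)) =ᶠ[𝓝 x] d := by
  filter_upwards [d.open_source.mem_nhds hx] with y hy
  exact (h y hy).2.symm

/-- The measured foliations of the quotient have prong singularities with at least two prongs in the
branched cover. -/
theorem exists_branched_prong [T2Space S] [LocallyCompactSpace S] [Finite G] [T1Space X]
    (F : TransverseFoliations π P) (hπ : IsBranchedQuotient π G F.sing)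
    (hP : ∀ q, π q ∈ P → ∃ g ∈ G, g ≠ 1 ∧ g q = q) {q : S} (hq : π q ∈ F.sing) :
    ∃ k : ℕ, 2 ≤ k ∧ ∃ ξ : OpenPartialHomeomorph S ℂ, q ∈ ξ.source ∧ ξ q = 0 ∧
      ∀ e ∈ F.charts, ∀ x ∈ ξ.source, π x ∈ e.source → ∃ w : S → ℂ,
        (∀ᶠ y in 𝓝 x, w y ^ 2 = ξ y ^ k) ∧
        ScalesBy 1 (fun y => (e (π y)).re) (fun y => (w y).re) x ∧
        ScalesBy 1 (fun y => (e (π y)).im) (fun y => (w y).im) x := by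
  obtain ⟨ζ, hqζ, hζ, hmodel⟩ := F.prong_model (π q) hq
  obtain ⟨m, hm, ξ, hqξ, hξq, hξ⟩ := hπ.exists_branch_chart F.finite_sing
    exists_isConnected_punctured_nhds_surface ζ hqζ hζ hq
  -- With `ξ ^ m = ζ ∘ π`, the branches of `ζ ^ (k / 2)` become branches of `ξ ^ (m k / 2)`.
  refine ⟨m * F.prongs (π q), ?_, ξ, hqξ, hξq, fun e he x hx hxe => ?_⟩
  · by_cases hqP : π q ∈ P
    · have h1 : m ≠ 1 := by
        rintro rfl
        obtain ⟨g, hg, hg1, hgq⟩ := hP q hqP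
        have hne : (𝓝[≠] q).NeBot := forall_mem_nonempty_iff_neBot.1 fun U hU => by
          obtain ⟨D, -, hD, hDU⟩ := exists_isConnected_punctured_nhds_surface q U hU
          exact hD.nonempty.mono hDU
        have hoff : ∀ᶠ y in 𝓝[≠] q, π y ∉ F.sing := by
          have h1 : (π ⁻¹' F.sing \ {q})ᶜ ∈ 𝓝 q :=
            ((hπ.finite_preimage F.finite_sing).subset
              sdiff_subset).isClosed.isOpen_compl.mem_nhds (by simp)
          filter_upwards [mem_nhdsWithin_of_mem_nhds h1, self_mem_nhdsWithin] with y h2 h3 h4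
          exact h2 ⟨h4, h3⟩
        have h2 : ∀ᶠ y in 𝓝[≠] q, y ∈ ξ.source :=
          mem_nhdsWithin_of_mem_nhds (ξ.open_source.mem_nhds hqξ)
        have h3 : ∀ᶠ y in 𝓝[≠] q, g y ∈ ξ.source := by
          refine mem_nhdsWithin_of_mem_nhds (g.continuous.continuousAt.preimage_mem_nhds ?_)
          rw [hgq]
          exact ξ.open_source.mem_nhds hqξ
        obtain ⟨y, hy1, hy2, hy3⟩ := (hoff.and (h2.and h3)).exists
        refine hg1 (hπ.free g hg y hy1 (ξ.injOn hy3 hy2 ?_))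
        have e1 := (hξ y hy2).2
        have e2 := (hξ (g y) hy3).2
        rw [pow_one] at e1 e2
        rw [e1, e2, hπ.map_eq hg]
      have h2 := F.one_le_prongs _ hq
      calc 2 = 2 * 1 := rfl
        _ ≤ m * F.prongs (π q) := Nat.mul_le_mul (by omega) h2
    · calc 2 = 1 * 2 := rfl
        _ ≤ m * F.prongs (π q) := Nat.mul_le_mul hm (F.two_le_prongs _ hq hqP)
  · obtain ⟨w, hw, h1, h2⟩ := hmodel e he (π x) ⟨hxe, (hξ x hx).1⟩
    have hc : ContinuousAt π x := hπ.continuous.continuousAt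
    refine ⟨fun y => w (π y), ?_, h1.comp hc, h2.comp hc⟩
    filter_upwards [hc.eventually hw, ξ.open_source.mem_nhds hx] with y h3 h4
    rw [h3, ← (hξ y h4).2, pow_mul]

/-- The pair of measured foliations of the branched cover that is lifted from the quotient. -/
theorem exists_lifted_foliations [T2Space S] [LocallyCompactSpace S] [Finite G] [T1Space X]
    (F : TransverseFoliations π P) (hπ : IsBranchedQuotient π G F.sing)
    (hP : ∀ q, π q ∈ P → ∃ g ∈ G, g ≠ 1 ∧ g q = q) :
    ∃ F' : TransverseFoliations (id : S → S) ∅, F'.sing = π ⁻¹' F.sing ∧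
      F'.charts = F.liftCharts := by
  classical
  have hprong (q : S) : ∃ k : ℕ, π q ∈ F.sing →
      2 ≤ k ∧ ∃ ξ : OpenPartialHomeomorph S ℂ, q ∈ ξ.source ∧ ξ q = 0 ∧
      ∀ e ∈ F.charts, ∀ x ∈ ξ.source, π x ∈ e.source → ∃ w : S → ℂ,
        (∀ᶠ y in 𝓝 x, w y ^ 2 = ξ y ^ k) ∧
        ScalesBy 1 (fun y => (e (π y)).re) (fun y => (w y).re) x ∧
        ScalesBy 1 (fun y => (e (π y)).im) (fun y => (w y).im) x := by
    by_cases hq : π q ∈ F.sing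
    · obtain ⟨k, hk⟩ := exists_branched_prong F hπ hP hq
      exact ⟨k, fun _ => hk⟩
    · exact ⟨0, fun h => absurd h hq⟩
  choose k hk using hprong
  have hc (x : S) : ContinuousAt π x := hπ.continuous.continuousAt
  refine ⟨{
    sing := π ⁻¹' F.sing
    finite_sing := hπ.finite_preimage F.finite_sing
    marked_subset := empty_subset _
    charts := F.liftCharts
    source_disjoint := ?_
    exists_chart := fun x hx => F.exists_liftChart hπ.continuous hx
    smooth := ?_
    compatible := ?_
    prongs := k
    one_le_prongs := fun p hp => one_le_two.trans (hk p hp).1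
    two_le_prongs := fun p hp _ => (hk p hp).1
    prong_model := ?_ }, rfl, rfl⟩
  · rintro d ⟨e, he, hd⟩
    exact Set.disjoint_left.2 fun y hy hys =>
      Set.disjoint_left.1 (F.source_disjoint e he) (hd y hy).1 hys
  · rintro d ⟨e, he, hd⟩ s hs
    exact isLocalDiffeomorphAt_congr (F.smooth e he s (hd s hs).1)
      (eventuallyEq_of_lift hd hs).symm
  · rintro d ⟨e, he, hd⟩ d' ⟨e', he', hd'⟩ x ⟨hx, hx'⟩
    obtain ⟨h1, h2⟩ := F.compatible e he e' he' (π x) ⟨(hd x hx).1, (hd' x hx').1⟩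
    have h3 := eventuallyEq_of_lift hd hx
    have h4 := eventuallyEq_of_lift hd' hx'
    exact ⟨(h1.comp (hc x)).congr (h3.fun_comp Complex.re) (h4.fun_comp Complex.re),
      (h2.comp (hc x)).congr (h3.fun_comp Complex.im) (h4.fun_comp Complex.im)⟩
  · intro p hp
    obtain ⟨-, ξ, hpξ, hξp, h⟩ := hk p hp
    refine ⟨ξ, hpξ, hξp, ?_⟩
    rintro d ⟨e, he, hd⟩ x ⟨hx, hxξ⟩
    obtain ⟨w, hw, h1, h2⟩ := h e he x hxξ (hd x hx).1
    have h3 := eventuallyEq_of_lift hd hx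
    exact ⟨w, hw, h1.congr (h3.fun_comp Complex.re) .rfl, h2.congr (h3.fun_comp Complex.im) .rfl⟩

theorem scalesBy_pow (F : TransverseFoliations π P) {ψ : X ≃ₜ X}
    (hψ : ∀ x, ψ x ∈ F.sing ↔ x ∈ F.sing) {lam : ℝ}
    (h : ∀ e ∈ F.charts, ∀ e' ∈ F.charts, ∀ x ∈ e.source, ψ x ∈ e'.source →
      ScalesBy lam⁻¹ (fun y => (e y).re) (fun y => (e' (ψ y)).re) x ∧
      ScalesBy lam (fun y => (e y).im) (fun y => (e' (ψ y)).im) x) (n : ℕ) :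
    ∀ e ∈ F.charts, ∀ e' ∈ F.charts, ∀ x ∈ e.source, (ψ ^ n) x ∈ e'.source →
      ScalesBy (lam ^ n)⁻¹ (fun y => (e y).re) (fun y => (e' ((ψ ^ n) y)).re) x ∧
      ScalesBy (lam ^ n) (fun y => (e y).im) (fun y => (e' ((ψ ^ n) y)).im) x := by
  induction n with
  | zero =>
    intro e he e' he' x hx hx'
    simpa using F.compatible e he e' he' x ⟨hx, hx'⟩
  | succ n ih =>
    intro e he e' he' x hx hx'
    have hxs : ψ x ∉ F.sing := by
      rw [hψ]
      exact Set.disjoint_left.1 (F.source_disjoint e he) hx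
    obtain ⟨e₁, he₁, hx₁⟩ := F.exists_chart (ψ x) hxs
    have hmul (y : X) : (ψ ^ (n + 1)) y = (ψ ^ n) (ψ y) := by
      rw [pow_succ]
      rfl
    obtain ⟨h1, h2⟩ := h e he e₁ he₁ x hx hx₁
    rw [hmul] at hx'
    obtain ⟨h3, h4⟩ := ih e₁ he₁ e' he' (ψ x) hx₁ hx'
    have hc : ContinuousAt ψ x := ψ.continuous.continuousAt
    simp only [hmul]
    rw [pow_succ' lam, mul_inv]
    exact ⟨h1.trans (h3.comp hc), h2.trans (h4.comp hc)⟩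

/-- A lift of a power of a pseudo-Anosov map of the quotient is pseudo-Anosov. -/
theorem isPseudoAnosov_lift [T2Space S] [LocallyCompactSpace S] [Finite G] [T1Space X]
    (F : TransverseFoliations π P) (hπ : IsBranchedQuotient π G F.sing)
    (hP : ∀ q, π q ∈ P → ∃ g ∈ G, g ≠ 1 ∧ g q = q) {ψ : X ≃ₜ X}
    (hψ : ∀ x, ψ x ∈ F.sing ↔ x ∈ F.sing) {lam : ℝ} (hlam : 1 < lam)
    (h : ∀ e ∈ F.charts, ∀ e' ∈ F.charts, ∀ x ∈ e.source, ψ x ∈ e'.source →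
      ScalesBy lam⁻¹ (fun y => (e y).re) (fun y => (e' (ψ y)).re) x ∧
      ScalesBy lam (fun y => (e y).im) (fun y => (e' (ψ y)).im) x) {n : ℕ} (hn : 0 < n)
    {Ψ : S ≃ₜ S} (hΨ : ∀ y, π (Ψ y) = (ψ ^ n) (π y)) :
    ∃ F' : TransverseFoliations (id : S → S) ∅, F'.sing = π ⁻¹' F.sing ∧ Ψ '' F'.sing = F'.sing ∧
      (∀ g ∈ G, ∀ e ∈ F'.charts, ∀ e' ∈ F'.charts, ∀ x ∈ e.source, g x ∈ e'.source →
        ScalesBy 1 (fun y => (e y).re) (fun y => (e' (g y)).re) x ∧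
        ScalesBy 1 (fun y => (e y).im) (fun y => (e' (g y)).im) x) ∧
      ∃ lam : ℝ, 1 < lam ∧ ∀ e ∈ F'.charts, ∀ e' ∈ F'.charts, ∀ x ∈ e.source, Ψ x ∈ e'.source →
        ScalesBy lam⁻¹ (fun y => (e y).re) (fun y => (e' (Ψ y)).re) x ∧
        ScalesBy lam (fun y => (e y).im) (fun y => (e' (Ψ y)).im) x := by
  obtain ⟨F', hsing, hcharts⟩ := exists_lifted_foliations F hπ hP
  have hψn (n : ℕ) : ∀ x, (ψ ^ n) x ∈ F.sing ↔ x ∈ F.sing := by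
    induction n with
    | zero => exact fun x => Iff.rfl
    | succ n ih =>
      intro x
      rw [pow_succ]
      exact (ih (ψ x)).trans (hψ x)
  have hc (x : S) : ContinuousAt π x := hπ.continuous.continuousAt
  refine ⟨F', hsing, ?_, ?_, lam ^ n, one_lt_pow₀ hlam hn.ne', ?_⟩
  · rw [hsing]
    ext y
    rw [← Ψ.preimage_symm, mem_preimage, mem_preimage, ← hψn n, ← hΨ, Ψ.apply_symm_apply]
    rfl
  · rw [hcharts]
    rintro g hg d ⟨e, he, hd⟩ d' ⟨e', he', hd'⟩ x hx hx'
    have h3 := eventuallyEq_of_lift hd hx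
    have h4 := g.continuous.continuousAt.eventually
      (eventuallyEq_of_lift hd' hx')
    have h5 : (fun y => e' (π y)) =ᶠ[𝓝 x] fun y => d' (g y) := by
      filter_upwards [h4] with y hy
      rw [← hy, hπ.map_eq hg]
    obtain ⟨h1, h2⟩ := F.compatible e he e' he' (π x)
      ⟨(hd x hx).1, by rw [← hπ.map_eq hg]; exact (hd' _ hx').1⟩
    exact ⟨(h1.comp (hc x)).congr (h3.fun_comp Complex.re) (h5.fun_comp Complex.re),
      (h2.comp (hc x)).congr (h3.fun_comp Complex.im) (h5.fun_comp Complex.im)⟩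
  · rw [hcharts]
    rintro d ⟨e, he, hd⟩ d' ⟨e', he', hd'⟩ x hx hx'
    have h3 := eventuallyEq_of_lift hd hx
    have h4 := Ψ.continuous.continuousAt.eventually
      (eventuallyEq_of_lift hd' hx')
    have h5 : (fun y => e' ((ψ ^ n) (π y))) =ᶠ[𝓝 x] fun y => d' (Ψ y) := by
      filter_upwards [h4] with y hy
      rw [← hy, hΨ]
    obtain ⟨h1, h2⟩ := scalesBy_pow F hψ h n e he e' he' (π x) (hd x hx).1
      (by rw [← hΨ]; exact (hd' _ hx').1)
    exact ⟨(h1.comp (hc x)).congr (h3.fun_comp Complex.re) (h5.fun_comp Complex.re),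
      (h2.comp (hc x)).congr (h3.fun_comp Complex.im) (h5.fun_comp Complex.im)⟩

end Lifted

/-! ### Smoothness of a metric pulled back by coordinates. -/

section FlatMetric

theorem contDiff_bilinearComp_self {E : Type*} [NormedAddCommGroup E] [NormedSpace ℝ E]
    (J : E →L[ℝ] E →L[ℝ] ℝ) {n : WithTop ℕ∞} :
    ContDiff ℝ n fun L : E →L[ℝ] E => J.bilinearComp L L := by
  have h3 : ContDiff ℝ n fun L : E →L[ℝ] E => J.comp L := contDiff_const.clm_comp contDiff_id
  have h4 : ContDiff ℝ n fun L : E →L[ℝ] E => (ContinuousLinearMap.compL ℝ E E ℝ).flip L :=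
    ContinuousLinearMap.contDiff _
  exact h4.clm_comp h3

variable {N : Type*} [TopologicalSpace N] [ChartedSpace (EuclideanSpace ℝ (Fin 3)) N]
  [IsManifold (𝓡 3) ∞ N]

local notation "E3" => EuclideanSpace ℝ (Fin 3)

/-- The derivative of a coordinate system. -/
def coordDeriv (κ : N → E3) (x : N) : TangentSpace (𝓡 3) x →L[ℝ] E3 := mfderiv (𝓡 3) (𝓡 3) κ x

theorem inCoordinates_tangent_model {x₀ x : N}
    (hx : x ∈ (trivializationAt E3 (TangentSpace (𝓡 3) : N → Type _) x₀).baseSet) (y₀ y : E3)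
    (ϕ : TangentSpace (𝓡 3) x →L[ℝ] TangentSpace (𝓡 3) y) (v : E3) :
    ContinuousLinearMap.inCoordinates E3 (TangentSpace (𝓡 3)) E3 (TangentSpace (𝓡 3)) x₀ x y₀ y ϕ v =
      ϕ ((trivializationAt E3 (TangentSpace (𝓡 3) : N → Type _) x₀).symm x v) := by
  rw [ContinuousLinearMap.inCoordinates_eq hx (by
    rw [TangentBundle.trivializationAt_baseSet, chartAt_self_eq]
    trivial)]
  simp
  rfl

/-- The pull-back of the Euclidean metric by a smooth map is smooth. -/
theorem contMDiffAt_pullback_metric {κ : N → E3} {x₀ : N} (hκ : ContMDiffAt (𝓡 3) (𝓡 3) ∞ κ x₀)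
    (g : ∀ x : N, TangentSpace (𝓡 3) x →L[ℝ] TangentSpace (𝓡 3) x →L[ℝ] ℝ)
    (hg : ∀ᶠ x in 𝓝 x₀, ∀ v w : TangentSpace (𝓡 3) x,
      g x v w = inner ℝ (coordDeriv κ x v) (coordDeriv κ x w)) :
    ContMDiffAt (𝓡 3) ((𝓡 3).prod 𝓘(ℝ, E3 →L[ℝ] E3 →L[ℝ] ℝ)) ∞
      (fun b => Bundle.TotalSpace.mk' (E3 →L[ℝ] E3 →L[ℝ] ℝ) (E := fun x : N =>
        TangentSpace (𝓡 3) x →L[ℝ] TangentSpace (𝓡 3) x →L[ℝ] ℝ) b (g b)) x₀ := by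
  rw [contMDiffAt_hom_bundle]
  refine ⟨contMDiffAt_id, ?_⟩
  -- The derivative of `κ` in a trivialization of the tangent bundle is a smooth matrix function
  -- `B`, and the metric is the smooth quadratic expression `J (B ·) (B ·)`.
  let B : N → (E3 →L[ℝ] E3) := inTangentCoordinates (𝓡 3) (𝓡 3) id κ (mfderiv (𝓡 3) (𝓡 3) κ) x₀
  have hB : ContMDiffAt (𝓡 3) 𝓘(ℝ, E3 →L[ℝ] E3) ∞ B x₀ := hκ.mfderiv_const (by simp)
  let J : E3 →L[ℝ] E3 →L[ℝ] ℝ := innerSL ℝ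
  have h1 : ContMDiffAt (𝓡 3) 𝓘(ℝ, E3 →L[ℝ] E3 →L[ℝ] ℝ) ∞
      (fun x => J.bilinearComp (B x) (B x)) x₀ := by
    have h2 := contDiff_bilinearComp_self J (n := ∞)
    exact ContMDiffAt.comp (g := fun L : E3 →L[ℝ] E3 => J.bilinearComp L L) (f := B) x₀
      h2.contMDiff.contMDiffAt hB
  refine h1.congr_of_eventuallyEq ?_
  filter_upwards [hg, (chartAt E3 x₀).open_source.mem_nhds (mem_chart_source E3 x₀)] with x hx hxs
  have hbase : x ∈ (trivializationAt E3 (TangentSpace (𝓡 3) : N → Type _) x₀).baseSet := by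
    rwa [TangentBundle.trivializationAt_baseSet]
  have hBx (v : E3) : B x v = coordDeriv κ x
      ((trivializationAt E3 (TangentSpace (𝓡 3) : N → Type _) x₀).symm x v) := by
    exact inCoordinates_tangent_model hbase _ _ (mfderiv (𝓡 3) (𝓡 3) κ x) v
  ext v w
  rw [inCoordinates_apply_eq₂ hbase hbase (by simp)]
  simp only [ContinuousLinearMap.bilinearComp_apply]
  change _ = inner ℝ (B x v) (B x w)
  rw [hBx, hBx, ← hx]
  simp

end FlatMetric

/-! ### Partial hyperbolicity from diagonal coordinates. -/

section FlatHyperbolic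

variable {N : Type*} [TopologicalSpace N] [ChartedSpace (EuclideanSpace ℝ (Fin 3)) N]

local notation "E3" => EuclideanSpace ℝ (Fin 3)

/-- Differentiate the relation `κ' i = a * κ i + b`. -/
theorem coordDeriv_of_scalesBy {κ κ' : N → E3} {x : N} {c : ℝ} {i : Fin 3}
    (hκ : MDifferentiableAt (𝓡 3) (𝓡 3) κ x) (hκ' : MDifferentiableAt (𝓡 3) (𝓡 3) κ' x)
    (h : ScalesBy c (fun y => κ y i) (fun y => κ' y i) x) :
    ∃ a : ℝ, |a| = c ∧ ∀ v, coordDeriv κ' x v i = a * coordDeriv κ x v i := by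
  obtain ⟨a, b, ha, h⟩ := h
  have key {k : N → E3} (hk : MDifferentiableAt (𝓡 3) (𝓡 3) k x) :
      HasMFDerivAt (𝓡 3) 𝓘(ℝ, ℝ) (fun y => k y i) x
        ((EuclideanSpace.proj i : E3 →L[ℝ] ℝ).comp (coordDeriv k x)) :=
    HasMFDerivAt.comp (g := (EuclideanSpace.proj i : E3 →L[ℝ] ℝ)) (f := k) x
      (EuclideanSpace.proj i : E3 →L[ℝ] ℝ).hasFDerivAt.hasMFDerivAt hk.hasMFDerivAt
  have haff : HasFDerivAt (fun t : ℝ => a * t + b) (a • ContinuousLinearMap.id ℝ ℝ) (κ x i) :=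
    ((hasFDerivAt_id (κ x i)).const_mul a).add_const b
  have h1 := HasMFDerivAt.comp (g := fun t : ℝ => a * t + b) (f := fun y => κ y i) x
    haff.hasMFDerivAt (key hκ)
  have h2 := (key hκ').congr_of_eventuallyEq (f₁ := (fun t : ℝ => a * t + b) ∘ fun y => κ y i)
    (h.mono fun y hy => hy.symm)
  have h3 := hasMFDerivAt_unique h2 h1
  exact ⟨a, ha, fun v => congrArg (fun L => L v) h3⟩

theorem tangentBundle_mk_eq {x x' : N} (h : x' = x) (v : E3) :
    (⟨x', v⟩ : TangentBundle (𝓡 3) N) = ⟨x, v⟩ := by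
  subst h
  rfl

/-- Near a point, the coordinate vector fields of a coordinate system are continuous. -/
theorem exists_continuousOn_coordDeriv [IsManifold (𝓡 3) ∞ N] {κ : N → E3} {x₀ : N}
    (h : IsLocalDiffeomorphAt (𝓡 3) (𝓡 3) ∞ κ x₀) (w : E3) :
    ∃ U ∈ 𝓝 x₀, ∃ s : ∀ x : N, TangentSpace (𝓡 3) x,
      ContinuousOn (fun x => (⟨x, s x⟩ : TangentBundle (𝓡 3) N)) U ∧
      ∀ x ∈ U, coordDeriv κ x (s x) = w := by
  obtain ⟨Φ, hx₀, hΦ⟩ := h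
  have hleft {x : N} (hx : x ∈ Φ.source) : Φ.symm (Φ x) = x := Φ.left_inv hx
  let s : N → E3 := fun x => mfderivWithin (𝓡 3) (𝓡 3) Φ.symm Φ.target (Φ x) w
  have hu : UniqueMDiffOn (𝓡 3) Φ.target := Φ.open_target.uniqueMDiffOn
  have hΦs : ContinuousOn Φ Φ.source := Φ.contMDiffOn_toFun.continuousOn
  refine ⟨Φ.source, Φ.open_source.mem_nhds hx₀, s, ?_, fun x hx => ?_⟩
  · have h1 : ContinuousOn (tangentMapWithin (𝓡 3) (𝓡 3) Φ.symm Φ.target)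
        (Bundle.TotalSpace.proj ⁻¹' Φ.target) :=
      Φ.contMDiffOn_invFun.continuousOn_tangentMapWithin (by simp) hu
    have h2 : ContinuousOn (fun x => (tangentBundleModelSpaceHomeomorph (𝓡 3)).symm (Φ x, w))
        Φ.source :=
      (Homeomorph.continuous _).comp_continuousOn (hΦs.prodMk continuousOn_const)
    have h3 := h1.comp h2 fun x hx => Φ.map_source hx
    refine h3.congr fun x hx => ?_
    exact (tangentBundle_mk_eq (hleft hx) (s x)).symm
  · have hy : Φ x ∈ Φ.target := Φ.map_source hx
    have h1 : HasMFDerivAt (𝓡 3) (𝓡 3) Φ.symm (Φ x)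
        (mfderivWithin (𝓡 3) (𝓡 3) Φ.symm Φ.target (Φ x)) := by
      have := ((Φ.contMDiffOn_invFun (Φ x) hy).mdifferentiableWithinAt
        (by simp)).hasMFDerivWithinAt
      exact this.hasMFDerivAt (Φ.open_target.mem_nhds hy)
    have h2 : MDifferentiableAt (𝓡 3) (𝓡 3) κ x := by
      have := (Φ.contMDiffOn_toFun.contMDiffAt (Φ.open_source.mem_nhds hx)).mdifferentiableAt
        (by simp)
      exact this.congr_of_eventuallyEq (hΦ.eventuallyEq_of_mem (Φ.open_source.mem_nhds hx))
    have h3 : HasMFDerivAt (𝓡 3) (𝓡 3) κ (Φ.symm (Φ x)) (coordDeriv κ x) := by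
      rw [hleft hx]
      exact h2.hasMFDerivAt
    have h4 := HasMFDerivAt.comp (Φ x) h3 h1
    have h5 : (κ ∘ Φ.symm) =ᶠ[𝓝 (Φ x)] id := by
      filter_upwards [Φ.open_target.mem_nhds hy] with z hz
      exact (hΦ (Φ.map_target hz)).trans (Φ.right_inv hz)
    have h6 := (hasMFDerivAt_id (I := 𝓡 3) (Φ x)).congr_of_eventuallyEq h5
    exact congrArg (fun L => L w) (hasMFDerivAt_unique h4 h6)

/-- A diffeomorphism that in suitable local coordinates is a diagonal affine map, with a contracting,
a neutral and an expanding direction, is partially hyperbolic. -/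
theorem isPartiallyHyperbolic_of_flat [IsManifold (𝓡 3) ∞ N] (α : Diffeomorph (𝓡 3) (𝓡 3) N N ∞)
    (K : N → (N → E3) → Prop) (hex : ∀ x, ∃ κ, K x κ)
    (hdiff : ∀ x κ, K x κ → IsLocalDiffeomorphAt (𝓡 3) (𝓡 3) ∞ κ x)
    (hnear : ∀ x κ, K x κ → ∀ᶠ y in 𝓝 x, K y κ)
    (hcompat : ∀ x κ κ', K x κ → K x κ' → ∀ i, ScalesBy 1 (fun y => κ y i) (fun y => κ' y i) x)
    {lam : ℝ} (hlam : 1 < lam)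
    (hscale : ∀ x κ κ', K x κ → K (α x) κ' → ∀ i,
      ScalesBy (![lam⁻¹, 1, lam] i) (fun y => κ y i) (fun y => κ' (α y) i) x) :
    IsPartiallyHyperbolic α := by
  -- The chosen coordinates need not vary continuously with the point. Any two differ by signs and
  -- translations in each coordinate, so the coordinate lines and the pulled-back metric do not
  -- depend on the choice; they can be computed near `x₀` with the single system `κ x₀`.
  choose κ hκ using hex
  have hmd {x : N} {k : N → E3} (hk : K x k) : MDifferentiableAt (𝓡 3) (𝓡 3) k x :=
    (hdiff x k hk).mdifferentiableAt (by simp)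
  let A (x : N) : TangentSpace (𝓡 3) x ≃L[ℝ] E3 :=
    (hdiff x _ (hκ x)).mfderivToContinuousLinearEquiv (by simp)
  have hA (x : N) (v : TangentSpace (𝓡 3) x) : A x v = coordDeriv (κ x) x v := rfl
  have hcoord {x : N} {k : N → E3} (hk : K x k) (i : Fin 3) :
      ∃ a : ℝ, |a| = 1 ∧ ∀ v, coordDeriv k x v i = a * A x v i :=
    coordDeriv_of_scalesBy (hmd (hκ x)) (hmd hk) (hcompat x _ _ (hκ x) hk i)
  set μ : Fin 3 → ℝ := ![lam⁻¹, 1, lam] with hμ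
  have hμ0 (i : Fin 3) : 0 < μ i := by
    fin_cases i
    · exact inv_pos.2 (zero_lt_one.trans hlam)
    · exact zero_lt_one
    · exact zero_lt_one.trans hlam
  have hαd (x : N) : MDifferentiableAt (𝓡 3) (𝓡 3) α x := α.mdifferentiable (by simp) x
  have hstep (x : N) (i : Fin 3) : ∃ a : ℝ, |a| = μ i ∧
      ∀ v, A (α x) (mfderiv (𝓡 3) (𝓡 3) α x v) i = a * A x v i := by
    have h1 := hmd (hκ (α x))
    obtain ⟨a, ha, h⟩ := coordDeriv_of_scalesBy (κ' := κ (α x) ∘ α) (hmd (hκ x))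
      (h1.comp x (hαd x)) (hscale x _ _ (hκ x) (hκ (α x)) i)
    refine ⟨a, ha, fun v => ?_⟩
    rw [hA x, ← h v]
    have h2 : coordDeriv (κ (α x) ∘ α) x =
        (coordDeriv (κ (α x)) (α x)).comp (mfderiv (𝓡 3) (𝓡 3) α x) :=
      mfderiv_comp x h1 (hαd x)
    rw [h2]
    rfl
  have hiter (n : ℕ) (x : N) (i : Fin 3) : ∃ a : ℝ, |a| = μ i ^ n ∧
      ∀ v, A (α^[n] x) (mfderiv (𝓡 3) (𝓡 3) (α^[n]) x v) i = a * A x v i := by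
    induction n generalizing x with
    | zero =>
      refine ⟨1, by simp, fun v => ?_⟩
      have : mfderiv (𝓡 3) (𝓡 3) (α^[0]) x = ContinuousLinearMap.id ℝ _ := mfderiv_id
      rw [this, one_mul]
      rfl
    | succ n ih =>
      obtain ⟨a, ha, h⟩ := hstep x i
      obtain ⟨a', ha', h'⟩ := ih (α x)
      refine ⟨a' * a, by rw [abs_mul, ha, ha', pow_succ], fun v => ?_⟩
      have hd : MDifferentiableAt (𝓡 3) (𝓡 3) (α^[n]) (α x) := by
        have : ContMDiff (𝓡 3) (𝓡 3) ∞ (α^[n]) := by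
          clear ih ha' h' a'
          induction n with
          | zero => exact contMDiff_id
          | succ n ih => exact ih.comp α.contMDiff
        exact this.mdifferentiableAt (by simp)
      have h2 : mfderiv (𝓡 3) (𝓡 3) (α^[n] ∘ α) x =
          (mfderiv (𝓡 3) (𝓡 3) (α^[n]) (α x)).comp (mfderiv (𝓡 3) (𝓡 3) α x) :=
        mfderiv_comp x hd (hαd x)
      have h3 := h' (mfderiv (𝓡 3) (𝓡 3) α x v)
      rw [h v, ← mul_assoc] at h3
      refine Eq.trans ?_ h3
      exact congrArg (fun L => A (α^[n] (α x)) (L v) i) h2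
  let b (x : N) : Module.Basis (Fin 3) ℝ (TangentSpace (𝓡 3) x) :=
    (EuclideanSpace.basisFun (Fin 3) ℝ).toBasis.map (A x).symm.toLinearEquiv
  have hb (x : N) (i : Fin 3) : A x (b x i) = EuclideanSpace.single i 1 := by
    have : b x i = (A x).symm (EuclideanSpace.single i 1) := by simp [b]
    rw [this, ContinuousLinearEquiv.apply_symm_apply]
  let E (i : Fin 3) (x : N) : Submodule ℝ (TangentSpace (𝓡 3) x) := Submodule.span ℝ {b x i}
  have hE {i : Fin 3} {x : N} {v : TangentSpace (𝓡 3) x} :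
      v ∈ E i x ↔ ∀ j ≠ i, A x v j = 0 := by
    rw [Submodule.mem_span_singleton]
    constructor
    · rintro ⟨c, rfl⟩ j hj
      rw [map_smul, hb]
      simp [hj]
    · intro h
      refine ⟨A x v i, (A x).injective ?_⟩
      rw [map_smul, hb]
      ext j
      by_cases hj : j = i
      · subst hj
        simp
      · simp [hj, h j hj]
  have hnorm {i : Fin 3} {x : N} {v : TangentSpace (𝓡 3) x} (hv : v ∈ E i x) :
      ‖A x v‖ = |A x v i| := by
    rw [EuclideanSpace.norm_eq, Finset.sum_eq_single i (fun j _ hj => by simp [hE.1 hv j hj])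
      (by simp), Real.norm_eq_abs, sq_abs, Real.sqrt_sq_eq_abs]
  let J : E3 →L[ℝ] E3 →L[ℝ] ℝ := innerSL ℝ
  let Ac (x : N) : TangentSpace (𝓡 3) x →L[ℝ] E3 := coordDeriv (κ x) x
  let G (x : N) : TangentSpace (𝓡 3) x →L[ℝ] TangentSpace (𝓡 3) x →L[ℝ] ℝ :=
    (fun B : E3 →L[ℝ] E3 => J.bilinearComp B B) (Ac x)
  let g : Bundle.ContMDiffRiemannianMetric (𝓡 3) ∞ E3 (fun x : N => TangentSpace (𝓡 3) x) :=
    { inner := G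
      symm := fun x v w => real_inner_comm (A x w) (A x v)
      pos := fun x v hv => real_inner_self_pos.2 fun h => hv ((A x).map_eq_zero_iff.1 h)
      isVonNBounded := fun x => by
        refine ((NormedSpace.isVonNBounded_ball ℝ E3 1).image
          ((A x).symm : E3 →L[ℝ] TangentSpace (𝓡 3) x)).subset ?_
        intro v hv
        refine ⟨A x v, ?_, (A x).symm_apply_apply v⟩
        have h1 : inner ℝ (A x v) (A x v) < (1 : ℝ) := hv
        rw [real_inner_self_eq_norm_sq] at h1
        rw [mem_ball_zero_iff]
        nlinarith [norm_nonneg (A x v)]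
      contMDiff := fun x₀ => by
        refine contMDiffAt_pullback_metric (hdiff x₀ _ (hκ x₀)).contMDiffAt G ?_
        filter_upwards [hnear x₀ _ (hκ x₀)] with x hx v w
        change inner ℝ (A x v) (A x w) = _
        rw [PiLp.inner_apply, PiLp.inner_apply]
        refine Finset.sum_congr rfl fun i _ => ?_
        obtain ⟨a, ha, h⟩ := hcoord hx i
        have ha2 : a * a = 1 := by rw [← abs_mul_abs_self, ha, one_mul]
        rw [h v, h w]
        simp only [RCLike.inner_apply, conj_trivial]
        linear_combination (-(A x w i * A x v i)) * ha2 }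
  have hg (x : N) (v : TangentSpace (𝓡 3) x) : √(g.inner x v v) = ‖A x v‖ := by
    change √(inner ℝ (A x v) (A x v)) = _
    rw [real_inner_self_eq_norm_sq, Real.sqrt_sq (norm_nonneg _)]
  refine ⟨g, E, fun i x₀ => ?_, fun i x => ?_, fun x => ?_, fun i x => ?_, ?_⟩
  · obtain ⟨U, hU, s, hs, hs'⟩ := exists_continuousOn_coordDeriv (hdiff x₀ _ (hκ x₀))
      (EuclideanSpace.single i 1)
    refine ⟨U ∩ {x | K x (κ x₀)}, inter_mem hU (hnear x₀ _ (hκ x₀)), 1, fun _ => s,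
      fun _ => hs.mono inter_subset_left, fun x hx => ?_⟩
    have h1 := hs' x hx.1
    have h2 (j : Fin 3) (hj : j ≠ i) : A x (s x) j = 0 := by
      obtain ⟨a, ha, h⟩ := hcoord hx.2 j
      have h3 := h (s x)
      rw [h1] at h3
      have ha0 : a ≠ 0 := by
        rintro rfl
        simp at ha
      simpa [hj, ha0] using h3.symm
    have hs0 : s x ≠ 0 := by
      intro h0
      rw [h0, map_zero] at h1
      have := congrArg (fun v : E3 => v i) h1
      simp at this
    refine ⟨LinearIndependent.of_subsingleton (0 : Fin 1) hs0, ?_⟩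
    have h3 : range (fun _ : Fin 1 => s x) = {s x} := range_const
    rw [h3]
    have h4 : s x ∈ E i x := hE.2 h2
    obtain ⟨c, hc⟩ := Submodule.mem_span_singleton.1 h4
    have hc0 : c ≠ 0 := by
      rintro rfl
      exact hs0 (by rw [← hc, zero_smul])
    rw [← hc]
    exact Submodule.span_singleton_smul_eq (IsUnit.mk0 c hc0) _
  · intro h
    have h1 : b x i ∈ E i x := Submodule.mem_span_singleton_self _
    rw [h, Submodule.mem_bot] at h1
    exact (b x).ne_zero i h1
  · refine DirectSum.isInternal_submodule_of_iSupIndep_of_iSup_eq_top ?_ ?_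
    · exact (b x).linearIndependent.iSupIndep_span_singleton
    · rw [← Submodule.span_range_eq_iSup]
      exact (b x).span_eq
  · ext v
    rw [Submodule.mem_map]
    constructor
    · rintro ⟨u, hu, rfl⟩
      rw [hE] at hu ⊢
      intro j hj
      obtain ⟨a, -, h⟩ := hstep x j
      exact (h u).trans (by rw [hu j hj, mul_zero])
    · intro hv
      let B := α.mfderivToContinuousLinearEquiv (by simp) x
      refine ⟨B.symm v, ?_, B.apply_symm_apply v⟩
      rw [hE] at hv ⊢
      intro j hj
      obtain ⟨a, ha, h⟩ := hstep x j
      have h1 : A (α x) v j = a * A x (B.symm v) j := by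
        rw [← h]
        exact congrArg (fun w => A (α x) w j) (B.apply_symm_apply v).symm
      rw [hv j hj] at h1
      refine (mul_eq_zero.1 h1.symm).resolve_left ?_
      rintro rfl
      rw [abs_zero] at ha
      exact (hμ0 j).ne ha
  -- On unit vectors the norms after `n` steps are exactly `lam⁻¹ ^ n`, `1` and `lam ^ n`, so any
  -- `n` with `lam ^ n > 2` works.
  · obtain ⟨n, hn⟩ := pow_unbounded_of_one_lt 2 hlam
    have hn0 : 0 < n := by
      rcases Nat.eq_zero_or_pos n with rfl | h
      · norm_num at hn
      · exact h
    refine ⟨n, hn0, ?_⟩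
    have key {i : Fin 3} {x : N} {v : TangentSpace (𝓡 3) x} (hv : v ∈ E i x)
        (h1 : √(g.inner x v v) = 1) :
        √(g.inner (α^[n] x) (mfderiv (𝓡 3) (𝓡 3) (α^[n]) x v)
          (mfderiv (𝓡 3) (𝓡 3) (α^[n]) x v)) = μ i ^ n := by
      have h2 : mfderiv (𝓡 3) (𝓡 3) (α^[n]) x v ∈ E i (α^[n] x) := by
        rw [hE] at hv ⊢
        intro j hj
        obtain ⟨a, -, h⟩ := hiter n x j
        rw [h, hv j hj, mul_zero]
      obtain ⟨a, ha, h⟩ := hiter n x i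
      rw [hg, hnorm hv] at h1
      rw [hg, hnorm h2, h, abs_mul, h1, ha, mul_one]
    intro nrm D x vs hvs vc hvc vu hvu h1 h2 h3
    have e1 : nrm _ (D x vs) = lam⁻¹ ^ n := key hvs h1
    have e2 : nrm _ (D x vc) = 1 := (key hvc h2).trans (one_pow n)
    have e3 : nrm _ (D x vu) = lam ^ n := key hvu h3
    rw [e1, e2, e3, min_self, max_self, inv_pow]
    refine ⟨?_, by linarith⟩
    rw [mul_one, ← one_div]
    exact one_div_le_one_div_of_le two_pos hn.le

end FlatHyperbolic

/-! ### Extending a surface map to the 3-manifold. -/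

section Suspension

variable {M : Type*} [TopologicalSpace M] [ChartedSpace (EuclideanSpace ℝ (Fin 3)) M]
variable {S : Type*} [TopologicalSpace S] [ChartedSpace (EuclideanSpace ℝ (Fin 2)) S]
variable {𝓕 : SeifertFibration M} {ι : S → M} {q : S × ℝ → M} {φ φ' : S ≃ₜ S} {e : ℝ}

namespace IsNormalized

/-- Two parameters of the same point differ by an element of the return group and an isometry of
the time. -/
theorem exists_deck (h : IsNormalized 𝓕 ι q φ φ' e) {x x' : S} {t t' : ℝ}
    (ht : t ∈ Ioo (-1 : ℝ) 1) (ht' : t' ∈ Ioo (-1 : ℝ) 1) (heq : q (x, t) = q (x', t')) :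
    ∃ g ∈ 𝓕.returnGroup ι, ∃ a b : ℝ, |a| = 1 ∧ x' = g x ∧ t' = a * t + b ∧
      ∃ W : Set ℝ, IsOpen W ∧ t ∈ W ∧ ∀ y, ∀ s ∈ W, q (g y, a * s + b) = q (y, s) := by
  have he : |e| = 1 := by rcases h.sign with rfl | rfl <;> simp
  rcases h.exchange x x' t ht t' ht' heq with ⟨rfl, rfl⟩ | ⟨h0, rfl, rfl⟩ | ⟨h0, rfl, rfl⟩
  · exact ⟨1, Subgroup.one_mem _, 1, 0, abs_one, rfl, by ring, univ, isOpen_univ, mem_univ _,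
      fun y s _ => by rw [one_mul, add_zero]; rfl⟩
  · exact ⟨φ, h.mem, e, -e, he, rfl, by ring, Ioo 0 1, isOpen_Ioo, ⟨h0, ht.2⟩, fun y s hs => by
      rw [← h.eq_of_pos y s hs, mul_sub, mul_one, sub_eq_add_neg]⟩
  · exact ⟨φ', h.mem', e, e, he, rfl, by ring, Ioo (-1) 0, isOpen_Ioo, ⟨ht.1, h0⟩, fun y s hs => by
      rw [← h.eq_of_neg y s hs, mul_add, mul_one]⟩

theorem map_nhds (h : IsNormalized 𝓕 ι q φ φ' e) (z : S × ℝ) : map q (𝓝 z) = 𝓝 (q z) :=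
  IsLocalDiffeomorphAt.map_nhds (h.localDiffeo z)

theorem continuous (h : IsNormalized 𝓕 ι q φ φ' e) : Continuous q :=
  continuous_iff_continuousAt.2 fun z => (h.map_nhds z).le

theorem eventually_time {x : S} {t : ℝ} (ht : t ∈ Ioo (-1 : ℝ) 1) :
    ∀ᶠ z in 𝓝 (x, t), z.2 ∈ Ioo (-1 : ℝ) 1 :=
  continuous_snd.continuousAt.eventually_mem (isOpen_Ioo.mem_nhds ht)

/-- A map of the surface that commutes with the returns extends to the fibers. -/
theorem exists_map (h : IsNormalized 𝓕 ι q φ φ' e) {Ψ : S → S} (hΨ : Continuous Ψ)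
    (hcomm : ∀ g ∈ 𝓕.returnGroup ι, ∀ y, Ψ (g y) = g (Ψ y)) :
    ∃ f : M → M, Continuous f ∧ ∀ x, ∀ t ∈ Ioo (-1 : ℝ) 1, f (q (x, t)) = q (Ψ x, t) := by
  choose X T hT hq using h.exists_eq
  -- The parameters `X y`, `T y` are arbitrary choices. Another parameter differs by a gluing, and
  -- `Ψ` commutes with the gluings, so the value is the same.
  have hf (x : S) (t : ℝ) (ht : t ∈ Ioo (-1 : ℝ) 1) :
      q (Ψ (X (q (x, t))), T (q (x, t))) = q (Ψ x, t) := by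
    obtain ⟨g, hg, a, b, -, hx, htb, W, -, htW, hW⟩ := h.exists_deck ht (hT (q (x, t)))
      (hq (q (x, t))).symm
    rw [hx, htb, hcomm g hg, hW _ t htW]
  refine ⟨fun y => q (Ψ (X y), T y), continuous_iff_continuousAt.2 fun y => ?_, hf⟩
  obtain ⟨x, t, ht, rfl⟩ := h.exists_eq y
  -- As `q` is continuous and open, continuity can be tested on the parameters, where the map is
  -- `(x, t) ↦ q (Ψ x, t)`.
  rw [ContinuousAt, ← h.map_nhds, tendsto_map'_iff, hf x t ht]
  have h1 : ContinuousAt (fun z : S × ℝ => q (Ψ z.1, z.2)) (x, t) :=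
    (h.continuous.comp ((hΨ.comp continuous_fst).prodMk continuous_snd)).continuousAt
  refine Tendsto.congr' ?_ h1.tendsto
  filter_upwards [eventually_time ht] with z hz
  exact (hf z.1 z.2 hz).symm

theorem exists_homeomorph (h : IsNormalized 𝓕 ι q φ φ' e) (Ψ : S ≃ₜ S)
    (hcomm : ∀ g ∈ 𝓕.returnGroup ι, ∀ y, Ψ (g y) = g (Ψ y)) :
    ∃ f : M ≃ₜ M, ∀ x, ∀ t ∈ Ioo (-1 : ℝ) 1, f (q (x, t)) = q (Ψ x, t) := by
  obtain ⟨f, hfc, hf⟩ := h.exists_map Ψ.continuous hcomm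
  obtain ⟨f', hfc', hf'⟩ := h.exists_map Ψ.symm.continuous fun g hg y => by
    rw [Homeomorph.symm_apply_eq, hcomm g hg, Ψ.apply_symm_apply]
  refine ⟨⟨⟨f, f', fun y => ?_, fun y => ?_⟩, hfc, hfc'⟩, hf⟩
  · obtain ⟨x, t, ht, rfl⟩ := h.exists_eq y
    rw [hf x t ht, hf' _ t ht, Ψ.symm_apply_apply]
  · obtain ⟨x, t, ht, rfl⟩ := h.exists_eq y
    rw [hf' x t ht, hf _ t ht, Ψ.apply_symm_apply]

end IsNormalized

/-- The union of the fibers through the points of `Q`. -/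
def fiberUnion (q : S × ℝ → M) (Q : Set S) : Set M := q '' (Q ×ˢ Ioo (-1 : ℝ) 1)

namespace IsNormalized

variable {Q : Set S}

/-- Different parameters of a point have surface coordinates in one orbit, so for invariant `Q` any
parameter decides membership. -/
theorem mem_fiberUnion_iff (h : IsNormalized 𝓕 ι q φ φ' e)
    (hQ : ∀ g ∈ 𝓕.returnGroup ι, ∀ y, g y ∈ Q ↔ y ∈ Q) {x : S} {t : ℝ}
    (ht : t ∈ Ioo (-1 : ℝ) 1) : q (x, t) ∈ fiberUnion q Q ↔ x ∈ Q := by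
  constructor
  · rintro ⟨⟨x', t'⟩, ⟨hx', ht'⟩, heq⟩
    obtain ⟨g, hg, -, -, -, hx, -⟩ := h.exists_deck ht ht' heq.symm
    have hx'' : x' ∈ Q := hx'
    rwa [hx, hQ g hg] at hx''
  · exact fun hx => ⟨(x, t), ⟨hx, ht⟩, rfl⟩

theorem isClosed_fiberUnion [T1Space S] (h : IsNormalized 𝓕 ι q φ φ' e)
    (hQ : ∀ g ∈ 𝓕.returnGroup ι, ∀ y, g y ∈ Q ↔ y ∈ Q) (hfin : Q.Finite) :
    IsClosed (fiberUnion q Q) := by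
  rw [← isOpen_compl_iff, isOpen_iff_mem_nhds]
  intro y hy
  obtain ⟨x, t, ht, rfl⟩ := h.exists_eq y
  rw [mem_compl_iff, h.mem_fiberUnion_iff hQ ht] at hy
  rw [← h.map_nhds, mem_map]
  filter_upwards [eventually_time ht, continuous_fst.continuousAt.eventually_mem
    (hfin.isClosed.isOpen_compl.mem_nhds (show (x, t).1 ∈ Qᶜ from hy))] with z hz hz'
  change q (z.1, z.2) ∈ (fiberUnion q Q)ᶜ
  rw [mem_compl_iff, h.mem_fiberUnion_iff hQ hz]
  exact hz'

theorem image_fiberUnion {Ψ : S ≃ₜ S} (hΨ : Ψ '' Q = Q) {f : M ≃ₜ M}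
    (hf : ∀ x, ∀ t ∈ Ioo (-1 : ℝ) 1, f (q (x, t)) = q (Ψ x, t)) :
    f '' fiberUnion q Q = fiberUnion q Q := by
  ext y
  constructor
  · rintro ⟨_, ⟨⟨x, t⟩, ⟨hx, ht⟩, rfl⟩, rfl⟩
    rw [hf x t ht]
    exact ⟨(Ψ x, t), ⟨hΨ ▸ mem_image_of_mem Ψ hx, ht⟩, rfl⟩
  · rintro ⟨⟨x, t⟩, ⟨hx, ht⟩, rfl⟩
    rw [← hΨ] at hx
    obtain ⟨x', hx', rfl⟩ := hx
    exact ⟨q (x', t), ⟨(x', t), ⟨hx', ht⟩, rfl⟩, hf x' t ht⟩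

end IsNormalized

section Coordinates

local notation "E3" => EuclideanSpace ℝ (Fin 3)

/-- Coordinates of space that arrange a complex and a real number in the order `(re, t, im)`. -/
def spaceCoord : (ℂ × ℝ) ≃L[ℝ] E3 :=
  LinearEquiv.toContinuousLinearEquiv
    { toFun := fun z => !₂[z.1.re, z.2, z.1.im]
      invFun := fun v => (⟨v 0, v 2⟩, v 1)
      map_add' := fun z w => by
        ext i
        fin_cases i <;> simp
      map_smul' := fun c z => by
        ext i
        fin_cases i <;> simp
      left_inv := fun z => by simp
      right_inv := fun v => by
        ext i
        fin_cases i <;> simp }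

/-- Coordinates of space that arrange a complex and a real number in the order `(t, re, im)`. -/
def axisCoord : (ℂ × ℝ) ≃L[ℝ] E3 :=
  LinearEquiv.toContinuousLinearEquiv
    { toFun := fun z => !₂[z.2, z.1.re, z.1.im]
      invFun := fun v => (⟨v 1, v 2⟩, v 0)
      map_add' := fun z w => by
        ext i
        fin_cases i <;> simp
      map_smul' := fun c z => by
        ext i
        fin_cases i <;> simp
      left_inv := fun z => by simp
      right_inv := fun v => by
        ext i
        fin_cases i <;> simp }

theorem isLocalDiffeomorphAt_linear_prod (L : (ℂ × ℝ) ≃L[ℝ] E3) {d : S → ℂ} {x : S}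
    (hd : IsLocalDiffeomorphAt (𝓡 2) 𝓘(ℝ, ℂ) ∞ d x) (t : ℝ) :
    IsLocalDiffeomorphAt ((𝓡 2).prod 𝓘(ℝ, ℝ)) (𝓡 3) ∞ (fun z : S × ℝ => L (d z.1, z.2)) (x, t) := by
  have h1 := isLocalDiffeomorphAt_prodMap hd (isLocalDiffeomorphAt_id (I₁ := 𝓘(ℝ, ℝ)) t)
  have h2 : IsLocalDiffeomorphAt (𝓘(ℝ, ℂ).prod 𝓘(ℝ, ℝ)) (𝓡 3) ∞ L (d x, t) := by
    rw [← modelWithCornersSelf_prod, chartedSpaceSelf_prod]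
    exact isLocalDiffeomorphAt_continuousLinearEquiv L (d x, t)
  exact isLocalDiffeomorphAt_comp (f := Prod.map d id) (g := L) h2 h1

theorem exists_complex_coordinate [IsManifold (𝓡 2) ∞ S] (x : S) :
    ∃ c : S → ℂ, IsLocalDiffeomorphAt (𝓡 2) 𝓘(ℝ, ℂ) ∞ c x ∧ c x = 0 := by
  let L : EuclideanSpace ℝ (Fin 2) ≃L[ℝ] ℂ := Complex.orthonormalBasisOneI.repr.symm.toContinuousLinearEquiv
  have h1 := extChartAt_isLocalDiffeomorphAt (I := 𝓡 2) x (mem_extChartAt_source (I := 𝓡 2) x)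
  have h2 := isLocalDiffeomorphAt_comp (isLocalDiffeomorphAt_continuousLinearEquiv L _) h1
  set c := L ∘ extChartAt (𝓡 2) x
  have h3 : IsLocalDiffeomorphAt 𝓘(ℝ, ℂ) 𝓘(ℝ, ℂ) ∞ (fun w : ℂ => w - c x) (c x) :=
    isLocalDiffeomorphAt_of_contDiffOn isOpen_univ (contDiff_id.sub contDiff_const).contDiffOn
      (mem_univ _) (ContinuousLinearEquiv.refl ℝ ℂ) ((hasFDerivAt_id _).sub_const _)
  exact ⟨_, isLocalDiffeomorphAt_comp h3 h2, sub_self _⟩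

variable [IsManifold (𝓡 3) ∞ M]

theorem exists_mem_maximalAtlas {k : M → E3} {y : M}
    (hk : IsLocalDiffeomorphAt (𝓡 3) (𝓡 3) ∞ k y) {W : Set M} (hW : W ∈ 𝓝 y) :
    ∃ c ∈ IsManifold.maximalAtlas (𝓡 3) ∞ M, y ∈ c.source ∧ c.source ⊆ W ∧
      ∀ z ∈ c.source, c z = k z := by
  obtain ⟨Φ, hy, hΦ⟩ := hk
  obtain ⟨V, hVW, hV, hyV⟩ := mem_nhds_iff.1 hW
  let Φ' := restrPartialDiffeomorph Φ V hV
  refine ⟨Φ'.toOpenPartialHomeomorph, ?_, ⟨hy, hyV⟩, fun z hz => hVW hz.2, fun z hz => ?_⟩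
  · exact OpenPartialHomeomorph.mem_maximalAtlas_of_contMDiffOn _ Φ'.contMDiffOn_toFun
      Φ'.contMDiffOn_invFun
  · exact (hΦ hz.1).symm

theorem IsNormalized.isEmbeddedOneManifold_fiberUnion [T1Space S] [IsManifold (𝓡 2) ∞ S] {Q : Set S}
    (h : IsNormalized 𝓕 ι q φ φ' e) (hQ : ∀ g ∈ 𝓕.returnGroup ι, ∀ y, g y ∈ Q ↔ y ∈ Q)
    (hfin : Q.Finite) : IsEmbeddedOneManifold (fiberUnion q Q) := by
  refine ⟨h.isClosed_fiberUnion hQ hfin, ?_⟩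
  rintro _ ⟨⟨x, t⟩, ⟨hx, ht⟩, rfl⟩
  obtain ⟨c, hc, hcx⟩ := exists_complex_coordinate x
  obtain ⟨V, hV, hinj⟩ := IsLocalDiffeomorphAt.exists_injOn hc
  have hq := h.localDiffeo (x, t)
  let k : M → E3 := fun y => axisCoord (c (hq.localInverse y).1, (hq.localInverse y).2)
  have hleft : ∀ᶠ z in 𝓝 (x, t), hq.localInverse (q z) = z := hq.localInverse_eventuallyEq_left
  have hk : IsLocalDiffeomorphAt (𝓡 3) (𝓡 3) ∞ k (q (x, t)) := by
    refine isLocalDiffeomorphAt_of_comp hq (isLocalDiffeomorphAt_linear_prod axisCoord hc t) ?_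
    filter_upwards [hleft] with z hz
    simp only [k]
    rw [hz]
  -- Near `x` the finite set `Q` has no other point. In the coordinates `(t, re c, im c)` the union
  -- of fibers is then the axis where the last two vanish.
  have hV' : V ∩ (Q \ {x})ᶜ ∈ 𝓝 x :=
    inter_mem hV ((hfin.subset sdiff_subset).isClosed.isOpen_compl.mem_nhds (by simp))
  have hW : ∀ᶠ y in 𝓝 (q (x, t)), y ∈ fiberUnion q Q ↔ k y 1 = 0 ∧ k y 2 = 0 := by
    rw [← h.map_nhds, eventually_map]
    have hV'' : ∀ᶠ z in 𝓝 (x, t), z.1 ∈ V ∩ (Q \ {x})ᶜ :=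
      continuous_fst.continuousAt.eventually_mem (x := (x, t)) hV'
    filter_upwards [hleft, IsNormalized.eventually_time ht, hV''] with z hz hzt hzV
    have e1 : k (q z) = axisCoord (c z.1, z.2) := by
      simp only [k]
      rw [hz]
    have e2 : k (q z) 1 = (c z.1).re := by rw [e1]; rfl
    have e3 : k (q z) 2 = (c z.1).im := by rw [e1]; rfl
    have e4 : q z ∈ fiberUnion q Q ↔ z.1 ∈ Q := h.mem_fiberUnion_iff hQ hzt
    rw [e2, e3, e4]
    constructor
    · intro hzQ
      have : z.1 = x := by
        by_contra hne
        exact hzV.2 ⟨hzQ, hne⟩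
      rw [this, hcx]
      exact ⟨rfl, rfl⟩
    · intro h0
      have h1 : c z.1 = c x := by rw [hcx]; exact Complex.ext h0.1 h0.2
      rw [hinj hzV.1 (mem_of_mem_nhds hV) h1]
      exact hx
  obtain ⟨c', hc', hy, hsub, heq⟩ := exists_mem_maximalAtlas hk hW
  refine ⟨c', hc', hy, fun y hy => ?_⟩
  rw [heq y hy]
  exact hsub hy

end Coordinates

end Suspension

/-! ### Flat coordinates and the partially pseudo-Anosov homeomorphism. -/

section FlatCoordinates

variable {M : Type*} [TopologicalSpace M] [ChartedSpace (EuclideanSpace ℝ (Fin 3)) M]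
variable {S : Type*} [TopologicalSpace S] [ChartedSpace (EuclideanSpace ℝ (Fin 2)) S]
variable {𝓕 : SeifertFibration M} {ι : S → M} {q : S × ℝ → M} {φ φ' : S ≃ₜ S} {e : ℝ}

local notation "E3" => EuclideanSpace ℝ (Fin 3)

theorem ScalesBy.of_map {X Y : Type*} [TopologicalSpace X] [TopologicalSpace Y] {c : ℝ}
    {u v : X → ℝ} {p : Y → X} {y : Y} (h : ScalesBy c (fun z => u (p z)) (fun z => v (p z)) y)
    (hp : map p (𝓝 y) = 𝓝 (p y)) : ScalesBy c u v (p y) := by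
  obtain ⟨a, b, ha, h⟩ := h
  refine ⟨a, b, ha, ?_⟩
  rw [← hp]
  exact h

/-- Local coordinates given by the natural coordinates of the foliations of the surface and the
time. -/
def IsFlatCoord (q : S × ℝ → M) (charts : Set (OpenPartialHomeomorph S ℂ)) (y : M) (κ : M → E3) :
    Prop :=
  ∃ d ∈ charts, ∃ x ∈ d.source, ∃ t ∈ Ioo (-1 : ℝ) 1, q (x, t) = y ∧
    ∀ᶠ z in 𝓝 (x, t), κ (q z) = spaceCoord (d z.1, z.2)

theorem isLocalDiffeomorphAt_diagonal (a b : Fin 3 → ℝ) (ha : ∀ i, a i ≠ 0) (v : E3) :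
    IsLocalDiffeomorphAt (𝓡 3) (𝓡 3) ∞ (fun v : E3 => WithLp.toLp 2 fun i => a i * v i + b i) v := by
  let L : E3 ≃L[ℝ] E3 := LinearEquiv.toContinuousLinearEquiv
    { toFun := fun v => WithLp.toLp 2 fun i => a i * v i
      invFun := fun v => WithLp.toLp 2 fun i => (a i)⁻¹ * v i
      map_add' := fun v w => by
        ext i
        simp [mul_add]
      map_smul' := fun c v => by
        ext i
        simp [mul_left_comm]
      left_inv := fun v => by
        ext i
        simp [ha i]
      right_inv := fun v => by
        ext i
        simp [ha i] }
  have h1 : (fun v : E3 => (WithLp.toLp 2 fun i => a i * v i + b i : E3)) =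
      fun v => L v + WithLp.toLp 2 b := by
    funext v
    rfl
  rw [h1]
  exact isLocalDiffeomorphAt_of_contDiffOn isOpen_univ (L.contDiff.add contDiff_const).contDiffOn
    (mem_univ v) L (L.hasFDerivAt.add_const _)

namespace IsNormalized

variable {F : TransverseFoliations (id : S → S) ∅}

theorem exists_isFlatCoord (h : IsNormalized 𝓕 ι q φ φ' e) {x : S} (hx : x ∉ F.sing) {t : ℝ}
    (ht : t ∈ Ioo (-1 : ℝ) 1) : ∃ κ, IsFlatCoord q F.charts (q (x, t)) κ := by
  obtain ⟨d, hd, hxd⟩ := F.exists_chart x hx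
  have hq := h.localDiffeo (x, t)
  refine ⟨fun y => spaceCoord (d (hq.localInverse y).1, (hq.localInverse y).2), d, hd, x, hxd, t,
    ht, rfl, ?_⟩
  filter_upwards [hq.localInverse_eventuallyEq_left] with z hz
  have hz' : hq.localInverse (q z) = z := hz
  rw [hz']

theorem isLocalDiffeomorphAt_of_isFlatCoord (h : IsNormalized 𝓕 ι q φ φ' e) {y : M} {κ : M → E3}
    (hκ : IsFlatCoord q F.charts y κ) : IsLocalDiffeomorphAt (𝓡 3) (𝓡 3) ∞ κ y := by
  obtain ⟨d, hd, x, hx, t, -, rfl, hκ⟩ := hκ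
  exact isLocalDiffeomorphAt_of_comp (h.localDiffeo _)
    (isLocalDiffeomorphAt_linear_prod spaceCoord (F.smooth d hd x hx) t) hκ

theorem eventually_isFlatCoord (h : IsNormalized 𝓕 ι q φ φ' e) {y : M} {κ : M → E3}
    (hκ : IsFlatCoord q F.charts y κ) : ∀ᶠ y' in 𝓝 y, IsFlatCoord q F.charts y' κ := by
  obtain ⟨d, hd, x, hx, t, ht, rfl, hκ⟩ := hκ
  rw [← h.map_nhds, eventually_map]
  have h1 : ∀ᶠ z in 𝓝 (x, t), z.1 ∈ d.source :=
    continuous_fst.continuousAt.eventually_mem (x := (x, t)) (d.open_source.mem_nhds hx)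
  filter_upwards [eventually_eventually_nhds.2 hκ, h1, eventually_time ht] with z hz hz1 hz2
  exact ⟨d, hd, z.1, hz1, z.2, hz2, rfl, hz⟩

/-- In the flat coordinates the map of the `3`-manifold that is induced by a map of the surface is
a diagonal affine map. -/
theorem scalesBy_isFlatCoord (h : IsNormalized 𝓕 ι q φ φ' e)
    (hG : ∀ g ∈ 𝓕.returnGroup ι, ∀ d ∈ F.charts, ∀ d' ∈ F.charts, ∀ x ∈ d.source, g x ∈ d'.source →
        ScalesBy 1 (fun y => (d y).re) (fun y => (d' (g y)).re) x ∧
        ScalesBy 1 (fun y => (d y).im) (fun y => (d' (g y)).im) x)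
    {Ψ : S ≃ₜ S} (hsing : ∀ x, Ψ x ∈ F.sing ↔ x ∈ F.sing) {c c' : ℝ}
    (hΨ : ∀ d ∈ F.charts, ∀ d' ∈ F.charts, ∀ x ∈ d.source, Ψ x ∈ d'.source →
        ScalesBy c (fun y => (d y).re) (fun y => (d' (Ψ y)).re) x ∧
        ScalesBy c' (fun y => (d y).im) (fun y => (d' (Ψ y)).im) x)
    {f : M → M} (hf : ∀ x, ∀ t ∈ Ioo (-1 : ℝ) 1, f (q (x, t)) = q (Ψ x, t)) {y : M} {κ κ' : M → E3}
    (hκ : IsFlatCoord q F.charts y κ) (hκ' : IsFlatCoord q F.charts (f y) κ') (i : Fin 3) :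
    ScalesBy (![c, 1, c'] i) (fun z => κ z i) (fun z => κ' (f z) i) y := by
  obtain ⟨d, hd, x, hx, t, ht, rfl, hκ⟩ := hκ
  obtain ⟨d', hd', x', hx', t', ht', heq, hκ'⟩ := hκ'
  rw [hf x t ht] at heq
  -- The image point has the parameter `(Ψ x, t)`, while `κ'` is given at a possibly different
  -- parameter. They differ by a gluing, whose surface part preserves both measures and whose time
  -- part has slope `a = ± 1`.
  obtain ⟨g, hg, a, b, ha, rfl, rfl, W, hW, htW, hdeck⟩ := h.exists_deck ht ht' heq.symm
  have hxs : Ψ x ∉ F.sing := by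
    rw [hsing]
    exact Set.disjoint_left.1 (F.source_disjoint d hd) hx
  obtain ⟨d₁, hd₁, hx₁⟩ := F.exists_chart (Ψ x) hxs
  obtain ⟨h1, h2⟩ := hΨ d hd d₁ hd₁ x hx hx₁
  obtain ⟨h3, h4⟩ := hG g hg d₁ hd₁ d' hd' (Ψ x) hx₁ hx'
  have h5 := h1.trans (h3.comp Ψ.continuous.continuousAt)
  have h6 := h2.trans (h4.comp Ψ.continuous.continuousAt)
  rw [mul_one] at h5 h6
  have hc : ContinuousAt (fun z : S × ℝ => (g (Ψ z.1), a * z.2 + b)) (x, t) :=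
    ((g.continuous.comp (Ψ.continuous.comp continuous_fst)).prodMk
      ((continuous_const.mul continuous_snd).add continuous_const)).continuousAt
  have hWe : ∀ᶠ z in 𝓝 (x, t), z.2 ∈ W :=
    continuous_snd.continuousAt.eventually_mem (x := (x, t)) (hW.mem_nhds htW)
  have hev : ∀ᶠ z in 𝓝 (x, t), κ' (f (q z)) = spaceCoord (d' (g (Ψ z.1)), a * z.2 + b) := by
    filter_upwards [hc.eventually hκ', hWe, eventually_time ht] with z h7 h8 h9
    have h10 : f (q z) = q (Ψ z.1, z.2) := hf z.1 z.2 h9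
    rw [h10, ← hdeck _ z.2 h8]
    exact h7
  refine ScalesBy.of_map (p := q) ?_ (h.map_nhds _)
  have hfst : ContinuousAt (Prod.fst : S × ℝ → S) (x, t) := continuous_fst.continuousAt
  have hu (i : Fin 3) : (fun z : S × ℝ => spaceCoord (d z.1, z.2) i) =ᶠ[𝓝 (x, t)]
      fun z => κ (q z) i := hκ.mono fun z hz => by beta_reduce; rw [hz]
  have hv (i : Fin 3) : (fun z : S × ℝ => spaceCoord (d' (g (Ψ z.1)), a * z.2 + b) i) =ᶠ[𝓝 (x, t)]
      fun z => κ' (f (q z)) i := hev.mono fun z hz => by beta_reduce; rw [hz]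
  refine ScalesBy.congr ?_ (hu i) (hv i)
  fin_cases i
  · exact h5.comp (p := Prod.fst) hfst
  · exact ⟨a, b, ha, Eventually.of_forall fun z => rfl⟩
  · exact h6.comp (p := Prod.fst) hfst

/-- The homeomorphism of the `3`-manifold that is induced by a pseudo-Anosov map of the surface is
partially pseudo-Anosov. -/
theorem isPartiallyPseudoAnosov [T1Space S] [IsManifold (𝓡 2) ∞ S] [IsManifold (𝓡 3) ∞ M]
    (h : IsNormalized 𝓕 ι q φ φ' e)
    (hG : ∀ g ∈ 𝓕.returnGroup ι, ∀ d ∈ F.charts, ∀ d' ∈ F.charts, ∀ x ∈ d.source, g x ∈ d'.source →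
        ScalesBy 1 (fun y => (d y).re) (fun y => (d' (g y)).re) x ∧
        ScalesBy 1 (fun y => (d y).im) (fun y => (d' (g y)).im) x)
    (hQ : ∀ g ∈ 𝓕.returnGroup ι, ∀ y, g y ∈ F.sing ↔ y ∈ F.sing)
    {Ψ : S ≃ₜ S} (hsing : Ψ '' F.sing = F.sing) {lam : ℝ} (hlam : 1 < lam)
    (hΨ : ∀ d ∈ F.charts, ∀ d' ∈ F.charts, ∀ x ∈ d.source, Ψ x ∈ d'.source →
        ScalesBy lam⁻¹ (fun y => (d y).re) (fun y => (d' (Ψ y)).re) x ∧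
        ScalesBy lam (fun y => (d y).im) (fun y => (d' (Ψ y)).im) x)
    {f : M ≃ₜ M} (hf : ∀ x, ∀ t ∈ Ioo (-1 : ℝ) 1, f (q (x, t)) = q (Ψ x, t)) :
    IsPartiallyPseudoAnosov f := by
  have hsing' (x : S) : Ψ x ∈ F.sing ↔ x ∈ F.sing := by
    conv_lhs => rw [← hsing]
    exact Ψ.injective.mem_set_image
  have hC := h.isEmbeddedOneManifold_fiberUnion hQ F.finite_sing
  have hfC := image_fiberUnion hsing hf
  refine ⟨fiberUnion q F.sing, hC, hfC, ?_⟩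
  intro U
  have hU (y : M) : f y ∈ U ↔ y ∈ U := by
    change f y ∈ (fiberUnion q F.sing)ᶜ ↔ y ∈ (fiberUnion q F.sing)ᶜ
    rw [mem_compl_iff, mem_compl_iff]
    conv_lhs => rw [← hfC]
    rw [f.injective.mem_set_image]
  have hex (y : M) (hy : y ∈ U) : ∃ κ, IsFlatCoord q F.charts y κ := by
    obtain ⟨x, t, ht, rfl⟩ := h.exists_eq y
    have hy' : q (x, t) ∉ fiberUnion q F.sing := hy
    rw [h.mem_fiberUnion_iff hQ ht] at hy'
    exact h.exists_isFlatCoord hy' ht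
  have hlam0 : 0 < lam := zero_lt_one.trans hlam
  -- Off the singular fibers `f` is a diagonal affine map with nonzero factors between flat
  -- coordinates, hence a local diffeomorphism, although `Ψ` is only a homeomorphism of `S`.
  have hloc (y : M) (hy : y ∈ U) : IsLocalDiffeomorphAt (𝓡 3) (𝓡 3) ∞ f y := by
    obtain ⟨κ, hκ⟩ := hex y hy
    obtain ⟨κ', hκ'⟩ := hex (f y) ((hU y).2 hy)
    have h1 := h.scalesBy_isFlatCoord hG hsing' hΨ hf hκ hκ'
    choose a b ha hab using h1
    have ha0 (i : Fin 3) : a i ≠ 0 := by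
      intro h0
      have h2 := ha i
      rw [h0, abs_zero] at h2
      fin_cases i
      · exact (inv_pos.2 hlam0).ne h2
      · exact zero_ne_one h2
      · exact hlam0.ne h2
    refine isLocalDiffeomorphAt_of_comp_left (h.isLocalDiffeomorphAt_of_isFlatCoord hκ')
      (isLocalDiffeomorphAt_comp (isLocalDiffeomorphAt_diagonal a b ha0 (κ y))
        (h.isLocalDiffeomorphAt_of_isFlatCoord hκ)) f.continuous.continuousAt ?_
    filter_upwards [hab 0, hab 1, hab 2] with z h0 h1 h2
    ext i
    fin_cases i
    · exact h0
    · exact h1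
    · exact h2
  have hloc' (y : M) (hy : y ∈ U) : IsLocalDiffeomorphAt (𝓡 3) (𝓡 3) ∞ f.symm (f y) :=
    isLocalDiffeomorphAt_of_comp (hloc y hy) (isLocalDiffeomorphAt_id y)
      (Eventually.of_forall f.symm_apply_apply)
  have hU' (y : M) (hy : y ∈ U) : f.symm y ∈ U := by
    rw [← hU, f.apply_symm_apply]
    exact hy
  let α : Diffeomorph (𝓡 3) (𝓡 3) U U ∞ :=
    { toFun := fun y => ⟨f y, (hU y).2 y.2⟩
      invFun := fun y => ⟨f.symm y, hU' y y.2⟩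
      left_inv := fun y => Subtype.ext (f.symm_apply_apply y)
      right_inv := fun y => Subtype.ext (f.apply_symm_apply y)
      contMDiff_toFun := fun y => contMDiffAt_opens_iff.2
        ((hloc y y.2).contMDiffAt.comp y contMDiff_subtype_val.contMDiffAt)
      contMDiff_invFun := fun y => by
        refine contMDiffAt_opens_iff.2 ?_
        have h1 := (hloc' _ (hU' y y.2)).contMDiffAt
        rw [f.apply_symm_apply] at h1
        exact h1.comp y contMDiff_subtype_val.contMDiffAt }
  refine ⟨α, fun _ => rfl, ?_⟩
  have hval (y : U) : ContinuousAt (Subtype.val : U → M) y := continuous_subtype_val.continuousAt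
  refine isPartiallyHyperbolic_of_flat α
    (fun y κ => ∃ κ' : M → E3, κ = κ' ∘ Subtype.val ∧ IsFlatCoord q F.charts y κ') ?_ ?_ ?_ ?_ hlam ?_
  · intro y
    obtain ⟨κ, hκ⟩ := hex y y.2
    exact ⟨_, κ, rfl, hκ⟩
  · rintro y _ ⟨κ, rfl, hκ⟩
    exact isLocalDiffeomorphAt_comp (h.isLocalDiffeomorphAt_of_isFlatCoord hκ)
      (subtype_val_isLocalDiffeomorphAt U y)
  · rintro y _ ⟨κ, rfl, hκ⟩
    filter_upwards [(hval y).eventually (h.eventually_isFlatCoord hκ)] with z hz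
    exact ⟨κ, rfl, hz⟩
  · rintro y _ _ ⟨κ, rfl, hκ⟩ ⟨κ', rfl, hκ'⟩ i
    -- Compatibility of two flat coordinate systems is the case of the identity map.
    have h1 := h.scalesBy_isFlatCoord hG (Ψ := Homeomorph.refl S) (fun _ => Iff.rfl) (c := 1)
      (c' := 1) (fun d hd d' hd' x hx hx' => F.compatible d hd d' hd' x ⟨hx, hx'⟩) (f := id)
      (fun _ _ _ => rfl) hκ hκ' i
    have h2 : (![1, 1, 1] : Fin 3 → ℝ) i = 1 := by fin_cases i <;> rfl
    rw [h2] at h1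
    exact h1.comp (hval y)
  · rintro y _ _ ⟨κ, rfl, hκ⟩ ⟨κ', rfl, hκ'⟩ i
    exact (h.scalesBy_isFlatCoord hG hsing' hΨ hf hκ hκ' i).comp (hval y)

end IsNormalized

end FlatCoordinates

end PASurface

end

/-! ### The proposition. -/

theorem proposition4p4
    {M : Type*} [TopologicalSpace M] [T2Space M] [CompactSpace M] [ConnectedSpace M]
    [ChartedSpace (EuclideanSpace ℝ (Fin 3)) M] [IsManifold (𝓡 3) ∞ M]
    (hM : PASurface.IsOrientable 3 M)
    (𝓕 : PASurface.SeifertFibration M)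
    {S : Type*} [TopologicalSpace S] [CompactSpace S] [ConnectedSpace S]
    [ChartedSpace (EuclideanSpace ℝ (Fin 2)) S] [IsManifold (𝓡 2) ∞ S]
    (ι : S → M) (hι : IsSmoothEmbedding (𝓡 2) (𝓡 3) ∞ ι)
    (two_sided : PASurface.IsTwoSided ι)
    (horizontal : 𝓕.IsHorizontal ι)
    (large : PASurface.IsLargeOrbifold (𝓕.returnGroup ι)) :
    PASurface.IsPseudoAnosovSurface ι ∧
      ∃ f : M ≃ₜ M, PASurface.Realizes f ι ∧ PASurface.IsPartiallyPseudoAnosov f := by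
  have : T2Space S := hι.isEmbedding.t2Space
  have : LocallyCompactSpace S := ChartedSpace.locallyCompactSpace (EuclideanSpace ℝ (Fin 2)) S
  obtain ⟨p, hp⟩ := PASurface.exists_isFiberClock 𝓕 hι two_sided horizontal
  obtain ⟨q, φ, φ', e, hq⟩ := PASurface.exists_isNormalized hp hι.isEmbedding
  obtain ⟨ψ, hP, F, hψsing, lam, hlam, hψ⟩ := large
  -- The return group moves points along their fibers, so its orbits are finite; with a point of
  -- trivial stabilizer this bounds the group.
  have : Finite (𝓕.returnGroup ι) := PASurface.finite_of_finite_orbits (fun x =>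
    (hp.finite_orbit hι.isEmbedding x).subset fun y ⟨g, hg, hgy⟩ =>
      hgy ▸ PASurface.rel_of_mem_returnGroup hg x) F
  have hbr := PASurface.isBranchedQuotient_orbit F
  have : T2Space (PASurface.OrbitSpace (𝓕.returnGroup ι)) := PASurface.t2Space_orbitSpace
  have := PASurface.locallyConnectedSpace_orbitSpace (𝓕.returnGroup ι)
  have hψs (x) : ψ x ∈ F.sing ↔ x ∈ F.sing := by
    conv_lhs => rw [← hψsing]
    exact ψ.injective.mem_set_image
  obtain ⟨n, hn, Ψ, hΨ, hcomm⟩ := hbr.exists_homeomorph_lift_pow F.finite_sing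
    F.exists_chart_source PASurface.exists_isConnected_punctured_nhds_surface hψs
  -- Membership in the cone locus gives a stabilizer at some point of the orbit; conjugation moves
  -- it to `x`.
  have hcone (x : S) (hx : Quotient.mk _ x ∈ PASurface.coneLocus (𝓕.returnGroup ι)) :
      ∃ g ∈ 𝓕.returnGroup ι, g ≠ 1 ∧ g x = x := by
    obtain ⟨y, ⟨g, hg, hg1, hgy⟩, hyx⟩ := hx
    obtain ⟨k, hk, rfl⟩ := PASurface.orbit_eq_iff.1 hyx
    refine ⟨k * g * k⁻¹, mul_mem (mul_mem hk hg) (inv_mem hk), ?_, ?_⟩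
    · rwa [Ne, conj_eq_one_iff]
    · change k (g (k.symm (k y))) = k y
      rw [k.symm_apply_apply, hgy]
  obtain ⟨F', hF', hΨsing, hG, μ, hμ, hscale⟩ :=
    PASurface.isPseudoAnosov_lift F hbr hcone hψs hlam hψ hn hΨ
  obtain ⟨f, hf⟩ := hq.exists_homeomorph Ψ hcomm
  have hreal : PASurface.Realizes f ι := by
    refine ⟨Ψ, ⟨by simp, F', hΨsing, μ, hμ, hscale⟩, fun x => ?_⟩
    rw [← hq.zero, hf x 0 (by norm_num), hq.zero]
  refine ⟨⟨inferInstance, hι, PASurface.isOrientable_of_isLocalDiffeomorphAt hM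
    fun x => hp.localDiffeo (x, 0), two_sided, hp.isIncompressible hι.isEmbedding.continuous, f,
    hreal⟩, f, hreal, hq.isPartiallyPseudoAnosov hG (fun g hg y => ?_) hΨsing hμ hscale hf⟩
  rw [hF', mem_preimage, mem_preimage, hbr.map_eq hg]
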